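/- **Setting.** Let $G=\langle a,b,c,d \mid abABcdCD=1\rangle$ (a capital letter denotes the inverse of the corresponding lowercase letter) be the fundamental group of the closed orientable surface of genus two. The surface is obtained from the regular octagon with all angles $\pi/4$ in the Poincaré disc $\mathbb H^2$; its translates under $G$ tessellate $\mathbb H^2$, and the sides of these octagons form a union $N$ of infinite geodesics. The Cayley graph $\Gamma$ of $G$ is embedded in $\mathbb H^2$ dually to $N$: its vertices are the centers of the octagons of the tessellation and its edges are the geodesic segments between the centers of adjacent octagons. The *octagons of $\Gamma$* are its cycles that read off the relation. The *limit points* of a set of edges of $\Gamma$ are its accumulation points on $\partial\mathbb H^2$. A *long* (*half*, *short*) *cycle* is a word that consists of more than (exactly, less than) half of a cyclic permutation of the relation or of its inverse. A *lift* of a cyclic word is a bi-infinite edge path in $\Gamma$ that reads it off periodically. **Snakes.** A *bi-infinite Topological Snake* in $\Gamma$ is an embedded bi-infinite sequence of arcs and bubble chains, where the entry point of each is identified with the exit point of the preceding one. A *bubble chain* is a (finite, infinite or bi-infinite) sequence of circles (bubbles), each sharing exactly one proper interval with each of its neighbors and no point with any other bubble of the chain; its entry (exit) point lies on the first (last) bubble,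 off the boundary intervals, and the two are distinct. It is a *Geometrical Snake* if (1) each bubble is an octagon of $\Gamma$; (2) in each bubble one can choose two *special points* among entry points, exit points and endpoints of boundary intervals, which are opposite vertices of the octagon and include the entry and exit points of the chain that lie on the bubble; (3) no two bubbles of the same chain share a special point; (4) if it contains at least four edges of an octagon of $\Gamma$, then it contains all eight. **The Markov chain.** A step consists of one, two or three directed edges of $\Gamma$ and a region of $\mathbb H^2$. For a vertex $g$ and a label $x$ let $H(g,x)$ be the open half-plane bounded by the geodesic of $N$ that the edge $x$ at $g$ crosses, on the side of $gx$; let $x^+,x^-$ be the labels next to $x$ at $g$, counterclockwise and clockwise. Put $A_x(g)=H(g,x)\setminus(\overline{H(g,x^+)}\cup\overline{H(g,x^-)})$ and $B_x(g)=\overline{H(g,x)}\cap\overline{H(g,x^-)}$ (closures in $\mathbb H^2$). - A step of type A is one edge $(g,x)$ with region $A_x(g)$. For type A$'$ (A$''$) with side $s$, left or right, go backwards from $g$ along the octagon of $\Gamma$ on the side $s$ of $(g,x)$: the region is $A_x(g)$ minus the closed half-plane beyond the second (third) edge traversed. - Let $O$ be the octagon of $\Gamma$ at a vertex $p$ between the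 edges $x$ (on the left) and $x^-$ (on the right), and consider the two paths of length four from $p$ around $O$ to the opposite vertex. Steps of types B, C, C$'$ and D consist of the first, second, third and fourth edges of both paths. The region is $B_x(p)$ for B, C and C$'$. - A step of type E with side left consists of the fourth edges together with the edge $i$ next counterclockwise to the fourth edge of the left path at the initial vertex $v$ of the latter, with region $B_i(v)$; with side right, it is the mirror image. The region of D is the interior of $B_x(p)$ minus both E regions. Up to deck transformations there are 88 steps; these are the *states*. The allowed types of successive steps are: A→A, A$'$, B; A$'$→A, A$'$, A$''$, B; A$''$→A, A$'$, B; B→C; C→C$'$; C$'$→D, E; E→C; D→A, A$'$, B. A state $K$ can follow $J$ if the types are allowed and, for suitable placements, the edges of $K$ start where those of $J$ end and the region of $K$ is one of the pieces into which the region of $J$ is subdivided, i.e. it is the intersection of the region of $J$ with $A_x(g)$ (for $K$ of type A, A$'$ or A$''$ with edge $(g,x)$) or with the region of $K$ (for the other types). An *element of the Markov chain* is a bi-infinite sequence of states in which each can follow the preceding one; its *image* is the union of the edges of its steps, placed in $\Gamma$ one after the other. **The algorithm.** Let $W$ be a cyclic word in the letters $a,b,c,d,A,B,C,D$ (indices modulo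 the current length) that represents a nontrivial element of $G$. 1. Remove neighboring inverse letters until there are none. 2. Replace long cycles by the equivalent short cycles, and remove neighboring inverses, until there are neither; call such a word reduced. 3. While there is a half cycle $w_i\cdots w_{i+3}$ such that, for the equivalent half cycle $v_1v_2v_3v_4$, the word $v_4w_{i+4}w_{i+5}w_{i+6}$ is again a half cycle, replace $w_i\cdots w_{i+3}$ by $v_1v_2v_3v_4$, and repeat this with the new half cycle $v_4w_{i+4}w_{i+5}w_{i+6}$ and so on as long as the condition holds for it; whenever a long cycle or neighboring inverses appear, eliminate them as in Step 2 and resume the scan. 4. Let $E$ be a bi-infinite edge path in $\Gamma$ that reads off the resulting word periodically. 5. Starting from the set of edges of $E$, whenever four consecutive edges of an octagon of $\Gamma$ are present but not all eight, add all its edges and do the same for its translates in all other periods of $E$. Iterate until this cannot be done anymore, and call the final set of edges $GS$. **Theorem.** For every such $W$ and for all choices made in the process, the algorithm terminates with an output $GS$. Every output $GS$ is a bi-infinite Geometrical Snake, it is the image of an element of the Markov chain, and it has the same limit points as some lift of $W$. -/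

import Mathlib

open scoped Real

noncomputable section

namespace SurfaceSnakes

/-! ### The group, its words, and its Cayley graph -/

/-- The eight letters: the generators `a, b, c, d` and, as capitals, their inverses. -/
inductive Letter
  | a | b | c | d | A | B | C | D
  deriving DecidableEq

namespace Letter

/-- The formal inverse of a letter. -/
def inv : Letter → Letter
  | a => A | b => B | c => C | d => D | A => a | B => b | C => c | D => d

/-- The element of the free group on four generators that is denoted by a letter. -/
def toFree : Letter → FreeGroup (Fin 4)
  | a => .of 0 | b => .of 1 | c => .of 2 | d => .of 3
  | A => (.of 0)⁻¹ | B => (.of 1)⁻¹ | C => (.of 2)⁻¹ | D => (.of 3)⁻¹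

end Letter

/-- The formal inverse of a word. -/
def invWord (w : List Letter) : List Letter := (w.map Letter.inv).reverse

/-- The word `abABcdCD`. -/
def relator : List Letter := [.a, .b, .A, .B, .c, .d, .C, .D]

/-- The fundamental group of the closed orientable surface of genus two,
`G = ⟨a, b, c, d | abABcdCD = 1⟩`. -/
abbrev G : Type := PresentedGroup {(relator.map Letter.toFree).prod}

/-- The element of `G` denoted by a letter. -/
def Letter.toG (x : Letter) : G := PresentedGroup.mk _ x.toFree

/-- The element of `G` denoted by a word. -/
def evalWord (w : List Letter) : G := (w.map Letter.toG).prod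

/-- The Cayley graph of `G`. The directed edge with label `x` at the vertex `g` runs from `g` to
`g * x`, and `G` acts by deck transformations, which are multiplications from the left. -/
abbrev Gam : SimpleGraph G := SimpleGraph.mulCayley (Set.range Letter.toG)

/-- A directed edge of the Cayley graph: its initial vertex and its label. -/
abbrev DEdge : Type := G × Letter

/-- The final vertex of a directed edge. -/
def DEdge.target (e : DEdge) : G := e.1 * e.2.toG

/-- The underlying undirected edge. -/
def DEdge.edge (e : DEdge) : Sym2 G := s(e.1, e.target)

/-- The octagons of the Cayley graph are the closed paths that read off the relator. In each octagon
the relator is read, in the positive direction, from exactly one of its vertices, so that the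
octagons are indexed by `G`. `octVertex g k` is the `k`-th vertex of the octagon of `g`. -/
def octVertex (g : G) (k : Fin 8) : G := g * evalWord (relator.take k)

/-- The `k`-th edge of the octagon of `g` (the index is understood modulo `8`). -/
def octEdge (g : G) (k : Fin 8) : Sym2 G := s(octVertex g k, octVertex g (k + 1))

/-- The eight edges of the octagon of `g`. -/
def octEdges (g : G) : Set (Sym2 G) := Set.range (octEdge g)

/-- `u` and `v` are the two paths, with the same initial and the same final vertex, into which two
vertices divide the boundary of an octagon: `u v⁻¹` is a cyclic permutation of the relator or of its
inverse. -/
def Complementary (u v : List Letter) : Prop :=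
  (u ++ invWord v) ~r relator ∨ (u ++ invWord v) ~r invWord relator

/-- A half cycle: exactly half of a cyclic permutation of the relator or of its inverse. -/
def IsHalfCycle (u : List Letter) : Prop := u.length = 4 ∧ ∃ v, Complementary u v

/-! ### The Poincaré disc, the tessellation by regular octagons, and limit points -/

/-- The edges of the Cayley graph at a vertex have a cyclic order; `ccw x` is the label of the edge
that follows the edge labelled `x` counterclockwise. A path that reads off the relator has its octagon
on the left, so `ccw y = x⁻¹` whenever `y` follows `x` in the cyclic word `abABcdCD`. -/
def ccw : Letter → Letter
  | .b => .A | .A => .B | .B => .a | .a => .d | .d => .C | .C => .D | .D => .c | .c => .b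

/-- The label of the edge that follows the edge labelled `x` clockwise. -/
def cw : Letter → Letter
  | .A => .b | .B => .A | .a => .B | .d => .a | .C => .d | .D => .C | .c => .D | .b => .c

/-- The direction, in multiples of `π / 4`, in which the edge labelled `x` leaves the centre of the
fundamental octagon. -/
def dir : Letter → ℤ
  | .b => 0 | .A => 1 | .B => 2 | .a => 3 | .d => 4 | .C => 5 | .D => 6 | .c => 7

/-- `exp (iπ / 8)`. -/
def eta : ℂ := Complex.exp (π / 8 * Complex.I)

lemma eta_ne_zero : eta ≠ 0 := Complex.exp_ne_zero _

/-- The rotation of the disc about its centre by the angle `n π / 4`. -/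
def rotation (n : ℤ) : Matrix.SpecialLinearGroup (Fin 2) ℂ :=
  ⟨!![eta ^ n, 0; 0, eta ^ (-n)], by
    rw [Matrix.det_fin_two_of, zpow_neg, mul_inv_cancel₀ (zpow_ne_zero _ eta_ne_zero)]; simp⟩

/-- The hyperbolic translation along the real diameter, to the right, by twice the inradius `ρ` of
the regular octagon with all angles equal to `π / 4`: `cosh ρ = cot (π / 8) = 1 + √2`. -/
def translation : Matrix.SpecialLinearGroup (Fin 2) ℂ :=
  ⟨!![((1 + √2 : ℝ) : ℂ), ((√(2 + 2 * √2) : ℝ) : ℂ);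
      ((√(2 + 2 * √2) : ℝ) : ℂ), ((1 + √2 : ℝ) : ℂ)], by
    rw [Matrix.det_fin_two_of, ← Complex.ofReal_mul, ← Complex.ofReal_mul, ← Complex.ofReal_sub,
      Real.mul_self_sqrt (by positivity)]
    have h : √2 * √2 = (2 : ℝ) := Real.mul_self_sqrt (by norm_num)
    rw [← Complex.ofReal_one]
    congr 1
    linear_combination h⟩

/-- The side pairing of the fundamental octagon that belongs to the letter `x`: the isometry that
moves the octagon across its side in the direction of `x`, and carries the side in the direction of
`x⁻¹` onto that side. -/
def sidePairing (x : Letter) : Matrix.SpecialLinearGroup (Fin 2) ℂ :=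
  rotation (dir x) * translation * rotation (-(dir x.inv + 4))

lemma eta_pow : eta ^ 8 = -1 := by
  rw [eta, ← Complex.exp_nat_mul, ← Complex.exp_pi_mul_I]; congr 1; push_cast; ring

lemma rotation_mul (m n : ℤ) : rotation m * rotation n = rotation (m + n) := by
  apply Subtype.ext
  change !![eta ^ m, 0; 0, eta ^ (-m)] * !![eta ^ n, 0; 0, eta ^ (-n)] =
    !![eta ^ (m + n), 0; 0, eta ^ (-(m + n))]
  rw [neg_add, zpow_add₀ eta_ne_zero, zpow_add₀ eta_ne_zero]
  simp

lemma rotation_zero : rotation 0 = 1 := by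
  apply Subtype.ext
  change !![eta ^ (0 : ℤ), 0; 0, eta ^ (-0 : ℤ)] = 1
  simp [Matrix.one_fin_two]

lemma coe_rotation_neg_eight : (rotation (-8) : Matrix (Fin 2) (Fin 2) ℂ) = -1 := by
  have h : eta ^ (8 : ℤ) = -1 := by exact_mod_cast eta_pow
  change !![eta ^ (-8 : ℤ), 0; 0, eta ^ (- -8 : ℤ)] = -1
  rw [neg_neg, zpow_neg, h, Matrix.one_fin_two]
  ext i j; fin_cases i <;> fin_cases j <;> simp

lemma rotation_neg_eight_comm (M : Matrix.SpecialLinearGroup (Fin 2) ℂ) :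
    rotation (-8) * M = M * rotation (-8) := by
  apply Subtype.ext
  rw [Matrix.SpecialLinearGroup.coe_mul, Matrix.SpecialLinearGroup.coe_mul,
    coe_rotation_neg_eight]
  simp

lemma rotation_mul_rotation_neg (n : ℤ) : rotation n * rotation (-n) = 1 := by
  rw [rotation_mul, add_neg_cancel, rotation_zero]

lemma rotation_inv (n : ℤ) : (rotation n)⁻¹ = rotation (-n) := by
  rw [inv_eq_iff_mul_eq_one, rotation_mul_rotation_neg]

lemma translation_inv : translation⁻¹ = rotation 4 * translation * rotation (-4) := by
  have h : eta ^ (4 : ℤ) * eta ^ (4 : ℤ) = -1 := by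
    rw [← zpow_add₀ eta_ne_zero]; exact_mod_cast eta_pow
  have h' : eta ^ (-4 : ℤ) * eta ^ (-4 : ℤ) = -1 := by
    rw [zpow_neg, ← mul_inv, h]; norm_num
  have h1 : eta ^ (4 : ℤ) * eta ^ (-4 : ℤ) = 1 := by
    rw [← zpow_add₀ eta_ne_zero]; simp
  apply Subtype.ext
  rw [Matrix.SpecialLinearGroup.coe_inv, Matrix.SpecialLinearGroup.coe_mul,
    Matrix.SpecialLinearGroup.coe_mul]
  change Matrix.adjugate !![((1 + √2 : ℝ) : ℂ), ((√(2 + 2 * √2) : ℝ) : ℂ);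
      ((√(2 + 2 * √2) : ℝ) : ℂ), ((1 + √2 : ℝ) : ℂ)] =
    !![eta ^ (4 : ℤ), 0; 0, eta ^ (-4 : ℤ)] *
    !![((1 + √2 : ℝ) : ℂ), ((√(2 + 2 * √2) : ℝ) : ℂ);
      ((√(2 + 2 * √2) : ℝ) : ℂ), ((1 + √2 : ℝ) : ℂ)] *
    !![eta ^ (-4 : ℤ), 0; 0, eta ^ (- -4 : ℤ)]
  rw [Matrix.adjugate_fin_two_of, Matrix.mul_fin_two, Matrix.mul_fin_two, neg_neg]
  generalize eta ^ (4 : ℤ) = p at *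
  generalize eta ^ (-4 : ℤ) = q at *
  generalize ((1 + √2 : ℝ) : ℂ) = k at *
  generalize ((√(2 + 2 * √2) : ℝ) : ℂ) = s at *
  ext i j
  fin_cases i <;> fin_cases j <;> simp
  · linear_combination (-k) * h1
  · linear_combination (-s) * h
  · linear_combination (-s) * h'
  · linear_combination (-k) * h1

lemma translation_rotation_pow :
    (translation * rotation 3) ^ 8 = rotation 8 := by
  have hs : ((√2 : ℝ) : ℂ) * ((√2 : ℝ) : ℂ) = 2 := by
    rw [← Complex.ofReal_mul, Real.mul_self_sqrt (by norm_num)]; norm_num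
  have he : eta ^ (3 : ℤ) * eta ^ (-3 : ℤ) = 1 := by
    rw [← zpow_add₀ eta_ne_zero]; simp
  have hc : eta ^ (3 : ℤ) * eta ^ (3 : ℤ) + eta ^ (-3 : ℤ) * eta ^ (-3 : ℤ) = -((√2 : ℝ) : ℂ) := by
    rw [← zpow_add₀ eta_ne_zero, ← zpow_add₀ eta_ne_zero, eta, ← Complex.exp_int_mul,
      ← Complex.exp_int_mul]
    have h2 : Complex.cos ((3 * π / 4 : ℝ) : ℂ) = ((-(√2 / 2) : ℝ) : ℂ) := by
      rw [← Complex.ofReal_cos]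
      congr 1
      rw [show 3 * π / 4 = π - π / 4 by ring, Real.cos_pi_sub, Real.cos_pi_div_four]
    have h3 := Complex.two_cos ((3 * π / 4 : ℝ) : ℂ)
    rw [h2] at h3
    push_cast at h3
    rw [show (3 + 3 : ℤ) = 6 by norm_num, show (-3 + -3 : ℤ) = -6 by norm_num]
    push_cast
    rw [show (6 : ℂ) * (π / 8 * Complex.I) = 3 * π / 4 * Complex.I by ring,
      show (-6 : ℂ) * (π / 8 * Complex.I) = -(3 * π / 4) * Complex.I by ring, ← h3]
    ring
  have hσ : ((√(2 + 2 * √2) : ℝ) : ℂ) * ((√(2 + 2 * √2) : ℝ) : ℂ) = 2 + 2 * ((√2 : ℝ) : ℂ) := by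
    rw [← Complex.ofReal_mul, Real.mul_self_sqrt (by positivity)]; push_cast; ring
  have hr : (rotation 8 : Matrix (Fin 2) (Fin 2) ℂ) = -1 := by
    have h : eta ^ (8 : ℤ) = -1 := by exact_mod_cast eta_pow
    change !![eta ^ (8 : ℤ), 0; 0, eta ^ (-8 : ℤ)] = -1
    rw [zpow_neg, h, Matrix.one_fin_two]
    ext i j; fin_cases i <;> fin_cases j <;> simp
  apply Subtype.ext
  rw [Matrix.SpecialLinearGroup.coe_pow, Matrix.SpecialLinearGroup.coe_mul, hr]
  have hU : (translation : Matrix (Fin 2) (Fin 2) ℂ) * (rotation 3 : Matrix (Fin 2) (Fin 2) ℂ) =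
      !![((1 + √2 : ℝ) : ℂ) * eta ^ (3 : ℤ), ((√(2 + 2 * √2) : ℝ) : ℂ) * eta ^ (-3 : ℤ);
      ((√(2 + 2 * √2) : ℝ) : ℂ) * eta ^ (3 : ℤ), ((1 + √2 : ℝ) : ℂ) * eta ^ (-3 : ℤ)] := by
    change !![_, _; _, _] * !![_, _; _, _] = _
    rw [Matrix.mul_fin_two]
    simp
  rw [hU]
  push_cast
  generalize eta ^ (3 : ℤ) = p at *
  generalize eta ^ (-3 : ℤ) = q at *
  generalize ((√(2 + 2 * √2) : ℝ) : ℂ) = s at *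
  generalize ((√2 : ℝ) : ℂ) = r at *
  set U : Matrix (Fin 2) (Fin 2) ℂ := !![(1 + r) * p, s * q; s * p, (1 + r) * q] with hUdef
  have ht : ((1 + r) * (p + q)) * ((1 + r) * (p + q)) = 2 + r := by
    linear_combination (1 + r) * (1 + r) * hc + 2 * (1 + r) * (1 + r) * he - r * hs
  have h2 : U ^ 2 = ((1 + r) * (p + q)) • U - 1 := by
    rw [pow_two, hUdef, Matrix.mul_fin_two, Matrix.one_fin_two]
    ext i j
    fin_cases i <;> fin_cases j <;> simp
    · linear_combination (p * q) * hσ - (p * q) * hs - he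
    · ring
    · ring
    · linear_combination (p * q) * hσ - (p * q) * hs - he
  have h4 : U ^ 4 = r • U ^ 2 - 1 := by
    have : U ^ 4 = U ^ 2 * U ^ 2 := by rw [← pow_add]
    rw [this]
    nth_rewrite 1 [h2]
    nth_rewrite 1 [h2]
    have hUU : U * U = ((1 + r) * (p + q)) • U - 1 := by rw [← pow_two, h2]
    generalize (1 + r) * (p + q) = t at *
    rw [sub_mul, mul_sub, smul_mul_smul_comm, ht, hUU, h2]
    simp only [smul_sub, mul_one, one_mul, smul_smul]
    rw [show (2 + r) * t = t + t + r * t by ring]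
    simp only [add_smul]
    rw [show (2 : ℂ) = 1 + 1 by norm_num]
    simp only [add_smul, one_smul]
    abel
  have h8 : U ^ 8 = U ^ 4 * U ^ 4 := by rw [← pow_add]
  rw [h8]
  nth_rewrite 1 [h4]
  nth_rewrite 1 [h4]
  have h22 : U ^ 2 * U ^ 2 = r • U ^ 2 - 1 := by rw [← pow_add, h4]
  rw [sub_mul, mul_sub, smul_mul_smul_comm, hs, h22]
  simp only [smul_sub, mul_one, one_mul, two_smul]
  abel

/-- The side pairings of the generators `a, b, c, d`. -/
def genPairing (i : Fin 4) : Matrix.SpecialLinearGroup (Fin 2) ℂ :=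
  sidePairing (![Letter.a, Letter.b, Letter.c, Letter.d] i)

lemma genPairing_relator :
    ∀ r ∈ ({(relator.map Letter.toFree).prod} : Set (FreeGroup (Fin 4))),
      FreeGroup.lift genPairing r = 1 := by
  rintro r rfl
  have h5 : rotation (-5) = rotation (-8) * rotation 3 := by rw [rotation_mul]; norm_num
  have hz : rotation (-8) * rotation (-8) = 1 := by
    apply Subtype.ext
    rw [Matrix.SpecialLinearGroup.coe_mul, coe_rotation_neg_eight]
    simp
  have g0 : genPairing 0 = rotation 3 * translation * rotation (-5) := rfl
  have g1 : genPairing 1 = rotation 0 * translation * rotation (-6) := rfl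
  have g2 : genPairing 2 = rotation 7 * translation * rotation (-9) := rfl
  have g3 : genPairing 3 = rotation 4 * translation * rotation (-10) := rfl
  have hra : ∀ (m n : ℤ) (X : Matrix.SpecialLinearGroup (Fin 2) ℂ),
      rotation m * (rotation n * X) = rotation (m + n) * X := by
    intro m n X; rw [← mul_assoc, rotation_mul]
  have hzc : ∀ X Y : Matrix.SpecialLinearGroup (Fin 2) ℂ,
      X * (rotation (-8) * Y) = rotation (-8) * (X * Y) := by
    intro X Y; rw [← mul_assoc, ← rotation_neg_eight_comm, mul_assoc]
  have h8 := translation_rotation_pow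
  simp only [relator, List.map_cons, List.map_nil, List.prod_cons, List.prod_nil, Letter.toFree,
    map_mul, map_inv, FreeGroup.lift_apply_of, g0, g1, g2, g3, mul_inv_rev,
    translation_inv, rotation_inv, mul_one]
  simp only [mul_assoc, hra, rotation_mul]
  norm_num
  rw [h5]
  have hfin : rotation (-8) * rotation (-8) *
      (rotation 3 * (translation * rotation 3) ^ 8 * rotation (-11)) = 1 := by
    rw [hz, h8, rotation_mul, rotation_mul, one_mul]; norm_num [rotation_zero]
  rw [← hfin]
  simp only [pow_succ, pow_zero, one_mul, mul_assoc, hzc]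
  simp only [rotation_mul]
  norm_num

/-- The action of `G` by deck transformations of the Poincaré disc, as a homomorphism. -/
def deck : G →* Matrix.SpecialLinearGroup (Fin 2) ℂ := PresentedGroup.toGroup genPairing_relator

/-- The deck transformation `g` applied to the point `z`, as a Möbius transformation. -/
def act (g : G) (z : ℂ) : ℂ := (deck g 0 0 * z + deck g 0 1) / (deck g 1 0 * z + deck g 1 1)

/-- The point of the Poincaré disc at which the vertex `g` of the Cayley graph is placed: the centre
of the octagon that is the image under `g` of the fundamental octagon. -/
def position (g : G) : ℂ := act g 0

/-- The Cayley graph in the disc: the geodesic segment that is the directed edge `e`. (It is the image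
of the radius from the centre of the disc to the neighbouring vertex.) -/
def segmentOf (e : DEdge) : Set ℂ := act e.1 '' segment ℝ 0 (position e.2.toG)

/-- The part of the disc that is covered by a set of edges of the Cayley graph. -/
def realization (S : Set (Sym2 G)) : Set ℂ := {z | ∃ e : DEdge, e.edge ∈ S ∧ z ∈ segmentOf e}

/-- The limit points, on the boundary circle of the Poincaré disc, of a set of edges. -/
def limitPoints (S : Set (Sym2 G)) : Set ℂ := Metric.sphere 0 1 ∩ closure (realization S)

/-- The open half-plane beyond the directed edge `e`. The edge crosses the common side of two
octagons of the tessellation; this side lies on a geodesic, the perpendicular bisector of the edge,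
and the half-plane is bounded by this geodesic and contains the final vertex of `e`. (Note that
`‖act g⁻¹ z‖` is an increasing function of the hyperbolic distance between `z` and the vertex `g`.) -/
def halfPlane (e : DEdge) : Set ℂ :=
  {z | ‖z‖ < 1 ∧ ‖act e.target⁻¹ z‖ < ‖act e.1⁻¹ z‖}

/-- The closed half-plane beyond the directed edge `e`. -/
def closedHalfPlane (e : DEdge) : Set ℂ :=
  {z | ‖z‖ < 1 ∧ ‖act e.target⁻¹ z‖ ≤ ‖act e.1⁻¹ z‖}

/-- The geodesics that bound the octagon of the tessellation around the vertex `g` cut its complement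
into `16` regions. This is the open region that is entered across the side of the edge labelled `x`. -/
def openRegion (g : G) (x : Letter) : Set ℂ :=
  halfPlane (g, x) \ (closedHalfPlane (g, ccw x) ∪ closedHalfPlane (g, cw x))

/-- The closed region, among these `16` regions, that is adjacent to the open regions of the edge
labelled `x` and of the next edge clockwise. -/
def wedge (g : G) (x : Letter) : Set ℂ :=
  closedHalfPlane (g, x) ∩ closedHalfPlane (g, cw x)

/-! ### The Markov chain -/

/-- The label of the edge that follows an edge labelled `y` along the octagon on the left of `y`. -/
def turnLeft (y : Letter) : Letter := cw y.inv

/-- The label of the edge that follows an edge labelled `y` along the octagon on the right of `y`. -/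
def turnRight (y : Letter) : Letter := ccw y.inv

/-- The octagon at the vertex `p` between the edges labelled `x` (on the left) and `cw x` (on the
right) is traversed from `p` to the opposite vertex on two paths. This is the edge number `n + 1`
(for `n = 0, 1, 2, 3`) of the path on the left. -/
def leftEdge (p : G) (x : Letter) (n : ℕ) : DEdge :=
  (p * evalWord ((List.range n).map fun k => turnRight^[k] x), turnRight^[n] x)

/-- The edge number `n + 1` of the path on the right. -/
def rightEdge (p : G) (x : Letter) (n : ℕ) : DEdge :=
  (p * evalWord ((List.range n).map fun k => turnLeft^[k] (cw x)), turnLeft^[n] (cw x))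

/-- Left or right, relative to the direction of traversal. -/
inductive Side
  | L | R

/-- The `88` states. The states of the types `A`, `A'` (here `Ap`) and `A''` (here `App`) are given by
the label `x` of the edge that is traversed, and by the side on which a wedge has been cut away. The
states of the types `B`, `C`, `C'` (here `Cp`), `D` and `E` belong to the first, second, third, fourth
and fourth edges of the two paths around an octagon that leave a vertex along edges labelled `x` on the
left and `cw x` on the right, and are given by `x`, which determines, and is determined by, the
labels `leftEdge _ x n` and `rightEdge _ x n` of the two edges traversed. For `E` the side `L` or `R`
tells whether the third edge of the step starts where the left or the right one of these edges starts. -/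
inductive State
  | A (x : Letter) | Ap (s : Side) (x : Letter) | App (s : Side) (x : Letter)
  | B (x : Letter) | C (x : Letter) | Cp (x : Letter) | D (x : Letter) | E (s : Side) (x : Letter)

/-- The types of states. -/
inductive Kind
  | A | Ap | App | B | C | Cp | D | E

/-- The type of a state. -/
def State.kind : State → Kind
  | .A _ => .A | .Ap _ _ => .Ap | .App _ _ => .App | .B _ => .B | .C _ => .C | .Cp _ => .Cp
  | .D _ => .D | .E _ _ => .E

/-- The directed edges of the graph of types. -/
def KindEdge : Kind → Kind → Prop
  | .A, .A | .A, .Ap | .A, .B => True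
  | .Ap, .A | .Ap, .Ap | .Ap, .App | .Ap, .B => True
  | .App, .A | .App, .Ap | .App, .B => True
  | .B, .C | .C, .Cp | .Cp, .D | .Cp, .E | .E, .C => True
  | .D, .A | .D, .Ap | .D, .B => True
  | _, _ => False

/-- The edge or edges of the step with state `J` that is placed at the vertex `p`: for the types `A`,
`A'`, `A''` this is the initial vertex of the edge, for the other types the vertex at which the two
paths around the octagon begin. -/
def State.edges : State → G → Set DEdge
  | .A x, p | .Ap _ x, p | .App _ x, p => {(p, x)}
  | .B x, p => {leftEdge p x 0, rightEdge p x 0}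
  | .C x, p => {leftEdge p x 1, rightEdge p x 1}
  | .Cp x, p => {leftEdge p x 2, rightEdge p x 2}
  | .D x, p => {leftEdge p x 3, rightEdge p x 3}
  | .E .L x, p => {((leftEdge p x 3).1, ccw (leftEdge p x 3).2), leftEdge p x 3, rightEdge p x 3}
  | .E .R x, p => {leftEdge p x 3, rightEdge p x 3, ((rightEdge p x 3).1, cw (rightEdge p x 3).2)}

/-- The region of a step of type `E`, a closed wedge between two of the geodesics, with its apex at the
centre of the octagon of the Cayley graph that is entered next. -/
def wedgeE (s : Side) (p : G) (x : Letter) : Set ℂ :=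
  match s with
  | .L => wedge (leftEdge p x 3).1 (ccw (leftEdge p x 3).2)
  | .R => wedge (rightEdge p x 3).1 (rightEdge p x 3).2

/-- The wedge that is cut away from the region of a step of type `A` to give that of a step of type
`A'`, as a half-plane. On the side `s` of the edge `(p, x)` lies an octagon, along which
one goes backwards from `p`; the half-plane lies beyond the second edge that is met. -/
def cutOne (s : Side) (p : G) (x : Letter) : Set ℂ :=
  match s with
  | .L => closedHalfPlane (leftEdge p (ccw x) 1)
  | .R => closedHalfPlane (rightEdge p x 1)

/-- What is cut away from the region of a step of type `A` to give that of a step of type `A''`; it lies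
beyond the third edge that is met along the same octagon. -/
def cutTwo (s : Side) (p : G) (x : Letter) : Set ℂ :=
  match s with
  | .L => closedHalfPlane (leftEdge p (ccw x) 2)
  | .R => closedHalfPlane (rightEdge p x 2)

/-- The region of the step with state `J` that is placed at the vertex `p`: the part of the disc in
which the continuation of a snake after this step can end. -/
def State.region : State → G → Set ℂ
  | .A x, p => openRegion p x
  | .Ap s x, p => openRegion p x \ cutOne s p x
  | .App s x, p => openRegion p x \ cutTwo s p x
  | .B x, p | .C x, p | .Cp x, p => wedge p x
  | .D x, p => interior (wedge p x \ (wedgeE .L p x ∪ wedgeE .R p x))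
  | .E s x, p => wedgeE s p x

/-- The whole region, before it is intersected with the region of the preceding step, to which a step
leads: for the types `A`, `A'`, `A''` this is one of the open regions among the `16` around `p`. -/
def State.piece : State → G → Set ℂ
  | .A x, p | .Ap _ x, p | .App _ x, p => openRegion p x
  | J, p => J.region p

/-- The step with state `J` placed at `p` can be followed by the step with state `K` placed at `q`: the
types follow each other in the graph of types, the edges of `K` start where those of `J` end, and the
region of `K` is one of the pieces into which the region of `J` is subdivided. -/
def FollowsAt (J : State) (p : G) (K : State) (q : G) : Prop :=
  KindEdge J.kind K.kind ∧
  DEdge.target '' J.edges p = Prod.fst '' K.edges q ∧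
  K.region q = J.region p ∩ K.piece q

/-- The transition matrix of the Markov chain. -/
def CanFollow (J K : State) : Prop := ∃ p q, FollowsAt J p K q

/-- The elements of the Markov chain: the bi-infinite sequences of states that it admits. -/
def IsMarkovElement (J : ℤ → State) : Prop := ∀ i, CanFollow (J i) (J (i + 1))

/-- `S` is the image, in the universal cover, of the element `J` of the Markov chain: the steps are
placed one after the other, and `S` is the set of all their edges. -/
def IsImageOf (S : Set (Sym2 G)) (J : ℤ → State) : Prop :=
  ∃ p : ℤ → G, (∀ i, FollowsAt (J i) (p i) (J (i + 1)) (p (i + 1))) ∧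
    S = ⋃ i, DEdge.edge '' (J i).edges (p i)

/-! ### Topological and geometrical snakes -/

/-- The pieces of an embedded snake: arcs, from an entry point to an exit point, and bubbles. -/
inductive Cell
  | arc {u v : G} (w : Gam.Walk u v)
  | bubble {u : G} (w : Gam.Walk u u)

/-- The image of a piece in the Cayley graph. -/
def Cell.image : Cell → Gam.Subgraph
  | .arc w => w.toSubgraph
  | .bubble w => w.toSubgraph

/-- Whether a piece is a bubble. -/
def Cell.IsBubble : Cell → Prop
  | .arc _ => False
  | .bubble _ => True

/-- How a piece is joined to the next one: either the exit point of the former is identified with the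
entry point of the latter, or both are neighbouring bubbles of one bubble chain, and share an
interval. -/
inductive Link
  | point (v : G)
  | interval {u v : G} (w : Gam.Walk u v)

/-- The point, or the endpoints of the interval. -/
def Link.points : Link → Set G
  | .point v => {v}
  | .interval (u := u) (v := v) _ => {u, v}

/-- Whether a link is an interval. -/
def Link.IsInterval : Link → Prop
  | .point _ => False
  | .interval _ => True

/-- A bi-infinite topological snake, embedded in the Cayley graph. The arcs and the bubbles of all the
bubble chains are enumerated in their order by the integers; a bubble chain is a maximal sequence of
bubbles such that neighbouring ones are linked by intervals. -/
structure TopologicalSnake where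
  /-- The arcs and the bubbles. -/
  cell : ℤ → Cell
  /-- The link between the pieces number `i` and `i + 1`. -/
  link : ℤ → Link
  /-- An arc is embedded, and is entered at its first and left at its last point. -/
  arc_embedded : ∀ i u v (w : Gam.Walk u v), cell i = .arc w →
    w.IsPath ∧ 0 < w.length ∧ link (i - 1) = .point u ∧ link i = .point v
  /-- A bubble is an embedded circle. -/
  bubble_embedded : ∀ i u (w : Gam.Walk u u), cell i = .bubble w → w.IsCycle
  /-- Two pieces that are linked by a point have exactly this point in common. -/
  point_link : ∀ i v, link i = .point v → ((cell i).image ⊓ (cell (i + 1)).image).verts = {v}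
  /-- Two bubbles that are linked by an interval have exactly this interval in common. -/
  interval_link : ∀ i u v (w : Gam.Walk u v), link i = .interval w →
    w.IsPath ∧ 0 < w.length ∧ (cell i).image ⊓ (cell (i + 1)).image = w.toSubgraph
  /-- Pieces that are not neighbours are disjoint. -/
  far_disjoint : ∀ i j, i + 1 < j → Disjoint (cell i).image.verts (cell j).image.verts

/-- The edges of a snake. -/
def TopologicalSnake.edges (T : TopologicalSnake) : Set (Sym2 G) := ⋃ i, (T.cell i).image.edgeSet

/-- The properties of a geometrical snake; `special i` is the set of the special points of the bubble
number `i`. -/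
structure TopologicalSnake.IsGeometrical (T : TopologicalSnake) (special : ℤ → Set G) : Prop where
  /-- Each bubble is an octagon, and its two special points are opposite vertices. -/
  octagon : ∀ i, (T.cell i).IsBubble →
    ∃ g k, (T.cell i).image.edgeSet = octEdges g ∧ special i = {octVertex g k, octVertex g (k + 4)}
  /-- The special points are entry points, exit points, or endpoints of boundary intervals. -/
  special_subset : ∀ i, (T.cell i).IsBubble →
    special i ⊆ (T.link (i - 1)).points ∪ (T.link i).points
  /-- An entry point of a bubble is a special point. -/
  entry_special : ∀ i v, (T.cell i).IsBubble → T.link (i - 1) = .point v → v ∈ special i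
  /-- An exit point of a bubble is a special point. -/
  exit_special : ∀ i v, (T.cell i).IsBubble → T.link i = .point v → v ∈ special i
  /-- Two bubbles in the same bubble chain do not share a special point. -/
  special_disjoint : ∀ i j, i < j → (∀ k, i ≤ k → k < j → (T.link k).IsInterval) →
    Disjoint (special i) (special j)
  /-- A snake that contains at least four edges of an octagon contains all eight. -/
  four_edges : ∀ g, 4 ≤ (octEdges g ∩ T.edges).ncard → octEdges g ⊆ T.edges

/-- `S` is (the set of edges of) a bi-infinite geometrical snake. -/
def IsGeometricalSnake (S : Set (Sym2 G)) : Prop :=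
  ∃ (T : TopologicalSnake) (special : ℤ → Set G), T.IsGeometrical special ∧ T.edges = S

/-! ### The algorithm -/

/-- Two neighbouring letters of a cyclic word that are inverse to each other are removed. -/
inductive Cancel : Cycle Letter → Cycle Letter → Prop
  | mk (x : Letter) (w : List Letter) : Cancel ((x :: x.inv :: w : List Letter) : Cycle Letter) w

/-- A long cycle, which is more than half of a cyclic permutation of the relator or of its inverse, is
replaced by the equivalent short cycle. -/
inductive ReplaceLong : Cycle Letter → Cycle Letter → Prop
  | mk (u v w : List Letter) (hu : 4 < u.length) (huv : Complementary u v) :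
      ReplaceLong ((u ++ w : List Letter) : Cycle Letter) ((v ++ w : List Letter) : Cycle Letter)

/-- A cyclic word is reduced if it contains neither neighbouring inverses nor long cycles. -/
def IsReduced (w : Cycle Letter) : Prop := ¬ ∃ w', Cancel w w' ∨ ReplaceLong w w'

/-- The half cycle `u` at the beginning of the first word has to be replaced by the equivalent half
cycle `v y`, since `y`, followed by the next three letters, is again a half cycle. In the second word,
a cyclic permutation of the result, the new half cycle stands at the beginning. -/
inductive ReplaceHalf : List Letter → List Letter → Prop
  | mk (u v t w : List Letter) (y : Letter) (hu : u.length = 4) (huv : Complementary u (v ++ [y]))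
      (ht : t.length = 3) (hyt : IsHalfCycle (y :: t)) :
      ReplaceHalf (u ++ t ++ w) (y :: t ++ w ++ v)

/-- The bi-infinite edge path in the Cayley graph with the vertices `E i` reads off the word `w`
periodically. -/
def ReadsOff (E : ℤ → G) (w : List Letter) : Prop :=
  ∀ i : ℤ, ∃ x ∈ w[(i % w.length).toNat]?, E (i + 1) = E i * x.toG

/-- The edges of a bi-infinite edge path. -/
def pathEdges (E : ℤ → G) : Set (Sym2 G) := Set.range fun i => s(E i, E (i + 1))

/-- The deck transformation that moves a path which reads off a word of length `n` periodically by one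
period. -/
def period (E : ℤ → G) (n : ℕ) : G := E n * (E 0)⁻¹

/-- The octagon of `g`, of which four consecutive edges but not all edges belong to `S`, is completed,
together with its translates under the powers of `t`. -/
inductive Complete (t : G) : Set (Sym2 G) → Set (Sym2 G) → Prop
  | mk (S : Set (Sym2 G)) (g : G) (k : Fin 8) (hk : ∀ j < 4, octEdge g (k + j) ∈ S)
      (hg : ¬ octEdges g ⊆ S) : Complete t S (S ∪ ⋃ n : ℤ, octEdges (t ^ n * g))

/-- The states of the algorithm. In `follow w`, a half cycle has been replaced during the third step,
and the new half cycle, at the beginning of the word `w`, is to be treated next. In `step5 t S`, the set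
`S` of edges is invariant under the deck transformation `t`. -/
inductive Config
  | step1 (w : Cycle Letter)
  | step2 (w : Cycle Letter)
  | step3 (w : Cycle Letter)
  | follow (w : List Letter)
  | step4 (w : Cycle Letter)
  | step5 (t : G) (S : Set (Sym2 G))
  | output (S : Set (Sym2 G))

/-- A single move of the algorithm. -/
inductive Move : Config → Config → Prop
  /-- First step: neighbouring inverses are removed until there are none. -/
  | cancel {w w' : Cycle Letter} : Cancel w w' → Move (.step1 w) (.step1 w')
  | cancel_done {w : Cycle Letter} : (¬ ∃ w', Cancel w w') → Move (.step1 w) (.step2 w)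
  /-- Second step: long cycles are replaced, and neighbouring inverses removed, until there are none. -/
  | shorten {w w' : Cycle Letter} : Cancel w w' ∨ ReplaceLong w w' → Move (.step2 w) (.step2 w')
  | shorten_done {w : Cycle Letter} : IsReduced w → Move (.step2 w) (.step3 w)
  /-- Third step: some half cycle that has to be replaced is replaced. -/
  | half {w w' : List Letter} : ReplaceHalf w w' → Move (.step3 (w : Cycle Letter)) (.follow w')
  /-- If long cycles or neighbouring inverses appear, they are eliminated as in the second step. -/
  | follow_shorten {w : List Letter} : ¬ IsReduced (w : Cycle Letter) →
      Move (.follow w) (.step2 (w : Cycle Letter))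
  /-- Otherwise the procedure is repeated with the new half cycle, as long as it has to be replaced. -/
  | follow_half {w w' : List Letter} : IsReduced (w : Cycle Letter) → ReplaceHalf w w' →
      Move (.follow w) (.follow w')
  | follow_done {w : List Letter} : IsReduced (w : Cycle Letter) → (¬ ∃ w', ReplaceHalf w w') →
      Move (.follow w) (.step3 (w : Cycle Letter))
  /-- The third step ends when no half cycle has to be replaced. -/
  | half_done {w : Cycle Letter} : (¬ ∃ v v' : List Letter, (v : Cycle Letter) = w ∧ ReplaceHalf v v') →
      Move (.step3 w) (.step4 w)
  /-- Fourth step: an edge path that reads off the cyclic word periodically is chosen. -/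
  | lift {w : List Letter} {E : ℤ → G} : ReadsOff E w →
      Move (.step4 (w : Cycle Letter)) (.step5 (period E w.length) (pathEdges E))
  /-- Fifth step: octagons of which four consecutive edges are present are completed, in each period,
  until this cannot be done anymore. -/
  | complete {t : G} {S S' : Set (Sym2 G)} : Complete t S S' → Move (.step5 t S) (.step5 t S')
  | complete_done {t : G} {S : Set (Sym2 G)} : (¬ ∃ S', Complete t S S') →
      Move (.step5 t S) (.output S)

/-- The algorithm, started with the cyclic word `w`, can reach the state `c`. -/
def Reaches (w : Cycle Letter) (c : Config) : Prop := Relation.ReflTransGen Move (.step1 w) c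

/-- The algorithm, started with the cyclic word `w`, terminates: no sequence of moves goes on forever,
and it does not get stuck before there is an output. -/
def Terminates (w : Cycle Letter) : Prop :=
  (¬ ∃ c : ℕ → Config, c 0 = .step1 w ∧ ∀ n, Move (c n) (c (n + 1))) ∧
  (∀ c, Reaches w c → (∃ c', Move c c') ∨ ∃ S, c = .output S)

end SurfaceSnakes

end

namespace SurfaceSnakes

/-! ### Letters, darts and octagons -/

/-! All geometry is reduced to the signs of one function. For a directed edge `e`, `ell e z` is the
difference of the hyperbolic cosines of the distances of `z` from the two ends of `e`; in the
hyperboloid model it is a linear functional, vanishing on the geodesic of N that `e` crosses and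
positive beyond it. Two facts carry the rest. The geodesics crossed by consecutive edges of an
octagon of Γ pass through its centre at successive angles π/4, so the functionals satisfy the
recursion of cos(kπ/4) (`ell_add_ell`). Two edges at a vertex that are neither equal nor neighbours
cross disjoint geodesics, with disjoint half-planes beyond them (`ell_add_lt`). Even the embedding
of Γ, such as the distinctness of the vertices of an octagon, is read off from these signs.

A snake is treated as a bi-infinite sequence of pieces, each a single edge or an octagon, of which
successive ones are `Linked`. Each piece has a zone. The zones decrease (`Linked.zone_mono`), a zone
contains the next piece (`Linked.zone_of_mem`), and the zone of the next piece contains no vertex of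
the present one (`Linked.not_zone_of_mem`). Hence pieces that are not neighbours are disjoint. The
same inequalities give the transitions of the Markov chain (`Linked.followsAt`), and show that an
octagon with four edges in the snake is one of its bubbles (`IsSnake.exists_bubble`).

On the side of words only the turns of the path matter, as angles modulo 8. After the third step no
turn is 0, no four successive turns are the same sharp turn, and no window of turns is 1, 1, 1, 2,
1, 1 up to a common sign (`tight_of_reduced`). The bubbles can then be read off from the turns: an
octagon sharing four edges with the path, or three of which the last is followed by an edge of the
path that starts the next bubble, or two between two bubbles. These bubbles and the remaining edges
form an admissible sequence (`IsPath.isTrack`). The fifth step never leaves its set of edges, since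
every octagon it may complete is one of these bubbles (`IsPath.exists_octSet_eq`), and it cannot
stop before all of them are complete (`IsPath.trackEdges_subset`). So the output depends only on the
path.

Termination of the first three steps rests on a lexicographic rank. Cancellations and replacements
of long cycles shorten the word. The replacement of a half cycle in a reduced word, as long as the
result is again reduced, does not diminish the number of half cycles. If this number is unchanged,
the number of replaceable half cycles does not grow; and if that is unchanged too, the procedure
continues with the new half cycle and the number of sharp turns towards its side drops
(`HalfMove.descent`). In the fifth step the number of incomplete octagons along one period drops.

For the limit points, let t be the period of the final path; it is conjugate to the element
represented by the original word. Some lift of this word therefore has the same period t. The output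
and this lift both consist of finitely many orbits of edges under the powers of t, so they stay at
bounded hyperbolic distance from each other and accumulate at the same points of the circle
(`limitPoints_subset`). -/

instance : Fintype Letter :=
  ⟨{.a, .b, .c, .d, .A, .B, .C, .D}, by intro x; cases x <;> decide⟩

instance : DecidableEq Side
  | .L, .L => isTrue rfl
  | .R, .R => isTrue rfl
  | .L, .R => isFalse nofun
  | .R, .L => isFalse nofun

/-- The opposite side. -/
def Side.opp : Side → Side
  | .L => .R
  | .R => .L

@[simp] lemma Side.opp_opp (s : Side) : s.opp.opp = s := by cases s <;> rfl

lemma Side.opp_ne (s : Side) : s.opp ≠ s := by cases s <;> nofun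

lemma Side.eq_or_eq_opp (s t : Side) : t = s ∨ t = s.opp := by
  cases s <;> cases t <;> simp [Side.opp]

/-- The angle, in multiples of `π / 4`, of a sharp turn towards a side. -/
def Side.sgn : Side → ZMod 8
  | .L => -1
  | .R => 1

@[simp] lemma Side.sgn_opp (s : Side) : s.opp.sgn = -s.sgn := by cases s <;> decide

/-- The direction of a letter, modulo `8`. -/
def Letter.angle (x : Letter) : ZMod 8 := (dir x : ZMod 8)

/-- The letter that has a given direction. -/
def Letter.ofAngle (k : ZMod 8) : Letter :=
  (![.b, .A, .B, .a, .d, .C, .D, .c] : Fin 8 → Letter) k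

/-- The letter that is found by turning counterclockwise, `k` times by `π / 4`. -/
def rot (k : ZMod 8) (x : Letter) : Letter := Letter.ofAngle (x.angle + k)

@[simp] lemma Letter.ofAngle_angle (x : Letter) : Letter.ofAngle x.angle = x := by
  cases x <;> rfl

@[simp] lemma Letter.angle_ofAngle (k : ZMod 8) : (Letter.ofAngle k).angle = k := by
  revert k; decide

@[simp] lemma angle_rot (k : ZMod 8) (x : Letter) : (rot k x).angle = x.angle + k := by
  simp [rot]

lemma Letter.angle_injective : Function.Injective Letter.angle :=
  Function.LeftInverse.injective Letter.ofAngle_angle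

@[simp] lemma rot_zero (x : Letter) : rot 0 x = x := by simp [rot]

lemma rot_rot (k l : ZMod 8) (x : Letter) : rot k (rot l x) = rot (l + k) x := by
  simp [rot, add_assoc]

@[simp] lemma rot_inj {k l : ZMod 8} {x : Letter} : rot k x = rot l x ↔ k = l := by
  constructor
  · intro h
    have := congrArg Letter.angle h
    simpa using this
  · rintro rfl; rfl

lemma exists_rot (x y : Letter) : ∃ k, y = rot k x :=
  ⟨y.angle - x.angle, by simp [rot]⟩

lemma ccw_eq_rot (x : Letter) : ccw x = rot 1 x := by cases x <;> rfl

lemma cw_eq_rot (x : Letter) : cw x = rot (-1) x := by cases x <;> rfl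

@[simp] lemma Letter.inv_inv (x : Letter) : x.inv.inv = x := by cases x <;> rfl

lemma inv_ne (x : Letter) : x.inv ≠ x := by cases x <;> decide

lemma toG_inv (x : Letter) : x.inv.toG = x.toG⁻¹ := by
  cases x <;> simp [Letter.toG, Letter.inv, Letter.toFree]

@[simp] lemma evalWord_nil : evalWord [] = 1 := rfl

@[simp] lemma evalWord_cons (x : Letter) (w : List Letter) :
    evalWord (x :: w) = x.toG * evalWord w := by simp [evalWord]

@[simp] lemma evalWord_append (u v : List Letter) :
    evalWord (u ++ v) = evalWord u * evalWord v := by simp [evalWord]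

lemma evalWord_invWord (w : List Letter) : evalWord (invWord w) = (evalWord w)⁻¹ := by
  induction w with
  | nil => simp [invWord]
  | cons x w ih =>
    have : invWord (x :: w) = invWord w ++ [x.inv] := by simp [invWord]
    rw [this, evalWord_append, ih]
    simp [toG_inv]

lemma evalWord_relator : evalWord relator = 1 := by
  have h : (PresentedGroup.mk {(relator.map Letter.toFree).prod})
      (relator.map Letter.toFree).prod = 1 :=
    PresentedGroup.one_of_mem (Set.mem_singleton _)
  rw [← h, map_list_prod, List.map_map]
  rfl

lemma isConj_evalWord_of_isRotated {u v : List Letter} (h : u ~r v) :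
    IsConj (evalWord u) (evalWord v) := by
  obtain ⟨n, rfl⟩ := h
  rw [List.rotate_eq_drop_append_take_mod, evalWord_append]
  nth_rewrite 1 [← List.take_append_drop (n % u.length) u]
  rw [evalWord_append, isConj_iff]
  exact ⟨(evalWord (u.take (n % u.length)))⁻¹, by group⟩

lemma evalWord_eq_one_of_isRotated {u v : List Letter} (h : u ~r v) (hv : evalWord v = 1) :
    evalWord u = 1 := by
  have := isConj_evalWord_of_isRotated h
  rw [hv] at this
  simpa using this

lemma Complementary.evalWord_eq {u v : List Letter} (h : Complementary u v) :
    evalWord u = evalWord v := by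
  have h1 : evalWord (u ++ invWord v) = 1 := by
    rcases h with h | h
    · exact evalWord_eq_one_of_isRotated h evalWord_relator
    · exact evalWord_eq_one_of_isRotated h (by rw [evalWord_invWord, evalWord_relator, inv_one])
  rw [evalWord_append, evalWord_invWord] at h1
  exact mul_inv_eq_one.mp h1

/-- The letter that follows `x` along the octagon on the side `s`. -/
def turn (s : Side) (x : Letter) : Letter := rot s.sgn x.inv

lemma turn_left : turn .L = turnLeft := by funext x; cases x <;> rfl

lemma turn_right : turn .R = turnRight := by funext x; cases x <;> rfl

/-- The reverse of a directed edge. -/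
def rev (e : DEdge) : DEdge := (e.target, e.2.inv)

/-- The directed edge that follows `e` along the octagon on the side `s`. -/
def nxt (s : Side) (e : DEdge) : DEdge := (e.target, turn s e.2)

/-- The directed edge with the same initial vertex whose label is found by turning. -/
def rotd (k : ZMod 8) (e : DEdge) : DEdge := (e.1, rot k e.2)

/-- The next directed edge, on the side `s`, with the same initial vertex. -/
def nbe (s : Side) (e : DEdge) : DEdge := rotd (-s.sgn) e

@[simp] lemma rev_fst (e : DEdge) : (rev e).1 = e.target := rfl

@[simp] lemma rev_target (e : DEdge) : (rev e).target = e.1 := by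
  simp [rev, DEdge.target, toG_inv]

@[simp] lemma rev_rev (e : DEdge) : rev (rev e) = e := by
  apply Prod.ext
  · simp
  · simp [rev]

@[simp] lemma edge_rev (e : DEdge) : (rev e).edge = e.edge := by
  simp [DEdge.edge, Sym2.eq_swap]

@[simp] lemma nxt_fst (s : Side) (e : DEdge) : (nxt s e).1 = e.target := rfl

@[simp] lemma nbe_fst (s : Side) (e : DEdge) : (nbe s e).1 = e.1 := rfl

@[simp] lemma rotd_fst (k : ZMod 8) (e : DEdge) : (rotd k e).1 = e.1 := rfl

@[simp] lemma rotd_snd (k : ZMod 8) (e : DEdge) : (rotd k e).2 = rot k e.2 := rfl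

@[simp] lemma rotd_zero (e : DEdge) : rotd 0 e = e := by simp [rotd]

lemma rotd_rotd (k l : ZMod 8) (e : DEdge) : rotd k (rotd l e) = rotd (l + k) e := by
  simp [rotd, rot_rot]

-- The edges at a vertex are permuted simply transitively by the rotations. Most later inequalities
-- between edges at a vertex are decided by comparing angles modulo 8 in this way.
@[simp] lemma rotd_inj {k l : ZMod 8} {e : DEdge} : rotd k e = rotd l e ↔ k = l := by
  simp [rotd]

lemma nxt_eq (s : Side) (e : DEdge) : nxt s e = rotd s.sgn (rev e) := rfl

lemma nbe_rev (s : Side) (e : DEdge) : nbe s.opp (rev e) = nxt s e := by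
  simp [nbe, nxt_eq]

lemma nbe_eq_nxt (s : Side) (e : DEdge) : nbe s e = nxt s.opp (rev e) := by
  rw [← nbe_rev]; simp

lemma nbe_opp_nbe (s : Side) (e : DEdge) : nbe s.opp (nbe s e) = e := by
  simp [nbe, rotd_rotd]

lemma nxt_opp_rev_nxt (s : Side) (e : DEdge) : nxt s.opp (rev (nxt s e)) = rev e := by
  rw [← nbe_eq_nxt, nxt_eq, nbe, rotd_rotd]; simp

lemma exists_rotd {e e' : DEdge} (h : e'.1 = e.1) : ∃ k, e' = rotd k e := by
  obtain ⟨k, hk⟩ := exists_rot e.2 e'.2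
  exact ⟨k, Prod.ext h hk⟩

lemma nxt_iterate (s : Side) (n : ℕ) (e : DEdge) :
    (nxt s)^[n] e =
      (e.1 * evalWord ((List.range n).map fun k => (turn s)^[k] e.2), (turn s)^[n] e.2) := by
  induction n with
  | zero => simp
  | succ n ih =>
    rw [Function.iterate_succ_apply', ih, List.range_succ, List.map_append, evalWord_append]
    simp [nxt, DEdge.target, mul_assoc, Function.iterate_succ_apply']

lemma leftEdge_eq (p : G) (x : Letter) (n : ℕ) : leftEdge p x n = (nxt .R)^[n] (p, x) := by
  rw [nxt_iterate, turn_right]; rfl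

lemma rightEdge_eq (p : G) (x : Letter) (n : ℕ) :
    rightEdge p x n = (nxt .L)^[n] (nbe .R (p, x)) := by
  rw [nxt_iterate, turn_left, rightEdge, cw_eq_rot]; rfl

/-- The labels met around the octagon form a cyclic permutation of the relator on the left, and of
its inverse on the right; this is checked for the eight initial letters. -/
lemma nxt_iterate_eight (s : Side) (e : DEdge) : (nxt s)^[8] e = e := by
  rw [nxt_iterate]
  obtain ⟨g, x⟩ := e
  have h1 : (turn s)^[8] x = x := by cases s <;> cases x <;> rfl
  have h2 : evalWord ((List.range 8).map fun k => (turn s)^[k] x) = 1 := by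
    cases s
    · refine evalWord_eq_one_of_isRotated (v := relator) ?_ evalWord_relator
      revert x; decide
    · refine evalWord_eq_one_of_isRotated (v := invWord relator) ?_
        (by rw [evalWord_invWord, evalWord_relator, inv_one])
      revert x; decide
  simp only [h1, h2, mul_one]

lemma nxt_iterate_add_eight (s : Side) (n : ℕ) (e : DEdge) :
    (nxt s)^[n + 8] e = (nxt s)^[n] e := by
  rw [Function.iterate_add_apply, nxt_iterate_eight]

lemma nxt_iterate_mod (s : Side) (n : ℕ) (e : DEdge) :
    (nxt s)^[n % 8] e = (nxt s)^[n] e := by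
  conv_rhs => rw [← Nat.mod_add_div n 8]
  rw [Function.iterate_add_apply, Function.iterate_mul]
  congr 1
  exact (Function.iterate_fixed (nxt_iterate_eight s e) _).symm

lemma nxt_opp_iterate_rev (s : Side) (n : ℕ) (e : DEdge) :
    (nxt s.opp)^[n] (rev ((nxt s)^[n] e)) = rev e := by
  induction n with
  | zero => rfl
  | succ n ih =>
    rw [Function.iterate_succ_apply, Function.iterate_succ_apply', nxt_opp_rev_nxt, ih]

lemma nxt_opp_iterate_rev_eq (s : Side) {n : ℕ} (hn : n ≤ 8) (e : DEdge) :
    (nxt s.opp)^[n] (rev e) = rev ((nxt s)^[8 - n] e) := by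
  rw [← nxt_opp_iterate_rev s n ((nxt s)^[8 - n] e), ← Function.iterate_add_apply,
    Nat.add_sub_cancel' hn, nxt_iterate_eight]

/-- Leaving the initial vertex of `e` along the other edge of the octagon, one runs through the same
circle backwards, starting with its eighth edge, number 7 when counting from 0. -/
lemma nxt_opp_iterate_nbe (s : Side) {n : ℕ} (hn : n ≤ 7) (e : DEdge) :
    (nxt s.opp)^[n] (nbe s e) = rev ((nxt s)^[7 - n] e) := by
  rw [nbe_eq_nxt, ← Function.iterate_succ_apply, nxt_opp_iterate_rev_eq s (by omega)]
  congr 2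
  omega

lemma nbe_eq_rev (s : Side) (e : DEdge) : nbe s e = rev ((nxt s)^[7] e) := by
  simpa using nxt_opp_iterate_nbe s (n := 0) (by omega) e

end SurfaceSnakes


noncomputable section
namespace SurfaceSnakes

/-! ### The action on the disc, and the half-planes -/

/-- The group `SU(1, 1)`. -/
def su11 : Subgroup (Matrix.SpecialLinearGroup (Fin 2) ℂ) where
  carrier := {M | M 1 1 = (starRingEnd ℂ) (M 0 0) ∧ M 1 0 = (starRingEnd ℂ) (M 0 1)}
  one_mem' := by simp
  mul_mem' := by
    rintro M N ⟨h1, h2⟩ ⟨h3, h4⟩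
    constructor <;>
    · simp only [Matrix.SpecialLinearGroup.coe_mul, Matrix.mul_apply, Fin.sum_univ_two, h1, h2, h3,
        h4, map_add, map_mul, Complex.conj_conj]
      ring
  inv_mem' := by
    rintro M ⟨h1, h2⟩
    constructor <;> simp [Matrix.SpecialLinearGroup.coe_inv, Matrix.adjugate_fin_two, h1, h2]

lemma norm_eta : ‖eta‖ = 1 := by
  rw [eta, show (π / 8 * Complex.I : ℂ) = ((π / 8 : ℝ) : ℂ) * Complex.I by push_cast; ring]
  exact Complex.norm_exp_ofReal_mul_I _

lemma conj_eta : (starRingEnd ℂ) eta = eta⁻¹ :=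
  (Complex.inv_eq_conj norm_eta).symm

lemma rotation_mem (n : ℤ) : rotation n ∈ su11 := by
  constructor
  · change eta ^ (-n) = (starRingEnd ℂ) (eta ^ n)
    rw [map_zpow₀, conj_eta, inv_zpow, zpow_neg]
  · change (0 : ℂ) = (starRingEnd ℂ) 0
    simp

lemma translation_mem : translation ∈ su11 := by
  constructor
  · change ((1 + √2 : ℝ) : ℂ) = (starRingEnd ℂ) ((1 + √2 : ℝ) : ℂ)
    rw [Complex.conj_ofReal]
  · change ((√(2 + 2 * √2) : ℝ) : ℂ) = (starRingEnd ℂ) ((√(2 + 2 * √2) : ℝ) : ℂ)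
    rw [Complex.conj_ofReal]

lemma sidePairing_mem (x : Letter) : sidePairing x ∈ su11 :=
  mul_mem (mul_mem (rotation_mem _) translation_mem) (rotation_mem _)

lemma deck_mk (w : FreeGroup (Fin 4)) : deck (PresentedGroup.mk _ w) = FreeGroup.lift genPairing w :=
  rfl

lemma deck_mem (g : G) : deck g ∈ su11 := by
  obtain ⟨w, rfl⟩ := PresentedGroup.mk_surjective _ g
  rw [deck_mk]
  have : (FreeGroup.lift genPairing).range ≤ su11 :=
    FreeGroup.range_lift_le (by rintro _ ⟨i, rfl⟩; exact sidePairing_mem _)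
  exact this ⟨w, rfl⟩

/-- The Möbius transformation of a matrix. -/
def mob (M : Matrix.SpecialLinearGroup (Fin 2) ℂ) (z : ℂ) : ℂ :=
  (M 0 0 * z + M 0 1) / (M 1 0 * z + M 1 1)

lemma act_eq_mob (g : G) (z : ℂ) : act g z = mob (deck g) z := rfl

/-- The denominator of a Möbius transformation. -/
def den (M : Matrix.SpecialLinearGroup (Fin 2) ℂ) (z : ℂ) : ℂ := M 1 0 * z + M 1 1

/-- Matrices in SU(1, 1) preserve the Hermitian form of signature (1, 1); here it is evaluated at
the vector (z, 1). -/
lemma normSq_den_sub {M : Matrix.SpecialLinearGroup (Fin 2) ℂ} (hM : M ∈ su11) (z : ℂ) :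
    Complex.normSq (den M z) - Complex.normSq (M 0 0 * z + M 0 1) = 1 - Complex.normSq z := by
  obtain ⟨h1, h2⟩ := hM
  have hd := M.det_coe
  rw [Matrix.det_fin_two, h1, h2] at hd
  have hr := congrArg Complex.re hd
  rw [den, h1, h2]
  generalize M 0 0 = α at *
  generalize M 0 1 = β at *
  simp only [Complex.sub_re, Complex.mul_re, Complex.conj_re, Complex.conj_im, Complex.one_re,
    Complex.normSq_apply, Complex.add_re, Complex.add_im, Complex.mul_im] at hr ⊢
  linear_combination (1 - z.re * z.re - z.im * z.im) * hr

lemma normSq_den_pos {M : Matrix.SpecialLinearGroup (Fin 2) ℂ} (hM : M ∈ su11) {z : ℂ}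
    (hz : Complex.normSq z < 1) : 0 < Complex.normSq (den M z) := by
  have := normSq_den_sub hM z
  have := Complex.normSq_nonneg (M 0 0 * z + M 0 1)
  linarith

lemma den_ne_zero {M : Matrix.SpecialLinearGroup (Fin 2) ℂ} (hM : M ∈ su11) {z : ℂ}
    (hz : Complex.normSq z < 1) : den M z ≠ 0 :=
  Complex.normSq_pos.mp (normSq_den_pos hM hz)

lemma one_sub_normSq_mob {M : Matrix.SpecialLinearGroup (Fin 2) ℂ} (hM : M ∈ su11) {z : ℂ}
    (hz : Complex.normSq z < 1) :
    1 - Complex.normSq (mob M z) = (1 - Complex.normSq z) / Complex.normSq (den M z) := by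
  have h := normSq_den_sub hM z
  have hp := normSq_den_pos hM hz
  rw [mob, Complex.normSq_div, eq_div_iff hp.ne', sub_mul]
  change 1 * Complex.normSq (den M z) - _ / Complex.normSq (den M z) * Complex.normSq (den M z) = _
  rw [div_mul_cancel₀ _ hp.ne', one_mul, h]

lemma normSq_mob_lt {M : Matrix.SpecialLinearGroup (Fin 2) ℂ} (hM : M ∈ su11) {z : ℂ}
    (hz : Complex.normSq z < 1) : Complex.normSq (mob M z) < 1 := by
  have h := one_sub_normSq_mob hM hz
  have : 0 < (1 - Complex.normSq z) / Complex.normSq (den M z) :=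
    div_pos (by linarith) (normSq_den_pos hM hz)
  linarith

lemma mob_mul {M N : Matrix.SpecialLinearGroup (Fin 2) ℂ} (hM : M ∈ su11) (hN : N ∈ su11) {z : ℂ}
    (hz : Complex.normSq z < 1) : mob (M * N) z = mob M (mob N z) := by
  have h1 := den_ne_zero hN hz
  have h2 := den_ne_zero hM (normSq_mob_lt hN hz)
  have h3 := den_ne_zero (mul_mem hM hN) hz
  simp only [den, mob, Matrix.SpecialLinearGroup.coe_mul, Matrix.mul_apply, Fin.sum_univ_two] at *
  rw [div_eq_div_iff h3 h2]
  field_simp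
  ring

lemma mob_one (z : ℂ) : mob 1 z = z := by simp [mob]

lemma normSq_lt_one_iff {z : ℂ} : Complex.normSq z < 1 ↔ ‖z‖ < 1 := by
  rw [Complex.normSq_eq_norm_sq, sq_lt_one_iff₀ (norm_nonneg z)]

lemma normSq_act_lt (g : G) {z : ℂ} (hz : Complex.normSq z < 1) : Complex.normSq (act g z) < 1 :=
  normSq_mob_lt (deck_mem g) hz

lemma act_mul (g h : G) {z : ℂ} (hz : Complex.normSq z < 1) : act (g * h) z = act g (act h z) := by
  simp only [act_eq_mob, map_mul]
  exact mob_mul (deck_mem g) (deck_mem h) hz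

lemma act_one (z : ℂ) : act 1 z = z := by simp [act_eq_mob, mob_one]

/-- The component of `w` in the direction number `n`. -/
def comp (n : ℤ) (w : ℂ) : ℝ := (eta ^ (-2 * n) * w).re

lemma eta_pow_four : eta ^ (4 : ℤ) = Complex.I := by
  rw [eta, ← Complex.exp_int_mul]
  rw [show ((4 : ℤ) : ℂ) * (π / 8 * Complex.I) = π / 2 * Complex.I by push_cast; ring]
  exact Complex.exp_pi_div_two_mul_I

lemma eta_zpow_eight : eta ^ (8 : ℤ) = -1 := by exact_mod_cast eta_pow

lemma eta_two_add : eta ^ (2 : ℤ) + eta ^ (-2 : ℤ) = ((√2 : ℝ) : ℂ) := by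
  rw [eta, ← Complex.exp_int_mul, ← Complex.exp_int_mul]
  have h3 := Complex.two_cos ((π / 4 : ℝ) : ℂ)
  rw [← Complex.ofReal_cos, Real.cos_pi_div_four] at h3
  push_cast at h3 ⊢
  rw [show (2 : ℂ) * (π / 8 * Complex.I) = π / 4 * Complex.I by ring,
    show (-2 : ℂ) * (π / 8 * Complex.I) = -(π / 4) * Complex.I by ring, ← h3]
  ring

lemma comp_add_four (n : ℤ) (w : ℂ) : comp (n + 4) w = -comp n w := by
  have : eta ^ (-2 * (n + 4)) = -eta ^ (-2 * n) := by
    rw [show -2 * (n + 4) = -2 * n - 8 by ring, zpow_sub₀ eta_ne_zero, eta_zpow_eight]; ring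
  rw [comp, this, neg_mul, Complex.neg_re, comp]

lemma comp_add_eight (n : ℤ) (w : ℂ) : comp (n + 8) w = comp n w := by
  rw [show n + 8 = n + 4 + 4 by ring, comp_add_four, comp_add_four, neg_neg]

lemma comp_add_eight_mul (n m : ℤ) (w : ℂ) : comp (n + 8 * m) w = comp n w := by
  induction m using Int.induction_on with
  | zero => simp
  | succ i ih => rw [← ih, ← comp_add_eight (n + 8 * (i : ℤ))]; congr 1; ring
  | pred i ih => rw [← ih, ← comp_add_eight (n + 8 * (-↑i - 1))]; congr 1; ring

lemma comp_congr {m n : ℤ} (h : (m : ZMod 8) = n) (w : ℂ) : comp m w = comp n w := by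
  obtain ⟨k, hk⟩ := (ZMod.intCast_eq_intCast_iff_dvd_sub _ _ 8).mp h
  rw [← comp_add_eight_mul m k, ← show n = m + 8 * k by push_cast at hk; linarith]

/-- Unit vectors in directions π/4 on both sides of a third one add up to 2 cos(π/4) times the
latter. -/
lemma comp_add_comp (n : ℤ) (w : ℂ) : comp n w + comp (n + 2) w = √2 * comp (n + 1) w := by
  have h : eta ^ (-2 * n) + eta ^ (-2 * (n + 2)) = ((√2 : ℝ) : ℂ) * eta ^ (-2 * (n + 1)) := by
    rw [← eta_two_add, add_mul, ← zpow_add₀ eta_ne_zero, ← zpow_add₀ eta_ne_zero]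
    congr 2 <;> ring
  rw [comp, comp, ← Complex.add_re, ← add_mul, h, mul_assoc, Complex.re_ofReal_mul, comp]

lemma normSq_eta_zpow (n : ℤ) : Complex.normSq (eta ^ n) = 1 := by
  rw [Complex.normSq_eq_norm_sq, norm_zpow, norm_eta]; simp

lemma comp_le (n : ℤ) (w : ℂ) : 2 * comp n w ≤ 1 + Complex.normSq w := by
  have h : Complex.normSq (eta ^ (-2 * n) * w) = Complex.normSq w := by
    rw [map_mul, normSq_eta_zpow, one_mul]
  rw [← h, comp, Complex.normSq_apply]
  nlinarith [sq_nonneg ((eta ^ (-2 * n) * w).re - 1), sq_nonneg (eta ^ (-2 * n) * w).im]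

/-- In SL₂ the side pairings of inverse letters are inverse only up to the sign −1 = `rotation 8`,
which the Möbius transformations do not see. -/
lemma sidePairing_inv (x : Letter) :
    (sidePairing x)⁻¹ = rotation 8 * sidePairing x.inv := by
  rw [sidePairing, mul_inv_rev, mul_inv_rev, translation_inv, rotation_inv, rotation_inv, sidePairing]
  simp only [← mul_assoc, rotation_mul]
  rw [mul_assoc, mul_assoc, rotation_mul]
  rw [← mul_assoc]
  simp only [Letter.inv_inv]
  congr 2 <;> congr 1 <;> ring

lemma mob_rotation_eight_mul (M : Matrix.SpecialLinearGroup (Fin 2) ℂ) (z : ℂ) :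
    mob (rotation 8 * M) z = mob M z := by
  have h : (rotation 8 : Matrix (Fin 2) (Fin 2) ℂ) = -1 := by
    change !![eta ^ (8 : ℤ), 0; 0, eta ^ (-8 : ℤ)] = -1
    rw [zpow_neg, eta_zpow_eight, Matrix.one_fin_two]
    ext i j; fin_cases i <;> fin_cases j <;> simp
  simp only [mob, Matrix.SpecialLinearGroup.coe_mul, h, neg_mul, one_mul, Matrix.neg_apply]
  rw [← neg_add, ← neg_add, neg_div_neg_eq]

lemma deck_toG (x : Letter) :
    deck x.toG = sidePairing x ∨ deck x.toG = (sidePairing x.inv)⁻¹ := by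
  cases x
  case a => left; simp [Letter.toG, deck_mk, Letter.toFree, genPairing]
  case b => left; simp [Letter.toG, deck_mk, Letter.toFree, genPairing]
  case c => left; simp [Letter.toG, deck_mk, Letter.toFree, genPairing]
  case d => left; simp [Letter.toG, deck_mk, Letter.toFree, genPairing]
  all_goals right; simp [Letter.toG, deck_mk, Letter.toFree, genPairing, Letter.inv]

lemma act_toG (x : Letter) (w : ℂ) : act x.toG w = mob (sidePairing x) w := by
  rw [act_eq_mob]
  rcases deck_toG x with h | h
  · rw [h]
  · rw [h, sidePairing_inv, mob_rotation_eight_mul, Letter.inv_inv]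

/-- The translation length, as a coefficient. -/
def cosh2 : ℝ := 5 + 4 * √2

/-- The coefficient of the components in `dist_mul`. -/
def sinh2 : ℝ := 4 * ((1 + √2) * √(2 + 2 * √2))

lemma sq_sqrt_two : √2 * √2 = (2 : ℝ) := Real.mul_self_sqrt (by norm_num)

/-- The hyperbolic cosine of the distance between `w` and the centre. -/
def height (w : ℂ) : ℝ := (1 + Complex.normSq w) / (1 - Complex.normSq w)

/-- Up to rotations before and after, a generator is the translation along the real diameter. Here
`v` is `w` rotated so that the direction of `x` becomes the positive real axis, and `u` is `v`
translated backwards by twice the inradius ρ, with cosh ρ = 1 + √2 and sinh ρ = √(2 + 2√2). -/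
lemma act_inv_toG (x : Letter) {w : ℂ} (hw : Complex.normSq w < 1) :
    ∃ v u : ℂ, (∀ n, comp (dir x + n) w = comp n v) ∧ Complex.normSq v = Complex.normSq w ∧
      0 < Complex.normSq (((1 + √2 : ℝ) : ℂ) - ((√(2 + 2 * √2) : ℝ) : ℂ) * v) ∧
      u = (((1 + √2 : ℝ) : ℂ) * v - ((√(2 + 2 * √2) : ℝ) : ℂ)) /
        (((1 + √2 : ℝ) : ℂ) - ((√(2 + 2 * √2) : ℝ) : ℂ) * v) ∧
      (∀ n, comp (dir x.inv + 4 + n) (act x.toG⁻¹ w) = comp n u) ∧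
      Complex.normSq (act x.toG⁻¹ w) = Complex.normSq u := by
  have hM : (sidePairing x.inv) ∈ su11 := sidePairing_mem _
  have hden := normSq_den_pos hM hw
  have hent : (sidePairing x.inv : Matrix (Fin 2) (Fin 2) ℂ) =
      !![eta ^ dir x.inv, 0; 0, eta ^ (-dir x.inv)] *
      !![((1 + √2 : ℝ) : ℂ), ((√(2 + 2 * √2) : ℝ) : ℂ);
        ((√(2 + 2 * √2) : ℝ) : ℂ), ((1 + √2 : ℝ) : ℂ)] *
      !![eta ^ (-(dir x + 4)), 0; 0, eta ^ (-(-(dir x + 4)))] := by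
    rw [sidePairing, Letter.inv_inv]; rfl
  have h8 : eta ^ (-4 : ℤ) * eta ^ (-4 : ℤ) = -1 := by
    rw [← zpow_add₀ eta_ne_zero, show (-4 + -4 : ℤ) = -8 by norm_num, zpow_neg, eta_zpow_eight]
    norm_num
  have hin : eta ^ dir x.inv * eta ^ (-dir x.inv) = 1 := by
    rw [← zpow_add₀ eta_ne_zero]; simp
  have hj : eta ^ dir x * eta ^ (-dir x) = 1 := by rw [← zpow_add₀ eta_ne_zero]; simp
  have h44 : eta ^ (4 : ℤ) * eta ^ (-4 : ℤ) = 1 := by rw [← zpow_add₀ eta_ne_zero]; simp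
  have e1 : eta ^ (-(dir x + 4)) = eta ^ (-dir x) * eta ^ (-4 : ℤ) := by
    rw [← zpow_add₀ eta_ne_zero]; congr 1; ring
  have e2 : eta ^ (-(-(dir x + 4))) = eta ^ dir x * eta ^ (4 : ℤ) := by
    rw [← zpow_add₀ eta_ne_zero]; congr 1; ring
  have e3 : eta ^ (-2 * dir x) = eta ^ (-dir x) * eta ^ (-dir x) := by
    rw [← zpow_add₀ eta_ne_zero]; congr 1; ring
  have e4 : eta ^ (2 * (dir x.inv + 4)) = -(eta ^ dir x.inv * eta ^ dir x.inv) := by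
    rw [show 2 * (dir x.inv + 4) = dir x.inv + dir x.inv + 8 by ring, zpow_add₀ eta_ne_zero,
      zpow_add₀ eta_ne_zero, eta_zpow_eight]; ring
  have hact : act x.toG⁻¹ w = mob (sidePairing x.inv) w := by rw [← toG_inv, act_toG]
  have h4 : eta ^ (4 : ℤ) = -eta ^ (-4 : ℤ) := by
    linear_combination eta ^ (4 : ℤ) * h8 - eta ^ (-4 : ℤ) * h44
  set v := eta ^ (-2 * dir x) * w with hv
  have hdv : den (sidePairing x.inv) w = eta ^ (-dir x.inv) * eta ^ dir x * eta ^ (4 : ℤ) *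
      (((1 + √2 : ℝ) : ℂ) - ((√(2 + 2 * √2) : ℝ) : ℂ) * v) := by
    rw [den, hent, Matrix.mul_fin_two, Matrix.mul_fin_two, e1, e2, hv, e3]
    generalize ((1 + √2 : ℝ) : ℂ) = k at *
    generalize ((√(2 + 2 * √2) : ℝ) : ℂ) = s at *
    clear hv hact hent e1 e2 e3 e4
    generalize eta ^ (4 : ℤ) = p at *
    generalize eta ^ (-4 : ℤ) = m at *
    generalize eta ^ dir x = q at *
    generalize eta ^ (-dir x) = q' at *
    generalize eta ^ dir x.inv = r at *
    generalize eta ^ (-dir x.inv) = r' at *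
    simp
    subst h4
    linear_combination (-r' * s * w * m * q') * hj
  have hnv : (sidePairing x.inv) 0 0 * w + (sidePairing x.inv) 0 1 =
      eta ^ dir x.inv * eta ^ dir x * eta ^ (-4 : ℤ) *
      (((1 + √2 : ℝ) : ℂ) * v - ((√(2 + 2 * √2) : ℝ) : ℂ)) := by
    rw [hent, Matrix.mul_fin_two, Matrix.mul_fin_two, e1, e2, hv, e3]
    clear hdv
    generalize ((1 + √2 : ℝ) : ℂ) = k at *
    generalize ((√(2 + 2 * √2) : ℝ) : ℂ) = s at *
    clear hv hact hent e1 e2 e3 e4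
    generalize eta ^ (4 : ℤ) = p at *
    generalize eta ^ (-4 : ℤ) = m at *
    generalize eta ^ dir x = q at *
    generalize eta ^ (-dir x) = q' at *
    generalize eta ^ dir x.inv = r at *
    generalize eta ^ (-dir x.inv) = r' at *
    simp
    subst h4
    linear_combination (-r * k * w * m * q') * hj
  rw [hdv, map_mul, map_mul, map_mul, normSq_eta_zpow, normSq_eta_zpow, normSq_eta_zpow, one_mul,
    one_mul, one_mul] at hden
  have hne := Complex.normSq_pos.mp hden
  have hmob : act x.toG⁻¹ w = eta ^ (2 * (dir x.inv + 4)) *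
      ((((1 + √2 : ℝ) : ℂ) * v - ((√(2 + 2 * √2) : ℝ) : ℂ)) /
        (((1 + √2 : ℝ) : ℂ) - ((√(2 + 2 * √2) : ℝ) : ℂ) * v)) := by
    rw [hact, mob, hnv]
    change _ / den _ _ = _
    rw [hdv, e4, ← mul_div_assoc, div_eq_div_iff _ hne]
    · generalize ((1 + √2 : ℝ) : ℂ) = k at *
      generalize ((√(2 + 2 * √2) : ℝ) : ℂ) = s at *
      linear_combination (eta ^ dir x.inv * eta ^ dir x * (k * v - s) * (k - s * v)) *
        (eta ^ (4 : ℤ) * h8 - eta ^ (-4 : ℤ) * h44 + eta ^ (4 : ℤ) * hin)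
    · exact mul_ne_zero (mul_ne_zero (mul_ne_zero (zpow_ne_zero _ eta_ne_zero)
        (zpow_ne_zero _ eta_ne_zero)) (zpow_ne_zero _ eta_ne_zero)) hne
  refine ⟨v, _, ?_, ?_, hden, rfl, ?_, ?_⟩
  · intro n
    rw [comp, comp, hv, ← mul_assoc, ← zpow_add₀ eta_ne_zero]
    congr 3; ring
  · rw [hv, map_mul, normSq_eta_zpow, one_mul]
  · intro n
    rw [hmob, comp, comp, ← mul_assoc, ← zpow_add₀ eta_ne_zero]
    congr 3; ring
  · rw [hmob, map_mul, normSq_eta_zpow, one_mul]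

/-- The hyperbolic cosine of the distance between the vertex `g` and the point `z`. -/
def coshDist (g : G) (z : ℂ) : ℝ := height (act g⁻¹ z)

/-- The component of `z`, seen from the vertex `g`, in the direction `k`, in the hyperboloid model
and suitably normalized. -/
def compAt (g : G) (k : ZMod 8) (z : ℂ) : ℝ :=
  sinh2 * (comp (k.val : ℤ) (act g⁻¹ z) / (1 - Complex.normSq (act g⁻¹ z)))

lemma compAt_eq (g : G) {k : ZMod 8} {n : ℤ} (h : (n : ZMod 8) = k) (z : ℂ) :
    compAt g k z = sinh2 * (comp n (act g⁻¹ z) / (1 - Complex.normSq (act g⁻¹ z))) := by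
  rw [compAt, comp_congr (n := n)]
  rw [h]; simp

lemma compAt_add_four (g : G) (k : ZMod 8) (z : ℂ) : compAt g (k + 4) z = -compAt g k z := by
  rw [compAt_eq g (n := (k.val : ℤ) + 4) (by simp), comp_add_four, compAt]
  ring

lemma compAt_add_two (g : G) (k : ZMod 8) (z : ℂ) :
    compAt g k z + compAt g (k + 2) z = √2 * compAt g (k + 1) z := by
  have h := comp_add_comp (k.val : ℤ) (act g⁻¹ z)
  rw [compAt_eq g (k := k + 2) (n := (k.val : ℤ) + 2) (by simp),
    compAt_eq g (k := k + 1) (n := (k.val : ℤ) + 1) (by simp), compAt]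
  linear_combination sinh2 / (1 - Complex.normSq (act g⁻¹ z)) * h

lemma sinh2_pos : 0 < sinh2 := by
  rw [sinh2]; positivity

lemma height_pos {w : ℂ} (hw : Complex.normSq w < 1) : 0 < height w :=
  div_pos (by linarith [Complex.normSq_nonneg w]) (by linarith)

lemma coshDist_pos (g : G) {z : ℂ} (hz : Complex.normSq z < 1) : 0 < coshDist g z :=
  height_pos (normSq_act_lt _ hz)

lemma compAt_le (g : G) (k : ZMod 8) {z : ℂ} (hz : Complex.normSq z < 1) :
    2 * compAt g k z ≤ sinh2 * coshDist g z := by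
  have h1 := normSq_act_lt g⁻¹ hz
  have h2 := comp_le (k.val : ℤ) (act g⁻¹ z)
  have h3 : 0 < 1 - Complex.normSq (act g⁻¹ z) := by linarith
  rw [compAt, coshDist, height, ← mul_assoc, mul_comm 2 sinh2, mul_assoc]
  refine mul_le_mul_of_nonneg_left ?_ sinh2_pos.le
  rw [← mul_div_assoc]
  gcongr

/-- Here `cosh2` is cosh 2ρ and `sinh2` is 2 sinh 2ρ for the inradius ρ, so that the inequality
amounts to tanh ρ > cos(π/4): by the angle of parallelism, geodesics at distance ρ from the centre
in perpendicular directions do not meet. -/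
lemma sqrt_mul_sinh2_lt : √2 * sinh2 < 4 * (cosh2 - 1) := by
  have h0 : 0 ≤ √2 := Real.sqrt_nonneg _
  have h1 := sq_sqrt_two
  have h2 : √(2 + 2 * √2) * √(2 + 2 * √2) = 2 + 2 * √2 := Real.mul_self_sqrt (by positivity)
  refine lt_of_pow_lt_pow_left₀ 2 (by rw [cosh2]; nlinarith) ?_
  rw [sinh2, cosh2]
  have : (√2 * (4 * ((1 + √2) * √(2 + 2 * √2)))) ^ 2 =
      16 * (√2 * √2) * (1 + √2) ^ 2 * (√(2 + 2 * √2) * √(2 + 2 * √2)) := by ring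
  rw [this, h1, h2]
  nlinarith [mul_nonneg h0 h0]

lemma act_inv_mul (g : G) (x : Letter) {z : ℂ} (hz : Complex.normSq z < 1) :
    act (g * x.toG)⁻¹ z = act x.toG⁻¹ (act g⁻¹ z) := by
  rw [mul_inv_rev, act_mul _ _ hz]

/-- This is the hyperbolic law of cosines for the triangle formed by `z` and two neighbouring
vertices of Γ. -/
lemma coshDist_mul (g : G) (x : Letter) {z : ℂ} (hz : Complex.normSq z < 1) :
    coshDist (g * x.toG) z = cosh2 * coshDist g z - compAt g x.angle z := by
  have hw := normSq_act_lt g⁻¹ hz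
  obtain ⟨v, u, h1, h2, h3, rfl, h4, h5⟩ := act_inv_toG x hw
  have h0 := h1 0
  rw [add_zero] at h0
  rw [coshDist, act_inv_mul g x hz, compAt_eq g (k := x.angle) (n := dir x) rfl, coshDist, height, height, h5,
    ← h2, h0, Complex.normSq_div]
  have hv : Complex.normSq v < 1 := by rw [h2]; exact hw
  clear h1 h2 h4 h5 h0
  have hs1 := sq_sqrt_two
  have hs2 : √(2 + 2 * √2) * √(2 + 2 * √2) = 2 + 2 * √2 := Real.mul_self_sqrt (by positivity)
  have hd : Complex.normSq (((1 + √2 : ℝ) : ℂ) - ((√(2 + 2 * √2) : ℝ) : ℂ) * v) -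
      Complex.normSq (((1 + √2 : ℝ) : ℂ) * v - ((√(2 + 2 * √2) : ℝ) : ℂ)) =
      1 - Complex.normSq v := by
    rw [Complex.normSq_apply, Complex.normSq_apply, Complex.normSq_apply]
    generalize √(2 + 2 * √2) = s at *
    simp
    linear_combination (1 - v.re * v.re - v.im * v.im) * (hs1 - hs2)
  have hsum : Complex.normSq (((1 + √2 : ℝ) : ℂ) - ((√(2 + 2 * √2) : ℝ) : ℂ) * v) +
      Complex.normSq (((1 + √2 : ℝ) : ℂ) * v - ((√(2 + 2 * √2) : ℝ) : ℂ)) =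
      cosh2 * (1 + Complex.normSq v) - sinh2 * comp 0 v := by
    rw [Complex.normSq_apply, Complex.normSq_apply, Complex.normSq_apply, cosh2, sinh2, comp]
    generalize √(2 + 2 * √2) = s at *
    simp
    linear_combination (1 + v.re * v.re + v.im * v.im) * (hs1 + hs2)
  have hne : 1 - Complex.normSq v ≠ 0 := by linarith
  generalize Complex.normSq (((1 + √2 : ℝ) : ℂ) - ((√(2 + 2 * √2) : ℝ) : ℂ) * v) = N at *
  generalize Complex.normSq (((1 + √2 : ℝ) : ℂ) * v - ((√(2 + 2 * √2) : ℝ) : ℂ)) = N' at *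
  have hN : N ≠ 0 := h3.ne'
  have : (1 + N' / N) / (1 - N' / N) = (N + N') / (N - N') := by
    rw [div_eq_div_iff]
    · field_simp
    · rw [one_sub_div hN, hd]; exact div_ne_zero hne hN
    · rw [hd]; exact hne
  rw [this, hsum, hd, sub_div, mul_div_assoc, mul_div_assoc]

/-- A translation preserves the component perpendicular to its axis. The sign changes since, seen
from the new vertex, `x.inv` points backwards, so that the perpendicular direction is the opposite
one. -/
lemma compAt_mul (g : G) (x : Letter) {z : ℂ} (hz : Complex.normSq z < 1) :
    compAt (g * x.toG) (x.inv.angle + 2) z = -compAt g (x.angle + 2) z := by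
  have hw := normSq_act_lt g⁻¹ hz
  obtain ⟨v, u, h1, h2, h3, hu, h4, h5⟩ := act_inv_toG x hw
  rw [compAt_eq (g * x.toG) (n := dir x.inv + 4 + -2), act_inv_mul g x hz, h4, h5,
    compAt_eq g (n := dir x + 2), h1, ← h2, ← mul_neg]
  · congr 1
    have hv : Complex.normSq v < 1 := by rw [h2]; exact hw
    have e1 : comp 2 v = v.im := by
      rw [comp, show (-2 * 2 : ℤ) = -4 by norm_num, zpow_neg, eta_pow_four]; simp
    have e2 : comp (-2) u = -u.im := by
      rw [comp, show (-2 * -2 : ℤ) = 4 by norm_num, eta_pow_four]; simp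
    rw [e1, e2, neg_div, neg_inj, hu, Complex.normSq_div, Complex.div_im]
    have hs1 := sq_sqrt_two
    have hs2 : √(2 + 2 * √2) * √(2 + 2 * √2) = 2 + 2 * √2 := Real.mul_self_sqrt (by positivity)
    have hd : Complex.normSq (((1 + √2 : ℝ) : ℂ) - ((√(2 + 2 * √2) : ℝ) : ℂ) * v) -
        Complex.normSq (((1 + √2 : ℝ) : ℂ) * v - ((√(2 + 2 * √2) : ℝ) : ℂ)) =
        1 - Complex.normSq v := by
      rw [Complex.normSq_apply, Complex.normSq_apply, Complex.normSq_apply]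
      generalize √(2 + 2 * √2) = s at *
      simp
      linear_combination (1 - v.re * v.re - v.im * v.im) * (hs1 - hs2)
    have hne : 1 - Complex.normSq v ≠ 0 := by linarith
    generalize hN : Complex.normSq (((1 + √2 : ℝ) : ℂ) - ((√(2 + 2 * √2) : ℝ) : ℂ) * v) = N at *
    generalize Complex.normSq (((1 + √2 : ℝ) : ℂ) * v - ((√(2 + 2 * √2) : ℝ) : ℂ)) = N' at *
    have hN0 : N ≠ 0 := h3.ne'
    have : 1 - N' / N = (1 - Complex.normSq v) / N := by rw [← hd, sub_div, div_self hN0]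
    rw [this]
    generalize √(2 + 2 * √2) = s at *
    simp
    field_simp
    linear_combination v.im * (hs1 - hs2)
  · push_cast; rfl
  · push_cast
    rw [add_assoc]
    rfl

/-- The signed distance, suitably normalized, of the point `z` from the geodesic that a directed edge
crosses; it is positive beyond that geodesic. -/
def ell (e : DEdge) (z : ℂ) : ℝ := coshDist e.1 z - coshDist e.target z

lemma ell_rev (e : DEdge) (z : ℂ) : ell (rev e) z = -ell e z := by
  simp [ell]

lemma ell_eq (e : DEdge) {z : ℂ} (hz : Complex.normSq z < 1) :
    ell e z = compAt e.1 e.2.angle z - (cosh2 - 1) * coshDist e.1 z := by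
  rw [ell, DEdge.target, coshDist_mul _ _ hz]; ring

/-- The sides of an octagon of the tessellation that are not adjacent lie on disjoint geodesics, so
no point is beyond both. The closest case, directions at a right angle, is `sqrt_mul_sinh2_lt`. -/
lemma ell_add_lt (e : DEdge) {k : ZMod 8} (h0 : k ≠ 0) (h1 : k ≠ 1) (h2 : k ≠ -1) {z : ℂ}
    (hz : Complex.normSq z < 1) : ell e z + ell (rotd k e) z < 0 := by
  rw [ell_eq _ hz, ell_eq _ hz]
  simp only [rotd_fst, rotd_snd, angle_rot]
  have hp := coshDist_pos e.1 hz
  have hs := mul_lt_mul_of_pos_right sqrt_mul_sinh2_lt hp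
  have hr : 1 < √2 := by
    rw [Real.lt_sqrt] <;> norm_num
  have hr2 := sq_sqrt_two
  have hr3 : √2 < 2 := by nlinarith
  have hr4 : 4 < cosh2 := by rw [cosh2]; linarith
  have hle := fun k => compAt_le e.1 k hz
  have hrel := fun k => compAt_add_two e.1 k z
  have hopp := fun k => compAt_add_four e.1 k z
  generalize hf : (fun k => compAt e.1 k z) = c at *
  have hc : ∀ k, compAt e.1 k z = c k := fun k => by rw [← hf]
  simp only [hc] at *
  generalize coshDist e.1 z = f at *
  generalize e.2.angle = j at *
  have hB : 0 < sinh2 := sinh2_pos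
  -- Directions at the angle π/2: the sum is √2 times the component in the direction between them,
  -- which is at most `sinh2 * f / 2`.
  have key2 : ∀ j, c j + c (j + 2) < 2 * (cosh2 - 1) * f := by
    intro j
    have := mul_le_mul_of_nonneg_left (hle (j + 1)) (by linarith : (0 : ℝ) ≤ √2)
    nlinarith [hrel j]
  -- Directions at the angle 3π/4: applying the relation twice expresses the sum as √2 − 1 times
  -- that of the two components in between.
  have key3 : ∀ j, c j + c (j + 3) < 2 * (cosh2 - 1) * f := by
    intro j
    have e1 := hrel j
    have e2 := hrel (j + 1)
    rw [show j + 1 + 2 = j + 3 by ring, show j + 1 + 1 = j + 2 by ring] at e2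
    have hsum : c (j + 1) + c (j + 2) ≤ sinh2 * f := by linarith [hle (j + 1), hle (j + 2)]
    have : c j + c (j + 3) = (√2 - 1) * (c (j + 1) + c (j + 2)) := by linear_combination e1 + e2
    rw [this]
    have h5 := mul_le_mul_of_nonneg_left hsum (by linarith : (0 : ℝ) ≤ √2 - 1)
    have h6 : 0 < sinh2 * f := mul_pos hB hp
    nlinarith
  have hk : k = 2 ∨ k = 3 ∨ k = 4 ∨ k = 5 ∨ k = 6 := by revert k; decide
  have e8 : (8 : ZMod 8) = 0 := by decide
  rcases hk with rfl | rfl | rfl | rfl | rfl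
  · linarith [key2 j]
  · linarith [key3 j]
  · rw [hopp]; nlinarith
  · have := key3 (j + 5)
    rw [add_assoc, show (5 + 3 : ZMod 8) = 0 by decide, add_zero] at this
    linarith
  · have := key2 (j + 6)
    rw [add_assoc, show (6 + 2 : ZMod 8) = 0 by decide, add_zero] at this
    linarith

/-- The three geodesics pass through the centre of the octagon of Γ at successive angles π/4, and
the functionals have equal norm. Hence the outer two add up to 2 cos(π/4) times the middle one. -/
lemma ell_add_ell (s : Side) (e : DEdge) {z : ℂ} (hz : Complex.normSq z < 1) :
    ell e z + ell (nxt s (nxt s e)) z = √2 * ell (nxt s e) z := by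
  -- With the middle edge `d` as reference, the other two functionals belong, up to sign, to edges
  -- that start at the two ends of `d`. Only the distances and components at these two vertices are
  -- then involved.
  obtain ⟨d, rfl⟩ : ∃ d, e = rev (nbe s d) := ⟨nxt s e, by
    rw [nbe_eq_nxt, nxt_opp_rev_nxt, rev_rev]⟩
  have hd : nxt s (rev (nbe s d)) = d := by rw [← nbe_rev, rev_rev, nbe_opp_nbe]
  rw [hd, ell_rev, ell_eq _ hz, ell_eq _ hz, ell_eq _ hz]
  have hs1 := sq_sqrt_two
  have hr : √2 ≠ 0 := by positivity
  have h1 := coshDist_mul d.1 d.2 hz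
  have h2 := coshDist_mul (d.1 * d.2.toG) d.2.inv hz
  rw [toG_inv, mul_assoc, mul_inv_cancel, mul_one] at h2
  have h3 := compAt_mul d.1 d.2 hz
  simp only [nbe, nxt, turn, rotd_fst, rotd_snd, angle_rot, DEdge.target] at *
  generalize d.1 * d.2.toG = q at *
  generalize d.1 = p at *
  generalize d.2.inv.angle = j' at *
  generalize d.2.angle = j at *
  have r1 := compAt_add_two p j z
  have r2 := compAt_add_two q j' z
  have r3 := compAt_add_two p (j - 2 + 1) z
  have r4 := compAt_add_two q (j' - 2 + 1) z
  rw [show j - 2 + 1 + 2 = j + 1 by ring, show j - 2 + 1 + 1 = j by ring] at r3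
  rw [show j' - 2 + 1 + 2 = j' + 1 by ring, show j' - 2 + 1 + 1 = j' by ring] at r4
  rw [show j - 2 + 1 = j + -1 by ring] at r3
  rw [show j' - 2 + 1 = j' + -1 by ring] at r4
  cases s <;> simp only [Side.sgn, neg_neg, cosh2] at *
  · refine mul_left_cancel₀ hr ?_
    generalize √2 = r at *
    linear_combination r1 + r * r4 + r2 - h3 + h2 - 3 * h1 +
      (compAt q j' z - compAt p j z + 8 * coshDist p z + 4 * r * coshDist p z -
        4 * coshDist q z) * hs1
  · refine mul_left_cancel₀ hr ?_
    generalize √2 = r at *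
    linear_combination h3 - r1 - r * r3 - r2 + h2 - 3 * h1 +
      (-2 * compAt p j z + 8 * coshDist p z + 4 * r * coshDist p z - 4 * coshDist q z) * hs1

lemma ell_self (e : DEdge) : ell e (position e.1) < 0 := by
  have h0 : Complex.normSq 0 < 1 := by simp
  have hz : Complex.normSq (position e.1) < 1 := normSq_act_lt _ h0
  have h1 : act e.1⁻¹ (position e.1) = 0 := by
    rw [position, ← act_mul _ _ h0, inv_mul_cancel, act_one]
  rw [ell_eq _ hz, compAt, coshDist, h1]
  simp [comp, height, cosh2]
  linarith [Real.sqrt_nonneg 2]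

lemma height_le_height {w v : ℂ} (hw : Complex.normSq w < 1) (hv : Complex.normSq v < 1) :
    height w ≤ height v ↔ ‖w‖ ≤ ‖v‖ := by
  rw [height, height, div_le_div_iff₀ (by linarith) (by linarith), ← abs_norm w, ← abs_norm v,
    ← sq_le_sq, ← Complex.normSq_eq_norm_sq, ← Complex.normSq_eq_norm_sq]
  constructor <;> intro h <;> nlinarith

lemma mem_closedHalfPlane {e : DEdge} {z : ℂ} :
    z ∈ closedHalfPlane e ↔ Complex.normSq z < 1 ∧ 0 ≤ ell e z := by
  rw [closedHalfPlane, Set.mem_ofPred_eq, ← normSq_lt_one_iff]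
  refine and_congr_right fun hz => ?_
  rw [ell, sub_nonneg, coshDist, coshDist,
    height_le_height (normSq_act_lt _ hz) (normSq_act_lt _ hz)]

lemma mem_halfPlane {e : DEdge} {z : ℂ} :
    z ∈ halfPlane e ↔ Complex.normSq z < 1 ∧ 0 < ell e z := by
  rw [halfPlane, Set.mem_ofPred_eq, ← normSq_lt_one_iff]
  refine and_congr_right fun hz => ?_
  rw [ell, sub_pos, coshDist, coshDist, ← not_le,
    ← height_le_height (normSq_act_lt _ hz) (normSq_act_lt _ hz), not_le]

end SurfaceSnakes

end


noncomputable section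
namespace SurfaceSnakes

/-! ### Signs of the distances from the geodesics -/

section Signs

variable {z : ℂ}

lemma ell_two (hz : Complex.normSq z < 1) (s : Side) (e : DEdge) :
    ell ((nxt s)^[2] e) z = √2 * ell (nxt s e) z - ell e z := by
  have := ell_add_ell s e hz
  simp only [Function.iterate_succ, Function.iterate_zero, Function.comp, id]
  linarith

lemma ell_three (hz : Complex.normSq z < 1) (s : Side) (e : DEdge) :
    ell ((nxt s)^[3] e) z = ell (nxt s e) z - √2 * ell e z := by
  have h1 := ell_two hz s e
  have h2 := ell_two hz s (nxt s e)
  simp only [Function.iterate_succ, Function.iterate_zero, Function.comp, id] at h1 h2 ⊢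
  linear_combination h2 + √2 * h1 + ell (nxt s e) z * sq_sqrt_two

/-- Four angles π/4 make a half turn: opposite edges of an octagon of Γ cross the same geodesic in
opposite directions. -/
lemma ell_add_four (hz : Complex.normSq z < 1) (s : Side) (n : ℕ) (e : DEdge) :
    ell ((nxt s)^[n + 4] e) z = -ell ((nxt s)^[n] e) z := by
  rw [add_comm, Function.iterate_add_apply]
  generalize (nxt s)^[n] e = e
  have h1 := ell_two hz s e
  have h2 := ell_three hz s (nxt s e)
  simp only [Function.iterate_succ, Function.iterate_zero, Function.comp, id] at h1 h2 ⊢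
  linear_combination h2 + h1

lemma ell_nbe (hz : Complex.normSq z < 1) (s : Side) (e : DEdge) :
    ell (nbe s e) z = ell (nxt s e) z - √2 * ell e z := by
  rw [nbe_eq_rev, ell_rev, show 7 = 3 + 4 from rfl, ell_add_four hz, ell_three hz, neg_neg]

/-- The two paths of length four around an octagon cross the same four geodesics, in opposite order.
-/
lemma ell_other (hz : Complex.normSq z < 1) (s : Side) {n : ℕ} (hn : n ≤ 3) (e : DEdge) :
    ell ((nxt s.opp)^[n] (nbe s e)) z = ell ((nxt s)^[3 - n] e) z := by
  rw [nxt_opp_iterate_nbe s (by omega), ell_rev, show 7 - n = 3 - n + 4 by omega,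
    ell_add_four hz, neg_neg]

lemma ell_rotd_neg (hz : Complex.normSq z < 1) {e : DEdge} (h : 0 ≤ ell e z) {k : ZMod 8}
    (h0 : k ≠ 0) (h1 : k ≠ 1) (h2 : k ≠ -1) : ell (rotd k e) z < 0 := by
  linarith [ell_add_lt e h0 h1 h2 hz]

/-- The two edges that turn sharply at the end of `e` are two steps apart, with only the reverse of
`e` between them, so they cross disjoint geodesics. -/
lemma ell_nxt_opp_neg (hz : Complex.normSq z < 1) {s : Side} {e : DEdge}
    (h : 0 ≤ ell (nxt s e) z) : ell (nxt s.opp e) z < 0 := by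
  have : nxt s.opp e = rotd (-2 * s.sgn) (nxt s e) := by
    rw [nxt_eq, nxt_eq, rotd_rotd, Side.sgn_opp]; congr 1; ring
  rw [this]
  apply ell_rotd_neg hz h <;> cases s <;> decide

lemma sqrt_two_pos : 0 < √2 := by positivity

/-- If the point is beyond the first and the fourth edge, it is beyond those between. -/
lemma ell_between (hz : Complex.normSq z < 1) {s : Side} {e : DEdge} (h0 : 0 ≤ ell e z)
    (h3 : 0 ≤ ell ((nxt s)^[3] e) z) :
    0 ≤ ell (nxt s e) z ∧ 0 ≤ ell ((nxt s)^[2] e) z := by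
  have e2 := ell_two hz s e
  have e3 := ell_three hz s e
  have := sqrt_two_pos
  have h1 : 0 ≤ √2 * ell e z := by positivity
  have h2 : 0 ≤ √2 * ell ((nxt s)^[3] e) z := by positivity
  constructor
  · linarith
  · nlinarith [sq_sqrt_two]

lemma ell_between_pos (hz : Complex.normSq z < 1) {s : Side} {e : DEdge} (h0 : 0 ≤ ell e z)
    (h3 : 0 ≤ ell ((nxt s)^[3] e) z) (h : 0 < ell e z ∨ 0 < ell ((nxt s)^[3] e) z) :
    0 < ell (nxt s e) z ∧ 0 < ell ((nxt s)^[2] e) z := by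
  have e2 := ell_two hz s e
  have e3 := ell_three hz s e
  have h5 : ell ((nxt s)^[2] e) z = √2 * ell ((nxt s)^[3] e) z + ell e z := by
    linear_combination e2 - √2 * e3 + ell e z * sq_sqrt_two
  have := sqrt_two_pos
  have h1 : 0 ≤ √2 * ell e z := by positivity
  have h2 : 0 ≤ √2 * ell ((nxt s)^[3] e) z := by positivity
  rcases h with h | h
  · have : 0 < √2 * ell e z := by positivity
    constructor <;> linarith
  · have : 0 < √2 * ell ((nxt s)^[3] e) z := by positivity
    constructor <;> linarith

/-- If the point is beyond an edge but not beyond the next one, it is not beyond those that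
follow. -/
lemma ell_deep (hz : Complex.normSq z < 1) {s : Side} {e : DEdge} (h0 : 0 < ell e z)
    (h1 : ell (nxt s e) z < 0) : ell ((nxt s)^[2] e) z < 0 ∧ ell ((nxt s)^[3] e) z < 0 := by
  have e2 := ell_two hz s e
  have e3 := ell_three hz s e
  have := sqrt_two_pos
  have : √2 * ell (nxt s e) z < 0 := mul_neg_of_pos_of_neg this h1
  have : 0 < √2 * ell e z := by positivity
  constructor <;> linarith

lemma ell_three_neg (hz : Complex.normSq z < 1) {s : Side} {e : DEdge} (h0 : 0 < ell e z)
    (h2 : ell ((nxt s)^[2] e) z < 0) : ell ((nxt s)^[3] e) z < 0 := by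
  have e2 := ell_two hz s e
  have e3 := ell_three hz s e
  have := sqrt_two_pos
  nlinarith [sq_sqrt_two]

lemma normSq_position (g : G) : Complex.normSq (position g) < 1 :=
  normSq_act_lt g (by simp)

lemma ell_self' {e : DEdge} {g : G} (h : e.1 = g) : ell e (position g) < 0 := h ▸ ell_self e

/-- For the first and the fourth edge this is `ell_self`, applied to the two edges of the octagon at
the vertex, since `nbe s e` and the fourth edge cross the same geodesic. The functionals in between
are positive combinations of these two. -/
lemma ell_vertex_neg (s : Side) (e : DEdge) {j : ℕ} (hj : j < 4) :
    ell ((nxt s)^[j] e) (position e.1) < 0 := by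
  have hz := normSq_position e.1
  have h0 := ell_self e
  have h3 : ell ((nxt s)^[3] e) (position e.1) < 0 := by
    have : ell (nbe s e) (position e.1) < 0 := ell_self (nbe s e)
    rw [ell_nbe hz] at this
    rwa [ell_three hz]
  have e2 := ell_two hz s e
  have e3 := ell_three hz s e
  have := sqrt_two_pos
  have h4 : √2 * ell e (position e.1) < 0 := mul_neg_of_pos_of_neg this h0
  have h5 : √2 * ell ((nxt s)^[3] e) (position e.1) < 0 := mul_neg_of_pos_of_neg this h3
  interval_cases j
  · exact h0
  · rw [Function.iterate_one]; linarith
  · nlinarith [sq_sqrt_two]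
  · exact h3

/-- The vertex number `k` of an octagon is not beyond the next four edges. -/
lemma ell_vertex_neg' (s : Side) (e : DEdge) {j k : ℕ} (h1 : k ≤ j) (h2 : j < k + 4) :
    ell ((nxt s)^[j] e) (position ((nxt s)^[k] e).1) < 0 := by
  have := ell_vertex_neg s ((nxt s)^[k] e) (j := j - k) (by omega)
  rwa [← Function.iterate_add_apply, Nat.sub_add_cancel h1] at this

/-- The vertex number `k` of an octagon is beyond the last four edges. -/
lemma ell_vertex_pos (s : Side) (e : DEdge) {j k : ℕ} (h1 : j < k) (h2 : k ≤ j + 4) :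
    0 < ell ((nxt s)^[j] e) (position ((nxt s)^[k] e).1) := by
  have := ell_vertex_neg' s e (j := j + 4) (k := k) (by omega) (by omega)
  rw [ell_add_four (normSq_position _)] at this
  linarith

end Signs

/-- The points from which, near the octagon on the side `s` of `e`, one can see only this octagon:
they are not beyond any other edge that leaves the octagon at the initial vertex of `e` or sharply
at a neighbouring vertex. -/
def Fan (s : Side) (e : DEdge) (z : ℂ) : Prop :=
  (∀ y : DEdge, y.1 = e.1 → y ≠ e → y ≠ nbe s e → ell y z < 0) ∧
    ell (nxt s.opp e) z < 0 ∧ ell (nxt s (nbe s e)) z < 0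

lemma fan_opp {s : Side} {e : DEdge} {z : ℂ} (h : Fan s.opp (nbe s e) z) : Fan s e z := by
  obtain ⟨h1, h2, h3⟩ := h
  rw [nbe_opp_nbe] at h1 h3
  rw [Side.opp_opp] at h2
  exact ⟨fun y hy h4 h5 => h1 y hy h5 h4, h3, h2⟩

/-- Only neighbours of `e` could be crossed together with `e`. One of them is excluded by
assumption, and for the other one `ell_nbe` turns the sign condition on the sharp turn into the one
required. -/
lemma ell_neg_of_ne {s : Side} {e : DEdge} {z : ℂ} (hz : Complex.normSq z < 1) (h0 : 0 ≤ ell e z)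
    (h1 : ell (nxt s.opp e) z < 0) {y : DEdge} (hy : y.1 = e.1) (h2 : y ≠ e) (h3 : y ≠ nbe s e) :
    ell y z < 0 := by
  obtain ⟨k, rfl⟩ := exists_rotd hy
  have k0 : k ≠ 0 := by rintro rfl; simp at h2
  have k1 : k ≠ -s.sgn := by rintro rfl; exact h3 rfl
  by_cases k2 : k = s.sgn
  · subst k2
    have : rotd s.sgn e = nbe s.opp e := by simp [nbe]
    rw [this, ell_nbe hz]
    have := mul_nonneg sqrt_two_pos.le h0
    linarith
  · cases s
    · exact ell_rotd_neg hz h0 k0 (by simpa [Side.sgn] using k1) k2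
    · exact ell_rotd_neg hz h0 k0 k2 k1

/-- A point beyond the two middle edges of a path around an octagon is also beyond the first edge of
one of the two paths, for otherwise the recursion makes a middle functional negative. From that edge
all other directions are excluded. -/
lemma fan_of_sector {s : Side} {e : DEdge} {z : ℂ} (hz : Complex.normSq z < 1)
    (h1 : 0 ≤ ell (nxt s e) z) (h2 : 0 ≤ ell ((nxt s)^[2] e) z) : Fan s e z := by
  have o1 := ell_nxt_opp_neg hz h1
  have o2 : ell (nxt s (nbe s e)) z < 0 := by
    have := ell_other hz s (n := 1) (by omega) e
    rw [Function.iterate_one] at this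
    have := ell_nxt_opp_neg hz (s := s.opp) (e := nbe s e) (by rw [this]; exact h2)
    rwa [Side.opp_opp] at this
  refine ⟨fun y hy hy1 hy2 => ?_, o1, o2⟩
  by_cases h0 : 0 ≤ ell e z
  · exact ell_neg_of_ne hz h0 o1 hy hy1 hy2
  by_cases h3 : 0 ≤ ell (nbe s e) z
  · refine ell_neg_of_ne (s := s.opp) hz h3 (by rwa [Side.opp_opp]) hy hy2 ?_
    rwa [nbe_opp_nbe]
  · exfalso
    rw [ell_nbe hz] at h3
    have e2 := ell_two hz s e
    have := sqrt_two_pos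
    nlinarith [sq_sqrt_two]

lemma fan_vertex_aux (s : Side) (e : DEdge) {k : ℕ} (hk : k ≤ 4) :
    Fan s e (position ((nxt s)^[k] e).1) := by
  have hz := normSq_position ((nxt s)^[k] e).1
  rcases Nat.eq_zero_or_pos k with rfl | hk0
  · exact ⟨fun y hy _ _ => ell_self' hy, ell_vertex_neg s.opp e (j := 1) (by omega),
      ell_vertex_neg s (nbe s e) (j := 1) (by omega)⟩
  have h0 := ell_vertex_pos s e hk0 (by omega)
  have o1 : ell (nxt s.opp e) (position ((nxt s)^[k] e).1) < 0 := by
    rcases Nat.lt_or_ge 1 k with h | h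
    · exact ell_nxt_opp_neg hz (ell_vertex_pos s e h (by omega)).le
    · obtain rfl : k = 1 := by omega
      exact ell_self' (by simp)
  have hl := fun y hy h1 h2 => ell_neg_of_ne (s := s) hz h0.le o1 (y := y) hy h1 h2
  refine ⟨hl, o1, ?_⟩
  rcases Nat.lt_or_ge 2 k with h | h
  · have h2 := ell_vertex_pos s e h (by omega)
    exact (fan_of_sector hz (ell_vertex_pos s e (j := 1) (by omega) (by omega)).le h2.le).2.2
  · have h3 := ell_vertex_neg' s e (j := 3) (k := k) (by omega) (by omega)
    have h4 := hl (nbe s (nbe s e)) rfl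
      (by intro h
          have : rotd (-s.sgn + -s.sgn) e = rotd 0 e := by simpa [nbe, rotd_rotd] using h
          rw [rotd_inj] at this
          revert this; cases s <;> decide)
      (by intro h
          have : rotd (-s.sgn + -s.sgn) e = rotd (-s.sgn) e := by simpa [nbe, rotd_rotd] using h
          rw [rotd_inj] at this
          revert this; cases s <;> decide)
    have h5 := ell_nbe hz s (nbe s e)
    have h6 : ell (nbe s e) (position ((nxt s)^[k] e).1) < 0 := by
      rw [ell_nbe hz]; rwa [ell_three hz] at h3
    have := mul_neg_of_pos_of_neg sqrt_two_pos h6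
    linarith

lemma vertex_other (s : Side) (e : DEdge) {k : ℕ} (hk : k ≤ 7) :
    ((nxt s.opp)^[k] (nbe s e)).1 = ((nxt s)^[8 - k] e).1 := by
  rw [nxt_opp_iterate_nbe s hk, rev_fst, ← nxt_fst s, ← Function.iterate_succ_apply' (nxt s)]
  congr 3; omega

/-- Seen from one of its vertices, an octagon does not spread beyond the angle between its two edges
there. The vertices in the second half are reached along the other path, by the symmetry that
exchanges the two sides. -/
lemma fan_vertex (s : Side) (e : DEdge) (k : ℕ) : Fan s e (position ((nxt s)^[k] e).1) := by
  rw [← nxt_iterate_mod]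
  have hk := Nat.mod_lt k (show 8 > 0 by norm_num)
  generalize k % 8 = k at *
  rcases Nat.lt_or_ge 4 k with h | h
  · apply fan_opp
    have := fan_vertex_aux s.opp (nbe s e) (k := 8 - k) (by omega)
    rwa [vertex_other s e (by omega), Nat.sub_sub_self (by omega)] at this
  · exact fan_vertex_aux s e h

/-- The points beyond `e`, but not beyond a neighbouring edge. -/
def Front (e : DEdge) (z : ℂ) : Prop := 0 < ell e z ∧ ∀ s, ell (nbe s e) z < 0

lemma Front.neg {e : DEdge} {z : ℂ} (hz : Complex.normSq z < 1) (h : Front e z) {y : DEdge}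
    (hy : y.1 = e.1) (hne : y ≠ e) : ell y z < 0 := by
  obtain ⟨k, rfl⟩ := exists_rotd hy
  have k0 : k ≠ 0 := by rintro rfl; simp at hne
  by_cases h1 : k = 1
  · subst h1; exact h.2 .L
  by_cases h2 : k = -1
  · subst h2; exact h.2 .R
  exact ell_rotd_neg hz h.1.le k0 h1 h2

lemma mem_openRegion {g : G} {x : Letter} {z : ℂ} :
    z ∈ openRegion g x ↔ Complex.normSq z < 1 ∧ Front (g, x) z := by
  have h1 : (g, ccw x) = nbe .L (g, x) := by rw [ccw_eq_rot]; rfl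
  have h2 : (g, cw x) = nbe .R (g, x) := by rw [cw_eq_rot]; rfl
  simp only [openRegion, Set.mem_sdiff, Set.mem_union, mem_halfPlane, mem_closedHalfPlane, h1, h2,
    Front]
  constructor
  · rintro ⟨⟨hz, h⟩, h3⟩
    refine ⟨hz, h, fun s => ?_⟩
    by_contra h4
    push Not at h4
    cases s
    · exact h3 (Or.inl ⟨hz, h4⟩)
    · exact h3 (Or.inr ⟨hz, h4⟩)
  · rintro ⟨hz, h, h3⟩
    refine ⟨⟨hz, h⟩, ?_⟩
    rintro (⟨-, h4⟩ | ⟨-, h4⟩)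
    · exact absurd h4 (h3 .L).not_ge
    · exact absurd h4 (h3 .R).not_ge

lemma mem_wedge {g : G} {x : Letter} {z : ℂ} :
    z ∈ wedge g x ↔ Complex.normSq z < 1 ∧ 0 ≤ ell (g, x) z ∧ 0 ≤ ell (nbe .R (g, x)) z := by
  have h2 : (g, cw x) = nbe .R (g, x) := by rw [cw_eq_rot]; rfl
  rw [wedge, Set.mem_inter_iff, mem_closedHalfPlane, mem_closedHalfPlane, h2]
  tauto

/-- The region of an arc of a snake that consists of the edge `e`, if `k` is the number of edges that
the snake contains of the octagon on the side `s` of `e` up to this edge. -/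
def Reg (e : DEdge) (s : Side) (k : ℕ) (z : ℂ) : Prop :=
  Front e z ∧ ell ((nxt s)^[4 - k] e) z < 0

/-- The number of edges, up to the present one, of the octagon on the side `t`. -/
def depth (s : Side) (k : ℕ) (t : Side) : ℕ := if t = s then k else 1

/-- The last edge, on the side `t`, of the octagon on the right of `b`. -/
def lastEdge (b : DEdge) : Side → DEdge
  | .L => (nxt .R)^[3] b
  | .R => (nxt .L)^[3] (nbe .R b)

/-- The interior of the union of three octagons of the tessellation that are opposite to the initial
vertex of `b`, extended by the geodesics that bound it. -/
def Sector (b : DEdge) (z : ℂ) : Prop := 0 < ell (nxt .R b) z ∧ 0 < ell ((nxt .R)^[2] b) z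

/-- The pieces of a snake: an arc that consists of one edge, or the octagon on the right of an edge that
leaves its first special point. -/
inductive Piece
  | arc (e : DEdge) (s : Side) (k : ℕ)
  | bub (b : DEdge)

/-- The region that contains all following pieces. -/
def Piece.Zone : Piece → ℂ → Prop
  | .arc e s k => Reg e s k
  | .bub b => Sector b

/-- The vertices of a piece. -/
def Piece.verts : Piece → Set G
  | .arc e _ _ => {e.1, e.target}
  | .bub b => Set.range fun k => ((nxt .R)^[k] b).1

/-- The number of edges of an octagon that an arc completes is at most three. -/
def Piece.Valid : Piece → Prop
  | .arc _ _ k => 1 ≤ k ∧ k ≤ 3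
  | .bub _ => True

/-- The admissible pairs of successive pieces of a snake. -/
inductive Linked : Piece → Piece → Prop
  | arc_arc {e e' : DEdge} {s s' : Side} {k : ℕ} (h : e'.1 = e.target) (hr : e' ≠ rev e)
      (hn : ∀ t, e' ≠ nxt t e) : Linked (.arc e s k) (.arc e' s' 1)
  | arc_arc_sharp {e : DEdge} {s : Side} {k : ℕ} (t : Side) (hd : depth s k t ≤ 2) :
      Linked (.arc e s k) (.arc (nxt t e) t (depth s k t + 1))
  | arc_bub {e b : DEdge} {s : Side} {k : ℕ} (h : b.1 = e.target) (hr : rev e ≠ b)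
      (hr' : rev e ≠ nbe .R b) (hd : ∀ t, nxt t e = b ∨ nxt t e = nbe .R b → depth s k t ≤ 2) :
      Linked (.arc e s k) (.bub b)
  | bub_arc {b e : DEdge} {s : Side} (h : e.1 = (lastEdge b .L).target)
      (hr : ∀ t, e ≠ rev (lastEdge b t)) (hn : ∀ t t', e ≠ nxt t' (lastEdge b t)) :
      Linked (.bub b) (.arc e s 1)
  | bub_arc_sharp {b : DEdge} (t : Side) :
      Linked (.bub b) (.arc (nxt t (lastEdge b t)) t 2)
  | bub_bub {b b' : DEdge} (h : b'.1 = (lastEdge b .L).target)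
      (hr : ∀ t, rev (lastEdge b t) ≠ b') (hr' : ∀ t, rev (lastEdge b t) ≠ nbe .R b') :
      Linked (.bub b) (.bub b')
  | chain_left (b : DEdge) : Linked (.bub b) (.bub (nbe .L (lastEdge b .L)))
  | chain_right (b : DEdge) : Linked (.bub b) (.bub (lastEdge b .R))

/-! ### The regions of arcs and how they are nested -/

section Transitions

variable {z : ℂ}

/-- On the side that is not recorded the depth is one, and the inequality is already part of
`Front`, because `(nxt t)^[3] e` crosses the same geodesic as `nbe t e`. -/
lemma Reg.depth_neg (hz : Complex.normSq z < 1) {e : DEdge} {s : Side} {k : ℕ}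
    (h : Reg e s k z) (t : Side) : ell ((nxt t)^[4 - depth s k t] e) z < 0 := by
  rw [depth]
  split_ifs with ht
  · subst ht; exact h.2
  · have := h.1.2 t
    rwa [ell_nbe hz, ← ell_three hz] at this

lemma depth_bounds {s t : Side} {k : ℕ} (h : 1 ≤ k ∧ k ≤ 3) :
    1 ≤ depth s k t ∧ depth s k t ≤ 3 := by
  rw [depth]; split_ifs <;> omega

lemma ell_depth_neg (hz : Complex.normSq z < 1) {t : Side} {e : DEdge} (h0 : 0 < ell e z)
    (h1 : ell (nxt t e) z < 0) {d : ℕ} (hd : 1 ≤ d ∧ d ≤ 3) : ell ((nxt t)^[4 - d] e) z < 0 := by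
  have := ell_deep hz h0 h1
  obtain rfl | rfl | rfl : d = 1 ∨ d = 2 ∨ d = 3 := by omega
  · exact this.2
  · exact this.1
  · exact h1

/-- The region of an arc contains the points that are in front of its final vertex. -/
lemma reg_of_depth (hz : Complex.normSq z < 1) {e : DEdge} {s : Side} {k : ℕ} (hk : 1 ≤ k ∧ k ≤ 3)
    (h0 : 0 < ell e z) (h : ∀ t, ell (nxt t e) z < 0 ∨
      depth s k t ≤ 2 ∧ ell ((nxt t)^[2] e) z < 0 ∨
      ell ((nxt t)^[4 - depth s k t] e) z < 0 ∧ ell ((nxt t)^[3] e) z < 0) : Reg e s k z := by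
  have key : ∀ t, ell ((nxt t)^[3] e) z < 0 ∧ ell ((nxt t)^[4 - depth s k t] e) z < 0 := by
    intro t
    rcases h t with h1 | ⟨h1, h2⟩ | ⟨h1, h2⟩
    · exact ⟨(ell_deep hz h0 h1).2, ell_depth_neg hz h0 h1 (depth_bounds hk)⟩
    · have h3 := ell_three_neg hz h0 h2
      refine ⟨h3, ?_⟩
      have := depth_bounds (s := s) (t := t) hk
      obtain h4 | h4 : depth s k t = 1 ∨ depth s k t = 2 := by omega
      · rw [h4]; exact h3
      · rw [h4]; exact h2
    · exact ⟨h2, h1⟩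
  refine ⟨⟨h0, fun t => ?_⟩, ?_⟩
  · rw [ell_nbe hz, ← ell_three hz]; exact (key t).1
  · have := (key s).2
    rwa [depth, if_pos rfl] at this

lemma nxt_ne_rev (t : Side) (e : DEdge) : nxt t e ≠ rev e := by
  rw [nxt_eq]
  intro h
  have : rotd t.sgn (rev e) = rotd 0 (rev e) := by simpa using h
  rw [rotd_inj] at this
  revert this; cases t <;> decide

lemma nxt_opp_ne (t : Side) (e : DEdge) : nxt t.opp e ≠ nxt t e := by
  rw [nxt_eq, nxt_eq]
  intro h
  rw [rotd_inj] at h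
  revert h; cases t <;> decide

lemma iterate_four_sub {d : ℕ} (hd : d ≤ 2) (t : Side) (e : DEdge) :
    (nxt t)^[4 - (d + 1)] (nxt t e) = (nxt t)^[4 - d] e := by
  rw [← Function.iterate_succ_apply]; congr 1; omega

/-- Along one octagon the depth grows by one with each edge while the number of edges left before
the forbidden one shrinks by one, so the geodesic that bounds the region remains the same. -/
lemma reg_sharp_iff (hz : Complex.normSq z < 1) {e : DEdge} {s : Side} {k : ℕ}
    (hk : 1 ≤ k ∧ k ≤ 3) (t : Side) (hd : depth s k t ≤ 2) :
    Reg (nxt t e) t (depth s k t + 1) z ↔ Reg e s k z ∧ Front (nxt t e) z := by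
  constructor
  · rintro ⟨h1, h2⟩
    refine ⟨?_, h1⟩
    have h0 : 0 < ell e z := by
      have := h1.neg hz (y := rev e) rfl (nxt_ne_rev t e).symm
      rw [ell_rev] at this; linarith
    refine reg_of_depth hz hk h0 fun u => ?_
    rcases Side.eq_or_eq_opp t u with rfl | rfl
    · rw [iterate_four_sub hd] at h2
      obtain h4 | h4 : depth s k u = 1 ∨ depth s k u = 2 := by
        have := depth_bounds (s := s) (t := u) hk
        omega
      · rw [h4] at h2 ⊢
        exact Or.inr (Or.inr ⟨h2, h2⟩)
      · rw [h4] at h2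
        exact Or.inr (Or.inl ⟨hd, h2⟩)
    · exact Or.inl (h1.neg hz rfl (nxt_opp_ne t e))
  · rintro ⟨h1, h2⟩
    refine ⟨h2, ?_⟩
    rw [iterate_four_sub hd]
    exact h1.depth_neg hz t

lemma reg_one_iff {e : DEdge} (hz : Complex.normSq z < 1) (s : Side) :
    Reg e s 1 z ↔ Front e z := by
  refine ⟨fun h => h.1, fun h => ⟨h, ?_⟩⟩
  have := h.2 s
  rwa [ell_nbe hz, ← ell_three hz] at this

lemma reg_of_front (hz : Complex.normSq z < 1) {e e' : DEdge} {s : Side} {k : ℕ}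
    (hk : 1 ≤ k ∧ k ≤ 3) (h : e'.1 = e.target) (hr : e' ≠ rev e) (hn : ∀ t, e' ≠ nxt t e)
    (hf : Front e' z) : Reg e s k z := by
  have h0 : 0 < ell e z := by
    have := hf.neg hz (y := rev e) h.symm hr.symm
    rw [ell_rev] at this; linarith
  exact reg_of_depth hz hk h0 fun t => Or.inl (hf.neg hz h.symm (hn t).symm)

/-- The only edges at the end of `e` that such a point may lie beyond are the two edges of the
bubble. If one of them continues an octagon beside `e` sharply, the fan still excludes the edge
after it, and this suffices as long as the depth is at most two. -/
lemma reg_of_fan (hz : Complex.normSq z < 1) {e b : DEdge} {s : Side} {k : ℕ}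
    (hk : 1 ≤ k ∧ k ≤ 3) (h : b.1 = e.target) (hr : rev e ≠ b) (hr' : rev e ≠ nbe .R b)
    (hd : ∀ t, nxt t e = b ∨ nxt t e = nbe .R b → depth s k t ≤ 2) (hf : Fan .R b z) :
    Reg e s k z := by
  obtain ⟨h1, h2, h3⟩ := hf
  have h0 : 0 < ell e z := by
    have := h1 (rev e) h.symm hr hr'
    rw [ell_rev] at this; linarith
  refine reg_of_depth hz hk h0 fun t => ?_
  by_cases hb : nxt t e = b
  · refine Or.inr (Or.inl ⟨hd t (Or.inl hb), ?_⟩)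
    cases t
    · subst hb; exact h2
    · exfalso
      apply hr'
      rw [← hb, nxt_eq, nbe, rotd_rotd]
      simp
  by_cases hb' : nxt t e = nbe .R b
  · refine Or.inr (Or.inl ⟨hd t (Or.inr hb'), ?_⟩)
    cases t
    · exfalso
      apply hr
      rw [← nbe_opp_nbe .R b, ← hb', nxt_eq, nbe, rotd_rotd]
      simp [Side.opp, Side.sgn]
    · rw [← hb'] at h3; exact h3
  · exact Or.inl (h1 _ h.symm hb hb')

end Transitions

end SurfaceSnakes

end


noncomputable section
namespace SurfaceSnakes

/-! ### The regions of successive pieces -/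

section Zones

variable {z : ℂ}

lemma lastEdge_right (b : DEdge) : lastEdge b .R = rev ((nxt .R)^[4] b) :=
  nxt_opp_iterate_nbe .R (n := 3) (by omega) b

lemma lastEdge_left (b : DEdge) : lastEdge b .L = (nxt .R)^[3] b := rfl

lemma rev_lastEdge_right (b : DEdge) : rev (lastEdge b .R) = (nxt .R)^[4] b := by
  rw [lastEdge_right, rev_rev]

lemma rev_lastEdge_left (b : DEdge) : rev (lastEdge b .L) = nbe .R ((nxt .R)^[4] b) := by
  rw [Function.iterate_succ_apply' _ 3, ← lastEdge_left, nxt_eq, nbe, rotd_rotd]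
  simp

lemma lastEdge_left_target (b : DEdge) : (lastEdge b .L).target = ((nxt .R)^[4] b).1 := by
  rw [Function.iterate_succ_apply' _ 3, nxt_fst, lastEdge_left]

lemma lastEdge_target (b : DEdge) (t : Side) : (lastEdge b t).target = ((nxt .R)^[4] b).1 := by
  cases t
  · exact lastEdge_left_target b
  · rw [lastEdge_right, rev_target]

lemma ell_lastEdge_right (hz : Complex.normSq z < 1) (b : DEdge) :
    ell (lastEdge b .R) z = ell b z :=
  ell_other hz .R (n := 3) (by omega) b

lemma Linked.valid {P Q : Piece} (h : Linked P Q) (hP : P.Valid) : Q.Valid := by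
  cases h with
  | @arc_arc_sharp e s k t hd =>
    have := depth_bounds (s := s) (t := t) (k := k) hP
    exact ⟨by omega, by omega⟩
  | _ => simp [Piece.Valid]

lemma sector_of_neg (hz : Complex.normSq z < 1) {b : DEdge}
    (h : ∀ t, ell (rev (lastEdge b t)) z < 0) : Sector b z := by
  have h1 := h .L
  have h2 := h .R
  rw [ell_rev] at h1 h2
  rw [ell_lastEdge_right hz] at h2
  rw [lastEdge_left] at h1
  exact ell_between_pos hz (by linarith) (by linarith) (Or.inl (by linarith))

/-- The next bubble lies across the last edge. At the initial vertex of that edge its fan excludes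
going back along the third edge, and at the final vertex it excludes the fifth edge, whose
functional is the negative of that of `b`. The recursion gives the edge between. -/
lemma Fan.sector_left (hz : Complex.normSq z < 1) {b : DEdge}
    (h : Fan .R (nbe .L (lastEdge b .L)) z) :
    0 < ell b z ∧ 0 < ell (nxt .R b) z ∧ 0 < ell ((nxt .R)^[2] b) z := by
  obtain ⟨h1, -, h3⟩ := h
  have hb : nbe .R (nbe .L (lastEdge b .L)) = lastEdge b .L := nbe_opp_nbe .L _
  rw [hb] at h1 h3
  have e3 : lastEdge b .L = rotd 1 (rev ((nxt .R)^[2] b)) := by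
    rw [lastEdge_left, Function.iterate_succ_apply' _ 2, nxt_eq]; rfl
  have h4 := h1 (rev ((nxt .R)^[2] b)) (by rw [e3]; rfl)
    (by
      rw [e3, nbe, rotd_rotd]
      intro h
      have h' : rotd (1 + -Side.sgn .L) (rev ((nxt .R)^[2] b)) = rotd 0 (rev ((nxt .R)^[2] b)) := by
        rw [← h, rotd_zero]
      rw [rotd_inj] at h'
      revert h'; decide)
    (by
      rw [e3]
      intro h
      have h' : rotd 1 (rev ((nxt .R)^[2] b)) = rotd 0 (rev ((nxt .R)^[2] b)) := by
        rw [← h, rotd_zero]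
      rw [rotd_inj] at h'
      revert h'; decide)
  rw [ell_rev] at h4
  rw [lastEdge_left, ← Function.iterate_succ_apply' (nxt .R),
    show Nat.succ 3 = 0 + 4 from rfl, ell_add_four hz, Function.iterate_zero, id] at h3
  have e2 := ell_two hz .R b
  refine ⟨by linarith, ?_, by linarith⟩
  have := sqrt_two_pos
  by_contra h5
  push Not at h5
  have := mul_nonpos_of_nonneg_of_nonpos this.le h5
  linarith

lemma Fan.sector_right (hz : Complex.normSq z < 1) {b : DEdge}
    (h : Fan .R (lastEdge b .R) z) :
    0 < ell (nxt .R b) z ∧ 0 < ell ((nxt .R)^[2] b) z ∧ 0 < ell ((nxt .R)^[3] b) z := by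
  obtain ⟨h1, h2, -⟩ := h
  rw [lastEdge_right] at h1 h2
  have h4 := h1 ((nxt .R)^[5] b) (by rw [Function.iterate_succ_apply' _ 4]; simp)
    (by
      rw [Function.iterate_succ_apply' _ 4, nxt_eq]
      intro h
      have h' : rotd (Side.sgn .R) (rev ((nxt .R)^[4] b)) = rotd 0 (rev ((nxt .R)^[4] b)) := by
        rw [h, rotd_zero]
      rw [rotd_inj] at h'
      revert h'; decide)
    (by
      rw [Function.iterate_succ_apply' _ 4, nxt_eq, nbe]
      intro h
      rw [rotd_inj] at h
      revert h; decide)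
  rw [show 5 = 1 + 4 from rfl, ell_add_four hz, Function.iterate_one] at h4
  rw [Function.iterate_succ_apply' _ 3] at h2
  change ell (nxt (Side.opp .R) (rev (nxt .R ((nxt .R)^[3] b)))) z < 0 at h2
  rw [nxt_opp_rev_nxt, ell_rev] at h2
  have e2 := ell_two hz .R (nxt .R b)
  simp only [Function.iterate_succ, Function.iterate_zero, Function.comp, id] at *
  refine ⟨by linarith, ?_, by linarith⟩
  have := sqrt_two_pos
  by_contra h5
  push Not at h5
  have := mul_nonpos_of_nonneg_of_nonpos this.le h5
  linarith

lemma Linked.zone_of_fan (hz : Complex.normSq z < 1) {P : Piece} {b : DEdge}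
    (h : Linked P (.bub b)) (hP : P.Valid) (hf : Fan .R b z) : P.Zone z := by
  cases h with
  | arc_bub h hr hr' hd => exact reg_of_fan hz hP h hr hr' hd hf
  | @bub_bub b₀ _ h hr hr' =>
    exact sector_of_neg hz fun t => hf.1 _
      (by rw [rev_fst, lastEdge_target, h, lastEdge_target]) (hr t) (hr' t)
  | chain_left => exact (hf.sector_left hz).2
  | chain_right => have := hf.sector_right hz; exact ⟨this.1, this.2.1⟩

lemma Linked.zone_of_reg (hz : Complex.normSq z < 1) {P : Piece} {e : DEdge} {s : Side} {k : ℕ}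
    (h : Linked P (.arc e s k)) (hP : P.Valid) (hf : Reg e s k z) : P.Zone z := by
  cases h with
  | arc_arc h hr hn => exact reg_of_front hz hP h hr hn hf.1
  | arc_arc_sharp _ hd => exact ((reg_sharp_iff hz hP s hd).mp hf).1
  | bub_arc h hr hn =>
    exact sector_of_neg hz fun t => hf.1.neg hz
      (by rw [rev_fst, lastEdge_target, h, lastEdge_target]) (hr t).symm
  | @bub_arc_sharp b _ =>
    refine sector_of_neg hz fun t => hf.1.neg hz (by simp [lastEdge_target]) ?_
    rcases Side.eq_or_eq_opp s t with rfl | rfl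
    · exact (nxt_ne_rev _ _).symm
    · intro h
      cases s
      · change rev (lastEdge b .R) = _ at h
        rw [rev_lastEdge_right, Function.iterate_succ_apply' _ 3, ← lastEdge_left] at h
        exact nxt_opp_ne .L _ h
      · change rev (lastEdge b .L) = _ at h
        rw [← nbe_rev, rev_lastEdge_right, rev_lastEdge_left, nbe, nbe, rotd_inj] at h
        revert h; decide

/-- Decreasing zones make a local condition global: by induction, everything that comes later stays
in the zone of a piece, where the preceding piece has no vertices. -/
lemma Linked.zone_mono (hz : Complex.normSq z < 1) {P Q : Piece}
    (h : Linked P Q) (hP : P.Valid) (hQ : Q.Zone z) : P.Zone z := by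
  cases Q with
  | arc e s k => exact h.zone_of_reg hz hP hQ
  | bub b => exact h.zone_of_fan hz hP (fan_of_sector hz hQ.1.le hQ.2.le)

lemma reg_target (e : DEdge) (s : Side) {k : ℕ} (hk : 1 ≤ k ∧ k ≤ 3) :
    Reg e s k (position e.target) := by
  refine reg_of_depth (normSq_position _) hk ?_ fun t => Or.inl (ell_self' (by simp))
  exact ell_vertex_pos .R e (j := 0) (k := 1) (by omega) (by omega)

lemma sector_vertex (b : DEdge) {k : ℕ} (hk : 3 ≤ k ∧ k ≤ 5) :
    Sector b (position ((nxt .R)^[k] b).1) :=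
  ⟨ell_vertex_pos .R b (j := 1) (by omega) (by omega),
    ell_vertex_pos .R b (j := 2) (by omega) (by omega)⟩

lemma Linked.zone_of_mem {P Q : Piece} (h : Linked P Q) (hP : P.Valid) {v : G}
    (hv : v ∈ Q.verts) : P.Zone (position v) := by
  cases Q with
  | bub b =>
    obtain ⟨k, rfl⟩ := hv
    exact h.zone_of_fan (normSq_position _) hP (fan_vertex .R b k)
  | arc e' s' k' =>
    obtain rfl | rfl := hv
    · cases h with
      | arc_arc h hr hn => rw [h]; exact reg_target _ _ hP
      | arc_arc_sharp t hd => exact reg_target _ _ hP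
      | bub_arc h hr hn =>
        rw [h, lastEdge_target]; exact sector_vertex _ (by omega)
      | bub_arc_sharp t =>
        rw [nxt_fst, lastEdge_target]; exact sector_vertex _ (by omega)
    · exact h.zone_of_reg (normSq_position _) hP (reg_target _ _ (h.valid hP))

lemma rotate_vertex (b : DEdge) (n k : ℕ) :
    ∃ j, ((nxt .R)^[k] b).1 = ((nxt .R)^[j] ((nxt .R)^[n] b)).1 := by
  -- Modulo 8, `7 * n` stands for `-n`.
  refine ⟨k + 7 * n, ?_⟩
  have h : (k + 7 * n + n) % 8 = k % 8 := by omega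
  rw [← Function.iterate_add_apply, ← nxt_iterate_mod, ← nxt_iterate_mod _ (k + 7 * n + n), h]

/-- This is `fan_vertex` at the exit of the bubble, where the two edges of the octagon are the
reversed last edges. -/
lemma ell_opposite_neg (b : DEdge) (k : ℕ) {y : DEdge} (hy : y.1 = ((nxt .R)^[4] b).1)
    (h : ∀ t, y ≠ rev (lastEdge b t)) : ell y (position ((nxt .R)^[k] b).1) < 0 := by
  obtain ⟨j, hj⟩ := rotate_vertex b 4 k
  rw [hj]
  refine (fan_vertex .R ((nxt .R)^[4] b) j).1 y hy ?_ ?_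
  · rw [← rev_lastEdge_right]; exact h .R
  · rw [← rev_lastEdge_left]; exact h .L

lemma not_sector_of_neg (hz : Complex.normSq z < 1) {b : DEdge} (h0 : ell b z < 0)
    (h1 : ell (nbe .R b) z < 0) : ¬ Sector b z := by
  rintro ⟨h2, -⟩
  rw [ell_nbe hz] at h1
  have := mul_neg_of_pos_of_neg sqrt_two_pos h0
  linarith

lemma rotd_ne {k l : ZMod 8} (e : DEdge) (h : k ≠ l) : rotd k e ≠ rotd l e := by
  simpa using h

lemma second_left_ne (b : DEdge) (t : Side) :
    nxt .L (lastEdge b .L) ≠ rev (lastEdge b t) := by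
  rw [nxt_eq, rev_lastEdge_left, nbe, rotd_rotd]
  cases t
  · rw [rev_lastEdge_left, nbe]; exact rotd_ne _ (by decide)
  · rw [rev_lastEdge_right, ← rotd_zero ((nxt .R)^[4] b), rotd_rotd]; exact rotd_ne _ (by decide)

lemma second_right_ne (b : DEdge) (t : Side) :
    nxt .R (lastEdge b .R) ≠ rev (lastEdge b t) := by
  rw [nxt_eq, rev_lastEdge_right]
  cases t
  · rw [rev_lastEdge_left, nbe]; exact rotd_ne _ (by decide)
  · rw [rev_lastEdge_right, ← rotd_zero ((nxt .R)^[4] b), rotd_rotd]; exact rotd_ne _ (by decide)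

lemma Linked.not_zone_of_mem {P Q : Piece} (h : Linked P Q) {v : G} (hv : v ∈ P.verts) :
    ¬ Q.Zone (position v) := by
  intro hQ
  have hz := normSq_position v
  have hrev : ∀ {e : DEdge} {v : G}, v = e.1 → ¬ ell (rev e) (position v) < 0 := by
    rintro e v rfl h
    rw [ell_rev] at h
    linarith [ell_self e]
  have harc : ∀ {e e' : DEdge}, e'.1 = e.target → e' ≠ rev e → v ∈ ({e.1, e.target} : Set G) →
      ¬ Front e' (position v) := by
    rintro e e' h hr (rfl | rfl) hQ
    · exact hrev rfl (hQ.neg hz (y := rev e) h.symm hr.symm)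
    · have := ell_self' h
      linarith [hQ.1]
  have hbub : ∀ {b y : DEdge}, v ∈ (Piece.bub b).verts → y.1 = ((nxt .R)^[4] b).1 →
      (∀ t, y ≠ rev (lastEdge b t)) → ell y (position v) < 0 := by
    rintro b y ⟨k, rfl⟩ hy h
    exact ell_opposite_neg b k hy h
  cases h with
  | arc_arc h hr hn => exact harc h hr hv hQ.1
  | arc_arc_sharp t hd => exact harc rfl (nxt_ne_rev _ _) hv hQ.1
  | @arc_bub e b _ _ h hr hr' hd =>
    rcases hv with rfl | rfl
    · have := (fan_of_sector hz hQ.1.le hQ.2.le).1 (rev e) h.symm hr hr'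
      exact hrev rfl this
    · have := ell_vertex_neg .R b (j := 1) (by omega)
      rw [h, Function.iterate_one] at this
      linarith [hQ.1]
  | bub_arc h hr hn =>
    have := hbub hv (by rw [h, lastEdge_target]) hr
    linarith [hQ.1.1]
  | @bub_arc_sharp b t =>
    have := hbub hv (y := nxt t (lastEdge b t)) (by rw [nxt_fst, lastEdge_target])
      (by cases t
          · exact second_left_ne b
          · exact second_right_ne b)
    linarith [hQ.1.1]
  | @bub_bub b b' h hr hr' =>
    refine not_sector_of_neg hz (hbub hv ?_ fun t => (hr t).symm)
      (hbub hv ?_ fun t => (hr' t).symm) hQ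
    · rw [h, lastEdge_target]
    · rw [nbe_fst, h, lastEdge_target]
  | chain_left b =>
    have h1 := hbub hv (y := nxt .L (lastEdge b .L)) (by rw [nxt_fst, lastEdge_target])
      (second_left_ne b)
    -- Around the next octagon the other path crosses the same geodesics, so that one of its sector
    -- conditions contradicts the sign of the sharp left turn at the exit of `b`.
    have h2 := ell_other hz .R (n := 1) (by omega) (nbe .L (lastEdge b .L))
    have hb : nbe .R (nbe .L (lastEdge b .L)) = lastEdge b .L := nbe_opp_nbe .L _
    rw [hb, Function.iterate_one] at h2
    change ell (nxt .L (lastEdge b .L)) (position v) = _ at h2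
    have := hQ.2
    change 0 < ell ((nxt .R)^[3 - 1] _) _ at this
    linarith
  | chain_right b =>
    have h1 := hbub hv (y := nxt .R (lastEdge b .R)) (by rw [nxt_fst, lastEdge_target])
      (second_right_ne b)
    linarith [hQ.1]

end Zones

/-! ### The transitions of the Markov chain -/

/-- The state of a step that is an arc. -/
def arcState (x : Letter) (s : Side) : ℕ → State
  | 0 | 1 => .A x
  | 2 => .Ap s x
  | _ => .App s x

/-- The second edge met backwards along the octagon crosses the same geodesic as `(nxt s)^[2] (p,
x)`, by `ell_other`. This connects the cuts of the Markov chain with `Reg`. -/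
lemma mem_cutOne {s : Side} {p : G} {x : Letter} {z : ℂ} :
    z ∈ cutOne s p x ↔ Complex.normSq z < 1 ∧ 0 ≤ ell ((nxt s)^[2] (p, x)) z := by
  cases s
  · rw [cutOne, mem_closedHalfPlane, leftEdge_eq, ccw_eq_rot]
    refine and_congr_right fun hz => ?_
    rw [← ell_other hz .L (n := 1) (by omega)]; rfl
  · rw [cutOne, mem_closedHalfPlane, rightEdge_eq]
    refine and_congr_right fun hz => ?_
    rw [← ell_other hz .R (n := 1) (by omega)]; rfl

lemma mem_cutTwo {s : Side} {p : G} {x : Letter} {z : ℂ} :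
    z ∈ cutTwo s p x ↔ Complex.normSq z < 1 ∧ 0 ≤ ell ((nxt s)^[1] (p, x)) z := by
  cases s
  · rw [cutTwo, mem_closedHalfPlane, leftEdge_eq, ccw_eq_rot]
    refine and_congr_right fun hz => ?_
    rw [← ell_other hz .L (n := 2) (by omega)]; rfl
  · rw [cutTwo, mem_closedHalfPlane, rightEdge_eq]
    refine and_congr_right fun hz => ?_
    rw [← ell_other hz .R (n := 2) (by omega)]; rfl

lemma mem_arcState_region {e : DEdge} {s : Side} {k : ℕ} (hk : 1 ≤ k ∧ k ≤ 3) {z : ℂ} :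
    z ∈ (arcState e.2 s k).region e.1 ↔ Complex.normSq z < 1 ∧ Reg e s k z := by
  obtain rfl | rfl | rfl : k = 1 ∨ k = 2 ∨ k = 3 := by omega
  · change z ∈ openRegion _ _ ↔ _
    rw [mem_openRegion]
    exact and_congr_right fun hz => (reg_one_iff hz s).symm
  · change z ∈ openRegion _ _ \ cutOne _ _ _ ↔ _
    rw [Set.mem_sdiff, mem_openRegion, mem_cutOne, Reg]
    change (_ ∧ Front e z) ∧ ¬ (_ ∧ 0 ≤ ell ((nxt s)^[2] e) z) ↔
      _ ∧ Front e z ∧ ell ((nxt s)^[2] e) z < 0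
    simp only [not_and, not_le]
    tauto
  · change z ∈ openRegion _ _ \ cutTwo _ _ _ ↔ _
    rw [Set.mem_sdiff, mem_openRegion, mem_cutTwo, Reg]
    change (_ ∧ Front e z) ∧ ¬ (_ ∧ 0 ≤ ell ((nxt s)^[1] e) z) ↔
      _ ∧ Front e z ∧ ell ((nxt s)^[1] e) z < 0
    simp only [not_and, not_le]
    tauto

lemma mem_arcState_piece {e : DEdge} {s : Side} {k : ℕ} {z : ℂ} :
    z ∈ (arcState e.2 s k).piece e.1 ↔ Complex.normSq z < 1 ∧ Front e z := by
  rw [← mem_openRegion]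
  match k with
  | 0 | 1 | 2 | _ + 3 => rfl

lemma arcState_edges (e : DEdge) (s : Side) (k : ℕ) : (arcState e.2 s k).edges e.1 = {e} := by
  match k with
  | 0 | 1 | 2 | _ + 3 => rfl

lemma mem_wedgeE {t : Side} {b : DEdge} {z : ℂ} :
    z ∈ wedgeE t b.1 b.2 ↔ Complex.normSq z < 1 ∧ 0 ≤ ell (lastEdge b t) z ∧
      0 ≤ ell (nbe t (lastEdge b t)) z := by
  cases t
  · rw [wedgeE, mem_wedge, leftEdge_eq, ccw_eq_rot]
    rw [show (nxt .R)^[3] (b.1, b.2) = lastEdge b .L from rfl]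
    generalize lastEdge b .L = d
    have h : (d.1, rot 1 d.2) = nbe .L d := rfl
    rw [h, show nbe .R (nbe .L d) = d from nbe_opp_nbe .L _]
    tauto
  · rw [wedgeE, mem_wedge, rightEdge_eq,
      show (nxt .L)^[3] (nbe .R (b.1, b.2)) = lastEdge b .R from rfl]

lemma isOpen_disc : IsOpen {z : ℂ | Complex.normSq z < 1} :=
  isOpen_lt Complex.continuous_normSq continuous_const

lemma continuousOn_act (g : G) : ContinuousOn (act g) {z | Complex.normSq z < 1} := by
  refine ContinuousOn.div (by fun_prop) (by fun_prop) fun z hz => den_ne_zero (deck_mem g) hz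

lemma continuousOn_coshDist (g : G) : ContinuousOn (coshDist g) {z | Complex.normSq z < 1} := by
  have h := continuousOn_act g⁻¹
  refine ContinuousOn.div ?_ ?_ fun z hz => ?_
  · exact continuousOn_const.add (Complex.continuous_normSq.comp_continuousOn h)
  · exact continuousOn_const.sub (Complex.continuous_normSq.comp_continuousOn h)
  · have := normSq_act_lt g⁻¹ hz
    exact (by linarith : 0 < 1 - Complex.normSq (act g⁻¹ z)).ne'

lemma continuousOn_ell (e : DEdge) : ContinuousOn (ell e) {z | Complex.normSq z < 1} :=
  (continuousOn_coshDist _).sub (continuousOn_coshDist _)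

/-- From a point on the geodesic one can move a little towards the initial vertex of `e` without
leaving `U`; but on that radius `ell e` becomes negative. -/
lemma ell_pos_of_mem_interior {U : Set ℂ} {e : DEdge} {z : ℂ} (hz : z ∈ interior U)
    (hU : ∀ w ∈ U, Complex.normSq w < 1 ∧ 0 ≤ ell e w) : 0 < ell e z := by
  obtain ⟨hz1, hz2⟩ := hU z (interior_subset hz)
  refine lt_of_le_of_ne hz2 fun h0 => ?_
  set u := act e.1⁻¹ z with hu
  have hu1 : Complex.normSq u < 1 := normSq_act_lt _ hz1
  have hback : act e.1 u = z := by rw [hu, ← act_mul _ _ hz1, mul_inv_cancel, act_one]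
  have hform : ∀ w, Complex.normSq w < 1 → ell e (act e.1 w) * (1 - Complex.normSq w) =
      sinh2 * comp (dir e.2) w - (cosh2 - 1) * (1 + Complex.normSq w) := by
    intro w hw
    rw [ell_eq _ (normSq_act_lt _ hw), compAt_eq e.1 (k := e.2.angle) (n := dir e.2) rfl, coshDist,
      ← act_mul _ _ hw, inv_mul_cancel, act_one, height]
    have : 1 - Complex.normSq w ≠ 0 := by linarith
    field_simp
  have hcont : ContinuousAt (fun s : ℝ => act e.1 ((s : ℂ) * u)) 1 := by
    have h1 : ContinuousAt (act e.1) (((1 : ℝ) : ℂ) * u) := by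
      refine (continuousOn_act e.1).continuousAt (isOpen_disc.mem_nhds ?_)
      simpa using hu1
    exact ContinuousAt.comp (f := fun s : ℝ => (s : ℂ) * u) h1 (by fun_prop)
  have hnear : ∀ᶠ s : ℝ in nhds 1, act e.1 ((s : ℂ) * u) ∈ U := by
    refine hcont.eventually_mem ?_
    rw [Complex.ofReal_one, one_mul, hback]
    exact mem_interior_iff_mem_nhds.mp hz
  have hlt : ∃ᶠ s : ℝ in nhds 1, s < 1 :=
    Filter.Frequently.filter_mono (Filter.Eventually.frequently
      (self_mem_nhdsWithin (s := Set.Iio (1 : ℝ)))) nhdsWithin_le_nhds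
  have hpos : ∀ᶠ s : ℝ in nhds 1, 0 < s := lt_mem_nhds (by norm_num)
  obtain ⟨s, hs1, hs2, hs3⟩ := (hlt.and_eventually (hpos.and hnear)).exists
  have hsu : Complex.normSq ((s : ℂ) * u) < 1 := by
    rw [map_mul, Complex.normSq_ofReal]
    nlinarith [Complex.normSq_nonneg u]
  have h1 := (hU _ hs3).2
  have h2 := hform _ hsu
  have h3 := hform u hu1
  rw [hback, ← h0, zero_mul] at h3
  have h4 : comp (dir e.2) ((s : ℂ) * u) = s * comp (dir e.2) u := by
    rw [comp, comp, mul_left_comm, Complex.re_ofReal_mul]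
  rw [h4, map_mul, Complex.normSq_ofReal] at h2
  rw [map_mul, Complex.normSq_ofReal] at hsu
  have h5 : 0 ≤ ell e (act e.1 ((s : ℂ) * u)) * (1 - s * s * Complex.normSq u) :=
    mul_nonneg h1 (by linarith)
  rw [h2] at h5
  have hc : 0 < cosh2 - 1 := by rw [cosh2]; linarith [Real.sqrt_nonneg 2]
  have h6 : sinh2 * (s * comp (dir e.2) u) = s * ((cosh2 - 1) * (1 + Complex.normSq u)) := by
    linear_combination -s * h3
  rw [h6] at h5
  -- With U = |u|², the difference s(1 + U) − (1 + s²U) equals −(1 − s)(1 − sU).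
  have h7 : 0 < (1 - s) * (1 - s * Complex.normSq u) := by
    have := Complex.normSq_nonneg u
    exact mul_pos (by linarith) (by nlinarith)
  nlinarith

/-- The wedge is given by the functionals of the two last edges, and the removal of the E regions
makes those of their outer neighbours negative. Those of the inner neighbours are negative
automatically, as the point is beyond the middle edges of the octagon. Passing to the interior only
makes the remaining weak inequalities strict. -/
lemma mem_D_region {b : DEdge} {z : ℂ} :
    z ∈ (State.D b.2).region b.1 ↔
      Complex.normSq z < 1 ∧ ∀ t, Front (lastEdge b t) z := by
  have hU : ∀ w, w ∈ wedge b.1 b.2 \ (wedgeE .L b.1 b.2 ∪ wedgeE .R b.1 b.2) ↔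
      Complex.normSq w < 1 ∧ (0 ≤ ell b w ∧ 0 ≤ ell (lastEdge b .L) w) ∧
        ∀ t, ell (nbe t (lastEdge b t)) w < 0 := by
    intro w
    rw [Set.mem_sdiff, Set.mem_union, mem_wedge, mem_wedgeE, mem_wedgeE]
    change (_ ∧ 0 ≤ ell b w ∧ 0 ≤ ell (nbe .R b) w) ∧ _ ↔ _
    constructor
    · rintro ⟨⟨hw, h1, h2⟩, h3⟩
      have h4 : 0 ≤ ell (lastEdge b .L) w := by
        have := ell_other hw .R (n := 0) (by omega) b
        rw [lastEdge_left]
        rw [Function.iterate_zero, id] at this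
        rwa [this] at h2
      refine ⟨hw, ⟨h1, h4⟩, fun t => ?_⟩
      by_contra h5
      push Not at h5
      cases t
      · exact h3 (Or.inl ⟨hw, h4, h5⟩)
      · exact h3 (Or.inr ⟨hw, by rwa [ell_lastEdge_right hw], h5⟩)
    · rintro ⟨hw, ⟨h1, h4⟩, h5⟩
      refine ⟨⟨hw, h1, ?_⟩, ?_⟩
      · have := ell_other hw .R (n := 0) (by omega) b
        rw [Function.iterate_zero, id] at this
        rwa [this]
      · rintro (⟨-, -, h⟩ | ⟨-, -, h⟩)
        · exact absurd h (h5 .L).not_ge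
        · exact absurd h (h5 .R).not_ge
  have hF : ∀ w, Complex.normSq w < 1 → ((∀ t, Front (lastEdge b t) w) ↔
      (0 < ell b w ∧ 0 < ell (lastEdge b .L) w) ∧ ∀ t, ell (nbe t (lastEdge b t)) w < 0) := by
    intro w hw
    constructor
    · intro h
      refine ⟨⟨?_, (h .L).1⟩, fun t => (h t).2 t⟩
      rw [← ell_lastEdge_right hw]; exact (h .R).1
    · rintro ⟨⟨h1, h2⟩, h3⟩
      have h4 := ell_between_pos hw (s := .R) h1.le h2.le (Or.inl h1)
      have key : ∀ t, 0 < ell (lastEdge b t) w ∧ ell (nbe t.opp (lastEdge b t)) w < 0 := by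
        intro t
        cases t
        · refine ⟨h2, ?_⟩
          change ell (nbe .R _) w < 0
          rw [lastEdge_left, Function.iterate_succ_apply' _ 2, nxt_eq, nbe, rotd_rotd,
            add_neg_cancel, rotd_zero, ell_rev]
          linarith [h4.2]
        · refine ⟨by rwa [ell_lastEdge_right hw], ?_⟩
          change ell (nbe .L _) w < 0
          have : nbe .L (lastEdge b .R) = (nxt .R)^[5] b := by
            rw [lastEdge_right, Function.iterate_succ_apply' _ 4, nxt_eq]; rfl
          rw [this, show 5 = 1 + 4 from rfl, ell_add_four hw, Function.iterate_one]
          linarith [h4.1]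
      refine fun t => ⟨(key t).1, fun s => ?_⟩
      rcases Side.eq_or_eq_opp t s with rfl | rfl
      · exact h3 s
      · exact (key t).2
  change z ∈ interior (wedge b.1 b.2 \ (wedgeE .L b.1 b.2 ∪ wedgeE .R b.1 b.2)) ↔ _
  constructor
  · intro hz
    obtain ⟨h1, h2, h3⟩ := (hU z).mp (interior_subset hz)
    refine ⟨h1, (hF z h1).mpr ⟨⟨?_, ?_⟩, h3⟩⟩
    · exact ell_pos_of_mem_interior hz fun w hw => ⟨((hU w).mp hw).1, ((hU w).mp hw).2.1.1⟩
    · exact ell_pos_of_mem_interior hz fun w hw => ⟨((hU w).mp hw).1, ((hU w).mp hw).2.1.2⟩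
  · rintro ⟨hz, h⟩
    rw [hF z hz] at h
    have hc : ∀ e : DEdge, ContinuousAt (ell e) z := fun e =>
      (continuousOn_ell e).continuousAt (isOpen_disc.mem_nhds hz)
    rw [mem_interior_iff_mem_nhds]
    filter_upwards [isOpen_disc.mem_nhds hz, (hc b).eventually (lt_mem_nhds h.1.1),
      (hc (lastEdge b .L)).eventually (lt_mem_nhds h.1.2),
      (hc (nbe .L (lastEdge b .L))).eventually (gt_mem_nhds (h.2 .L)),
      (hc (nbe .R (lastEdge b .R))).eventually (gt_mem_nhds (h.2 .R))] with w h1 h2 h3 h4 h5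
    refine (hU w).mpr ⟨h1, ⟨h2.le, h3.le⟩, fun t => ?_⟩
    cases t
    · exact h4
    · exact h5

end SurfaceSnakes

end


/-! ### Pieces as sequences of steps of the Markov chain -/

noncomputable section
namespace SurfaceSnakes

/-- The first vertex of a piece. -/
def Piece.base : Piece → G
  | .arc e _ _ => e.1
  | .bub b => b.1

/-- The state of the first step of a piece that is not linked to the preceding piece by an interval. -/
def Piece.first : Piece → State
  | .arc e s k => arcState e.2 s k
  | .bub b => .B b.2

/-- The state of the last step of a piece that is not linked to the next piece by an interval. -/
def Piece.last : Piece → State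
  | .arc e s k => arcState e.2 s k
  | .bub b => .D b.2

/-- The next bubble in a bubble chain. -/
def chainNext (b : DEdge) : Side → DEdge
  | .L => nbe .L (lastEdge b .L)
  | .R => lastEdge b .R

lemma linked_chainNext (b : DEdge) (t : Side) : Linked (.bub b) (.bub (chainNext b t)) := by
  cases t
  · exact .chain_left b
  · exact .chain_right b

/-- The second piece is the next bubble of the bubble chain. -/
def IsChain (P Q : Piece) : Prop := ∃ b t, P = .bub b ∧ Q = .bub (chainNext b t)

lemma nbe_left (d : DEdge) : nbe .L d = (d.1, rot 1 d.2) := rfl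

lemma nbe_right (d : DEdge) : nbe .R d = (d.1, rot (-1) d.2) := rfl

section Follows

attribute [local irreducible] nxt rev rotd

variable {z : ℂ}

lemma leftEdge_pair (b : DEdge) (n : ℕ) : leftEdge b.1 b.2 n = (nxt .R)^[n] b := leftEdge_eq _ _ _

lemma rightEdge_pair (b : DEdge) (n : ℕ) :
    rightEdge b.1 b.2 n = (nxt .L)^[n] (nbe .R b) := rightEdge_eq _ _ _

lemma edges_B (b : DEdge) : (State.B b.2).edges b.1 = {b, nbe .R b} := by
  rw [State.edges, leftEdge_pair, rightEdge_pair]; rfl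

lemma edges_C (b : DEdge) : (State.C b.2).edges b.1 = {nxt .R b, nxt .L (nbe .R b)} := by
  rw [State.edges, leftEdge_pair, rightEdge_pair]; rfl

lemma edges_Cp (b : DEdge) :
    (State.Cp b.2).edges b.1 = {(nxt .R)^[2] b, (nxt .L)^[2] (nbe .R b)} := by
  rw [State.edges, leftEdge_pair, rightEdge_pair]

lemma edges_D (b : DEdge) : (State.D b.2).edges b.1 = {lastEdge b .L, lastEdge b .R} := by
  rw [State.edges, leftEdge_pair, rightEdge_pair]; rfl

lemma edges_E (b : DEdge) (t : Side) : (State.E t b.2).edges b.1 =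
    {lastEdge b .L, lastEdge b .R} ∪ {chainNext b t, nbe .R (chainNext b t)} := by
  have hl : (nxt .R)^[3] b = lastEdge b .L := rfl
  have hr : (nxt .L)^[3] (nbe .R b) = lastEdge b .R := rfl
  cases t
  · rw [State.edges, leftEdge_pair, rightEdge_pair, ccw_eq_rot, hl, hr, ← nbe_left]
    rw [show nbe .R (chainNext b .L) = lastEdge b .L from nbe_opp_nbe .L _, chainNext]
    ext; simp only [Set.mem_insert_iff, Set.mem_singleton_iff, Set.mem_union]; tauto
  · rw [State.edges, leftEdge_pair, rightEdge_pair, cw_eq_rot, hl, hr, ← nbe_right, chainNext]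
    ext; simp only [Set.mem_insert_iff, Set.mem_singleton_iff, Set.mem_union]; tauto

lemma region_E (b : DEdge) (t : Side) :
    (State.E t b.2).region b.1 = wedge (chainNext b t).1 (chainNext b t).2 := by
  ext z
  change z ∈ wedgeE _ _ _ ↔ _
  rw [mem_wedgeE, mem_wedge]
  cases t
  · change _ ↔ _ ∧ 0 ≤ ell (nbe .L (lastEdge b .L)) z ∧ 0 ≤ ell (nbe .R (nbe .L (lastEdge b .L))) z
    rw [show nbe .R (nbe .L (lastEdge b .L)) = lastEdge b .L from nbe_opp_nbe .L _]
    tauto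
  · rfl

/-- By this the inclusions of the wedges of types B and E in the preceding regions become instances
of the inequalities for fans. -/
lemma fan_of_mem_wedge {b : DEdge} (h : z ∈ wedge b.1 b.2) :
    Complex.normSq z < 1 ∧ Fan .R b z := by
  obtain ⟨hz, h1, h2⟩ := mem_wedge.mp h
  have h3 : ell (nbe .R b) z = ell ((nxt .R)^[3] b) z :=
    ell_other hz .R (n := 0) (by omega) b
  change 0 ≤ ell (nbe .R b) z at h2
  rw [h3] at h2
  have := ell_between hz (s := .R) h1 h2
  exact ⟨hz, fan_of_sector hz this.1 this.2⟩

lemma followsAt_B_C (b : DEdge) : FollowsAt (.B b.2) b.1 (.C b.2) b.1 := by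
  refine ⟨trivial, ?_, (Set.inter_self _).symm⟩
  rw [edges_B, edges_C, Set.image_pair, Set.image_pair, nxt_fst, nxt_fst]

lemma followsAt_C_Cp (b : DEdge) : FollowsAt (.C b.2) b.1 (.Cp b.2) b.1 := by
  refine ⟨trivial, ?_, (Set.inter_self _).symm⟩
  rw [edges_C, edges_Cp, Set.image_pair, Set.image_pair, Function.iterate_succ_apply' _ 1,
    Function.iterate_succ_apply' _ 1, nxt_fst, nxt_fst]; rfl

lemma lastEdge_fst_left (b : DEdge) : (lastEdge b .L).1 = ((nxt .R)^[2] b).target := by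
  rw [lastEdge, Function.iterate_succ_apply' _ 2, nxt_fst]

lemma lastEdge_fst_right (b : DEdge) :
    (lastEdge b .R).1 = ((nxt .L)^[2] (nbe .R b)).target := by
  rw [lastEdge, Function.iterate_succ_apply' _ 2, nxt_fst]

lemma followsAt_Cp_D (b : DEdge) : FollowsAt (.Cp b.2) b.1 (.D b.2) b.1 := by
  refine ⟨trivial, ?_, (Set.inter_eq_right.mpr ?_).symm⟩
  · rw [edges_Cp, edges_D, Set.image_pair, Set.image_pair, lastEdge_fst_left, lastEdge_fst_right]
  · exact interior_subset.trans Set.sdiff_subset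

lemma fst_nbe_chainNext (b : DEdge) (t : Side) :
    (chainNext b t).1 = (lastEdge b t).1 := by
  cases t
  · rw [chainNext, nbe_fst]
  · rfl

lemma followsAt_Cp_E (b : DEdge) (t : Side) : FollowsAt (.Cp b.2) b.1 (.E t b.2) b.1 := by
  refine ⟨by cases t <;> trivial, ?_, (Set.inter_eq_right.mpr ?_).symm⟩
  · rw [edges_Cp, edges_E, Set.image_union, Set.image_pair, Set.image_pair, Set.image_pair]
    rw [nbe_fst, fst_nbe_chainNext, Set.pair_eq_singleton, Set.union_eq_self_of_subset_right,
      lastEdge_fst_left, lastEdge_fst_right]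
    cases t <;> simp
  · change (State.E t b.2).region b.1 ⊆ wedge b.1 b.2
    rw [region_E]
    intro z h
    obtain ⟨hz, hf⟩ := fan_of_mem_wedge h
    rw [mem_wedge]
    refine ⟨hz, ?_⟩
    have h3 : ell (nbe .R b) z = ell ((nxt .R)^[3] b) z :=
      ell_other hz .R (n := 0) (by omega) b
    change 0 ≤ ell b z ∧ 0 ≤ ell (nbe .R b) z
    rw [h3]
    have h4 := mem_wedge.mp h
    cases t
    · refine ⟨(hf.sector_left hz).1.le, ?_⟩
      have := h4.2.2
      change 0 ≤ ell (nbe .R (nbe .L (lastEdge b .L))) z at this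
      rwa [show nbe .R (nbe .L (lastEdge b .L)) = lastEdge b .L from nbe_opp_nbe .L _] at this
    · refine ⟨?_, (hf.sector_right hz).2.2.le⟩
      have := h4.2.1
      change 0 ≤ ell (lastEdge b .R) z at this
      rwa [ell_lastEdge_right hz] at this

lemma followsAt_E_C (b : DEdge) (t : Side) :
    FollowsAt (.E t b.2) b.1 (.C (chainNext b t).2) (chainNext b t).1 := by
  refine ⟨by cases t <;> trivial, ?_, ?_⟩
  · rw [edges_E, edges_C, Set.image_union, Set.image_pair, Set.image_pair, Set.image_pair,
      lastEdge_target, lastEdge_target, nxt_fst, nxt_fst, Set.pair_eq_singleton,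
      Set.union_eq_self_of_subset_left]
    cases t
    · rw [show nbe .R (chainNext b .L) = lastEdge b .L from nbe_opp_nbe .L _, lastEdge_target]
      simp
    · rw [show chainNext b .R = lastEdge b .R from rfl, lastEdge_target]; simp
  · rw [region_E]
    exact (Set.inter_self _).symm

/-- At the exit of a bubble the reversed last edges are neighbours. An edge that turns sharply away
from one of them is therefore two steps from the reverse of the other one. -/
lemma sharp_ne (b : DEdge) (t : Side) :
    nxt t (lastEdge b t) ≠ rev (lastEdge b t.opp) ∧
      ∀ u, nxt t (lastEdge b t) ≠ nxt u (lastEdge b t.opp) := by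
  have h1 : rev (lastEdge b .L) = nbe .R (rev (lastEdge b .R)) := by
    rw [rev_lastEdge_left, rev_lastEdge_right]
  constructor
  · cases t
    · exact second_left_ne b .R
    · exact second_right_ne b .L
  · intro u
    cases t
    · change nxt .L (lastEdge b .L) ≠ nxt u (lastEdge b .R)
      rw [nxt_eq, nxt_eq, h1, nbe, rotd_rotd]
      exact rotd_ne _ (by cases u <;> decide)
    · change nxt .R (lastEdge b .R) ≠ nxt u (lastEdge b .L)
      rw [nxt_eq, nxt_eq, h1, nbe, rotd_rotd]
      exact rotd_ne _ (by cases u <;> decide)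

/-- The regions of the last step of a piece, and of the first step of the next one. -/
lemma Linked.followsAt {P Q : Piece} (h : Linked P Q) (hP : P.Valid) (hc : ¬ IsChain P Q) :
    FollowsAt P.last P.base Q.first Q.base := by
  have hb : ∀ b : DEdge, DEdge.target '' (State.D b.2).edges b.1 = {(lastEdge b .L).target} := by
    intro b
    rw [edges_D, Set.image_pair, lastEdge_target, lastEdge_target, Set.pair_eq_singleton]
  have hB : ∀ b : DEdge, Prod.fst '' (State.B b.2).edges b.1 = {b.1} := by
    intro b
    rw [edges_B, Set.image_pair, nbe_fst, Set.pair_eq_singleton]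
  cases h with
  | @arc_arc e e' s s' k h hr hn =>
    refine ⟨?_, ?_, ?_⟩
    · change KindEdge (arcState e.2 s k).kind .A
      match k with
      | 0 | 1 | 2 | _ + 3 => trivial
    · change _ '' (arcState e.2 s k).edges e.1 = _ '' (arcState e'.2 s' 1).edges e'.1
      rw [arcState_edges, arcState_edges, Set.image_singleton, Set.image_singleton, h]
    · ext z
      change z ∈ (arcState e'.2 s' 1).region e'.1 ↔ z ∈ (arcState e.2 s k).region e.1 ∧
        z ∈ (arcState e'.2 s' 1).piece e'.1
      rw [mem_arcState_region (by omega), mem_arcState_region hP, mem_arcState_piece]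
      refine ⟨fun ⟨hz, h1⟩ => ⟨⟨hz, reg_of_front hz hP h hr hn h1.1⟩, hz, h1.1⟩, ?_⟩
      rintro ⟨⟨hz, -⟩, -, h1⟩
      exact ⟨hz, (reg_one_iff hz s').mpr h1⟩
  | @arc_arc_sharp e s k t hd =>
    have hdb := depth_bounds (s := s) (t := t) (k := k) hP
    refine ⟨?_, ?_, ?_⟩
    -- The bound on the depth excludes that A'' is continued on its own side; on the other side the
    -- depth is one and the next type is A'.
    · change KindEdge (arcState e.2 s k).kind (arcState _ t (depth s k t + 1)).kind
      obtain ⟨hk1, hk2⟩ : 1 ≤ k ∧ k ≤ 3 := hP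
      obtain rfl | rfl | rfl : k = 1 ∨ k = 2 ∨ k = 3 := by omega
      all_goals
        rw [depth] at hd ⊢
        split_ifs at hd ⊢
      all_goals trivial
    · change _ '' (arcState e.2 s k).edges e.1 =
        _ '' (arcState (nxt t e).2 t (depth s k t + 1)).edges (nxt t e).1
      rw [arcState_edges, arcState_edges, Set.image_singleton, Set.image_singleton, nxt_fst]
    · ext z
      change z ∈ (arcState (nxt t e).2 t (depth s k t + 1)).region (nxt t e).1 ↔
        z ∈ (arcState e.2 s k).region e.1 ∧
        z ∈ (arcState (nxt t e).2 t (depth s k t + 1)).piece (nxt t e).1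
      rw [mem_arcState_region (by omega), mem_arcState_region hP, mem_arcState_piece]
      constructor
      · rintro ⟨hz, h1⟩
        have := (reg_sharp_iff hz hP t hd).mp h1
        exact ⟨⟨hz, this.1⟩, hz, this.2⟩
      · rintro ⟨⟨hz, h1⟩, -, h2⟩
        exact ⟨hz, (reg_sharp_iff hz hP t hd).mpr ⟨h1, h2⟩⟩
  | @arc_bub e b s k h hr hr' hd =>
    refine ⟨?_, ?_, ?_⟩
    · change KindEdge (arcState e.2 s k).kind .B
      match k with
      | 0 | 1 | 2 | _ + 3 => trivial
    · change _ '' (arcState e.2 s k).edges e.1 = _ '' (State.B b.2).edges b.1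
      rw [arcState_edges, hB, Set.image_singleton, h]
    · refine (Set.inter_eq_right.mpr fun z hz => ?_).symm
      change z ∈ (arcState e.2 s k).region e.1
      obtain ⟨hz1, hf⟩ := fan_of_mem_wedge hz
      rw [mem_arcState_region hP]
      exact ⟨hz1, reg_of_fan hz1 hP h hr hr' hd hf⟩
  | @bub_arc b e s h hr hn =>
    refine ⟨trivial, ?_, ?_⟩
    · change _ '' (State.D b.2).edges b.1 = _ '' (arcState e.2 s 1).edges e.1
      rw [arcState_edges, hb, Set.image_singleton, h]
    · ext z
      change z ∈ (arcState e.2 s 1).region e.1 ↔ z ∈ (State.D b.2).region b.1 ∧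
        z ∈ (arcState e.2 s 1).piece e.1
      rw [mem_arcState_region (by omega), mem_D_region, mem_arcState_piece]
      constructor
      · rintro ⟨hz, h1⟩
        refine ⟨⟨hz, fun t => (reg_of_front hz (s := .L) (k := 1) (by omega) ?_ (hr t)
          (hn t) h1.1).1⟩, hz, h1.1⟩
        rw [h, lastEdge_target, lastEdge_target]
      · rintro ⟨⟨hz, -⟩, -, h1⟩
        exact ⟨hz, (reg_one_iff hz s).mpr h1⟩
  | @bub_arc_sharp b t =>
    refine ⟨by cases t <;> trivial, ?_, ?_⟩
    · change _ '' (State.D b.2).edges b.1 =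
        _ '' (arcState (nxt t (lastEdge b t)).2 t 2).edges (nxt t (lastEdge b t)).1
      rw [arcState_edges, hb, Set.image_singleton, nxt_fst, lastEdge_target, lastEdge_target]
    · ext z
      change z ∈ (arcState (nxt t (lastEdge b t)).2 t 2).region (nxt t (lastEdge b t)).1 ↔
        z ∈ (State.D b.2).region b.1 ∧
        z ∈ (arcState (nxt t (lastEdge b t)).2 t 2).piece (nxt t (lastEdge b t)).1
      rw [mem_arcState_region (by omega), mem_D_region, mem_arcState_piece]
      -- The last edge is treated as an arc of depth one, so that the sharp turn after it has depth
      -- two.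
      have hs := fun hz : Complex.normSq z < 1 =>
        reg_sharp_iff hz (e := lastEdge b t) (s := t) (k := 1) (by omega) t (by simp [depth])
      rw [show depth t 1 t + 1 = 2 by simp [depth]] at hs
      constructor
      · rintro ⟨hz, h1⟩
        refine ⟨⟨hz, fun u => ?_⟩, hz, h1.1⟩
        rcases Side.eq_or_eq_opp t u with rfl | rfl
        · exact ((hs hz).mp h1).1.1
        · exact (reg_of_front hz (s := .L) (k := 1) (by omega)
            (by rw [nxt_fst, lastEdge_target, lastEdge_target]) (sharp_ne b t).1
            (sharp_ne b t).2 h1.1).1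
      · rintro ⟨⟨hz, h1⟩, -, h2⟩
        exact ⟨hz, (hs hz).mpr ⟨(reg_one_iff hz t).mpr (h1 t), h2⟩⟩
  | @bub_bub b b' h hr hr' =>
    refine ⟨trivial, ?_, ?_⟩
    · change _ '' (State.D b.2).edges b.1 = _ '' (State.B b'.2).edges b'.1
      rw [hb, hB, h]
    · refine (Set.inter_eq_right.mpr fun z hz => ?_).symm
      change z ∈ (State.D b.2).region b.1
      obtain ⟨hz1, hf⟩ := fan_of_mem_wedge hz
      rw [mem_D_region]
      refine ⟨hz1, fun t => (reg_of_fan hz1 (s := .L) (k := 1) (by omega) ?_ (hr t) (hr' t)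
        (fun u _ => by rw [depth, ite_self]; norm_num) hf).1⟩
      rw [h, lastEdge_target, lastEdge_target]
  | chain_left b => exact absurd ⟨b, .L, rfl, rfl⟩ hc
  | chain_right b => exact absurd ⟨b, .R, rfl, rfl⟩ hc

end Follows

end SurfaceSnakes

end


/-! ### Tracks: pieces indexed by the places of their first steps -/

noncomputable section
namespace SurfaceSnakes

/-- The edges of a piece. -/
def Piece.edges : Piece → Set (Sym2 G)
  | .arc e _ _ => {e.edge}
  | .bub b => Set.range fun k => ((nxt .R)^[k] b).edge

/-- The bi-infinite sequences of pieces, each of which stands at the place, in a bi-infinite sequence of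
steps, where its first step stands. Bubbles consist of four steps, the last of which is at the same time
the first step of the next bubble of the bubble chain, if there is one. -/
structure IsTrack (pc : ℤ → Option Piece) : Prop where
  valid : ∀ i P, pc i = some P → P.Valid
  arc : ∀ i e s k, pc i = some (.arc e s k) →
    ∃ Q, pc (i + 1) = some Q ∧ Linked (.arc e s k) Q
  bub : ∀ i b, pc i = some (.bub b) → pc (i + 1) = none ∧ pc (i + 2) = none ∧
    ((∃ t, pc (i + 3) = some (.bub (chainNext b t))) ∨
      pc (i + 3) = none ∧ ∃ Q, pc (i + 4) = some Q ∧ Linked (.bub b) Q ∧ ¬ IsChain (.bub b) Q)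
  cover : ∀ i, ∃ j ≤ i, pc j ≠ none

/-- The edges of the pieces of a track. -/
def trackEdges (pc : ℤ → Option Piece) : Set (Sym2 G) :=
  {x | ∃ i P, pc i = some P ∧ x ∈ P.edges}

open Classical in
/-- The step at a given place of a track. -/
def stepAt (pc : ℤ → Option Piece) (i : ℤ) : State × G :=
  match pc i, pc (i - 1), pc (i - 2), pc (i - 3) with
  | some (.arc e s k), _, _, _ => (arcState e.2 s k, e.1)
  | some (.bub b), _, _, some (.bub b') =>
    if h : ∃ t, b = chainNext b' t then (.E h.choose b'.2, b'.1) else (.B b.2, b.1)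
  | some (.bub b), _, _, _ => (.B b.2, b.1)
  | none, some (.bub b), _, _ => (.C b.2, b.1)
  | none, _, some (.bub b), _ => (.Cp b.2, b.1)
  | none, _, _, some (.bub b) => (.D b.2, b.1)
  -- On a track this value does not occur, by `IsTrack.level_cases`.
  | _, _, _, _ => (.A .a, 1)

namespace IsTrack

variable {pc : ℤ → Option Piece}

/-- There is an occupied place somewhere below, and from there on each piece determines at which
place the next one begins. So no place is more than three steps after the beginning of the piece
that it belongs to. -/
lemma level_cases (h : IsTrack pc) (i : ℤ) : (∃ e s k, pc i = some (.arc e s k)) ∨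
    (∃ b, pc i = some (.bub b)) ∨ (∃ b, pc (i - 1) = some (.bub b)) ∨
    (∃ b, pc (i - 2) = some (.bub b)) ∨ (pc i = none ∧ ∃ b, pc (i - 3) = some (.bub b)) := by
  obtain ⟨j, hj, hj'⟩ := h.cover i
  induction i, hj using Int.leInduction with
  | base =>
    obtain ⟨P, hP⟩ := Option.ne_none_iff_exists'.mp hj'
    cases P with
    | arc e s k => exact Or.inl ⟨e, s, k, hP⟩
    | bub b => exact Or.inr (Or.inl ⟨b, hP⟩)
  | succ i hji ih =>
    have key : ∀ Q, pc (i + 1) = some Q → (∃ e s k, pc (i + 1) = some (.arc e s k)) ∨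
      (∃ b, pc (i + 1) = some (.bub b)) := by
      rintro (⟨e, s, k⟩ | b) hQ
      · exact Or.inl ⟨e, s, k, hQ⟩
      · exact Or.inr ⟨b, hQ⟩
    rcases ih with ⟨e, s, k, h0⟩ | ⟨b, h0⟩ | ⟨b, h0⟩ | ⟨b, h0⟩ | ⟨h0, b, h1⟩
    · obtain ⟨Q, hQ, -⟩ := h.arc i e s k h0
      exact (key Q hQ).imp_right Or.inl
    · refine Or.inr (Or.inr (Or.inl ⟨b, ?_⟩))
      rwa [add_sub_cancel_right]
    · refine Or.inr (Or.inr (Or.inr (Or.inl ⟨b, ?_⟩)))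
      rwa [show i + 1 - 2 = i - 1 by ring]
    · obtain ⟨-, -, h1⟩ := h.bub _ b h0
      rw [show i - 2 + 3 = i + 1 by ring] at h1
      rcases h1 with ⟨t, h1⟩ | ⟨h1, -⟩
      · exact Or.inr (Or.inl ⟨_, h1⟩)
      · refine Or.inr (Or.inr (Or.inr (Or.inr ⟨h1, b, ?_⟩)))
        rwa [show i + 1 - 3 = i - 2 by ring]
    · obtain ⟨-, -, h2⟩ := h.bub _ b h1
      rw [sub_add_cancel] at h2
      rcases h2 with ⟨t, h2⟩ | ⟨-, Q, hQ, -⟩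
      · rw [h0] at h2; simp at h2
      · rw [show i - 3 + 4 = i + 1 by ring] at hQ
        exact (key Q hQ).imp_right Or.inl

lemma stepAt_first {i : ℤ} {Q : Piece} (hQ : pc i = some Q)
    (h3 : ∀ b, pc (i - 3) ≠ some (.bub b)) : stepAt pc i = (Q.first, Q.base) := by
  rw [stepAt, hQ]
  cases Q with
  | arc e s k => rfl
  | bub b =>
    rcases h : pc (i - 3) with _ | (⟨e, s, k⟩ | b')
    · rfl
    · rfl
    · exact absurd h (h3 b')

lemma stepAt_chain {i : ℤ} {b b' : DEdge} {t : Side} (hb : pc i = some (.bub b))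
    (hb' : pc (i - 3) = some (.bub b')) (ht : b = chainNext b' t) :
    ∃ t, b = chainNext b' t ∧ stepAt pc i = (.E t b'.2, b'.1) := by
  have h : ∃ t, b = chainNext b' t := ⟨t, ht⟩
  refine ⟨h.choose, h.choose_spec, ?_⟩
  rw [stepAt, hb, hb']
  simp only [dif_pos h]

lemma stepAt_C (h : IsTrack pc) {i : ℤ} {b : DEdge} (hb : pc i = some (.bub b)) :
    stepAt pc (i + 1) = (.C b.2, b.1) := by
  have h1 := (h.bub i b hb).1
  rw [stepAt, h1, add_sub_cancel_right, hb]

lemma stepAt_Cp (h : IsTrack pc) {i : ℤ} {b : DEdge} (hb : pc i = some (.bub b)) :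
    stepAt pc (i + 2) = (.Cp b.2, b.1) := by
  obtain ⟨h1, h2, -⟩ := h.bub i b hb
  rw [stepAt, h2, add_sub_cancel_right, hb, show i + 2 - 1 = i + 1 by ring, h1]

lemma stepAt_D (h : IsTrack pc) {i : ℤ} {b : DEdge} (hb : pc i = some (.bub b))
    (h3 : pc (i + 3) = none) : stepAt pc (i + 3) = (.D b.2, b.1) := by
  obtain ⟨h1, h2, -⟩ := h.bub i b hb
  rw [stepAt, h3, add_sub_cancel_right, hb, show i + 3 - 1 = i + 2 by ring, h2,
    show i + 3 - 2 = i + 1 by ring, h1]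

/-- The step at the place where a bubble begins. -/
lemma stepAt_bub (h : IsTrack pc) {i : ℤ} {b : DEdge} (hb : pc i = some (.bub b)) :
    stepAt pc i = (.B b.2, b.1) ∨
      ∃ b' t, pc (i - 3) = some (.bub b') ∧ b = chainNext b' t ∧ stepAt pc i = (.E t b'.2, b'.1) := by
  by_cases h3 : ∀ b', pc (i - 3) ≠ some (.bub b')
  · exact Or.inl (stepAt_first hb h3)
  · push Not at h3
    obtain ⟨b', hb'⟩ := h3
    obtain ⟨-, -, h1⟩ := h.bub _ b' hb'
    rw [sub_add_cancel, hb] at h1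
    rcases h1 with ⟨t, h1⟩ | ⟨h1, -⟩
    · obtain ⟨t', ht', hs⟩ := stepAt_chain hb hb' (t := t) (by simpa using h1)
      exact Or.inr ⟨b', t', hb', ht', hs⟩
    · simp at h1

lemma followsAt (h : IsTrack pc) (i : ℤ) :
    FollowsAt (stepAt pc i).1 (stepAt pc i).2 (stepAt pc (i + 1)).1 (stepAt pc (i + 1)).2 := by
  rcases h.level_cases i with ⟨e, s, k, h0⟩ | ⟨b, h0⟩ | ⟨b, h0⟩ | ⟨b, h0⟩ | ⟨h0, b, h1⟩
  · obtain ⟨Q, hQ, hl⟩ := h.arc i e s k h0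
    rw [stepAt_first hQ, stepAt_first h0]
    · exact hl.followsAt (h.valid _ _ h0) (by rintro ⟨b, t, hb, -⟩; cases hb)
    · intro b hb
      obtain ⟨-, -, h1⟩ := h.bub _ b hb
      rw [sub_add_cancel, h0] at h1
      simp at h1
    · intro b hb
      have := (h.bub _ b hb).2.1
      rw [show i + 1 - 3 + 2 = i by ring, h0] at this
      simp at this
  · rw [h.stepAt_C h0]
    rcases h.stepAt_bub h0 with h1 | ⟨b', t, -, rfl, h1⟩
    · rw [h1]; exact followsAt_B_C b
    · rw [h1]; exact followsAt_E_C b' t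
  · have h1 := h.stepAt_C h0
    have h2 := h.stepAt_Cp h0
    rw [sub_add_cancel] at h1
    rw [show i - 1 + 2 = i + 1 by ring] at h2
    rw [h1, h2]
    exact followsAt_C_Cp b
  · have h1 := h.stepAt_Cp h0
    rw [sub_add_cancel] at h1
    rw [h1]
    obtain ⟨-, -, h2⟩ := h.bub _ b h0
    rw [show i - 2 + 3 = i + 1 by ring] at h2
    rcases h2 with ⟨t, h2⟩ | ⟨h2, -⟩
    · obtain ⟨t', -, h3⟩ := stepAt_chain h2 (by rwa [show i + 1 - 3 = i - 2 by ring]) rfl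
      rw [h3]
      exact followsAt_Cp_E b t'
    · have h3 := h.stepAt_D h0
      rw [show i - 2 + 3 = i + 1 by ring] at h3
      rw [h3 h2]
      exact followsAt_Cp_D b
  · have h3 := h.stepAt_D h1
    rw [sub_add_cancel] at h3
    rw [h3 h0]
    obtain ⟨-, h2, h4⟩ := h.bub _ b h1
    rw [sub_add_cancel, h0] at h4
    rcases h4 with ⟨t, h4⟩ | ⟨-, Q, hQ, hl, hc⟩
    · simp at h4
    · rw [show i - 3 + 4 = i + 1 by ring] at hQ
      rw [stepAt_first hQ]
      · exact hl.followsAt (h.valid _ _ h1) hc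
      · intro b' hb'
        rw [show i + 1 - 3 = i - 3 + 1 by ring, (h.bub _ b h1).1] at hb'
        simp at hb'

lemma mem_bub_edges {b : DEdge} {x : Sym2 G} : x ∈ (Piece.bub b).edges ↔
    ∃ n ≤ 3, x = ((nxt .R)^[n] b).edge ∨ x = ((nxt .L)^[n] (nbe .R b)).edge := by
  constructor
  · rintro ⟨k, rfl⟩
    simp only [← nxt_iterate_mod .R k]
    have hk := Nat.mod_lt k (show 8 > 0 by norm_num)
    generalize k % 8 = k at *
    rcases Nat.lt_or_ge 3 k with h | h
    · refine ⟨7 - k, by omega, Or.inr ?_⟩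
      have := nxt_opp_iterate_nbe .R (n := 7 - k) (by omega) b
      change (nxt .L)^[7 - k] _ = _ at this
      rw [this, edge_rev]
      congr 3
      omega
    · exact ⟨k, h, Or.inl rfl⟩
  · rintro ⟨n, hn, rfl | rfl⟩
    · exact ⟨n, rfl⟩
    · refine ⟨7 - n, ?_⟩
      have := nxt_opp_iterate_nbe .R (n := n) (by omega) b
      change (nxt .L)^[n] _ = _ at this
      rw [this, edge_rev]

lemma image_subset (h : IsTrack pc) (i : ℤ) :
    DEdge.edge '' (stepAt pc i).1.edges (stepAt pc i).2 ⊆ trackEdges pc := by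
  have left : ∀ {j b} (n : ℕ), n ≤ 3 → pc j = some (.bub b) →
      ((nxt .R)^[n] b).edge ∈ trackEdges pc :=
    fun n hn hb => ⟨_, _, hb, mem_bub_edges.mpr ⟨n, hn, Or.inl rfl⟩⟩
  have right : ∀ {j b} (n : ℕ), n ≤ 3 → pc j = some (.bub b) →
      ((nxt .L)^[n] (nbe .R b)).edge ∈ trackEdges pc :=
    fun n hn hb => ⟨_, _, hb, mem_bub_edges.mpr ⟨n, hn, Or.inr rfl⟩⟩
  rcases h.level_cases i with ⟨e, s, k, h0⟩ | ⟨b, h0⟩ | ⟨b, h0⟩ | ⟨b, h0⟩ | ⟨h0, b, h1⟩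
  · rw [stepAt_first h0]
    · change _ '' (arcState e.2 s k).edges e.1 ⊆ _
      rw [arcState_edges, Set.image_singleton, Set.singleton_subset_iff]
      exact ⟨i, _, h0, rfl⟩
    · intro b hb
      obtain ⟨-, -, h1⟩ := h.bub _ b hb
      rw [sub_add_cancel, h0] at h1
      simp at h1
  · rcases h.stepAt_bub h0 with h1 | ⟨b', t, h2, rfl, h1⟩
    · rw [h1, edges_B, Set.image_pair, Set.pair_subset_iff]
      exact ⟨left 0 (by omega) h0, right 0 (by omega) h0⟩
    · rw [h1, edges_E, Set.image_union, Set.image_pair, Set.image_pair, Set.union_subset_iff,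
        Set.pair_subset_iff, Set.pair_subset_iff]
      exact ⟨⟨left 3 (by omega) h2, right 3 (by omega) h2⟩,
        left 0 (by omega) h0, right 0 (by omega) h0⟩
  · have h1 := h.stepAt_C h0
    rw [sub_add_cancel] at h1
    rw [h1, edges_C, Set.image_pair, Set.pair_subset_iff]
    exact ⟨left 1 (by omega) h0, right 1 (by omega) h0⟩
  · have h1 := h.stepAt_Cp h0
    rw [sub_add_cancel] at h1
    rw [h1, edges_Cp, Set.image_pair, Set.pair_subset_iff]
    exact ⟨left 2 (by omega) h0, right 2 (by omega) h0⟩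
  · have h2 := h.stepAt_D h1
    rw [sub_add_cancel] at h2
    rw [h2 h0, edges_D, Set.image_pair, Set.pair_subset_iff]
    exact ⟨left 3 (by omega) h1, right 3 (by omega) h1⟩

lemma subset_image (h : IsTrack pc) :
    trackEdges pc ⊆ ⋃ i, DEdge.edge '' (stepAt pc i).1.edges (stepAt pc i).2 := by
  rintro x ⟨i, P, hP, hx⟩
  rw [Set.mem_iUnion]
  cases P with
  | arc e s k =>
    refine ⟨i, ?_⟩
    rw [stepAt_first hP]
    · change x ∈ _ '' (arcState e.2 s k).edges e.1
      rwa [arcState_edges, Set.image_singleton]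
    · intro b hb
      obtain ⟨-, -, h1⟩ := h.bub _ b hb
      rw [sub_add_cancel, hP] at h1
      simp at h1
  | bub b =>
    obtain ⟨n, hn, hx⟩ := mem_bub_edges.mp hx
    obtain rfl | rfl | rfl | rfl : n = 0 ∨ n = 1 ∨ n = 2 ∨ n = 3 := by omega
    · refine ⟨i, ?_⟩
      rcases h.stepAt_bub hP with h1 | ⟨b', t, h2, rfl, h1⟩
      · rw [h1, edges_B, Set.image_pair]; exact hx
      · rw [h1, edges_E, Set.image_union, Set.image_pair, Set.image_pair]; exact Or.inr hx
    · refine ⟨i + 1, ?_⟩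
      rw [h.stepAt_C hP, edges_C, Set.image_pair]; exact hx
    · refine ⟨i + 2, ?_⟩
      rw [h.stepAt_Cp hP, edges_Cp, Set.image_pair]; exact hx
    · refine ⟨i + 3, ?_⟩
      by_cases h3 : pc (i + 3) = none
      · rw [h.stepAt_D hP h3, edges_D, Set.image_pair]; exact hx
      · obtain ⟨-, -, ⟨t, h1⟩ | ⟨h1, -⟩⟩ := h.bub _ b hP
        · obtain ⟨t', -, h2⟩ := stepAt_chain h1 (by rwa [add_sub_cancel_right]) rfl
          rw [h2, edges_E, Set.image_union, Set.image_pair, Set.image_pair]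
          exact Or.inl hx
        · exact absurd h1 h3

/-- The edges of a track are the image of an element of the Markov chain. -/
theorem exists_markov (h : IsTrack pc) :
    ∃ J : ℤ → State, IsMarkovElement J ∧ IsImageOf (trackEdges pc) J := by
  refine ⟨fun i => (stepAt pc i).1, fun i => ⟨_, _, h.followsAt i⟩, fun i => (stepAt pc i).2,
    h.followsAt, ?_⟩
  exact Set.Subset.antisymm h.subset_image (Set.iUnion_subset h.image_subset)

end IsTrack

end SurfaceSnakes

end


noncomputable section
namespace SurfaceSnakes

/-! ### The octagons of the Cayley graph -/

/-- The vertices of the octagon on the side `s` of `e`. -/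
def octVerts (s : Side) (e : DEdge) : Set G := Set.range fun k => ((nxt s)^[k] e).1

/-- The edges of the octagon on the side `s` of `e`. -/
def octSet (s : Side) (e : DEdge) : Set (Sym2 G) := Set.range fun k => ((nxt s)^[k] e).edge

section Oct

attribute [local irreducible] nxt rev rotd

lemma edge_eq_mk (e : DEdge) : e.edge = s(e.1, e.target) := rfl

lemma range_iterate {α : Type*} (f : DEdge → α) (s : Side) (n : ℕ) (e : DEdge) :
    (Set.range fun k => f ((nxt s)^[k] ((nxt s)^[n] e))) = Set.range fun k => f ((nxt s)^[k] e) := by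
  apply Set.Subset.antisymm
  · rintro _ ⟨k, rfl⟩
    exact ⟨k + n, by simp only [Function.iterate_add_apply]⟩
  · rintro _ ⟨k, rfl⟩
    refine ⟨k + 7 * n, ?_⟩
    have h : (k + 7 * n + n) % 8 = k % 8 := by omega
    simp only [← Function.iterate_add_apply]
    rw [← nxt_iterate_mod, h, nxt_iterate_mod]

lemma octVerts_iterate (s : Side) (n : ℕ) (e : DEdge) :
    octVerts s ((nxt s)^[n] e) = octVerts s e := range_iterate Prod.fst s n e

lemma octSet_iterate (s : Side) (n : ℕ) (e : DEdge) :
    octSet s ((nxt s)^[n] e) = octSet s e := range_iterate DEdge.edge s n e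

lemma octVerts_nxt (s : Side) (e : DEdge) : octVerts s (nxt s e) = octVerts s e :=
  octVerts_iterate s 1 e

lemma rev_subset {α : Type*} (f g : DEdge → α) (h : ∀ d, f (rev d) = g d) (s : Side) (e : DEdge) :
    (Set.range fun k => f ((nxt s.opp)^[k] (rev e))) ⊆ Set.range fun k => g ((nxt s)^[k] e) := by
  rintro _ ⟨k, rfl⟩
  have hk := Nat.mod_lt k (show 8 > 0 by norm_num)
  refine ⟨8 - k % 8, ?_⟩
  simp only
  rw [← nxt_iterate_mod s.opp k, nxt_opp_iterate_rev_eq s hk.le, h]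

lemma octSet_rev (s : Side) (e : DEdge) : octSet s.opp (rev e) = octSet s e := by
  apply Set.Subset.antisymm
  · exact rev_subset DEdge.edge DEdge.edge edge_rev s e
  · have := rev_subset DEdge.edge DEdge.edge edge_rev s.opp (rev e)
    rwa [Side.opp_opp, rev_rev] at this

lemma octVerts_rev (s : Side) (e : DEdge) : octVerts s.opp (rev e) = octVerts s e := by
  have h : ∀ (s : Side) (e : DEdge), octVerts s.opp (rev e) ⊆ octVerts s e := by
    intro s e
    rw [← octVerts_nxt s e]
    rintro _ ⟨k, rfl⟩
    obtain ⟨j, hj⟩ := rev_subset Prod.fst DEdge.target rev_fst s e ⟨k, rfl⟩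
    refine ⟨j, hj ▸ ?_⟩
    simp only [← Function.iterate_succ_apply, Function.iterate_succ_apply', nxt_fst]
  apply Set.Subset.antisymm (h s e)
  have := h s.opp (rev e)
  rwa [Side.opp_opp, rev_rev] at this

lemma octSet_nbe (s : Side) (e : DEdge) : octSet s.opp (nbe s e) = octSet s e := by
  rw [nbe_eq_rev, octSet_rev, octSet_iterate]

lemma octVerts_nbe (s : Side) (e : DEdge) : octVerts s.opp (nbe s e) = octVerts s e := by
  rw [nbe_eq_rev, octVerts_rev, octVerts_iterate]

lemma mem_octVerts_of_mem {s : Side} {e : DEdge} {x : Sym2 G} (hx : x ∈ octSet s e) {v : G}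
    (hv : v ∈ x) : v ∈ octVerts s e := by
  obtain ⟨k, rfl⟩ := hx
  simp only [edge_eq_mk, Sym2.mem_iff] at hv
  rcases hv with rfl | rfl
  · exact ⟨k, rfl⟩
  · exact ⟨k + 1, by simp only [Function.iterate_succ_apply', nxt_fst]⟩

lemma front_target (e : DEdge) : Front e (position e.target) :=
  (reg_target e .L (k := 1) (by omega)).1

/-- That no generator is trivial in the presented group is seen from its action: the two ends of `e`
lie on different sides of a geodesic. -/
lemma fst_ne_target (e : DEdge) : e.1 ≠ e.target := by
  intro h
  have h1 := (front_target e).1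
  rw [← h] at h1
  linarith [ell_self e]

/-- The final vertex of `e` is beyond `e` and beyond no other edge at the same vertex. -/
lemma dart_ext {e e' : DEdge} (h : e'.1 = e.1) (h' : e'.target = e.target) : e' = e := by
  by_contra hne
  have h1 := (front_target e).neg (normSq_position _) h hne
  rw [← h'] at h1
  linarith [(front_target e').1]

lemma edge_inj {e e' : DEdge} (h : e'.edge = e.edge) : e' = e ∨ e' = rev e := by
  rw [edge_eq_mk, edge_eq_mk, Sym2.eq_iff] at h
  rcases h with ⟨h1, h2⟩ | ⟨h1, h2⟩
  · exact Or.inl (dart_ext h1 h2)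
  · exact Or.inr (dart_ext (by rw [rev_fst, h1]) (by rw [rev_target, h2]))

lemma oct_eq_of_mem {s : Side} {e d : DEdge} (h : d.edge ∈ octSet s e) :
    ∃ u, octSet s e = octSet u d ∧ octVerts s e = octVerts u d := by
  obtain ⟨k, hk⟩ := h
  rcases edge_inj hk.symm with rfl | rfl
  · exact ⟨s, (octSet_iterate s k e).symm, (octVerts_iterate s k e).symm⟩
  · exact ⟨s.opp, by rw [octSet_rev, octSet_iterate], by rw [octVerts_rev, octVerts_iterate]⟩

/-- Two octagons on both sides of an edge have only the endpoints of this edge in common. -/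
lemma mem_both {s : Side} {e : DEdge} {v : G} (h1 : v ∈ octVerts s e) (h2 : v ∈ octVerts s.opp e) :
    v = e.1 ∨ v = e.target := by
  obtain ⟨k, rfl⟩ := h1
  obtain ⟨j, hj⟩ := h2
  simp only at hj ⊢
  have hf := fan_vertex s.opp e j
  rw [hj] at hf
  obtain ⟨f1, f2, -⟩ := hf
  rw [Side.opp_opp] at f2
  have hz := normSq_position ((nxt s)^[k] e).1
  have f3 := f1 (nbe s e) (nbe_fst s e) (by
    rw [nbe]; intro h
    rw [← rotd_zero e, rotd_rotd, rotd_inj] at h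
    revert h; cases s <;> decide) (by
    rw [nbe, nbe]; intro h
    rw [rotd_inj] at h
    revert h; cases s <;> decide)
  rw [ell_nbe hz, ← ell_three hz] at f3
  rw [← nxt_iterate_mod s k] at f2 f3 ⊢
  have hk := Nat.mod_lt k (show 8 > 0 by norm_num)
  generalize k % 8 = k at *
  by_cases h0 : k = 0
  · left; subst h0; rfl
  by_cases h1 : k = 1
  · right; subst h1; rw [Function.iterate_one, nxt_fst]
  exfalso
  rcases Nat.lt_or_ge 5 k with h | h
  · have := ell_vertex_pos s e (j := 3) (k := k) (by omega) (by omega)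
    linarith
  · have := ell_vertex_pos s e (j := 1) (k := k) (by omega) (by omega)
    rw [Function.iterate_one] at this
    linarith

lemma edge_mem_both {s : Side} {e : DEdge} {x : Sym2 G} (h1 : x ∈ octSet s e)
    (h2 : x ∈ octSet s.opp e) : x = e.edge := by
  obtain ⟨k, rfl⟩ := h1
  simp only at h2 ⊢
  have key := fun (v : G) (hv : v ∈ ((nxt s)^[k] e).edge) => mem_both (mem_octVerts_of_mem ⟨k, rfl⟩ hv) (mem_octVerts_of_mem h2 hv)
  generalize (nxt s)^[k] e = d at key
  have h3 := key d.1 (by simp [edge_eq_mk])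
  have h4 := key d.target (by simp [edge_eq_mk])
  have h5 := fst_ne_target d
  rw [edge_eq_mk, edge_eq_mk, Sym2.eq_iff]
  rcases h3 with h3 | h3 <;> rcases h4 with h4 | h4
  · exact absurd (h3.trans h4.symm) h5
  · exact Or.inl ⟨h3, h4⟩
  · exact Or.inr ⟨h3, h4⟩
  · exact absurd (h3.trans h4.symm) h5

/-- Two different octagons with a common edge lie on its two sides, so `edge_mem_both` applies. -/
lemma subsingleton_inter {s s' : Side} {e e' : DEdge} (h : octSet s e ≠ octSet s' e') :
    (octSet s e ∩ octSet s' e').Subsingleton := by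
  rintro x ⟨hx, hx'⟩ y ⟨hy, hy'⟩
  obtain ⟨k, rfl⟩ := hx
  simp only at hx'
  obtain ⟨u, hu, -⟩ := oct_eq_of_mem hx'
  have h1 : octSet s e = octSet s ((nxt s)^[k] e) := (octSet_iterate s k e).symm
  rcases Side.eq_or_eq_opp s u with rfl | rfl
  · exact absurd (h1.trans hu.symm) h
  · rw [h1] at hy
    rw [hu] at hy'
    exact (edge_mem_both hy hy').symm

/-- A point of the octagon on the other side of the edge number `m` of an octagon is not beyond the next
edge of the latter, and beyond the preceding one. -/
lemma ell_across {s : Side} {e : DEdge} {v : G} {m : ℕ}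
    (hv : v ∈ octVerts s.opp ((nxt s)^[m] e)) :
    ell ((nxt s)^[m + 1] e) (position v) < 0 ∧ 0 < ell ((nxt s)^[m + 7] e) (position v) := by
  constructor
  · obtain ⟨j, rfl⟩ := hv
    have := (fan_vertex s.opp ((nxt s)^[m] e) j).2.1
    rwa [Side.opp_opp, ← Function.iterate_succ_apply' (nxt s)] at this
  · rw [← octVerts_rev, Side.opp_opp] at hv
    obtain ⟨j, rfl⟩ := hv
    have := (fan_vertex s (rev ((nxt s)^[m] e)) j).2.1
    rw [← nbe_eq_nxt, nbe_eq_rev, ell_rev, ← Function.iterate_add_apply, add_comm 7 m] at this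
    simp only
    linarith

lemma octVertex_eq (g : G) (k : Fin 8) : octVertex g k = ((nxt .L)^[k.val] (g, Letter.a)).1 := by
  rw [nxt_iterate, octVertex]
  have h : ∀ k : Fin 8, relator.take k =
      (List.range k.val).map fun j => (turn .L)^[j] .a := by decide
  rw [h]

lemma octVertex_ofNat (g : G) (k : ℕ) :
    octVertex g (Fin.ofNat 8 k) = ((nxt .L)^[k] (g, Letter.a)).1 := by
  rw [octVertex_eq, Fin.val_ofNat, nxt_iterate_mod]

lemma octEdge_ofNat (g : G) (k : ℕ) :
    octEdge g (Fin.ofNat 8 k) = ((nxt .L)^[k] (g, Letter.a)).edge := by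
  have : Fin.ofNat 8 k + 1 = Fin.ofNat 8 (k + 1) := by
    apply Fin.ext
    simp [Fin.val_add, Fin.ofNat]
  rw [octEdge, this, octVertex_ofNat, octVertex_ofNat, Function.iterate_succ_apply', nxt_fst,
    edge_eq_mk]

lemma octEdges_eq (g : G) : octEdges g = octSet .L (g, Letter.a) := by
  apply Set.Subset.antisymm
  · rintro _ ⟨k, rfl⟩
    refine ⟨k.val, ?_⟩
    simp only
    rw [← octEdge_ofNat]
    congr 1
    exact Fin.ext (Nat.mod_eq_of_lt k.isLt)
  · rintro _ ⟨k, rfl⟩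
    exact ⟨_, octEdge_ofNat g k⟩

/-- Every octagon is read off, in the positive direction, from one of its vertices. -/
lemma exists_octVertex (e : DEdge) : ∃ g m, e = (nxt .L)^[m] (g, Letter.a) := by
  obtain ⟨g, x⟩ := e
  obtain ⟨m, hm⟩ : ∃ m : ℕ, (turn .L)^[m] .a = x := by
    have : ∃ m : Fin 8, (turn .L)^[m.val] .a = x := by revert x; decide
    exact ⟨_, this.choose_spec⟩
  refine ⟨g * (evalWord ((List.range m).map fun k => (turn .L)^[k] .a))⁻¹, m, ?_⟩
  rw [nxt_iterate, hm]
  simp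

lemma finite_octSet (s : Side) (e : DEdge) : (octSet s e).Finite := by
  refine (Set.finite_range fun k : Fin 8 => ((nxt s)^[k.val] e).edge).subset ?_
  rintro _ ⟨k, rfl⟩
  exact ⟨⟨k % 8, Nat.mod_lt _ (by norm_num)⟩, by simp only [nxt_iterate_mod]⟩

lemma finite_octVerts (s : Side) (e : DEdge) : (octVerts s e).Finite := by
  refine (Set.finite_range fun k : Fin 8 => ((nxt s)^[k.val] e).1).subset ?_
  rintro _ ⟨k, rfl⟩
  exact ⟨⟨k % 8, Nat.mod_lt _ (by norm_num)⟩, by simp only [nxt_iterate_mod]⟩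

/-- Of two vertices of an octagon, one is reached from the other in at most four steps in the given
direction; the edge that leaves the latter crosses a geodesic that separates them. -/
lemma vertex_inj (s : Side) (e : DEdge) {j k : ℕ} (hj : j < 8) (hk : k < 8)
    (h : ((nxt s)^[j] e).1 = ((nxt s)^[k] e).1) : j = k := by
  have key : ∀ {j k : ℕ}, j < k → k < 8 → ((nxt s)^[j] e).1 ≠ ((nxt s)^[k] e).1 := by
    intro j k hjk hk h
    rcases Nat.lt_or_ge (j + 4) k with h1 | h1
    · have h2 := ell_vertex_pos s e (j := k) (k := j + 8) (by omega) (by omega)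
      have h3 := ell_vertex_neg' s e (j := k) (k := k) le_rfl (by omega)
      rw [nxt_iterate_add_eight, h] at h2
      linarith
    · have h2 := ell_vertex_pos s e hjk h1
      have h3 := ell_vertex_neg' s e (j := j) (k := j) le_rfl (by omega)
      rw [← h] at h2
      linarith
  rcases lt_trichotomy j k with h1 | h1 | h1
  · exact absurd h (key h1 hk)
  · exact h1
  · exact absurd h.symm (key h1 hj)

end Oct

end SurfaceSnakes

end


noncomputable section
namespace SurfaceSnakes

/-! ### The snake that belongs to a sequence of pieces -/

section Cells

attribute [local irreducible] nxt rev rotd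

lemma adj_dart (e : DEdge) : Gam.Adj e.1 e.target :=
  (SimpleGraph.mulCayley_adj' _ _ _).mpr ⟨fst_ne_target e, _, ⟨e.2, rfl⟩, Or.inl rfl⟩

/-- The path that consists of one edge. -/
def arcWalk (e : DEdge) : Gam.Walk e.1 e.target := (adj_dart e).toWalk

lemma adj_nxt (s : Side) (e : DEdge) : Gam.Adj e.1 (nxt s e).1 := by
  rw [nxt_fst]; exact adj_dart e

/-- The path along an octagon. -/
def octWalk (s : Side) : (n : ℕ) → (e : DEdge) → Gam.Walk e.1 ((nxt s)^[n] e).1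
  | 0, _ => .nil
  | n + 1, e => .cons (adj_nxt s e) ((octWalk s n (nxt s e)).copy rfl (by
    rw [← Function.iterate_succ_apply]))

lemma support_octWalk (s : Side) (n : ℕ) (e : DEdge) :
    (octWalk s n e).support = (List.range (n + 1)).map fun k => ((nxt s)^[k] e).1 := by
  induction n generalizing e with
  | zero => simp [octWalk]
  | succ n ih =>
    rw [octWalk, SimpleGraph.Walk.support_cons, SimpleGraph.Walk.support_copy, ih, List.range_succ_eq_map (n := n + 1)]
    simp

lemma edges_octWalk (s : Side) (n : ℕ) (e : DEdge) :
    (octWalk s n e).edges = (List.range n).map fun k => ((nxt s)^[k] e).edge := by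
  induction n generalizing e with
  | zero => simp [octWalk]
  | succ n ih =>
    rw [octWalk, SimpleGraph.Walk.edges_cons, SimpleGraph.Walk.edges_copy, ih, List.range_succ_eq_map (n := n), nxt_fst]
    simp [edge_eq_mk]

/-- The circle around an octagon. -/
def octCycle (s : Side) (e : DEdge) : Gam.Walk e.1 e.1 :=
  .cons (adj_nxt s e) ((octWalk s 7 (nxt s e)).copy rfl (by
    rw [← Function.iterate_succ_apply, nxt_iterate_eight]))

lemma support_octCycle (s : Side) (e : DEdge) :
    (octCycle s e).support = (List.range 9).map fun k => ((nxt s)^[k] e).1 := by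
  rw [octCycle, SimpleGraph.Walk.support_cons, SimpleGraph.Walk.support_copy, support_octWalk,
    List.range_succ_eq_map (n := 8)]
  simp

lemma edges_octCycle (s : Side) (e : DEdge) :
    (octCycle s e).edges = (List.range 8).map fun k => ((nxt s)^[k] e).edge := by
  rw [octCycle, SimpleGraph.Walk.edges_cons, SimpleGraph.Walk.edges_copy, edges_octWalk,
    List.range_succ_eq_map (n := 7), nxt_fst]
  simp [edge_eq_mk]

lemma isCycle_octCycle (s : Side) (e : DEdge) : (octCycle s e).IsCycle := by
  rw [octCycle, SimpleGraph.Walk.cons_isCycle_iff, SimpleGraph.Walk.isPath_copy,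
    SimpleGraph.Walk.edges_copy, edges_octWalk, SimpleGraph.Walk.isPath_def, support_octWalk]
  constructor
  · refine List.Nodup.map_on ?_ List.nodup_range
    intro j hj k hk h
    rw [List.mem_range] at hj hk
    exact vertex_inj s _ hj hk h
  · rw [List.mem_map]
    rintro ⟨k, hk, h⟩
    rw [List.mem_range] at hk
    rw [nxt_fst, ← edge_eq_mk, ← Function.iterate_succ_apply] at h
    rcases edge_inj h with h1 | h1
    · have := vertex_inj s e (j := k + 1) (k := 0) (by omega) (by omega) (by rw [h1]; rfl)
      omega
    · have := vertex_inj s e (j := k + 1) (k := 1) (by omega) (by omega)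
        (by rw [h1, rev_fst, Function.iterate_one, nxt_fst])
      obtain rfl : k = 0 := by omega
      exact nxt_ne_rev s e h1

/-- A piece as a subset of the Cayley graph. -/
def Piece.toCell : Piece → Cell
  | .arc e _ _ => .arc (arcWalk e)
  | .bub b => .bubble (octCycle .R b)

lemma verts_arcWalk (e : DEdge) : (arcWalk e).toSubgraph.verts = {e.1, e.target} := by
  rw [SimpleGraph.Walk.verts_toSubgraph]; ext; simp [arcWalk]

lemma edgeSet_arcWalk (e : DEdge) : (arcWalk e).toSubgraph.edgeSet = {e.edge} := by
  rw [SimpleGraph.Walk.edgeSet_toSubgraph]; ext; simp [arcWalk, edge_eq_mk]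

lemma Piece.image_verts (P : Piece) : P.toCell.image.verts = P.verts := by
  cases P with
  | arc e s k => exact verts_arcWalk e
  | bub b =>
    change (octCycle .R b).toSubgraph.verts = _
    rw [SimpleGraph.Walk.verts_toSubgraph]
    ext v
    rw [Set.mem_ofPred_eq, support_octCycle, List.mem_map]
    constructor
    · rintro ⟨k, -, rfl⟩; exact ⟨k, rfl⟩
    · rintro ⟨k, rfl⟩
      exact ⟨k % 8, by rw [List.mem_range]; omega, by simp only [nxt_iterate_mod]⟩

lemma Piece.image_edgeSet (P : Piece) : P.toCell.image.edgeSet = P.edges := by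
  cases P with
  | arc e s k => exact edgeSet_arcWalk e
  | bub b =>
    change (octCycle .R b).toSubgraph.edgeSet = _
    rw [SimpleGraph.Walk.edgeSet_toSubgraph]
    ext v
    change v ∈ (octCycle .R b).edges ↔ _
    rw [edges_octCycle, List.mem_map]
    constructor
    · rintro ⟨k, -, rfl⟩; exact ⟨k, rfl⟩
    · rintro ⟨k, rfl⟩
      exact ⟨k % 8, by rw [List.mem_range]; omega, by simp only [nxt_iterate_mod]⟩

lemma Piece.mem_verts {P : Piece} {x : Sym2 G} (hx : x ∈ P.edges) {v : G} (hv : v ∈ x) :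
    v ∈ P.verts := by
  cases P with
  | arc e s k => obtain rfl := hx; exact Sym2.mem_iff.mp hv
  | bub b => exact mem_octVerts_of_mem hx hv

lemma Linked.base_left {P Q : Piece} (h : Linked P Q) (hc : ¬ IsChain P Q) :
    (∀ e s k, P = .arc e s k → Q.base = e.target) ∧
      ∀ b, P = .bub b → Q.base = ((nxt .R)^[4] b).1 := by
  cases h with
  | arc_arc h hr hn => exact ⟨by rintro _ _ _ ⟨⟩; exact h, by rintro _ ⟨⟩⟩
  | arc_arc_sharp t hd => exact ⟨by rintro _ _ _ ⟨⟩; exact nxt_fst _ _, by rintro _ ⟨⟩⟩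
  | arc_bub h hr hr' hd => exact ⟨by rintro _ _ _ ⟨⟩; exact h, by rintro _ ⟨⟩⟩
  | bub_arc h hr hn =>
    exact ⟨by rintro _ _ _ ⟨⟩, by rintro _ ⟨⟩; exact h.trans (lastEdge_target _ _)⟩
  | bub_arc_sharp t =>
    exact ⟨by rintro _ _ _ ⟨⟩,
      by rintro _ ⟨⟩; exact (nxt_fst _ _).trans (lastEdge_target _ _)⟩
  | bub_bub h hr hr' =>
    exact ⟨by rintro _ _ _ ⟨⟩, by rintro _ ⟨⟩; exact h.trans (lastEdge_target _ _)⟩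
  | chain_left b => exact absurd ⟨b, .L, rfl, rfl⟩ hc
  | chain_right b => exact absurd ⟨b, .R, rfl, rfl⟩ hc

lemma Piece.base_mem (P : Piece) : P.base ∈ P.verts := by
  cases P with
  | arc e s k => exact Or.inl rfl
  | bub b => exact ⟨0, rfl⟩

lemma Linked.base_mem {P Q : Piece} (h : Linked P Q) (hc : ¬ IsChain P Q) : Q.base ∈ P.verts := by
  cases P with
  | arc e s k => exact Or.inr ((h.base_left hc).1 _ _ _ rfl)
  | bub b => exact ⟨4, ((h.base_left hc).2 _ rfl).symm⟩

/-- Every vertex of the octagon except the first is beyond the first edge of one of the two paths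
that start there. -/
lemma eq_base_of_neg {b : DEdge} {v : G} (hv : v ∈ (Piece.bub b).verts)
    (h1 : ell b (position v) < 0) (h2 : ell (nbe .R b) (position v) < 0) : v = b.1 := by
  obtain ⟨k, rfl⟩ := hv
  rw [ell_nbe (normSq_position _), ← ell_three (normSq_position _)] at h2
  simp only [← nxt_iterate_mod .R k] at h1 h2 ⊢
  have hk := Nat.mod_lt k (show 8 > 0 by norm_num)
  generalize k % 8 = k at *
  by_cases h0 : k = 0
  · subst h0; rfl
  exfalso
  rcases Nat.lt_or_ge 4 k with h | h
  · have := ell_vertex_pos .R b (j := 3) (k := k) (by omega) (by omega)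
    linarith
  · have := ell_vertex_pos .R b (j := 0) (k := k) (by omega) (by omega)
    rw [Function.iterate_zero, id] at this
    linarith

/-- Two successive pieces that are not linked by an interval have only one point in common. -/
lemma Linked.eq_base {P Q : Piece} (h : Linked P Q) (hP : P.Valid) (hc : ¬ IsChain P Q) {v : G}
    (h1 : v ∈ P.verts) (h2 : v ∈ Q.verts) : v = Q.base := by
  have hb := h.base_left hc
  cases Q with
  | arc e s k =>
    rcases h2 with h2 | h2
    · exact h2
    · refine absurd ?_ (h.not_zone_of_mem h1)
      rw [h2]
      exact reg_target _ _ (h.valid hP)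
  | bub b =>
    cases h with
    | arc_bub h hr hr' hd =>
      rcases h1 with h1 | h1
      · obtain ⟨k, hk⟩ := h2
        have h3 := (fan_vertex .R b k).1 _ (by rw [rev_fst, h]) hr hr'
        simp only at hk
        rw [hk, ell_rev] at h3
        linarith [ell_self' h1.symm]
      · exact h1.trans h.symm
    | @bub_bub b₀ _ h hr hr' =>
      obtain ⟨j, rfl⟩ := h1
      refine eq_base_of_neg h2 (ell_opposite_neg b₀ j ?_ fun t => (hr t).symm)
        (ell_opposite_neg b₀ j ?_ fun t => (hr' t).symm)
      · rw [h, lastEdge_target]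
      · rw [nbe_fst, h, lastEdge_target]
    | chain_left b => exact absurd ⟨b, .L, rfl, rfl⟩ hc
    | chain_right b => exact absurd ⟨b, .R, rfl, rfl⟩ hc

lemma oct_last (b : DEdge) (t : Side) : octVerts .R b = octVerts t.opp (lastEdge b t) ∧
    octSet .R b = octSet t.opp (lastEdge b t) := by
  cases t
  · exact ⟨(octVerts_iterate _ 3 b).symm, (octSet_iterate _ 3 b).symm⟩
  · rw [lastEdge_right, octVerts_rev, octSet_rev, octVerts_iterate, octSet_iterate]
    exact ⟨rfl, rfl⟩

lemma oct_chainNext (b : DEdge) (t : Side) :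
    octVerts .R (chainNext b t) = octVerts t (lastEdge b t) ∧
    octSet .R (chainNext b t) = octSet t (lastEdge b t) := by
  cases t
  · exact ⟨octVerts_nbe .L _, octSet_nbe .L _⟩
  · exact ⟨rfl, rfl⟩

open Classical in
/-- The link between two successive pieces. -/
def linkOf (P Q : Piece) : Link :=
  if h : IsChain P Q then .interval (arcWalk (lastEdge h.choose h.choose_spec.choose))
  else .point Q.base

lemma linkOf_chain {P Q : Piece} (h : IsChain P Q) :
    ∃ b t, P = .bub b ∧ Q = .bub (chainNext b t) ∧
      linkOf P Q = .interval (arcWalk (lastEdge b t)) :=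
  ⟨_, _, h.choose_spec.choose_spec.1, h.choose_spec.choose_spec.2, by rw [linkOf, dif_pos h]⟩

lemma linkOf_not_chain {P Q : Piece} (h : ¬ IsChain P Q) : linkOf P Q = .point Q.base := by
  rw [linkOf, dif_neg h]

/-- The bi-infinite sequences of pieces of a snake. -/
structure IsSnake (c : ℤ → Piece) : Prop where
  valid : ∀ n, (c n).Valid
  linked : ∀ n, Linked (c n) (c (n + 1))

namespace IsSnake

variable {c : ℤ → Piece}

lemma zone_mono (h : IsSnake c) {z : ℂ} (hz : Complex.normSq z < 1) {m n : ℤ} (hmn : m ≤ n)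
    (hn : (c n).Zone z) : (c m).Zone z := by
  induction n, hmn using Int.leInduction with
  | base => exact hn
  | succ n _ ih => exact ih ((h.linked n).zone_mono hz (h.valid n) hn)

lemma zone_of_mem (h : IsSnake c) {m n : ℤ} (hmn : m < n) {v : G} (hv : v ∈ (c n).verts) :
    (c m).Zone (position v) := by
  have h1 := h.linked (n - 1)
  rw [sub_add_cancel] at h1
  exact h.zone_mono (normSq_position v) (by omega) (h1.zone_of_mem (h.valid _) hv)

lemma disjoint (h : IsSnake c) {m n : ℤ} (hmn : m + 1 < n) :
    Disjoint (c m).verts (c n).verts := by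
  rw [Set.disjoint_left]
  exact fun v hv hv' => (h.linked m).not_zone_of_mem hv (h.zone_of_mem hmn hv')

/-- The topological snake. -/
def toSnake (h : IsSnake c) : TopologicalSnake where
  cell n := (c n).toCell
  link n := linkOf (c n) (c (n + 1))
  arc_embedded := by
    intro i u v w hw
    rcases hc : c i with ⟨e, s, k⟩ | b
    · rw [hc] at hw
      change Cell.arc (arcWalk e) = _ at hw
      have h1 : ¬ IsChain (c (i - 1)) (c i) := by
        rintro ⟨b, t, -, hb⟩; rw [hc] at hb; cases hb
      have h2 : ¬ IsChain (c i) (c (i + 1)) := by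
        rintro ⟨b, t, hb, -⟩; rw [hc] at hb; cases hb
      have h3 := ((h.linked i).base_left h2).1 e s k hc
      rw [sub_add_cancel, linkOf_not_chain h1, ← hc, linkOf_not_chain h2, h3, hc]
      cases hw
      refine ⟨?_, ?_, rfl, rfl⟩
      · rw [arcWalk, SimpleGraph.Walk.isPath_def]
        simpa using fst_ne_target e
      · simp [arcWalk]
    · rw [hc] at hw; cases hw
  bubble_embedded := by
    intro i u w hw
    rcases hc : c i with ⟨e, s, k⟩ | b
    · rw [hc] at hw; cases hw
    · rw [hc] at hw
      change Cell.bubble (octCycle .R b) = _ at hw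
      cases hw
      exact isCycle_octCycle .R b
  point_link := by
    intro i v hv
    by_cases hc : IsChain (c i) (c (i + 1))
    · obtain ⟨b, t, -, -, hl⟩ := linkOf_chain hc
      rw [hl] at hv; cases hv
    · rw [linkOf_not_chain hc] at hv
      cases hv
      rw [SimpleGraph.Subgraph.verts_inf, Piece.image_verts, Piece.image_verts]
      ext v
      rw [Set.mem_inter_iff, Set.mem_singleton_iff]
      constructor
      · rintro ⟨h1, h2⟩
        exact (h.linked i).eq_base (h.valid i) hc h1 h2
      · rintro rfl
        exact ⟨(h.linked i).base_mem hc, Piece.base_mem _⟩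
  interval_link := by
    intro i u v w hw
    by_cases hc : IsChain (c i) (c (i + 1))
    · obtain ⟨b, t, hP, hQ, hl⟩ := linkOf_chain hc
      rw [hl] at hw
      cases hw
      refine ⟨?_, ?_, ?_⟩
      · rw [arcWalk, SimpleGraph.Walk.isPath_def]
        simpa using fst_ne_target (lastEdge b t)
      · simp [arcWalk]
      -- The two bubbles are the octagons on both sides of `lastEdge b t`, so `mem_both` and
      -- `edge_mem_both` determine the vertices and the edges that they share.
      · have e1 := (c i).image_edgeSet
        have e2 := (c (i + 1)).image_edgeSet
        have v1 := (c i).image_verts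
        have v2 := (c (i + 1)).image_verts
        have e3 := edgeSet_arcWalk (lastEdge b t)
        have v3 := verts_arcWalk (lastEdge b t)
        rw [hP] at e1 v1
        rw [hQ] at e2 v2
        rw [hP, hQ]
        replace e1 := e1.trans (oct_last b t).2
        replace v1 := v1.trans (oct_last b t).1
        replace e2 := e2.trans (oct_chainNext b t).2
        replace v2 := v2.trans (oct_chainNext b t).1
        refine SimpleGraph.Subgraph.ext ?_ ?_
        · rw [SimpleGraph.Subgraph.verts_inf, v1, v2, v3]
          ext v
          constructor
          · rintro ⟨h1, h2⟩; exact mem_both h2 h1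
          · rintro (rfl | rfl)
            · exact ⟨⟨0, rfl⟩, ⟨0, rfl⟩⟩
            · exact ⟨⟨1, nxt_fst _ _⟩, ⟨1, nxt_fst _ _⟩⟩
        · funext p q
          rw [SimpleGraph.Subgraph.inf_adj, ← SimpleGraph.Subgraph.mem_edgeSet,
            ← SimpleGraph.Subgraph.mem_edgeSet, ← SimpleGraph.Subgraph.mem_edgeSet, e1, e2, e3,
            eq_iff_iff]
          constructor
          · rintro ⟨h1, h2⟩; exact edge_mem_both h2 h1
          · intro h; rw [Set.mem_singleton_iff] at h; rw [h]
            exact ⟨⟨0, rfl⟩, ⟨0, rfl⟩⟩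
    · rw [linkOf_not_chain hc] at hw
      cases hw
  far_disjoint := by
    intro i j hij
    rw [Piece.image_verts, Piece.image_verts]
    exact h.disjoint hij

lemma toSnake_edges (h : IsSnake c) : h.toSnake.edges = ⋃ n, (c n).edges :=
  Set.iUnion_congr fun n => (c n).image_edgeSet

end IsSnake

end Cells

end SurfaceSnakes

end


/-! ### Special points, and octagons with four edges in a snake -/

noncomputable section
namespace SurfaceSnakes

section Geometrical

attribute [local irreducible] nxt rev rotd

/-- The special points of a piece, if it is a bubble. -/
def Piece.special : Piece → Set G
  | .arc _ _ _ => ∅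
  | .bub b => {b.1, ((nxt .R)^[4] b).1}

/-- The first edge, on the side `t`, of the octagon on the right of `b`. -/
def firstEdge (b : DEdge) : Side → DEdge
  | .L => b
  | .R => nbe .R b

lemma lastEdge_eq (b : DEdge) (t : Side) : lastEdge b t = (nxt t.opp)^[3] (firstEdge b t) := by
  cases t <;> rfl

lemma octSet_firstEdge (b : DEdge) (t : Side) : octSet t.opp (firstEdge b t) = octSet .R b := by
  cases t
  · rfl
  · exact octSet_nbe .R b

lemma ell_lastEdge_opp {z : ℂ} (hz : Complex.normSq z < 1) (b : DEdge) (t : Side) :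
    ell (lastEdge b t.opp) z = ell (firstEdge b t) z := by
  cases t
  · exact ell_lastEdge_right hz b
  · exact (ell_other hz .R (n := 0) (by omega) b).symm

/-- The edges of an octagon that contains `e` between vertices in front of `e`. -/
lemma front_edges {u : Side} {e : DEdge} {x : Sym2 G} (hx : x ∈ octSet u e)
    (h : ∀ v ∈ x, Front e (position v)) : x = (nxt u e).edge ∨ x = ((nxt u)^[2] e).edge := by
  obtain ⟨k, rfl⟩ := hx
  simp only [← nxt_iterate_mod u k] at h ⊢
  have hk := Nat.mod_lt k (show 8 > 0 by norm_num)
  generalize k % 8 = k at *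
  have h1 := h ((nxt u)^[k] e).1 (Sym2.mem_mk_left _ _)
  have h2 := h ((nxt u)^[k + 1] e).1 (by
    rw [Function.iterate_succ_apply', nxt_fst]; exact Sym2.mem_mk_right _ _)
  have h4 : ∀ j, j = 4 → ¬ Front e (position ((nxt u)^[j] e).1) := by
    rintro j rfl hf
    have hf2 := hf.2 u
    rw [ell_nbe (normSq_position _), ← ell_three (normSq_position _)] at hf2
    have := ell_vertex_pos u e (j := 3) (k := 4) (by omega) (by omega)
    linarith
  obtain rfl | rfl | rfl | h5 | h5 | h5 :
    k = 1 ∨ k = 2 ∨ k = 0 ∨ k = 3 ∨ k = 4 ∨ 5 ≤ k := by omega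
  · exact Or.inl rfl
  · exact Or.inr rfl
  · exact absurd h1.1 (ell_self e).not_gt
  · exact absurd h2 (h4 _ (by omega))
  · exact absurd h1 (h4 _ h5)
  · have := ell_vertex_pos u e (j := 0 + 4) (k := k) (by omega) (by omega)
    rw [ell_add_four (normSq_position _), Function.iterate_zero, id] at this
    linarith [h1.1]

/-- The zone of the next bubble lies beyond the first three edges of the path of the preceding
bubble that leads to the shared edge, and beyond the sharp turn after that edge. -/
lemma sector_chainNext {z : ℂ} (hz : Complex.normSq z < 1) {b : DEdge} {t : Side}
    (h : Sector (chainNext b t) z) :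
    (0 < ell (nxt t (lastEdge b t)) z ∧ 0 < ell (firstEdge b t) z) ∧
      0 < ell (nxt t.opp (firstEdge b t)) z ∧ 0 < ell ((nxt t.opp)^[2] (firstEdge b t)) z := by
  have hf : Fan .R (chainNext b t) z := fan_of_sector hz h.1.le h.2.le
  cases t
  · have h1 := hf.sector_left hz
    have h2 := ell_other hz .L (n := 2) (by omega) (lastEdge b .L)
    refine ⟨⟨?_, h1.1⟩, h1.2⟩
    have h3 := h.2
    change 0 < ell ((nxt .R)^[2] (nbe .L (lastEdge b .L))) z at h3
    change ell ((nxt .R)^[2] (nbe .L (lastEdge b .L))) z = ell (nxt .L (lastEdge b .L)) z at h2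
    rwa [← h2]
  · have h1 := hf.sector_right hz
    have h2 := ell_other hz .R (n := 0) (by omega) b
    have h3 := ell_other hz .R (n := 1) (by omega) b
    have h4 := ell_other hz .R (n := 2) (by omega) b
    refine ⟨⟨h.1, ?_⟩, ?_, ?_⟩
    · change ell (nbe .R b) z = _ at h2
      change 0 < ell (nbe .R b) z
      rw [h2]; exact h1.2.2
    · change ell (nxt .L (nbe .R b)) z = _ at h3
      change 0 < ell (nxt .L (nbe .R b)) z
      rw [h3]; exact h1.2.1
    · change ell ((nxt .L)^[2] (nbe .R b)) z = _ at h4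
      change 0 < ell ((nxt .L)^[2] (nbe .R b)) z
      rw [h4]; exact h1.1

/-- The octagons that share an edge with a bubble, but are different from the next bubble of the chain,
do not reach the zone of the latter. -/
lemma not_sector_across {b : DEdge} {t : Side} {m : ℕ} (hm : m < 8) (hm3 : m ≠ 3) {v : G}
    (hv : v ∈ octVerts t ((nxt t.opp)^[m] (firstEdge b t))) :
    ¬ Sector (chainNext b t) (position v) := by
  intro h
  have hz := normSq_position v
  obtain ⟨⟨a1, l0⟩, l1, l2⟩ := sector_chainNext hz h
  obtain ⟨ha, hb⟩ := ell_across (s := t.opp) (e := firstEdge b t) (m := m)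
    (by rwa [Side.opp_opp])
  have h8 : ∀ n, ell ((nxt t.opp)^[n + 12] (firstEdge b t)) (position v) =
      -ell ((nxt t.opp)^[n] (firstEdge b t)) (position v) := by
    intro n
    rw [show n + 12 = n + 4 + 4 + 4 by ring, ell_add_four hz, ell_add_four hz, ell_add_four hz,
      neg_neg]
  have hd := lastEdge_eq b t
  generalize firstEdge b t = e at *
  generalize lastEdge b t = d at *
  -- For m = 0, 1 the edge after number m gives the contradiction, and for m = 5, 6, 7 the edge
  -- before it, which is opposite to number m − 5. For m = 2 and m = 4 the octagon contains an
  -- endpoint of the shared edge, number 3, and its fan at this endpoint excludes the zone.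
  obtain rfl | rfl | rfl | rfl | rfl | rfl | rfl :
    m = 0 ∨ m = 1 ∨ m = 2 ∨ m = 4 ∨ m = 5 ∨ m = 6 ∨ m = 7 := by omega
  · exact absurd l1 ha.not_gt
  · exact absurd l2 ha.not_gt
  · rw [Function.iterate_succ_apply' _ 2] at hd
    generalize (nxt t.opp)^[2] e = d2 at *
    rw [← octVerts_nxt] at hv
    obtain ⟨j, rfl⟩ := hv
    have hf := (fan_vertex t (nxt t d2) j).1
    have f0 := hf d (by rw [hd, nxt_fst, nxt_fst]) (by rw [hd]; exact nxt_opp_ne t d2) (by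
      rw [hd, nxt_eq, nxt_eq, nbe, rotd_rotd]
      exact rotd_ne _ (by cases t <;> decide))
    have f3 := hf (nbe t d) (by rw [hd, nbe_fst, nxt_fst, nxt_fst]) (by
        rw [hd, nxt_eq, nxt_eq, nbe, rotd_rotd]
        exact rotd_ne _ (by cases t <;> decide)) (by
      rw [hd, nxt_eq, nxt_eq, nbe, nbe, rotd_rotd, rotd_rotd]
      exact rotd_ne _ (by cases t <;> decide))
    rw [ell_nbe hz] at f3
    have := mul_neg_of_pos_of_neg sqrt_two_pos f0
    linarith
  · rw [Function.iterate_succ_apply' _ 3, ← hd] at hv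
    obtain ⟨j, rfl⟩ := hv
    have := (fan_vertex t (nxt t.opp d) j).1 (nxt t d) (by rw [nxt_fst, nxt_fst])
      (nxt_opp_ne t d).symm (by
        rw [nxt_eq, nxt_eq, nbe, rotd_rotd]
        exact rotd_ne _ (by cases t <;> decide))
    linarith
  · have := h8 0
    simp only [Function.iterate_zero, id] at this
    linarith
  · have := h8 1
    rw [Function.iterate_one] at this
    linarith
  · have := h8 2
    linarith

/-- At the end of a bubble chain each of the two last edges can stand for an arc of depth one, so
that the results on arcs can be applied to the pieces that follow. -/
lemma Linked.arc_of_bub {b : DEdge} {Q : Piece} (h : Linked (.bub b) Q)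
    (hc : ¬ IsChain (.bub b) Q) (t : Side) : ∃ Q', Linked (.arc (lastEdge b t) t 1) Q' ∧
      Q'.verts = Q.verts ∧ ∀ z, Complex.normSq z < 1 → Q.Zone z → Q'.Zone z := by
  cases h with
  | bub_arc h hr hn =>
    refine ⟨_, .arc_arc ?_ (hr t) (fun u => hn t u), rfl, fun _ _ => id⟩
    rw [h, lastEdge_target, lastEdge_target]
  | bub_bub h hr hr' =>
    refine ⟨_, .arc_bub ?_ (hr t) (hr' t) (fun u _ => ?_), rfl, fun _ _ => id⟩
    · rw [h, lastEdge_target, lastEdge_target]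
    · rw [depth, ite_self]; norm_num
  | bub_arc_sharp u =>
    rcases Side.eq_or_eq_opp u t with rfl | rfl
    · refine ⟨_, .arc_arc_sharp t (by simp [depth]), rfl, fun z _ => ?_⟩
      simp [depth]
    · refine ⟨.arc (nxt u (lastEdge b u)) u 1, .arc_arc ?_ (sharp_ne b u).1 (sharp_ne b u).2, rfl,
        fun z hz hQ => (reg_one_iff hz u).mpr hQ.1⟩
      rw [nxt_fst, lastEdge_target, lastEdge_target]
  | chain_left b => exact absurd ⟨b, .L, rfl, rfl⟩ hc
  | chain_right b => exact absurd ⟨b, .R, rfl, rfl⟩ hc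

lemma ncard_le_three {α : Type*} {S : Set α} {x y z : α}
    (h : ∀ w ∈ S, w = x ∨ w = y ∨ w = z) : S.ncard ≤ 3 := by
  have h1 : S ⊆ {x, y, z} := h
  have h2 := Set.ncard_le_ncard h1 (by simp)
  have h3 := Set.ncard_insert_le x {y, z}
  have h4 := Set.ncard_insert_le y {z}
  rw [Set.ncard_singleton] at h4
  omega

lemma exists_firstEdge {b : DEdge} {x : Sym2 G} (hx : x ∈ octSet .R b) :
    ∃ t, ∃ m ≤ 3, x = ((nxt t.opp)^[m] (firstEdge b t)).edge := by
  obtain ⟨m, hm, h | h⟩ := IsTrack.mem_bub_edges.mp hx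
  · exact ⟨.L, m, hm, h⟩
  · exact ⟨.R, m, hm, h⟩

namespace IsSnake

variable {c : ℤ → Piece}

lemma bddBelow_verts (h : IsSnake c) (v : G) : BddBelow {n | v ∈ (c n).verts} := by
  by_cases hv : ∃ m, v ∈ (c m).verts
  · obtain ⟨m, hm⟩ := hv
    refine ⟨m - 1, fun n hn => ?_⟩
    by_contra hlt
    exact Set.disjoint_left.mp (h.disjoint (m := n) (n := m) (by omega)) hn hm
  · push Not at hv
    exact ⟨0, fun n hn => absurd hn (hv n)⟩

/-- Later pieces lie in front of the last edges of a bubble that is not linked to the next one. -/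
lemma front_lastEdge (h : IsSnake c) {n : ℤ} {b : DEdge} (hb : c n = .bub b)
    (hc : ¬ IsChain (c n) (c (n + 1))) {m : ℤ} (hm : n < m) {v : G} (hv : v ∈ (c m).verts)
    (t : Side) : Front (lastEdge b t) (position v) := by
  have hl := h.linked n
  rw [hb] at hl hc
  obtain ⟨Q', h1, h2, h3⟩ := hl.arc_of_bub hc t
  have hval : (Piece.arc (lastEdge b t) t 1).Valid := ⟨le_rfl, by norm_num⟩
  rcases eq_or_lt_of_le (show n + 1 ≤ m by omega) with rfl | hlt
  · exact (h1.zone_of_mem hval (h2 ▸ hv)).1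
  · exact (h1.zone_mono (normSq_position v) hval
      (h3 _ (normSq_position v) (h.zone_of_mem hlt hv))).1

/-- An octagon of which a snake contains at least four edges is a bubble. -/
theorem exists_bubble (h : IsSnake c) (s : Side) (e : DEdge)
    (h4 : 4 ≤ (octSet s e ∩ ⋃ n, (c n).edges).ncard) :
    ∃ n b, c n = .bub b ∧ octSet s e = octSet .R b := by
  by_contra hsub
  have hbub : ∀ n b, c n = .bub b → octSet s e ≠ octSet .R b := fun n b hb heq =>
    hsub ⟨n, b, hb, heq⟩
  refine absurd h4 (Nat.not_le.mpr (Nat.lt_succ_of_le ?_))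
  -- The argument starts at the first piece that has an edge in common with the octagon; all other
  -- common edges are in this piece or in its zone. It exists since only finitely many pieces meet
  -- the finitely many vertices of the octagon.
  obtain ⟨n, ⟨x₀, hx₀, hx₀'⟩, hmin⟩ : ∃ n, ((c n).edges ∩ octSet s e).Nonempty ∧
      ∀ m, ((c m).edges ∩ octSet s e).Nonempty → n ≤ m := by
    apply Int.exists_least_of_bdd
    · obtain ⟨N, hN⟩ := ((finite_octVerts s e).bddBelow_biUnion
        (S := fun v => {n | v ∈ (c n).verts})).mpr fun v _ => h.bddBelow_verts v
      refine ⟨N, fun m ⟨x, hx, hx'⟩ => hN ?_⟩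
      induction x with
      | h p q =>
        exact Set.mem_biUnion (mem_octVerts_of_mem hx' (Sym2.mem_mk_left p q))
          (Piece.mem_verts hx (Sym2.mem_mk_left p q))
    · obtain ⟨x, hx, hx'⟩ := Set.nonempty_of_ncard_ne_zero
        (s := octSet s e ∩ ⋃ n, (c n).edges) (by omega)
      obtain ⟨m, hm⟩ := Set.mem_iUnion.mp hx'
      exact ⟨m, x, hm, hx⟩
  have later : ∀ x ∈ octSet s e ∩ ⋃ n, (c n).edges, x ∈ (c n).edges ∨
      ∃ m, n < m ∧ x ∈ (c m).edges := by
    rintro x ⟨hx, hx'⟩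
    obtain ⟨m, hm⟩ := Set.mem_iUnion.mp hx'
    rcases eq_or_lt_of_le (hmin m ⟨x, hm, hx⟩) with rfl | hlt
    · exact Or.inl hm
    · exact Or.inr ⟨m, hlt, hm⟩
  rcases hc : c n with ⟨d, s', k⟩ | b
  · rw [hc] at hx₀
    obtain rfl : x₀ = d.edge := hx₀
    obtain ⟨u, hu, -⟩ := oct_eq_of_mem hx₀'
    -- Of an octagon beside the arc, only the next two edges have both ends in front of the arc,
    -- which makes three edges at most.
    refine ncard_le_three (x := d.edge) (y := (nxt u d).edge) (z := ((nxt u)^[2] d).edge)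
      fun x hx => ?_
    rcases later x hx with h1 | ⟨m, hm, h1⟩
    · rw [hc] at h1
      exact Or.inl h1
    · refine Or.inr (front_edges (hu ▸ hx.1) fun v hv => ?_)
      have := h.zone_of_mem hm (Piece.mem_verts h1 hv)
      rw [hc] at this
      exact this.1
  · have hb := hbub n b hc
    rw [hc] at hx₀
    change x₀ ∈ octSet .R b at hx₀
    have across : ∀ t m, x₀ = ((nxt t.opp)^[m] (firstEdge b t)).edge →
        octSet s e = octSet t ((nxt t.opp)^[m] (firstEdge b t)) ∧
        octVerts s e = octVerts t ((nxt t.opp)^[m] (firstEdge b t)) ∧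
        ∀ x ∈ octSet s e, x ∈ (c n).edges → x = x₀ := by
      intro t m hx
      rw [hx] at hx₀'
      obtain ⟨u, hu, hu'⟩ := oct_eq_of_mem hx₀'
      rcases Side.eq_or_eq_opp t u with rfl | rfl
      · refine ⟨hu, hu', fun x h1 h2 => ?_⟩
        rw [hc] at h2
        change x ∈ octSet .R b at h2
        rw [← octSet_firstEdge b u, ← octSet_iterate _ m] at h2
        rw [hu] at h1
        rw [hx]
        exact edge_mem_both h1 h2
      · rw [octSet_iterate, octSet_firstEdge] at hu
        exact absurd hu hb
    by_cases hch : IsChain (c n) (c (n + 1))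
    · obtain ⟨b₁, t, h1, h2, -⟩ := linkOf_chain hch
      obtain rfl : b₁ = b := by rw [hc] at h1; cases h1; rfl
      have hb' := hbub _ _ h2
      rw [← octSet_firstEdge b₁ t] at hx₀
      obtain ⟨m, hm⟩ := hx₀
      simp only [← nxt_iterate_mod _ m] at hm
      have hm8 := Nat.mod_lt m (show 8 > 0 by norm_num)
      generalize m % 8 = m at *
      obtain ⟨a1, a2, a3⟩ := across t m hm.symm
      have hm3 : m ≠ 3 := by
        rintro rfl
        rw [← lastEdge_eq, ← (oct_chainNext b₁ t).2] at a1
        exact hb' a1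
      -- Inside a bubble chain the octagon shares one edge with the present bubble, at most one with
      -- the next, and none with later pieces, by `not_sector_across`.
      have key : octSet s e ∩ ⋃ n, (c n).edges ⊆
          {x₀} ∪ octSet s e ∩ octSet .R (chainNext b₁ t) := by
        intro x hx
        rcases later x hx with h3 | ⟨j, hj, h3⟩
        · exact Or.inl (a3 x hx.1 h3)
        rcases eq_or_lt_of_le (show n + 1 ≤ j by omega) with rfl | hlt
        · refine Or.inr ⟨hx.1, ?_⟩
          rw [h2] at h3
          exact h3
        · exfalso
          induction x with
          | h p q =>
            have h5 := h.zone_of_mem hlt (Piece.mem_verts h3 (Sym2.mem_mk_left p q))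
            rw [h2] at h5
            refine not_sector_across hm8 hm3 ?_ h5
            rw [← a2]
            exact mem_octVerts_of_mem hx.1 (Sym2.mem_mk_left p q)
      have h5 := Set.ncard_le_ncard key ((Set.finite_singleton x₀).union
        ((finite_octSet s e).inter_of_left _))
      have h6 := Set.ncard_union_le {x₀} (octSet s e ∩ octSet .R (chainNext b₁ t))
      rw [Set.ncard_singleton] at h6
      have h7 : (octSet s e ∩ octSet .R (chainNext b₁ t)).ncard ≤ 1 :=
        haveI := ((finite_octSet s e).inter_of_left (octSet .R (chainNext b₁ t))).to_subtype
        Set.ncard_le_one_iff_subsingleton.mpr (subsingleton_inter hb')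
      omega
    · obtain ⟨t, m, hm, hx⟩ := exists_firstEdge hx₀
      obtain ⟨a1, a2, a3⟩ := across t m hx
      -- At the end of a chain, an octagon across one of the first three edges of a path does not
      -- meet the common front of the two last edges. Across the last edge itself, the argument for
      -- arcs applies.
      rcases Nat.lt_or_ge m 3 with hm3 | hm3
      · refine ncard_le_three (x := x₀) (y := x₀) (z := x₀) fun x hx => Or.inl ?_
        rcases later x hx with h3 | ⟨j, hj, h3⟩
        · exact a3 x hx.1 h3
        · exfalso
          induction x with
          | h p q =>
            have hp := Sym2.mem_mk_left p q
            have h5 := h.front_lastEdge hc hch hj (Piece.mem_verts h3 hp)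
            have h6 := mem_octVerts_of_mem hx.1 hp
            rw [a2, ← Side.opp_opp t, Side.opp_opp t.opp] at h6
            have h7 := (ell_across (s := t.opp) (by rwa [Side.opp_opp] at h6 ⊢)).1
            have h8 := (h5 t.opp).1
            have h9 := (h5 t).1
            have hz := normSq_position p
            rw [ell_lastEdge_opp hz] at h8
            rw [lastEdge_eq] at h9
            obtain ⟨h10, h11⟩ := ell_between_pos hz h8.le h9.le (Or.inl h8)
            obtain rfl | rfl | rfl : m = 0 ∨ m = 1 ∨ m = 2 := by omega
            · exact absurd h10 h7.not_gt
            · exact absurd h11 h7.not_gt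
            · exact absurd h9 h7.not_gt
      · obtain rfl : m = 3 := by omega
        rw [← lastEdge_eq] at hx a1
        refine ncard_le_three (x := x₀) (y := (nxt t (lastEdge b t)).edge)
          (z := ((nxt t)^[2] (lastEdge b t)).edge) fun x hx' => ?_
        rcases later x hx' with h3 | ⟨j, hj, h3⟩
        · exact Or.inl (a3 x hx'.1 h3)
        · exact Or.inr (front_edges (a1 ▸ hx'.1) fun v hv =>
            h.front_lastEdge hc hch hj (Piece.mem_verts h3 hv) t)

/-- A snake that contains at least four edges of an octagon contains all eight. -/
theorem four_edges (h : IsSnake c) (s : Side) (e : DEdge)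
    (h4 : 4 ≤ (octSet s e ∩ ⋃ n, (c n).edges).ncard) : octSet s e ⊆ ⋃ n, (c n).edges := by
  obtain ⟨n, b, hb, heq⟩ := h.exists_bubble s e h4
  refine fun x hx => Set.mem_iUnion.mpr ⟨n, ?_⟩
  rw [heq] at hx
  rw [hb]; exact hx

lemma isBubble {P : Piece} (h : P.toCell.IsBubble) : ∃ b, P = .bub b := by
  cases P with
  | arc e s k => exact absurd h not_false
  | bub b => exact ⟨b, rfl⟩

lemma isChain_of_isInterval {P Q : Piece} (h : (linkOf P Q).IsInterval) : IsChain P Q := by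
  by_contra hc
  rw [linkOf_not_chain hc] at h
  exact h

lemma special_subset_verts (P : Piece) : P.special ⊆ P.verts := by
  cases P with
  | arc e s k => exact Set.empty_subset _
  | bub b => exact Set.pair_subset ⟨0, rfl⟩ ⟨4, rfl⟩

lemma points_arcWalk (e : DEdge) : (Link.interval (arcWalk e)).points = {e.1, e.target} := rfl

/-- The base of a bubble is an entry point, or an endpoint of the interval that it shares with the
preceding one. -/
lemma base_mem_points {P : Piece} {b : DEdge} : b.1 ∈ (linkOf P (.bub b)).points := by
  by_cases hc : IsChain P (.bub b)
  · obtain ⟨b₀, t, -, h2, h3⟩ := linkOf_chain hc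
    rw [h3, points_arcWalk]
    obtain rfl : b = chainNext b₀ t := by cases h2; rfl
    rw [fst_nbe_chainNext]
    exact Or.inl rfl
  · rw [linkOf_not_chain hc]; exact rfl

lemma opposite_mem_points {b : DEdge} {Q : Piece} (h : Linked (.bub b) Q) :
    ((nxt .R)^[4] b).1 ∈ (linkOf (.bub b) Q).points := by
  by_cases hc : IsChain (.bub b) Q
  · obtain ⟨b₀, t, h1, -, h3⟩ := linkOf_chain hc
    rw [h3, points_arcWalk]
    obtain rfl : b₀ = b := by cases h1; rfl
    rw [lastEdge_target]
    exact Or.inr rfl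
  · rw [linkOf_not_chain hc]
    exact ((h.base_left hc).2 b rfl).symm

/-- The snake is geometrical. -/
theorem isGeometricalSnake (h : IsSnake c) : IsGeometricalSnake (⋃ n, (c n).edges) := by
  refine ⟨h.toSnake, fun n => (c n).special, ?_, h.toSnake_edges⟩
  have hlink : ∀ i, h.toSnake.link (i - 1) = linkOf (c (i - 1)) (c i) := by
    intro i
    change linkOf _ (c (i - 1 + 1)) = _
    rw [sub_add_cancel]
  refine ⟨?_, ?_, ?_, ?_, ?_, ?_⟩
  · intro i hi
    obtain ⟨b, hb⟩ := isBubble hi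
    obtain ⟨g, m, hm⟩ := exists_octVertex (nbe .R b)
    have h1 : octSet .R b = octEdges g := by
      rw [octEdges_eq, ← octSet_iterate .L m, ← hm]
      exact (octSet_nbe .R b).symm
    refine ⟨g, Fin.ofNat 8 m, ?_, ?_⟩
    · change (c i).toCell.image.edgeSet = _
      rw [Piece.image_edgeSet, hb, ← h1]; rfl
    · have h2 : Fin.ofNat 8 m + 4 = Fin.ofNat 8 (m + 4) := by
        apply Fin.ext
        simp [Fin.val_add, Fin.ofNat]
      have h3 := vertex_other .R b (k := 4) (by omega)
      change ((nxt .L)^[4] (nbe .R b)).1 = _ at h3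
      rw [hb, h2, octVertex_ofNat, octVertex_ofNat, ← hm, add_comm m 4,
        Function.iterate_add_apply, ← hm, h3, nbe_fst]
      rfl
  · intro i hi
    obtain ⟨b, hb⟩ := isBubble hi
    rw [hlink, hb]
    refine Set.pair_subset (Or.inl base_mem_points) (Or.inr ?_)
    change _ ∈ (linkOf (c i) (c (i + 1))).points
    have := h.linked i
    rw [hb] at this ⊢
    exact opposite_mem_points this
  · intro i v hi hv
    obtain ⟨b, hb⟩ := isBubble hi
    rw [hlink, hb] at hv
    have := base_mem_points (P := c (i - 1)) (b := b)
    rw [hv] at this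
    obtain rfl : b.1 = v := this
    rw [hb]; exact Or.inl rfl
  · intro i v hi hv
    obtain ⟨b, hb⟩ := isBubble hi
    change linkOf (c i) (c (i + 1)) = _ at hv
    have hl := h.linked i
    rw [hb] at hv hl
    have := opposite_mem_points hl
    rw [hv] at this
    obtain rfl : _ = v := this
    rw [hb]; exact Or.inr rfl
  · intro i j hij hk
    rcases eq_or_lt_of_le (show i + 1 ≤ j by omega) with rfl | hlt
    · obtain ⟨b, t, h1, h2, -⟩ := linkOf_chain (isChain_of_isInterval (hk i le_rfl (by omega)))
      rw [Set.disjoint_left]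
      intro v hv hv'
      have hl := (h.linked i).not_zone_of_mem (special_subset_verts _ hv)
      rw [h2] at hv' hl
      rcases hv' with rfl | rfl
      · rw [h1, fst_nbe_chainNext] at hv
        -- The first special point of the next bubble is vertex 3 or 5 of the present one, whose
        -- special points are the vertices 0 and 4. The other special point of the next bubble lies
        -- in its own sector, where the present bubble has no vertex.
        obtain ⟨k, hk, hk'⟩ : ∃ k, (k = 3 ∨ k = 5) ∧ (lastEdge b t).1 = ((nxt .R)^[k] b).1 := by
          cases t
          · exact ⟨3, Or.inl rfl, rfl⟩
          · refine ⟨5, Or.inr rfl, ?_⟩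
            rw [lastEdge_right, rev_fst, Function.iterate_succ_apply' _ 4, nxt_fst]
        rcases hv with hv | hv
        · have := vertex_inj .R b (j := k) (k := 0) (by omega) (by omega) (hk'.symm.trans hv)
          omega
        · have := vertex_inj .R b (j := k) (k := 4) (by omega) (by omega) (hk'.symm.trans hv)
          omega
      · exact hl (sector_vertex _ (by omega))
    · exact (h.disjoint hlt).mono (special_subset_verts _) (special_subset_verts _)
  · intro g hg
    rw [h.toSnake_edges, octEdges_eq] at hg ⊢
    exact h.four_edges _ _ hg

end IsSnake

end Geometrical

end SurfaceSnakes

end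


/-! ### From tracks to snakes -/

noncomputable section
namespace SurfaceSnakes

/-- Subsets of the integers that are unbounded in both directions are enumerated by the integers. -/
lemma exists_enumeration {A : Set ℤ} (hne : A.Nonempty) (hup : ∀ i ∈ A, ∃ j ∈ A, i < j)
    (hdown : ∀ i ∈ A, ∃ j ∈ A, j < i) : Nonempty (ℤ ≃o A) := by
  classical
  have : Nonempty A := hne.to_subtype
  have : NoMaxOrder A := ⟨fun ⟨i, hi⟩ => by
    obtain ⟨j, hj, hij⟩ := hup i hi
    exact ⟨⟨j, hj⟩, hij⟩⟩
  have : NoMinOrder A := ⟨fun ⟨i, hi⟩ => by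
    obtain ⟨j, hj, hij⟩ := hdown i hi
    exact ⟨⟨j, hj⟩, hij⟩⟩
  have : LocallyFiniteOrder A := inferInstanceAs (LocallyFiniteOrder {x // x ∈ A})
  let : SuccOrder A := LinearLocallyFiniteOrder.succOrder A
  let : PredOrder A := LinearLocallyFiniteOrder.predOrder A
  exact ⟨(orderIsoIntOfLinearSuccPredArch (ι := A)).symm⟩

/-- The pieces of a track are those of a snake. -/
theorem IsTrack.exists_snake {pc : ℤ → Option Piece} (h : IsTrack pc) :
    ∃ c : ℤ → Piece, IsSnake c ∧ (∀ n, ∃ i, pc i = some (c n)) ∧ ⋃ n, (c n).edges = trackEdges pc := by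
  have next : ∀ i P, pc i = some P → ∃ j, i < j ∧ (∃ Q, pc j = some Q ∧ Linked P Q) ∧
      ∀ k, i < k → k < j → pc k = none := by
    intro i P hP
    cases P with
    | arc e s k =>
      obtain ⟨Q, hQ, hl⟩ := h.arc i e s k hP
      exact ⟨i + 1, by omega, ⟨Q, hQ, hl⟩, fun k h1 h2 => by omega⟩
    | bub b =>
      obtain ⟨h1, h2, ⟨t, h3⟩ | ⟨h3, Q, hQ, hl, -⟩⟩ := h.bub i b hP
      · refine ⟨i + 3, by omega, ⟨_, h3, linked_chainNext b t⟩, fun k h4 h5 => ?_⟩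
        obtain rfl | rfl : k = i + 1 ∨ k = i + 2 := by omega
        · exact h1
        · exact h2
      · refine ⟨i + 4, by omega, ⟨Q, hQ, hl⟩, fun k h4 h5 => ?_⟩
        obtain rfl | rfl | rfl : k = i + 1 ∨ k = i + 2 ∨ k = i + 3 := by omega
        · exact h1
        · exact h2
        · exact h3
  obtain ⟨σ⟩ := exists_enumeration (A := {i | pc i ≠ none})
    (by obtain ⟨j, -, hj⟩ := h.cover 0; exact ⟨j, hj⟩)
    (by
      intro i hi
      obtain ⟨P, hP⟩ := Option.ne_none_iff_exists'.mp hi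
      obtain ⟨j, hj, ⟨Q, hQ, -⟩, -⟩ := next i P hP
      exact ⟨j, by simp [hQ], hj⟩)
    (by
      intro i _
      obtain ⟨j, hj, hj'⟩ := h.cover (i - 1)
      exact ⟨j, hj', by omega⟩)
  have hσ : ∀ n, ∃ P, pc (σ n) = some P := fun n => Option.ne_none_iff_exists'.mp (σ n).2
  choose c hc using hσ
  refine ⟨c, ⟨fun n => h.valid _ _ (hc n), fun n => ?_⟩, fun n => ⟨_, hc n⟩, ?_⟩
  · obtain ⟨j, hj, ⟨Q, hQ, hl⟩, hbet⟩ := next _ _ (hc n)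
    have h1 : (σ n : ℤ) < σ (n + 1) := σ.lt_iff_lt.mpr (by omega)
    obtain ⟨m, hm⟩ := σ.surjective ⟨j, by simp [hQ]⟩
    have hm' : (σ m : ℤ) = j := by rw [hm]
    have h2 : n < m := σ.lt_iff_lt.mp (show (σ n : ℤ) < σ m by omega)
    have h3 : (σ (n + 1) : ℤ) ≤ σ m := σ.le_iff_le.mpr (by omega)
    have h4 : (σ (n + 1) : ℤ) = j := by
      by_contra hne
      have := hbet _ h1 (by omega)
      rw [hc] at this
      simp at this
    have h5 := hc (n + 1)
    rw [h4, hQ] at h5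
    cases h5
    exact hl
  · ext x
    rw [Set.mem_iUnion]
    constructor
    · rintro ⟨n, hn⟩; exact ⟨_, _, hc n, hn⟩
    · rintro ⟨i, P, hP, hx⟩
      obtain ⟨n, hn⟩ := σ.surjective ⟨i, by simp [hP]⟩
      have := hc n
      rw [hn, hP] at this
      cases this
      exact ⟨n, hx⟩

end SurfaceSnakes

end


noncomputable section
namespace SurfaceSnakes

/-! ### The track of an edge path -/

lemma Side.sgn_inj {s t : Side} (h : s.sgn = t.sgn) : s = t := by
  revert h; cases s <;> cases t <;> decide

/-- A turn `s.sgn` stays on the octagon on the side `s`; a turn `2 * s.sgn` passes to the octagon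
that shares with it the edge not taken. Bubbles are recognized by windows of such turns, and
conflicting windows are told apart by this inequality. -/
lemma Side.sgn_ne_two (s t : Side) : s.sgn ≠ 2 * t.sgn := by cases s <;> cases t <;> decide

/-- A bubble begins with the edge number `i` of a path with the turns `τ`, on the side `s`: it shares
four edges with the path, or three, if it is followed by another bubble. -/
inductive Start (τ : ℤ → ZMod 8) (s : Side) : ℤ → Prop
  | seed {i : ℤ} : τ (i + 1) = s.sgn → τ (i + 2) = s.sgn → τ (i + 3) = s.sgn → Start τ s i
  | chain {i : ℤ} : τ (i + 1) = s.sgn → τ (i + 2) = s.sgn → τ (i + 3) = 2 * s.sgn →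
      Start τ s (i + 3) → Start τ s i

/-- A bubble shares two edges with a path, and lies between two other bubbles. -/
structure Gap (τ : ℤ → ZMod 8) (s : Side) (i : ℤ) : Prop where
  a0 : τ (i - 2) = s.sgn
  a1 : τ (i - 1) = s.sgn
  a2 : τ i = s.sgn
  a3 : τ (i + 1) = 2 * s.sgn
  a4 : τ (i + 2) = s.sgn
  a5 : τ (i + 3) = 2 * s.sgn
  a6 : Start τ s (i + 3)

/-- The turns of a path without backtracking and long cycles, and without replaceable half cycles. -/
structure Tight (τ : ℤ → ZMod 8) : Prop where
  ne_zero : ∀ i, τ i ≠ 0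
  four : ∀ i s, τ (i + 1) = Side.sgn s → τ (i + 2) = s.sgn → τ (i + 3) = s.sgn →
    τ (i + 4) ≠ s.sgn
  half : ∀ i s, τ (i + 1) = Side.sgn s → τ (i + 2) = s.sgn → τ (i + 3) = s.sgn →
    τ (i + 4) = 2 * s.sgn → τ (i + 5) = s.sgn → τ (i + 6) ≠ s.sgn

section Turns

variable {τ : ℤ → ZMod 8} {s t : Side} {i : ℤ}

lemma Start.t1 (h : Start τ s i) {j : ℤ} (hj : j = i + 1 := by omega) : τ j = s.sgn := by
  subst hj; cases h <;> assumption

lemma Start.t2 (h : Start τ s i) {j : ℤ} (hj : j = i + 2 := by omega) : τ j = s.sgn := by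
  subst hj; cases h <;> assumption

lemma Start.t3 (h : Start τ s i) {j : ℤ} (hj : j = i + 3 := by omega) :
    τ j = s.sgn ∨ τ j = 2 * s.sgn ∧ Start τ s j := by
  subst hj
  cases h with
  | seed _ _ h => exact Or.inl h
  | chain _ _ h1 h2 => exact Or.inr ⟨h1, h2⟩

lemma Gap.at0 (h : Gap τ s i) {j : ℤ} (hj : i - 2 ≤ j ∧ j ≤ i ∨ j = i + 2 := by omega) :
    τ j = s.sgn := by
  obtain rfl | rfl | rfl | rfl : j = i - 2 ∨ j = i - 1 ∨ j = i ∨ j = i + 2 := by omega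
  exacts [h.a0, h.a1, h.a2, h.a4]

lemma Gap.at2 (h : Gap τ s i) {j : ℤ} (hj : j = i + 1 ∨ j = i + 3 := by omega) :
    τ j = 2 * s.sgn := by
  rcases hj with rfl | rfl
  exacts [h.a3, h.a5]

lemma Gap.start (h : Gap τ s i) {j : ℤ} (hj : j = i + 3 := by omega) : Start τ s j :=
  hj ▸ h.a6

/-- The edge number `i` continues an octagon on the side `t`. -/
def Continues (τ : ℤ → ZMod 8) (t : Side) (i : ℤ) : Prop :=
  τ i = t.sgn ∨ τ i = 2 * t.sgn ∧ τ (i - 1) = t.sgn ∧ τ (i - 2) = t.sgn ∧ τ (i - 3) = t.sgn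

lemma Continues.unique (h : Continues τ s i) (h' : Continues τ t i) : s = t := by
  rcases h with h | ⟨h, h1, -⟩ <;> rcases h' with h' | ⟨h', h1', -⟩
  · exact Side.sgn_inj (h.symm.trans h')
  · exact absurd (h.symm.trans h') (Side.sgn_ne_two _ _)
  · exact absurd (h'.symm.trans h) (Side.sgn_ne_two _ _)
  · exact Side.sgn_inj (h1.symm.trans h1')

open Classical in
/-- The number of edges, up to the edge number `i`, of the octagon on the side `t`. -/
def depthAt (τ : ℤ → ZMod 8) (t : Side) (i : ℤ) : ℕ :=
  if τ i = t.sgn ∧ Continues τ t (i - 1) then 3 else if Continues τ t i then 2 else 1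

lemma depthAt_bounds : 1 ≤ depthAt τ t i ∧ depthAt τ t i ≤ 3 := by
  rw [depthAt]; split_ifs <;> omega

lemma depthAt_of_not (h : ¬ Continues τ t i) : depthAt τ t i = 1 := by
  rw [depthAt, if_neg, if_neg h]
  exact fun h1 => h (Or.inl h1.1)

lemma depthAt_eq_three (h : ¬ depthAt τ t i ≤ 2) : τ i = t.sgn ∧ Continues τ t (i - 1) := by
  by_contra h1
  rw [depthAt, if_neg h1] at h
  split_ifs at h <;> omega

open Classical in
/-- The side on which the edge number `i` continues an octagon. -/
def sideAt (τ : ℤ → ZMod 8) (i : ℤ) : Side := if Continues τ .R i then .R else .L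

lemma sideAt_eq (h : Continues τ t i) : sideAt τ i = t := by
  rw [sideAt]
  split_ifs with h1
  · exact h1.unique h
  · cases t
    · rfl
    · exact absurd h h1

/-- An edge continues an octagon on at most one side, so a single side and a single number record
the depths on both sides. -/
lemma depth_sideAt : depth (sideAt τ i) (depthAt τ (sideAt τ i) i) t = depthAt τ t i := by
  rw [depth]
  split_ifs with h
  · rw [h]
  · rw [depthAt_of_not]
    intro h1
    exact h (sideAt_eq h1).symm

/-- The side `s` of `d` becomes the right side. -/
def rform : Side → DEdge → DEdge
  | .L, d => nbe .L d
  | .R, d => d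

lemma chainNext_eq (b : DEdge) (t : Side) : chainNext b t = rform t (lastEdge b t) := by
  cases t <;> rfl

lemma rform_nbe (s : Side) (d : DEdge) : rform s.opp (nbe s d) = rform s d := by
  cases s
  · rfl
  · exact nbe_opp_nbe .R d

lemma rform_cases (s : Side) (d : DEdge) :
    rform s d = d ∧ nbe .R (rform s d) = nbe s d ∨
      rform s d = nbe s d ∧ nbe .R (rform s d) = d := by
  cases s
  · exact Or.inr ⟨rfl, nbe_opp_nbe .L d⟩
  · exact Or.inl ⟨rfl, rfl⟩

lemma rform_fst (s : Side) (d : DEdge) : (rform s d).1 = d.1 := by cases s <;> rfl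

lemma firstEdge_rform (s : Side) (d : DEdge) : firstEdge (rform s d) s.opp = d := by
  cases s
  · exact nbe_opp_nbe .L d
  · rfl

lemma lastEdge_rform (s : Side) (d : DEdge) :
    lastEdge (rform s d) s.opp = (nxt s)^[3] d := by
  rw [lastEdge_eq, firstEdge_rform, Side.opp_opp]

lemma rev_lastEdge (b : DEdge) (s : Side) :
    rev (lastEdge b s) = rotd s.sgn (rev (lastEdge b s.opp)) := by
  have h1 : rev (lastEdge b .L) = nbe .R (rev (lastEdge b .R)) := by
    rw [rev_lastEdge_left, rev_lastEdge_right]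
  cases s
  · exact h1
  · change _ = rotd _ (rev (lastEdge b .L))
    rw [h1, nbe, rotd_rotd]
    simp

/-- A bubble with the first edge `b`, whose octagon is on the right of `b`, begins at the edge number `i`
of the path `e`. -/
inductive BubbleAt (e : ℤ → DEdge) (τ : ℤ → ZMod 8) : ℤ → DEdge → Prop
  | start {s : Side} {i : ℤ} : Start τ s i → BubbleAt e τ i (rform s (e i))
  | gap {s : Side} {i : ℤ} : Gap τ s i → BubbleAt e τ i (rform s (rev (rotd s.sgn (rev (e i)))))

variable {e : ℤ → DEdge} {b b' : DEdge}

lemma BubbleAt.unique (h : BubbleAt e τ i b) (h' : BubbleAt e τ i b') : b = b' := by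
  cases h with
  | @start s _ h =>
    cases h' with
    | @start s' _ h' =>
      have := Side.sgn_inj ((h.t1 (j := i + 1)).symm.trans h'.t1)
      rw [this]
    | gap h' => exact absurd ((h.t1 (j := i + 1)).symm.trans h'.at2) (Side.sgn_ne_two _ _)
  | gap h =>
    cases h' with
    | start h' => exact absurd ((h'.t1 (j := i + 1)).symm.trans h.at2) (Side.sgn_ne_two _ _)
    | gap h' =>
      have := Side.sgn_inj ((h.at0 (j := i)).symm.trans h'.at0)
      rw [this]

/-- Bubbles that begin at successive edges would produce four equal sharp turns or a replaceable
half cycle; the other combinations require a turn to be both sharp and twice as wide. -/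
lemma BubbleAt.not_succ (hτ : Tight τ) (h : BubbleAt e τ i b) : ¬ BubbleAt e τ (i + 1) b' := by
  intro h'
  cases h with
  | start h =>
    cases h' with
    | start h' =>
      obtain rfl := Side.sgn_inj ((h.t2 (j := i + 2)).symm.trans h'.t1)
      have h3 : τ (i + 3) = _ := h'.t2
      rcases h'.t3 (j := i + 4) with h4 | ⟨h4, h5⟩
      · exact hτ.four i _ h.t1 h.t2 h3 h4
      · exact hτ.half i _ h.t1 h.t2 h3 h4 h5.t1 h5.t2
    | gap h' => exact absurd ((h.t2 (j := i + 2)).symm.trans h'.at2) (Side.sgn_ne_two _ _)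
  | gap h =>
    cases h' with
    | start h' => exact absurd ((h'.t2 (j := i + 3)).symm.trans h.at2) (Side.sgn_ne_two _ _)
    | gap h' => exact absurd ((h'.at0 (j := i + 1)).symm.trans h.at2) (Side.sgn_ne_two _ _)

lemma BubbleAt.not_succ_succ (hτ : Tight τ) (h : BubbleAt e τ i b) :
    ¬ BubbleAt e τ (i + 2) b' := by
  intro h'
  cases h with
  | start h =>
    cases h' with
    | start h' =>
      rcases h.t3 (j := i + 3) with h3 | ⟨h3, -⟩
      · obtain rfl := Side.sgn_inj (h3.symm.trans h'.t1)
        exact hτ.four i _ h.t1 h.t2 h3 h'.t2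
      · exact absurd ((h'.t1 (j := i + 3)).symm.trans h3) (Side.sgn_ne_two _ _)
    | gap h' =>
      rcases h.t3 (j := i + 3) with h3 | ⟨-, h3⟩
      · exact absurd (h3.symm.trans h'.at2) (Side.sgn_ne_two _ _)
      · exact absurd ((h3.t2 (j := i + 5)).symm.trans h'.at2) (Side.sgn_ne_two _ _)
  | gap h =>
    cases h' with
    | start h' => exact absurd ((h'.t1 (j := i + 3)).symm.trans h.at2) (Side.sgn_ne_two _ _)
    | gap h' => exact absurd ((h'.at0 (j := i + 1)).symm.trans h.at2) (Side.sgn_ne_two _ _)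

lemma rotd_ne_self {k : ZMod 8} (d : DEdge) (hk : k ≠ 0) : rotd k d ≠ d := by
  intro h
  rw [← rotd_zero d, rotd_rotd, rotd_inj, zero_add] at h
  exact hk h

end Turns

/-- A path with the edges `e` and the turns `τ`. -/
structure IsPath (e : ℤ → DEdge) (τ : ℤ → ZMod 8) : Prop where
  succ : ∀ i, e (i + 1) = rotd (τ (i + 1)) (rev (e i))
  tight : Tight τ

/-! ### The track of a path without replaceable half cycles -/

namespace IsPath

attribute [local irreducible] nxt rev rotd

variable {e : ℤ → DEdge} {τ : ℤ → ZMod 8} {i : ℤ} {b b' : DEdge}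

lemma dart (h : IsPath e τ) {i j : ℤ} (hj : j = i + 1 := by omega) :
    e j = rotd (τ j) (rev (e i)) := by
  subst hj; exact h.succ i

lemma nxt_of_turn (h : IsPath e τ) {i j : ℤ} {s : Side} (hs : τ j = s.sgn)
    (hj : j = i + 1 := by omega) : e j = nxt s (e i) := by
  rw [h.dart hj, hs, nxt_eq]

lemma nbe_of_turn (h : IsPath e τ) {i j : ℤ} {s : Side} (hs : τ j = 2 * s.sgn)
    (hj : j = i + 1 := by omega) : nbe s (e j) = nxt s (e i) := by
  rw [h.dart hj, hs, nbe, rotd_rotd, nxt_eq]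
  congr 1
  ring

/-- If two bubbles begin at a distance of three edges, they are neighbours in a bubble chain. -/
lemma chain (h : IsPath e τ) (hb : BubbleAt e τ i b) (hb' : BubbleAt e τ (i + 3) b') :
    ∃ t, b' = chainNext b t := by
  have key : ∀ s d, e (i + 1) = nxt s d → τ (i + 2) = s.sgn → τ (i + 3) = 2 * s.sgn →
      rform s (e (i + 3)) = chainNext (rform s d) s.opp := by
    intro s d h1 h2 h3
    rw [chainNext_eq, lastEdge_rform, Function.iterate_succ_apply' _ 2,
      Function.iterate_succ_apply' _ 1, Function.iterate_one, ← h1, ← h.nxt_of_turn h2,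
      ← h.nbe_of_turn h3, rform_nbe]
  cases hb with
  | @start s _ hs =>
    cases hb' with
    | @start s' _ hs' =>
      rcases hs.t3 (j := i + 3) with h3 | ⟨h3, h4⟩
      · have hne : s' ≠ s := by
          rintro rfl
          exact h.tight.four i _ hs.t1 hs.t2 h3 hs'.t1
        obtain rfl : s' = s.opp := (Side.eq_or_eq_opp s s').resolve_left hne
        -- The octagon on the side `s` has used up its four edges, so the bubble that also begins at
        -- the fourth edge lies on the other side of it.
        refine ⟨s.opp, ?_⟩
        rw [chainNext_eq, lastEdge_rform, Function.iterate_succ_apply' _ 2,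
          Function.iterate_succ_apply' _ 1, Function.iterate_one, ← h.nxt_of_turn (hs.t1 (j := i + 1)),
          ← h.nxt_of_turn (i := i + 1) (hs.t2 (j := i + 2)), ← h.nxt_of_turn (i := i + 2) h3]
      · obtain rfl := Side.sgn_inj ((h4.t1 (j := i + 4)).symm.trans hs'.t1)
        exact ⟨_, key s _ (h.nxt_of_turn hs.t1) hs.t2 h3⟩
    | @gap s' _ hs' =>
      obtain rfl := Side.sgn_inj ((hs.t1 (j := i + 1)).symm.trans hs'.at0)
      refine ⟨s, ?_⟩
      have h1 : (nxt s)^[3] (e i) = e (i + 3) := by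
        rw [Function.iterate_succ_apply' _ 2,
          Function.iterate_succ_apply' _ 1, Function.iterate_one, ← h.nxt_of_turn (hs.t1 (j := i + 1)),
          ← h.nxt_of_turn (i := i + 1) (hs.t2 (j := i + 2)),
          ← h.nxt_of_turn (i := i + 2) (hs'.at0 (j := i + 3))]
      rw [chainNext_eq, ← rev_rev (lastEdge _ s), rev_lastEdge, lastEdge_rform, h1]
  | @gap s _ hs =>
    cases hb' with
    | @start s' _ hs' =>
      obtain rfl := Side.sgn_inj (((hs.start (j := i + 3)).t1 (j := i + 4)).symm.trans hs'.t1)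
      refine ⟨_, key s _ ?_ hs.at0 hs.at2⟩
      rw [nxt_eq, rev_rev, rotd_rotd, h.dart (i := i) (j := i + 1), hs.at2]
      congr 1
      ring
    | gap hs' =>
      exact absurd ((hs'.at0 (j := i + 1)).symm.trans hs.at2) (Side.sgn_ne_two _ _)

/-- Bubbles of the other two kinds, with three or two edges on the path, are by definition followed
by a bubble three places later. -/
lemma seed_of_not (hb : BubbleAt e τ i b) (hn : ∀ b', ¬ BubbleAt e τ (i + 3) b') :
    ∃ s, τ (i + 1) = Side.sgn s ∧ τ (i + 2) = s.sgn ∧ τ (i + 3) = s.sgn ∧ b = rform s (e i) := by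
  cases hb with
  | @start s _ hs =>
    rcases hs.t3 (j := i + 3) with h3 | ⟨-, h3⟩
    · exact ⟨s, hs.t1, hs.t2, h3, rfl⟩
    · exact absurd (.start h3) (hn _)
  | gap hs => exact absurd (.start hs.start) (hn _)

/-- The edge number `i` belongs to a bubble. -/
def Covered (e : ℤ → DEdge) (τ : ℤ → ZMod 8) (i : ℤ) : Prop :=
  ∃ j, i - 3 ≤ j ∧ j ≤ i ∧ ∃ b, BubbleAt e τ j b

/-- The arc that consists of the edge number `i`. -/
def arcAt (e : ℤ → DEdge) (τ : ℤ → ZMod 8) (i : ℤ) : Piece :=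
  .arc (e i) (sideAt τ i) (depthAt τ (sideAt τ i) i)

open Classical in
/-- The track of a path. -/
def track (e : ℤ → DEdge) (τ : ℤ → ZMod 8) (i : ℤ) : Option Piece :=
  if h : ∃ b, BubbleAt e τ i b then some (.bub h.choose)
  else if Covered e τ i then none else some (arcAt e τ i)

lemma track_bub (hb : BubbleAt e τ i b) : track e τ i = some (.bub b) := by
  have h : ∃ b, BubbleAt e τ i b := ⟨b, hb⟩
  rw [track, dif_pos h, h.choose_spec.unique hb]

lemma track_arc (hc : ¬ Covered e τ i) : track e τ i = some (arcAt e τ i) := by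
  rw [track, dif_neg, if_neg hc]
  rintro h
  exact hc ⟨i, by omega, le_rfl, h⟩

lemma track_none (hb : ∀ b, ¬ BubbleAt e τ i b) (hc : Covered e τ i) : track e τ i = none := by
  rw [track, dif_neg (by simpa using hb), if_pos hc]

lemma of_track_bub (ht : track e τ i = some (.bub b)) : BubbleAt e τ i b := by
  rw [track] at ht
  split_ifs at ht with h1 h2
  · obtain rfl : h1.choose = b := by simpa using ht
    exact h1.choose_spec
  · cases ht

lemma of_track_arc {d : DEdge} {s : Side} {k : ℕ} (ht : track e τ i = some (.arc d s k)) :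
    Piece.arc d s k = arcAt e τ i ∧ ¬ Covered e τ i := by
  rw [track] at ht
  split_ifs at ht with h1 h2
  · simp at ht
  · exact ⟨by simpa using ht.symm, h2⟩

/-- On an octagon that is not completed, there are at most two edges before a further one. -/
lemma depthAt_le_two (h : IsPath e τ) {t : Side} (hc : ¬ Covered e τ i)
    (ht : τ (i + 1) = t.sgn) : depthAt τ t i ≤ 2 := by
  by_contra h3
  obtain ⟨h0, h1 | ⟨h1, h2, h4, h5⟩⟩ := depthAt_eq_three h3
  · refine hc ⟨i - 2, by omega, by omega, _, .start (.seed ?_ ?_ ?_ : Start τ t (i - 2))⟩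
    · rwa [show i - 2 + 1 = i - 1 by ring]
    · rwa [sub_add_cancel]
    · rwa [show i - 2 + 3 = i + 1 by ring]
  -- Here the octagon was entered from a half cycle by a turn `2 * t.sgn`; with two more sharp turns
  -- that half cycle could have been replaced.
  · refine h.tight.half (i - 5) t ?_ ?_ ?_ ?_ ?_ ?_
    · rwa [show i - 5 + 1 = i - 1 - 3 by ring]
    · rwa [show i - 5 + 2 = i - 1 - 2 by ring]
    · rwa [show i - 5 + 3 = i - 1 - 1 by ring]
    · rwa [show i - 5 + 4 = i - 1 by ring]
    · rwa [sub_add_cancel]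
    · rwa [show i - 5 + 6 = i + 1 by ring]

lemma linked_arc_arc (h : IsPath e τ) (hc : ¬ Covered e τ i) :
    Linked (arcAt e τ i) (arcAt e τ (i + 1)) := by
  by_cases ht : ∃ t, τ (i + 1) = Side.sgn t
  · obtain ⟨t, ht⟩ := ht
    have h2 := h.depthAt_le_two hc ht
    have h3 := Linked.arc_arc_sharp (e := e i) (s := sideAt τ i) (k := depthAt τ (sideAt τ i) i) t
      (by rwa [depth_sideAt])
    rw [depth_sideAt, ← h.nxt_of_turn ht] at h3
    have h4 : depthAt τ t i + 1 = depthAt τ t (i + 1) := by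
      rw [depthAt] at h2 ⊢
      rw [depthAt, add_sub_cancel_right]
      have h5 : Continues τ t (i + 1) := Or.inl ht
      split_ifs at h2 ⊢ <;> first | omega | tauto
    rw [arcAt, arcAt, sideAt_eq (t := t) (Or.inl ht), ← h4]
    exact h3
  · push Not at ht
    have hn : ∀ t, ¬ Continues τ t (i + 1) := by
      rintro t (h1 | ⟨-, h2, h3, h4⟩)
      · exact ht t h1
      · refine hc ⟨i - 3, by omega, by omega, _, .start (.seed ?_ ?_ ?_ : Start τ t (i - 3))⟩
        · rwa [show i - 3 + 1 = i + 1 - 3 by ring]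
        · rwa [show i - 3 + 2 = i + 1 - 2 by ring]
        · rwa [show i - 3 + 3 = i + 1 - 1 by ring]
    rw [arcAt, arcAt, depthAt_of_not (hn _), h.dart (i := i) (j := i + 1)]
    refine .arc_arc ?_ ?_ fun t => ?_
    · rw [rotd_fst, rev_fst]
    · exact rotd_ne_self _ (h.tight.ne_zero _)
    · rw [nxt_eq, ne_eq, rotd_inj]; exact ht t

/-- If the arc were the third edge of an octagon that has its next edge in common with the bubble,
that octagon would have four consecutive edges in the completed set. The constructors `Start.chain`
and `Gap` are made to count it as a bubble, so that the arc would be covered. -/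
lemma linked_arc_bub (h : IsPath e τ) (hc : ¬ Covered e τ i) (hb : BubbleAt e τ (i + 1) b) :
    Linked (arcAt e τ i) (.bub b) := by
  cases hb with
  | @start s _ hs =>
    have h0 := h.tight.ne_zero (i + 1)
    have hs0 : τ (i + 1) ≠ s.sgn := by
      intro h1
      exact hc ⟨i, by omega, le_rfl, _, .start (.seed h1 hs.t1 hs.t2)⟩
    have hd := h.dart (i := i) (j := i + 1)
    have hset : ∀ d, d = rform s (e (i + 1)) ∨ d = nbe .R (rform s (e (i + 1))) →
        d = rotd (τ (i + 1)) (rev (e i)) ∨ d = rotd (τ (i + 1) + -s.sgn) (rev (e i)) := by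
      rw [← rotd_rotd, ← hd]
      intro d h1
      rcases rform_cases s (e (i + 1)) with ⟨h2, h3⟩ | ⟨h2, h3⟩ <;> rw [h3, h2, nbe] at h1 <;> tauto
    have hrev : ∀ d, d = rform s (e (i + 1)) ∨ d = nbe .R (rform s (e (i + 1))) → rev (e i) ≠ d := by
      intro d h1 h2
      rcases hset d h1 with h3 | h3
      · exact rotd_ne_self _ h0 (h3.symm.trans h2.symm)
      · exact rotd_ne_self _ (by rwa [← sub_eq_add_neg, sub_ne_zero]) (h3.symm.trans h2.symm)
    refine .arc_bub ?_ (hrev _ (Or.inl rfl)) (hrev _ (Or.inr rfl)) fun t ht => ?_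
    · rw [rform_fst, hd, rotd_fst, rev_fst]
    · rw [depth_sideAt]
      have h1 := hset (nxt t (e i)) ht
      rw [nxt_eq, rotd_inj, rotd_inj] at h1
      rcases h1 with h1 | h1
      · exact h.depthAt_le_two hc h1.symm
      · by_contra h3
        obtain ⟨h4, h5⟩ := depthAt_eq_three h3
        have h6 : τ (i + 1) = t.sgn + s.sgn := by rw [h1]; ring
        have hts : t = s := by
          by_contra hne
          have : s = t.opp := (Side.eq_or_eq_opp t s).resolve_left fun h => hne h.symm
          apply h0
          rw [h6, this, Side.sgn_opp, add_neg_cancel]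
        subst hts
        rw [← two_mul] at h6
        have key : ∀ j, j + 3 = i + 1 → τ (j + 1) = t.sgn → Start τ t j := by
          intro j hj h7
          obtain rfl : i = j + 2 := by omega
          refine .chain h7 h4 ?_ ?_
          · rwa [show j + 3 = j + 2 + 1 by ring]
          · rwa [show j + 3 = j + 2 + 1 by ring]
        rcases h5 with h7 | ⟨h7, h8, h9, h10⟩
        · refine hc ⟨i - 2, by omega, by omega, _, .start (key (i - 2) (by ring) ?_)⟩
          rwa [show i - 2 + 1 = i - 1 by ring]
        · refine hc ⟨i - 2, by omega, by omega, _, .gap (s := t) ⟨?_, ?_, ?_, ?_, ?_, ?_, ?_⟩⟩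
          · rwa [show i - 2 - 2 = i - 1 - 3 by ring]
          · rwa [show i - 2 - 1 = i - 1 - 2 by ring]
          · rwa [show i - 2 = i - 1 - 1 by ring]
          · rwa [show i - 2 + 1 = i - 1 by ring]
          · rwa [sub_add_cancel]
          · rwa [show i - 2 + 3 = i + 1 by ring]
          · rwa [show i - 2 + 3 = i + 1 by ring]
  | @gap s _ hs =>
    refine absurd ⟨i - 2, by omega, by omega, _, .start (.seed ?_ ?_ ?_ : Start τ s (i - 2))⟩ hc
    · exact hs.at0
    · exact hs.at0
    · exact hs.at0

/-- The bubble shares four edges with the path, of which `e (i + 3)` is its last edge on the side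
`s.opp`. The next turn is neither 0 nor `s.sgn`. The turns `-s.sgn` and `2 * s.sgn` are sharp with
respect to one of the two last edges; all others leave the bubble at a wider angle. -/
lemma linked_bub (h : IsPath e τ) (hb : BubbleAt e τ i b)
    (hn : ∀ b', ¬ BubbleAt e τ (i + 3) b') (hc : Covered e τ (i + 4) → ∃ b, BubbleAt e τ (i + 4) b) :
    ∃ Q, track e τ (i + 4) = some Q ∧ Linked (.bub b) Q ∧ ¬ IsChain (.bub b) Q := by
  obtain ⟨s, h1, h2, h3, rfl⟩ := seed_of_not hb hn
  have hlast : lastEdge (rform s (e i)) s.opp = e (i + 3) := by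
    rw [lastEdge_rform, Function.iterate_succ_apply' _ 2,
      Function.iterate_succ_apply' _ 1, Function.iterate_one, ← h.nxt_of_turn h1,
      ← h.nxt_of_turn (i := i + 1) h2, ← h.nxt_of_turn (i := i + 2) h3]
  have hrev := rev_lastEdge (rform s (e i)) s
  rw [hlast] at hrev
  have h0 := h.tight.ne_zero (i + 4)
  have h4 := h.tight.four i s h1 h2 h3
  have hd := h.dart (i := i + 3) (j := i + 4)
  have hbase : (e (i + 4)).1 = (lastEdge (rform s (e i)) .L).target := by
    rw [lastEdge_target, ← lastEdge_target _ s.opp, hlast, hd, rotd_fst, rev_fst]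
  generalize rform s (e i) = b at *
  have hne : ∀ k t, k ≠ 0 → k ≠ s.sgn → rotd k (rev (e (i + 3))) ≠ rev (lastEdge b t) := by
    intro k t hk hks
    rcases Side.eq_or_eq_opp s t with rfl | rfl
    · rw [hrev, ne_eq, rotd_inj]; exact hks
    · rw [hlast]; exact rotd_ne_self _ hk
  by_cases hcov : Covered e τ (i + 4)
  · obtain ⟨b', hb'⟩ := hc hcov
    refine ⟨_, track_bub hb', ?_⟩
    cases hb' with
    | @start s' _ hs =>
      have h7 : τ (i + 4) ≠ s'.sgn := by
        intro h5
        have h6 : s' = s.opp := (Side.eq_or_eq_opp s s').resolve_left (by rintro rfl; exact h4 h5)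
        subst h6
        refine hn _ (.start (.seed ?_ ?_ ?_ : Start τ s.opp (i + 3)))
        · rwa [show i + 3 + 1 = i + 4 by ring]
        · exact hs.t1
        · exact hs.t2
      -- This turn would make the next bubble share a last edge with the present one. On equal sides
      -- it gives a replaceable half cycle, on opposite sides a backtracking.
      have h8 : τ (i + 4) ≠ s'.sgn + s.sgn := by
        intro h5
        rcases Side.eq_or_eq_opp s s' with rfl | rfl
        · rw [← two_mul] at h5
          exact h.tight.half i s' h1 h2 h3 h5 hs.t1 hs.t2
        · rw [Side.sgn_opp, neg_add_cancel] at h5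
          exact h0 h5
      have hset : ∀ d t, d = rform s' (e (i + 4)) ∨ d = nbe .R (rform s' (e (i + 4))) →
          rev (lastEdge b t) ≠ d := by
        intro d t h9
        have h10 : d = rotd (τ (i + 4)) (rev (e (i + 3))) ∨
            d = rotd (τ (i + 4) + -s'.sgn) (rev (e (i + 3))) := by
          rw [← rotd_rotd, ← hd]
          rcases rform_cases s' (e (i + 4)) with ⟨h2, h3⟩ | ⟨h2, h3⟩ <;>
            rw [h3, h2, nbe] at h9 <;> tauto
        rcases h10 with rfl | rfl
        · exact (hne _ t h0 h4).symm
        · refine (hne _ t ?_ ?_).symm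
          · rwa [← sub_eq_add_neg, sub_ne_zero]
          · rw [← sub_eq_add_neg, ne_eq, sub_eq_iff_eq_add, add_comm s.sgn]; exact h8
      refine ⟨.bub_bub ?_ (fun t => hset _ t (Or.inl rfl)) (fun t => hset _ t (Or.inr rfl)), ?_⟩
      · rw [rform_fst, hbase]
      · rintro ⟨b₀, t, hb0, hb1⟩
        cases hb0
        have h9 : rform s' (e (i + 4)) = chainNext b t := Piece.bub.inj hb1
        have h10 := congrArg Prod.fst h9
        rw [rform_fst, hbase, fst_nbe_chainNext, lastEdge_target, ← lastEdge_target b t] at h10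
        exact fst_ne_target _ h10.symm
    | @gap s' _ hs =>
      obtain rfl := Side.sgn_inj (h3.symm.trans hs.at0)
      exact absurd hs.at0 h4
  · refine ⟨_, track_arc hcov, ?_, by rintro ⟨b₀, t, -, hb1⟩; cases hb1⟩
    have hsharp : ∀ t, τ (i + 4) = s.opp.sgn ∧ t = s.opp ∨ τ (i + 4) = 2 * s.sgn ∧ t = s →
        Linked (.bub b) (arcAt e τ (i + 4)) := by
      intro t ht
      have hcont : Continues τ t (i + 4) := by
        rcases ht with ⟨h5, rfl⟩ | ⟨h5, rfl⟩
        · exact Or.inl h5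
        · refine Or.inr ⟨h5, ?_, ?_, ?_⟩
          · rwa [show i + 4 - 1 = i + 3 by ring]
          · rwa [show i + 4 - 2 = i + 2 by ring]
          · rwa [show i + 4 - 3 = i + 1 by ring]
      have hdep : depthAt τ t (i + 4) = 2 := by
        rw [depthAt, if_neg, if_pos hcont]
        rintro ⟨h5, h6⟩
        rw [show i + 4 - 1 = i + 3 by ring] at h6
        rcases ht with ⟨h7, rfl⟩ | ⟨h7, rfl⟩
        · have := h6.unique (Or.inl h3)
          exact Side.opp_ne _ this
        · exact Side.sgn_ne_two _ _ (h5.symm.trans h7)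
      rw [arcAt, sideAt_eq hcont, hdep]
      have h8 : e (i + 4) = nxt t (lastEdge b t) := by
        rw [nxt_eq]
        rcases ht with ⟨h5, rfl⟩ | ⟨h5, rfl⟩
        · rw [hlast, hd, h5]
        · rw [hrev, rotd_rotd, hd, h5, two_mul]
      rw [h8]
      exact .bub_arc_sharp t
    by_cases h5 : τ (i + 4) = s.opp.sgn
    · exact hsharp _ (Or.inl ⟨h5, rfl⟩)
    by_cases h6 : τ (i + 4) = 2 * s.sgn
    · exact hsharp _ (Or.inr ⟨h6, rfl⟩)
    have hnot : ∀ t, ¬ Continues τ t (i + 4) := by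
      rintro t (h7 | ⟨h7, h8, -⟩)
      · rcases Side.eq_or_eq_opp s t with rfl | rfl
        · exact h4 h7
        · exact h5 h7
      · rw [show i + 4 - 1 = i + 3 by ring] at h8
        obtain rfl := Side.sgn_inj (h3.symm.trans h8)
        exact h6 h7
    rw [arcAt, depthAt_of_not (hnot _)]
    refine .bub_arc hbase (fun t => ?_) fun t t' => ?_
    · rw [hd]; exact hne _ t h0 h4
    · rw [hd, nxt_eq]
      rcases Side.eq_or_eq_opp s t with rfl | rfl
      · rw [hrev, rotd_rotd, ne_eq, rotd_inj]
        rcases Side.eq_or_eq_opp t t' with rfl | rfl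
        · rw [← two_mul]; exact h6
        · rw [Side.sgn_opp, add_neg_cancel]; exact h0
      · rw [hlast, ne_eq, rotd_inj]
        rcases Side.eq_or_eq_opp s t' with rfl | rfl
        · exact h4
        · exact h5

theorem isTrack (h : IsPath e τ) : IsTrack (track e τ) := by
  refine ⟨?_, ?_, ?_, ?_⟩
  · intro i P hP
    cases P with
    | arc d s k =>
      obtain ⟨h1, -⟩ := of_track_arc hP
      cases h1
      exact depthAt_bounds
    | bub b => trivial
  · intro i d s k hP
    obtain ⟨h1, hc⟩ := of_track_arc hP
    rw [h1]
    by_cases hb : ∃ b, BubbleAt e τ (i + 1) b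
    · obtain ⟨b, hb⟩ := hb
      exact ⟨_, track_bub hb, h.linked_arc_bub hc hb⟩
    · have hc' : ¬ Covered e τ (i + 1) := by
        rintro ⟨j, h1, h2, h3⟩
        obtain rfl | h4 : j = i + 1 ∨ j ≤ i := by omega
        · exact hb h3
        · exact hc ⟨j, by omega, h4, h3⟩
      exact ⟨_, track_arc hc', h.linked_arc_arc hc⟩
  · intro i b hP
    have hb := of_track_bub hP
    have n1 : ∀ b', ¬ BubbleAt e τ (i + 1) b' := fun b' => hb.not_succ h.tight
    have n2 : ∀ b', ¬ BubbleAt e τ (i + 2) b' := fun b' => hb.not_succ_succ h.tight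
    refine ⟨track_none n1 ⟨i, by omega, by omega, b, hb⟩,
      track_none n2 ⟨i, by omega, by omega, b, hb⟩, ?_⟩
    by_cases h3 : ∃ b', BubbleAt e τ (i + 3) b'
    · obtain ⟨b', h3⟩ := h3
      obtain ⟨t, rfl⟩ := h.chain hb h3
      exact Or.inl ⟨t, track_bub h3⟩
    · push Not at h3
      refine Or.inr ⟨track_none h3 ⟨i, by omega, by omega, b, hb⟩, h.linked_bub hb h3 ?_⟩
      rintro ⟨j, h4, h5, b', h6⟩
      obtain rfl | rfl | rfl | rfl : j = i + 1 ∨ j = i + 2 ∨ j = i + 3 ∨ j = i + 4 := by omega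
      · exact absurd h6 (n1 _)
      · exact absurd h6 (n2 _)
      · exact absurd h6 (h3 _)
      · exact ⟨_, h6⟩
  · intro i
    by_cases hc : Covered e τ i
    · obtain ⟨j, -, hj, b, hb⟩ := hc
      exact ⟨j, hj, by rw [track_bub hb]; simp⟩
    · exact ⟨i, le_rfl, by rw [track_arc hc]; simp⟩

end IsPath

end SurfaceSnakes

end


noncomputable section
namespace SurfaceSnakes

/-! ### The completion of an edge path -/

/-- The deck transformation `t`, applied to a directed edge. -/
def shift (t : G) (e : DEdge) : DEdge := (t * e.1, e.2)

lemma nxt_shift (t : G) (s : Side) (e : DEdge) : nxt s (shift t e) = shift t (nxt s e) :=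
  Prod.ext (mul_assoc _ _ _) rfl

lemma nxt_iterate_shift (t : G) (s : Side) (e : DEdge) (k : ℕ) :
    (nxt s)^[k] (shift t e) = shift t ((nxt s)^[k] e) := by
  induction k with
  | zero => rfl
  | succ k ih => rw [Function.iterate_succ_apply', ih, nxt_shift, Function.iterate_succ_apply']

/-- The deck transformation `t`, applied to an edge. -/
def trans (t : G) (x : Sym2 G) : Sym2 G := x.map (t * ·)

lemma trans_edge (t : G) (e : DEdge) : trans t e.edge = (shift t e).edge := by
  change s(t * e.1, t * e.target) = s(t * e.1, _)
  rw [DEdge.target, ← mul_assoc]; rfl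

lemma trans_trans (t u : G) (x : Sym2 G) : trans t (trans u x) = trans (t * u) x := by
  rw [trans, trans, trans, Sym2.map_map]
  congr 1
  funext v
  exact (mul_assoc _ _ _).symm

lemma trans_one (x : Sym2 G) : trans 1 x = x := by
  rw [trans]
  simp only [one_mul, Sym2.map_id', id]

lemma mem_octSet_shift {t : G} {s : Side} {e : DEdge} {x : Sym2 G} (h : x ∈ octSet s e) :
    trans t x ∈ octSet s (shift t e) := by
  obtain ⟨k, rfl⟩ := h
  refine ⟨k, ?_⟩
  rw [trans_edge, ← nxt_iterate_shift]

lemma mem_octEdges_mul {t g : G} {x : Sym2 G} (h : x ∈ octEdges g) :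
    trans t x ∈ octEdges (t * g) := by
  rw [octEdges_eq] at h ⊢
  exact mem_octSet_shift h

lemma trans_octEdge (t g : G) (k : Fin 8) : trans t (octEdge g k) = octEdge (t * g) k := by
  change s(t * (g * _), t * (g * _)) = s(t * g * _, t * g * _)
  rw [mul_assoc, mul_assoc]

lemma iterate_edge_inj (s : Side) (e : DEdge) {j k : ℕ} (hj : j < 8) (hk : k < 8)
    (h : ((nxt s)^[j] e).edge = ((nxt s)^[k] e).edge) : j = k := by
  rcases edge_inj h with h1 | h1
  · exact vertex_inj s e hj hk (congrArg Prod.fst h1)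
  · have h2 := congrArg Prod.fst h1
    have h3 := congrArg DEdge.target h1
    rw [rev_fst, ← nxt_fst s, ← Function.iterate_succ_apply' (nxt s), ← nxt_iterate_mod s (k + 1)] at h2
    rw [rev_target, ← nxt_fst s, ← Function.iterate_succ_apply' (nxt s), ← nxt_iterate_mod s (j + 1)] at h3
    have h4 := vertex_inj s e hj (Nat.mod_lt _ (by norm_num)) h2
    have h5 := vertex_inj s e (Nat.mod_lt _ (by norm_num)) hk h3
    omega

lemma four_le_ncard {s : Side} {d : DEdge} {S : Set (Sym2 G)}
    (h : ∀ k < 4, ((nxt s)^[k] d).edge ∈ S) : 4 ≤ (octSet s d ∩ S).ncard := by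
  have h1 := Set.ncard_le_ncard (s := (fun k => ((nxt s)^[k] d).edge) '' (Finset.range 4))
    (t := octSet s d ∩ S) (by
      rintro _ ⟨k, hk, rfl⟩
      exact ⟨⟨k, rfl⟩, h k (by simpa using hk)⟩) ((finite_octSet s d).inter_of_left _)
  rwa [Set.InjOn.ncard_image, Set.ncard_coe_finset, Finset.card_range] at h1
  intro j hj k hk hjk
  simp only [Finset.coe_range, Set.mem_Iio] at hj hk
  exact iterate_edge_inj s d (by omega) (by omega) hjk

lemma octSet_rform (s : Side) (d : DEdge) : octSet .R (rform s d) = octSet s d := by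
  cases s
  · exact octSet_nbe .L d
  · rfl

lemma edge_mem_octSet (s : Side) (e : DEdge) (k : ℕ := 0) : ((nxt s)^[k] e).edge ∈ octSet s e :=
  ⟨k, rfl⟩

lemma edge_nbe_mem_octSet (s : Side) (e : DEdge) : (nbe s e).edge ∈ octSet s e :=
  octSet_nbe s e ▸ edge_mem_octSet s.opp (nbe s e)

lemma octSet_nxt (s : Side) (e : DEdge) : octSet s (nxt s e) = octSet s e := octSet_iterate s 1 e

/-- No octagon has four consecutive edges in `S`, but not all. -/
def Completed (S : Set (Sym2 G)) : Prop :=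
  ∀ s d, (∀ k < 4, ((nxt s)^[k] d).edge ∈ S) → octSet s d ⊆ S

namespace IsPath

attribute [local irreducible] nxt rev rotd

variable {e : ℤ → DEdge} {τ : ℤ → ZMod 8} {i : ℤ} {b b' : DEdge} {S : Set (Sym2 G)}

lemma octSet_bubble (h : IsPath e τ) (hb : BubbleAt e τ i b) :
    ∃ s, octSet .R b = octSet s (e (i + 1)) := by
  cases hb with
  | @start s _ hs => exact ⟨s, by rw [octSet_rform, h.nxt_of_turn (i := i) (hs.t1 (j := i + 1)), octSet_nxt]⟩
  | @gap s _ hs =>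
    refine ⟨s, ?_⟩
    rw [octSet_rform, ← octSet_nxt, nxt_eq, rev_rev, rotd_rotd, h.dart (i := i) (j := i + 1),
      hs.at2, two_mul]

/-- Induction along the chain, from its far end: a bubble with only three edges on the path has its
fourth edge in common with the next bubble, which is already complete. -/
lemma start_subset (h : IsPath e τ) (hS : Completed S) (hp : ∀ i, (e i).edge ∈ S) {s : Side}
    (hs : Start τ s i) : octSet s (e i) ⊆ S := by
  induction hs with
  | @seed i h1 h2 h3 =>
    refine hS s _ fun k hk => ?_
    have e1 := h.nxt_of_turn (i := i) h1
    have e2 := h.nxt_of_turn (i := i + 1) h2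
    have e3 := h.nxt_of_turn (i := i + 2) h3
    obtain rfl | rfl | rfl | rfl : k = 0 ∨ k = 1 ∨ k = 2 ∨ k = 3 := by omega
    · exact hp i
    · rw [Function.iterate_one, ← e1]; exact hp _
    · rw [Function.iterate_succ_apply' _ 1, Function.iterate_one, ← e1, ← e2]; exact hp _
    · rw [Function.iterate_succ_apply' _ 2, Function.iterate_succ_apply' _ 1,
        Function.iterate_one, ← e1, ← e2, ← e3]; exact hp _
  | @chain i h1 h2 h3 _ ih =>
    refine hS s _ fun k hk => ?_
    have e1 := h.nxt_of_turn (i := i) h1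
    have e2 := h.nxt_of_turn (i := i + 1) h2
    have e3 := h.nbe_of_turn (i := i + 2) h3
    obtain rfl | rfl | rfl | rfl : k = 0 ∨ k = 1 ∨ k = 2 ∨ k = 3 := by omega
    · exact hp i
    · rw [Function.iterate_one, ← e1]; exact hp _
    · rw [Function.iterate_succ_apply' _ 1, Function.iterate_one, ← e1, ← e2]; exact hp _
    · rw [Function.iterate_succ_apply' _ 2, Function.iterate_succ_apply' _ 1,
        Function.iterate_one, ← e1, ← e2, ← e3]
      exact ih (edge_nbe_mem_octSet s _)

lemma bubble_subset (h : IsPath e τ) (hS : Completed S) (hp : ∀ i, (e i).edge ∈ S)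
    (hb : BubbleAt e τ i b) : octSet .R b ⊆ S := by
  cases hb with
  | start hs => rw [octSet_rform]; exact h.start_subset hS hp hs
  | @gap s _ hs =>
    rw [octSet_rform]
    set d := rev (rotd s.sgn (rev (e i))) with hd
    have e0 : rev d = nxt s (e i) := by rw [hd, rev_rev, nxt_eq]
    have e1 : e (i + 1) = nxt s d := by
      rw [nxt_eq, hd, rev_rev, rotd_rotd, h.dart (i := i) (j := i + 1), hs.at2, two_mul]
    have e2 := h.nxt_of_turn (i := i + 1) (hs.at0 (j := i + 2))
    have e3 := h.nbe_of_turn (i := i + 2) (hs.at2 (j := i + 3))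
    refine hS s _ fun k hk => ?_
    obtain rfl | rfl | rfl | rfl : k = 0 ∨ k = 1 ∨ k = 2 ∨ k = 3 := by omega
    -- The octagon of a gap gets its first edge from the preceding bubble, which shares four edges
    -- with the path, and its fourth edge from the next bubble.
    · have h1 : Start τ s (i - 3) := .seed hs.at0 hs.at0 hs.at0
      refine h.start_subset hS hp h1 ?_
      have f1 := h.nxt_of_turn (i := i - 3) (hs.at0 (j := i - 2))
      have f2 := h.nxt_of_turn (i := i - 2) (hs.at0 (j := i - 1))
      have f3 := h.nxt_of_turn (i := i - 1) (hs.at0 (j := i))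
      rw [← octSet_nxt, ← f1, ← octSet_nxt, ← f2, ← octSet_nxt, ← f3, ← octSet_nxt, ← e0,
        Function.iterate_zero_apply, ← edge_rev]
      exact edge_mem_octSet s _
    · rw [Function.iterate_one, ← e1]; exact hp _
    · rw [Function.iterate_succ_apply' _ 1, Function.iterate_one, ← e1, ← e2]; exact hp _
    · rw [Function.iterate_succ_apply' _ 2, Function.iterate_succ_apply' _ 1,
        Function.iterate_one, ← e1, ← e2, ← e3]
      exact h.start_subset hS hp hs.start (edge_nbe_mem_octSet s _)

lemma trackEdges_subset (h : IsPath e τ) (hS : Completed S) (hp : ∀ i, (e i).edge ∈ S) :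
    trackEdges (track e τ) ⊆ S := by
  rintro x ⟨i, P, hP, hx⟩
  cases P with
  | arc d s k =>
    obtain rfl : x = d.edge := hx
    obtain ⟨h1, -⟩ := of_track_arc hP
    cases h1
    exact hp i
  | bub b => exact h.bubble_subset hS hp (of_track_bub hP) hx

lemma bubble_subset_track (hb : BubbleAt e τ i b) : octSet .R b ⊆ trackEdges (track e τ) :=
  fun _ hx => ⟨i, _, track_bub hb, hx⟩

lemma start_mem_track (h : IsPath e τ) {s : Side} (hs : Start τ s i) {j : ℤ} (h1 : i ≤ j)
    (h2 : j ≤ i + 3) : (e j).edge ∈ trackEdges (track e τ) := by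
  have hsub : octSet s (e i) ⊆ _ := octSet_rform s (e i) ▸ bubble_subset_track (e := e) (.start hs)
  have e1 := h.nxt_of_turn (i := i) (hs.t1 (j := i + 1))
  have e2 := h.nxt_of_turn (i := i + 1) (hs.t2 (j := i + 2))
  obtain rfl | rfl | rfl | rfl : j = i ∨ j = i + 1 ∨ j = i + 2 ∨ j = i + 3 := by omega
  · exact hsub (edge_mem_octSet s _)
  · refine hsub ?_
    rw [← octSet_nxt, ← e1]
    exact edge_mem_octSet s _
  · refine hsub ?_
    rw [← octSet_nxt, ← e1, ← octSet_nxt, ← e2]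
    exact edge_mem_octSet s _
  · rcases hs.t3 (j := i + 3) with h3 | ⟨-, h3⟩
    · refine hsub ?_
      rw [← octSet_nxt, ← e1, ← octSet_nxt, ← e2, ← octSet_nxt, ← h.nxt_of_turn (i := i + 2) h3]
      exact edge_mem_octSet s _
    · exact bubble_subset_track (e := e) (.start h3) (octSet_rform s _ ▸ edge_mem_octSet s _)

lemma edge_mem_track (h : IsPath e τ) (i : ℤ) : (e i).edge ∈ trackEdges (track e τ) := by
  by_cases hc : Covered e τ i
  · obtain ⟨j, h1, h2, b, hb⟩ := hc
    cases hb with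
    | start hs => exact h.start_mem_track hs h2 (by omega)
    | @gap s _ hs =>
      -- Of the four places assigned to the octagon of a gap, only the middle two carry edges of it;
      -- the outer ones carry edges of the neighbouring bubbles.
      obtain rfl | rfl | h3 : i = j ∨ i = j + 3 ∨ i = j + 1 ∨ i = j + 2 := by omega
      · exact h.start_mem_track (.seed hs.at0 hs.at0 hs.at0 : Start τ s (i - 3)) (by omega) (by omega)
      · exact h.start_mem_track hs.start le_rfl (by omega)
      · have hsub := bubble_subset_track (e := e) (.gap hs)
        rw [octSet_rform, ← octSet_nxt, nxt_eq, rev_rev, rotd_rotd, ← two_mul,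
          ← hs.at2 (j := j + 1), ← h.succ] at hsub
        rcases h3 with rfl | rfl
        · exact hsub (edge_mem_octSet s _)
        · refine hsub ?_
          rw [← octSet_nxt, ← h.nxt_of_turn (i := j + 1) (hs.at0 (j := j + 2))]
          exact edge_mem_octSet s _
  · exact ⟨i, _, track_arc hc, rfl⟩

/-- An octagon of which the track contains four edges is one of its bubbles. -/
lemma exists_octSet_eq (h : IsPath e τ) {s : Side} {d : DEdge}
    (h4 : 4 ≤ (octSet s d ∩ trackEdges (track e τ)).ncard) :
    (∃ u j, octSet s d = octSet u (e j)) ∧ octSet s d ⊆ trackEdges (track e τ) := by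
  obtain ⟨c, hc, h1, h2⟩ := h.isTrack.exists_snake
  rw [← h2] at h4
  refine ⟨?_, h2 ▸ hc.four_edges s d h4⟩
  obtain ⟨n, b, hb, h3⟩ := hc.exists_bubble s d h4
  obtain ⟨i, hi⟩ := h1 n
  rw [hb] at hi
  obtain ⟨u, hu⟩ := h.octSet_bubble (of_track_bub hi)
  exact ⟨u, _, h3.trans hu⟩

end IsPath

lemma octEdge_add (g : G) (k : Fin 8) (j : ℕ) :
    octEdge g (k + Fin.ofNat 8 j) = ((nxt .L)^[j] ((nxt .L)^[k.val] (g, Letter.a))).edge := by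
  have h : k + Fin.ofNat 8 j = Fin.ofNat 8 (j + k.val) := by
    apply Fin.ext
    simp only [Fin.val_add, Fin.ofNat_eq_cast, Fin.val_natCast]
    omega
  rw [h, octEdge_ofNat, Function.iterate_add_apply]

lemma fin_eight_eq (j : Fin 8) : Fin.ofNat 8 j.val = j := by simp

/-- The moves of the fifth step read octagons in the positive direction; four edges along an octagon
on the right are four edges along one on the left when traversed backwards. -/
lemma completed_of_not {t : G} {S : Set (Sym2 G)} (h : ¬ ∃ S', Complete t S S') :
    Completed S := by
  have left : ∀ d, (∀ k < 4, ((nxt .L)^[k] d).edge ∈ S) → octSet .L d ⊆ S := by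
    intro d hd
    by_contra hsub
    obtain ⟨g, m, rfl⟩ := exists_octVertex d
    rw [octSet_iterate, ← octEdges_eq] at hsub
    refine h ⟨_, .mk S g (Fin.ofNat 8 m) (fun j hj => ?_) hsub⟩
    rw [← fin_eight_eq j, octEdge_add, Fin.ofNat_eq_cast, Fin.val_natCast, nxt_iterate_mod]
    exact hd _ (by omega)
  intro s d hd
  cases s
  · exact left d hd
  · have h1 := left (rev ((nxt .R)^[3] d)) fun k hk => by
      have h2 := nxt_opp_iterate_rev .R k ((nxt .R)^[3 - k] d)
      rw [← Function.iterate_add_apply, show k + (3 - k) = 3 by omega] at h2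
      change ((nxt Side.R.opp)^[k] _).edge ∈ S
      rw [h2, edge_rev]
      exact hd _ (by omega)
    have h2 := octSet_rev .R ((nxt .R)^[3] d)
    rw [octSet_iterate] at h2
    rw [← h2]
    exact h1

/-- A path that is periodic under the deck transformation `t`. -/
structure IsPeriodic (e : ℤ → DEdge) (τ : ℤ → ZMod 8) (n : ℕ) (t : G) : Prop
    extends IsPath e τ where
  pos : 0 < n
  add : ∀ i k : ℤ, e (i + k * n) = shift (t ^ k) (e i)

/-- What remains true of the set of edges while octagons are completed. -/
structure Partial (e : ℤ → DEdge) (τ : ℤ → ZMod 8) (t : G) (S : Set (Sym2 G)) : Prop where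
  trans_mem : ∀ k : ℤ, ∀ x ∈ S, trans (t ^ k) x ∈ S
  path : ∀ i, (e i).edge ∈ S
  subset : S ⊆ trackEdges (IsPath.track e τ)

/-- The octagons at one period of the path that are not completed yet. -/
def missing (e : ℤ → DEdge) (n : ℕ) (S : Set (Sym2 G)) : Set (Fin n × Bool) :=
  {p | ¬ octSet (if p.2 then .R else .L) (e p.1.val) ⊆ S}

namespace IsPeriodic

variable {e : ℤ → DEdge} {τ : ℤ → ZMod 8} {n : ℕ} {t : G} {S S' : Set (Sym2 G)}

lemma exists_rep (h : IsPeriodic e τ n t) (i : ℤ) :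
    ∃ (j : Fin n) (k : ℤ), e i = shift (t ^ k) (e j.val) := by
  have hn : (0 : ℤ) < n := by exact_mod_cast h.pos
  have h0 := Int.emod_nonneg i hn.ne'
  have h1 := Int.emod_lt_of_pos i hn
  refine ⟨⟨(i % n).toNat, by omega⟩, i / n, ?_⟩
  rw [← h.add, Int.toNat_of_nonneg h0]
  congr 1
  rw [mul_comm]
  exact (Int.emod_add_mul_ediv i n).symm

/-- An octagon with four edges in the track is one of its bubbles. So its completion does not leave
the track. Moreover a bubble always lies beside some edge of the path, so that a translate of it
disappears from the finite set of missing octagons along one period. -/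
lemma complete (h : IsPeriodic e τ n t) (hS : Partial e τ t S) (hc : Complete t S S') :
    Partial e τ t S' ∧ (missing e n S').ncard < (missing e n S).ncard := by
  obtain @⟨g, k, hk, hg⟩ := hc
  have hL : ∀ m, octEdges m = octSet .L ((nxt .L)^[k.val] (m, Letter.a)) := fun m => by
    rw [octSet_iterate, octEdges_eq]
  have key : ∀ m : ℤ, (∃ u j, octEdges (t ^ m * g) = octSet u (e j)) ∧
      octEdges (t ^ m * g) ⊆ trackEdges (IsPath.track e τ) := by
    intro m
    rw [hL]
    refine h.exists_octSet_eq (four_le_ncard fun j hj => hS.subset ?_)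
    rw [← octEdge_add, ← trans_octEdge]
    refine hS.trans_mem m _ (hk _ ?_)
    rw [Fin.lt_def, Fin.ofNat_eq_cast, Fin.val_natCast]
    simp only [Fin.isValue, show ((4 : Fin 8) : ℕ) = 4 from rfl]
    omega
  constructor
  · refine ⟨?_, fun i => Or.inl (hS.path i), ?_⟩
    · rintro m x (hx | hx)
      · exact Or.inl (hS.trans_mem m x hx)
      · obtain ⟨l, hl⟩ := Set.mem_iUnion.mp hx
        refine Or.inr (Set.mem_iUnion.mpr ⟨m + l, ?_⟩)
        rw [zpow_add, mul_assoc]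
        exact mem_octEdges_mul hl
    · rintro x (hx | hx)
      · exact hS.subset hx
      · obtain ⟨l, hl⟩ := Set.mem_iUnion.mp hx
        exact (key l).2 hl
  · obtain ⟨⟨u, i, hu⟩, -⟩ := key 0
    rw [zpow_zero, one_mul] at hu
    obtain ⟨j, m, hj⟩ := h.exists_rep i
    refine Set.ncard_lt_ncard ⟨fun p hp => fun hs => hp (hs.trans Set.subset_union_left), ?_⟩
      (Set.toFinite _)
    intro hsub
    obtain ⟨β, hβ⟩ : ∃ β : Bool, (if β then Side.R else .L) = u := by
      cases u
      · exact ⟨false, rfl⟩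
      · exact ⟨true, rfl⟩
    have hmem : (j, β) ∈ missing e n S := by
      change ¬ octSet (if β then .R else .L) (e j.val) ⊆ S
      rw [hβ]
      intro hs
      refine hg fun x hx => ?_
      rw [hu, hj] at hx
      obtain ⟨l, rfl⟩ := hx
      simp only [nxt_iterate_shift, ← trans_edge]
      exact hS.trans_mem _ _ (hs ⟨l, rfl⟩)
    refine hsub hmem fun x hx => Or.inr (Set.mem_iUnion.mpr ⟨-m, ?_⟩)
    change x ∈ octSet (if β then .R else .L) (e j.val) at hx
    rw [hβ] at hx
    have h1 := mem_octSet_shift (t := t ^ m) hx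
    rw [← hj, ← hu] at h1
    have h2 := mem_octEdges_mul (t := t ^ (-m)) h1
    rwa [trans_trans, ← zpow_add, neg_add_cancel, zpow_zero, trans_one] at h2

/-- The order in which octagons are completed is thus irrelevant. -/
lemma eq_trackEdges (h : IsPeriodic e τ n t) (hS : Partial e τ t S)
    (hc : ¬ ∃ S', Complete t S S') : S = trackEdges (IsPath.track e τ) :=
  hS.subset.antisymm (h.trackEdges_subset (completed_of_not hc) hS.path)

lemma partial_path (h : IsPeriodic e τ n t) : Partial e τ t (Set.range fun i => (e i).edge) := by
  refine ⟨?_, fun i => ⟨i, rfl⟩, ?_⟩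
  · rintro k _ ⟨i, rfl⟩
    exact ⟨i + k * n, by simp only [h.add, trans_edge]⟩
  · rintro _ ⟨i, rfl⟩
    exact h.edge_mem_track i

/-- The track lies in the union of the translates of a finite set. -/
lemma exists_finite (h : IsPeriodic e τ n t) : ∃ F : Set (Sym2 G), F.Finite ∧
    ∀ x ∈ trackEdges (IsPath.track e τ), ∃ k : ℤ, ∃ y ∈ F, x = trans (t ^ k) y := by
  refine ⟨⋃ j : Fin n, (octSet .L (e j.val) ∪ octSet .R (e j.val)),
    Set.finite_iUnion fun j => (finite_octSet _ _).union (finite_octSet _ _), ?_⟩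
  have key : ∀ s i, ∀ x ∈ octSet s (e i), ∃ k : ℤ,
      ∃ y ∈ ⋃ j : Fin n, (octSet .L (e j.val) ∪ octSet .R (e j.val)), x = trans (t ^ k) y := by
    rintro s i _ ⟨l, rfl⟩
    obtain ⟨j, m, hj⟩ := h.exists_rep i
    refine ⟨m, ((nxt s)^[l] (e j.val)).edge, Set.mem_iUnion.mpr ⟨j, ?_⟩, ?_⟩
    · cases s
      · exact Or.inl ⟨l, rfl⟩
      · exact Or.inr ⟨l, rfl⟩
    · rw [trans_edge, ← nxt_iterate_shift, ← hj]
  rintro x ⟨i, P, hP, hx⟩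
  cases P with
  | arc d s k =>
    obtain rfl : x = d.edge := hx
    obtain ⟨h1, -⟩ := IsPath.of_track_arc hP
    cases h1
    exact key .L i _ (edge_mem_octSet .L (e i))
  | bub b =>
    obtain ⟨s, hs⟩ := h.octSet_bubble (IsPath.of_track_bub hP)
    refine key s (i + 1) x ?_
    rw [← hs]
    exact hx

end IsPeriodic

end SurfaceSnakes

end


noncomputable section
namespace SurfaceSnakes

/-! ### Cyclic words and their turns -/

/-- The letters of a word, with indices modulo its length `n`. -/
def lets (n : ℕ) (l : List Letter) (i : ZMod n) : Letter := l.getD i.val .a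

/-- The turns between the letters of a cyclic word. -/
def turns {n : ℕ} (x : ZMod n → Letter) (i : ZMod n) : ZMod 8 :=
  (x i).angle - (x (i - 1)).inv.angle

lemma turns_eq_iff {n : ℕ} {x : ZMod n → Letter} {i j : ZMod n} (hj : j = i + 1) {k : ZMod 8} :
    turns x j = k ↔ x j = rot k (x i).inv := by
  have h : j - 1 = i := by rw [hj, add_sub_cancel_right]
  rw [turns, h, sub_eq_iff_eq_add, ← Letter.angle_injective.eq_iff, angle_rot, add_comm]

lemma lets_natCast {n : ℕ} {l : List Letter} (hn : l.length = n) {k : ℕ} (hk : k < n) :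
    lets n l (k : ZMod n) = l[k]'(hn ▸ hk) := by
  rw [lets, ZMod.val_natCast_of_lt hk, List.getD_eq_getElem]

lemma lets_eq {n : ℕ} [NeZero n] {l : List Letter} (hn : l.length = n) (i : ZMod n) :
    lets n l i = l[i.val]'(hn ▸ ZMod.val_lt i) := by
  rw [lets, List.getD_eq_getElem]

lemma lets_rotate {n : ℕ} [NeZero n] {l : List Letter} (hn : l.length = n) (m i : ZMod n) :
    lets n (l.rotate m.val) i = lets n l (i + m) := by
  rw [lets_eq (by rwa [List.length_rotate]), lets_eq hn, List.getElem_rotate]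
  simp only [ZMod.val_add, hn]

lemma turns_rotate {n : ℕ} [NeZero n] {l : List Letter} (hn : l.length = n) (m i : ZMod n) :
    turns (lets n (l.rotate m.val)) i = turns (lets n l) (i + m) := by
  rw [turns, turns, lets_rotate hn, lets_rotate hn, sub_add_eq_add_sub]

/-- The word of length `k` that begins with `x` and runs along an octagon on the side `s`. -/
def run (s : Side) (x : Letter) (k : ℕ) : List Letter := (List.range k).map fun j => (turn s)^[j] x

@[simp] lemma length_run (s : Side) (x : Letter) (k : ℕ) : (run s x k).length = k := by simp [run]

lemma run_add (s : Side) (x : Letter) (j k : ℕ) :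
    run s x (j + k) = run s x j ++ run s ((turn s)^[j] x) k := by
  rw [run, run, run, List.range_add, List.map_append, List.map_map]
  congr 1
  apply List.map_congr_left
  intro i _
  rw [Function.comp_apply, add_comm, Function.iterate_add_apply]

lemma invWord_invWord (w : List Letter) : invWord (invWord w) = w := by
  simp [invWord, Function.comp_def]

lemma complementary_run (s : Side) (x : Letter) {k : ℕ} (hk : k ≤ 8) :
    Complementary (run s x k) (invWord (run s ((turn s)^[k] x) (8 - k))) := by
  rw [Complementary, invWord_invWord, ← run_add, Nat.add_sub_cancel' hk]
  cases s <;> revert x <;> decide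

/-- Cyclic permutations of the relator run around octagons on the left, those of its inverse around
octagons on the right. -/
lemma Complementary.eq_run {u v : List Letter} (h : Complementary u v) :
    ∃ s x, u ++ invWord v = run s x 8 := by
  have key : ∀ r : List Letter, r.length = 8 → (u ++ invWord v) ~r r →
      ∃ m < 8, r.rotate m = u ++ invWord v := by
    intro r hr h1
    obtain ⟨m, hm⟩ := h1.symm
    exact ⟨m % 8, Nat.mod_lt _ (by norm_num), by rw [← hm, ← hr, List.rotate_mod]⟩
  rcases h with h | h
  · obtain ⟨m, hm, h1⟩ := key _ rfl h
    rw [← h1]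
    have : ∀ m < 8, ∃ x, relator.rotate m = run .L x 8 := by decide
    exact ⟨_, this m hm⟩
  · obtain ⟨m, hm, h1⟩ := key _ rfl h
    rw [← h1]
    have : ∀ m < 8, ∃ x, (invWord relator).rotate m = run .R x 8 := by decide
    exact ⟨_, this m hm⟩

lemma lets_of_turns {n : ℕ} {x : ZMod n → Letter} {s : Side} {k : ℕ} {i : ZMod n}
    (h : ∀ j < k, turns x (i + j + 1) = s.sgn) : x (i + k) = (turn s)^[k] (x i) := by
  induction k with
  | zero => simp
  | succ k ih =>
    rw [Function.iterate_succ_apply', ← ih fun j hj => h j (by omega), Nat.cast_succ, ← add_assoc]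
    exact (turns_eq_iff rfl).mp (h k (by omega))

lemma take_eq_run {n : ℕ} [NeZero n] {l : List Letter} (hn : l.length = n) {s : Side} {k : ℕ}
    (hk : k + 1 ≤ n) (h : ∀ j < k, turns (lets n l) (j + 1) = s.sgn) :
    l.take (k + 1) = run s (lets n l 0) (k + 1) := by
  refine List.ext_getElem (by simp; omega) fun j h1 h2 => ?_
  rw [length_run] at h2
  have h3 := lets_of_turns (x := lets n l) (i := 0) (s := s) (k := j) fun m hm => by
    rw [zero_add]; exact h m (by omega)
  rw [zero_add, lets_natCast hn (by omega)] at h3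
  rw [List.getElem_take, h3]
  simp only [run, List.getElem_map, List.getElem_range]

lemma iterate_turn_ne (s : Side) (x : Letter) {k : ℕ} (h1 : 0 < k) (h2 : k < 8) :
    (turn s)^[k] x ≠ x := by
  have : ∀ k < 8, 0 < k → (turn s)^[k] x ≠ x := by cases s <;> revert x <;> decide
  exact this k h2 h1

/-- The turns of a cyclic word without neighbouring inverses and long cycles. -/
structure ReducedTurns {n : ℕ} (τ : ZMod n → ZMod 8) : Prop where
  ne_zero : ∀ i, τ i ≠ 0
  four : ∀ i s, τ (i + 1) = Side.sgn s → τ (i + 2) = s.sgn → τ (i + 3) = s.sgn →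
    τ (i + 4) ≠ s.sgn

lemma coe_rotate (l : List Letter) (m : ℕ) : ((l.rotate m : List Letter) : Cycle Letter) = l :=
  Cycle.coe_eq_coe.mpr (List.IsRotated.symm ⟨m, rfl⟩)

lemma IsReduced.reducedTurns {n : ℕ} [NeZero n] {l : List Letter} (hn : l.length = n)
    (hl : IsReduced (l : Cycle Letter)) : ReducedTurns (turns (lets n l)) := by
  have hpos : 0 < n := Nat.pos_of_ne_zero (NeZero.ne n)
  constructor
  · intro i h0
    obtain ⟨i, rfl⟩ : ∃ j, i = 1 + j := ⟨i - 1, by ring⟩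
    rw [← turns_rotate hn] at h0
    rw [← coe_rotate l i.val] at hl
    replace hn : (l.rotate i.val).length = n := by rwa [List.length_rotate]
    generalize l.rotate i.val = l at *
    rw [turns_eq_iff (zero_add 1).symm, rot_zero] at h0
    have h1 := lets_natCast hn hpos
    rw [Nat.cast_zero] at h1
    rcases Nat.lt_or_ge 1 n with h2 | h2
    · have h3 := lets_natCast hn h2
      rw [Nat.cast_one] at h3
      rw [h1, h3] at h0
      match l, hn with
      | [], hn => simp at hn; omega
      | [_], hn => simp at hn; omega
      | x :: y :: w, _ =>
        simp only [List.getElem_cons_zero, List.getElem_cons_succ] at h0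
        subst h0
        exact hl ⟨_, Or.inl (.mk x w)⟩
    -- In a word of one letter the letter is its own neighbour and would be its own inverse.
    · obtain rfl : n = 1 := by omega
      have h2 : (1 : ZMod 1) = 0 := rfl
      rw [h2] at h0
      exact inv_ne _ h0.symm
  · intro i s h1 h2 h3 h4
    rw [add_comm, ← turns_rotate hn] at h1 h2 h3 h4
    rw [← coe_rotate l i.val] at hl
    replace hn : (l.rotate i.val).length = n := by rwa [List.length_rotate]
    generalize l.rotate i.val = l at *
    have h : ∀ j : ℕ, j < 4 → turns (lets n l) (j + 1) = s.sgn := by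
      intro j hj
      obtain rfl | rfl | rfl | rfl : j = 0 ∨ j = 1 ∨ j = 2 ∨ j = 3 := by omega
      · rw [Nat.cast_zero, zero_add]; exact h1
      · rw [Nat.cast_one, one_add_one_eq_two]; exact h2
      · rw [Nat.cast_two, two_add_one_eq_three]; exact h3
      · rw [Nat.cast_ofNat, three_add_one_eq_four]; exact h4
    -- In a word with fewer than five letters the turns wrap around, so that the labels along an
    -- octagon would repeat after `n` steps; but its eight labels are distinct.
    rcases Nat.lt_or_ge n 5 with h5 | h5
    · have h6 := lets_of_turns (x := lets n l) (i := 0) (s := s) (k := n) fun m hm => by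
        rw [zero_add]; exact h m (by omega)
      rw [ZMod.natCast_self, zero_add] at h6
      exact iterate_turn_ne s _ hpos (by omega) h6.symm
    · have h6 := take_eq_run hn h5 h
      rw [← List.take_append_drop 5 l, h6] at hl
      exact hl ⟨_, Or.inr (.mk _ _ _ (by simp) (complementary_run s _ (by norm_num)))⟩

/-- A half cycle at the beginning of a word that has to be replaced. -/
lemma exists_replaceHalf {n : ℕ} [NeZero n] {l : List Letter} (hn : l.length = n) (h7 : 7 ≤ n)
    {s : Side} (h : ∀ j : ℕ, j < 3 → turns (lets n l) (j + 1) = s.sgn)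
    (h4 : turns (lets n l) 4 = 2 * s.sgn) (h5 : turns (lets n l) 5 = s.sgn)
    (h6 : turns (lets n l) 6 = s.sgn) : ∃ l', ReplaceHalf l l' := by
  have e1 := take_eq_run hn (k := 3) (by omega) h
  set x := lets n l 0 with hx
  have e3 := lets_of_turns (x := lets n l) (i := 0) (s := s) (k := 3) fun m hm => by
    rw [zero_add]; exact h m hm
  rw [zero_add, ← hx, Nat.cast_ofNat] at e3
  set y := ((turn s)^[4] x).inv with hy
  have e4 : lets n l 4 = turn s y := by
    rw [(turns_eq_iff three_add_one_eq_four.symm).mp h4, e3, hy, turn, Letter.inv_inv,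
      Function.iterate_succ_apply' _ 3, turn, rot_rot, two_mul]
  have e5 : lets n l 5 = (turn s)^[2] y := by
    rw [(turns_eq_iff (i := 4) (by norm_num)).mp h5, e4]; rfl
  have e6 : lets n l 6 = (turn s)^[3] y := by
    rw [(turns_eq_iff (i := 5) (by norm_num)).mp h6, e5]; rfl
  have e7 : (l.drop 4).take 3 = [turn s y, (turn s)^[2] y, (turn s)^[3] y] := by
    refine List.ext_getElem (by simp; omega) fun j h1 h2 => ?_
    have h3 : j < 3 := h2
    rw [List.getElem_take, List.getElem_drop, ← lets_natCast hn (by omega)]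
    obtain rfl | rfl | rfl : j = 0 ∨ j = 1 ∨ j = 2 := by omega
    · exact e4
    · exact e5
    · exact e6
  have e8 : l = run s x 4 ++ [turn s y, (turn s)^[2] y, (turn s)^[3] y] ++ (l.drop 4).drop 3 := by
    rw [← e1, ← e7, List.append_assoc, List.take_append_drop, List.take_append_drop]
  rw [e8]
  have e9 : invWord (run s ((turn s)^[4] x) 4) = invWord ((run s ((turn s)^[4] x) 4).tail) ++ [y] := by
    simp [run, invWord, List.range_succ, hy]
  refine ⟨_, .mk _ (invWord ((run s ((turn s)^[4] x) 4).tail)) _ _ y (by simp) ?_ rfl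
    ⟨rfl, invWord (run s ((turn s)^[4] y) 4), ?_⟩⟩
  · rw [← e9]
    exact complementary_run s x (k := 4) (by norm_num)
  · exact complementary_run s y (k := 4) (by norm_num)

lemma tight_of_reduced {n : ℕ} [NeZero n] {l : List Letter} (hn : l.length = n)
    (hl : IsReduced (l : Cycle Letter))
    (hh : ¬ ∃ v v' : List Letter, (v : Cycle Letter) = l ∧ ReplaceHalf v v') :
    Tight fun i : ℤ => turns (lets n l) i := by
  have hr := hl.reducedTurns hn
  refine ⟨fun i => hr.ne_zero i, fun i s h1 h2 h3 => ?_, fun i s h1 h2 h3 h4 h5 h6 => ?_⟩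
  · push_cast at h1 h2 h3 ⊢
    exact hr.four i s h1 h2 h3
  · push_cast at h1 h2 h3 h4 h5 h6
    generalize (i : ZMod n) = i at *
    have hn0 : (n : ZMod n) = 0 := ZMod.natCast_self n
    have hpos : 0 < n := Nat.pos_of_ne_zero (NeZero.ne n)
    -- In shorter words the window of six turns overlaps itself. For n ≤ 3 a turn would be both
    -- sharp and wide, for n = 4 the letters do not close up, and for n = 5, 6 the sharp turns at
    -- both ends join to four in a row.
    have h7 : 7 ≤ n := by
      by_contra hlt
      obtain rfl | rfl | rfl | rfl | h | h : n = 1 ∨ n = 2 ∨ n = 3 ∨ n = 4 ∨ n = 5 ∨ n = 6 := by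
        omega
      · rw [show (4 : ZMod 1) = 1 from rfl, h1] at h4
        exact Side.sgn_ne_two _ _ h4
      · rw [show (4 : ZMod 2) = 2 from rfl, h2] at h4
        exact Side.sgn_ne_two _ _ h4
      · rw [show (4 : ZMod 3) = 1 from rfl, h1] at h4
        exact Side.sgn_ne_two _ _ h4
      · have e1 := (turns_eq_iff (i := i) rfl).mp h1
        have e2 := (turns_eq_iff (i := i + 1) (by ring)).mp h2
        have e3 := (turns_eq_iff (i := i + 2) (by ring)).mp h3
        have e4 := (turns_eq_iff (i := i + 3) (by ring)).mp h4
        rw [e3, e2, e1, show (4 : ZMod 4) = 0 from rfl, add_zero] at e4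
        have : ∀ x : Letter, x ≠ rot (2 * s.sgn) (rot s.sgn (rot s.sgn (rot s.sgn
          x.inv).inv).inv).inv := by cases s <;> decide
        exact this _ e4
      · refine hr.four (i - 1) s ?_ ?_ ?_ ?_
        · rw [← h5]
          congr 1
          have : (5 : ZMod n) = 0 := by rw [← hn0, h]; norm_cast
          rw [this]; ring
        · rw [← h1]; congr 1; ring
        · rw [← h2]; congr 1; ring
        · rw [← h3]; congr 1; ring
      · refine hr.four (i - 1) s ?_ ?_ ?_ ?_
        · rw [← h6]
          congr 1
          have : (6 : ZMod n) = 0 := by rw [← hn0, h]; norm_cast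
          rw [this]; ring
        · rw [← h1]; congr 1; ring
        · rw [← h2]; congr 1; ring
        · rw [← h3]; congr 1; ring
    rw [add_comm, ← turns_rotate hn] at h1 h2 h3 h4 h5 h6
    obtain ⟨l', h⟩ := exists_replaceHalf (s := s) (l := l.rotate i.val) (by rwa [List.length_rotate])
      h7 (fun j hj => by
        obtain rfl | rfl | rfl : j = 0 ∨ j = 1 ∨ j = 2 := by omega
        · rw [Nat.cast_zero, zero_add]; exact h1
        · rw [Nat.cast_one, one_add_one_eq_two]; exact h2
        · rw [Nat.cast_two, two_add_one_eq_three]; exact h3) h4 h5 h6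
    exact hh ⟨_, _, coe_rotate l i.val, h⟩

/-! ### Periodic edge paths that read off a word -/

lemma ReadsOff.exists_lets {n : ℕ} [NeZero n] {l : List Letter} (hn : l.length = n) {E : ℤ → G}
    (h : ReadsOff E l) (i : ℤ) : E (i + 1) = E i * (lets n l i).toG := by
  obtain ⟨x, hx, h1⟩ := h i
  rw [h1, lets_eq hn]
  rw [Option.mem_def, List.getElem?_eq_some_iff] at hx
  obtain ⟨h2, h3⟩ := hx
  rw [← h3]
  congr 3
  have h4 := ZMod.val_intCast (n := n) i
  rw [hn]
  omega

lemma ReadsOff.eval {l : List Letter} {E : ℤ → G} (h : ReadsOff E l) :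
    E l.length = E 0 * evalWord l := by
  have key : ∀ j ≤ l.length, E j = E 0 * evalWord (l.take j) := by
    intro j hj
    induction j with
    | zero => simp
    | succ j ih =>
      have : NeZero l.length := ⟨by omega⟩
      have h1 := h.exists_lets rfl j
      rw [Int.cast_natCast, lets_natCast rfl (by omega), ih (by omega)] at h1
      rw [Nat.cast_succ, h1, ← List.take_concat_get' _ _ (by omega), evalWord_append,
        evalWord_cons, evalWord_nil, mul_one, mul_assoc]
  rw [key _ le_rfl, List.take_length]

/-- The directed edges of a path that reads off a word. -/
def darts (E : ℤ → G) (l : List Letter) (i : ℤ) : DEdge := (E i, lets l.length l i)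

lemma ReadsOff.add_period {l : List Letter} (hl : l ≠ []) {E : ℤ → G} (h : ReadsOff E l) (i k : ℤ) :
    E (i + k * l.length) = period E l.length ^ k * E i := by
  have : NeZero l.length := ⟨by simpa using hl⟩
  have one : ∀ i : ℤ, E (i + l.length) * (E i)⁻¹ = period E l.length := by
    have step : ∀ i : ℤ, E (i + 1 + l.length) * (E (i + 1))⁻¹ = E (i + l.length) * (E i)⁻¹ := by
      intro i
      rw [add_right_comm, h.exists_lets rfl i, h.exists_lets rfl (i + l.length), Int.cast_add,
        Int.cast_natCast, ZMod.natCast_self, add_zero]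
      group
    intro i
    induction i using Int.induction_on with
    | zero => rw [zero_add]; rfl
    | succ i ih => rw [step, ih]
    | pred i ih => rw [← step, sub_add_cancel, ih]
  have one' : ∀ i : ℤ, E (i + l.length) = period E l.length * E i := fun i =>
    mul_inv_eq_iff_eq_mul.mp (one i)
  induction k using Int.induction_on with
  | zero => simp
  | succ k ih => rw [add_mul, one_mul, ← add_assoc, one', ih, ← mul_assoc, ← zpow_one_add, add_comm]
  | pred k ih =>
    have h1 := one' (i + (-k - 1) * l.length)
    rw [show i + (-k - 1) * (l.length : ℤ) + l.length = i + -k * l.length by ring, ih] at h1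
    rw [← inv_mul_eq_iff_eq_mul] at h1
    rw [← h1, ← mul_assoc, ← zpow_neg_one, ← zpow_add]
    congr 2
    ring

lemma ReadsOff.darts_add {l : List Letter} (hl : l ≠ []) {E : ℤ → G} (h : ReadsOff E l) (i k : ℤ) :
    darts E l (i + k * l.length) = shift (period E l.length ^ k) (darts E l i) := by
  refine Prod.ext (h.add_period hl i k) ?_
  change lets _ l _ = lets _ l _
  push_cast
  rw [ZMod.natCast_self, mul_zero, add_zero]

lemma ReadsOff.isPeriodic {l : List Letter} (hl : l ≠ []) {E : ℤ → G} (h : ReadsOff E l)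
    (ht : Tight fun i : ℤ => turns (lets l.length l) i) :
    IsPeriodic (darts E l) (fun i : ℤ => turns (lets l.length l) i) l.length
      (period E l.length) := by
  have : NeZero l.length := ⟨by simpa using hl⟩
  refine ⟨⟨fun i => Prod.ext (h.exists_lets rfl i) ?_, ht⟩, List.length_pos_iff.mpr hl,
    h.darts_add hl⟩
  exact (turns_eq_iff (x := lets l.length l) (i := (i : ZMod l.length))
    (j := ((i + 1 : ℤ) : ZMod l.length)) (by push_cast; rfl)).mp rfl

lemma ReadsOff.pathEdges_eq {l : List Letter} (hl : l ≠ []) {E : ℤ → G} (h : ReadsOff E l) :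
    pathEdges E = Set.range fun i => (darts E l i).edge := by
  have : NeZero l.length := ⟨by simpa using hl⟩
  rw [pathEdges]
  congr 1
  funext i
  rw [h.exists_lets rfl i]; rfl

lemma exists_readsOff {l : List Letter} (hl : l ≠ []) (g : G) : ∃ E, ReadsOff E l ∧ E 0 = g := by
  have hn : (0 : ℤ) < l.length := by exact_mod_cast List.length_pos_iff.mpr hl
  refine ⟨fun i => g * evalWord l ^ (i / l.length) * evalWord (l.take (i % l.length).toNat),
    fun i => ?_, by simp⟩
  have h0 := Int.emod_nonneg i hn.ne'
  have h1 := Int.emod_lt_of_pos i hn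
  have h2 : (i % l.length).toNat < l.length := by omega
  refine ⟨l[(i % l.length).toNat], List.getElem?_eq_getElem h2, ?_⟩
  beta_reduce
  have h3 : evalWord (l.take ((i % l.length).toNat + 1)) =
      evalWord (l.take (i % l.length).toNat) * (l[(i % l.length).toNat]).toG := by
    rw [List.take_succ_eq_append_getElem h2, evalWord_append, evalWord_cons, evalWord_nil, mul_one]
  have h4 := Int.emod_add_mul_ediv i l.length
  generalize i / (l.length : ℤ) = q at *
  have h5 : i = i % l.length + l.length * q := h4.symm
  generalize i % (l.length : ℤ) = r at *
  subst h5
  rcases eq_or_lt_of_le (Int.add_one_le_of_lt h1) with h6 | h6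
  · have e1 : r + l.length * q + 1 = l.length * (q + 1) := by linear_combination h6
    rw [e1, Int.mul_ediv_cancel_left _ hn.ne', Int.mul_emod_right, mul_assoc _ _ (Letter.toG _), ← h3,
      show r.toNat + 1 = l.length by omega, List.take_length, zpow_add_one]
    simp [mul_assoc]
  · have e1 : (r + l.length * q + 1) / (l.length : ℤ) = q := by
      rw [show r + l.length * q + 1 = r + 1 + l.length * q by ring,
        Int.add_mul_ediv_left _ _ hn.ne', Int.ediv_eq_zero_of_lt (by omega) h6, zero_add]
    have e2 : (r + l.length * q + 1) % (l.length : ℤ) = r + 1 := by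
      rw [show r + l.length * q + 1 = r + 1 + l.length * q by ring,
        Int.add_mul_emod_self_left, Int.emod_eq_of_lt (by omega) h6]
    rw [e1, e2, show (r + 1).toNat = r.toNat + 1 by omega, h3, mul_assoc (g * _)]

end SurfaceSnakes

end


noncomputable section
namespace SurfaceSnakes

/-! ### The replacement of half cycles -/

/-- The change of the turns of a cyclic word when a half cycle is replaced that stands at its
beginning. -/
structure HalfMove {n : ℕ} (τ τ' : ZMod n → ZMod 8) (s : Side) : Prop where
  t1 : τ 1 = s.sgn
  t2 : τ 2 = s.sgn
  t3 : τ 3 = s.sgn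
  t4 : τ 4 = 2 * s.sgn
  t5 : τ 5 = s.sgn
  t6 : τ 6 = s.sgn
  t0' : τ' 0 = τ 0 - s.sgn
  t1' : τ' 1 = -s.sgn
  t2' : τ' 2 = -s.sgn
  t3' : τ' 3 = -s.sgn
  t4' : τ' 4 = s.sgn
  same : ∀ i, i ≠ 0 → i ≠ 1 → i ≠ 2 → i ≠ 3 → i ≠ 4 → τ' i = τ i

lemma run_four (s : Side) (x : Letter) :
    run s x 4 = [x, turn s x, turn s (turn s x), turn s (turn s (turn s x))] := rfl

/-- The shape of the words before and after the replacement of a half cycle. -/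
lemma ReplaceHalf.exists_run {l l' : List Letter} (h : ReplaceHalf l l') :
    ∃ s s' x w, l = run s x 4 ++ (run s' ((turn s)^[4] x).inv 4).tail ++ w ∧
      l' = run s' ((turn s)^[4] x).inv 4 ++ w ++ invWord (run s ((turn s)^[5] x) 3) := by
  obtain ⟨u, v, t, w, y, hu, huv, ht, -, v', hv'⟩ := h
  obtain ⟨s, x, h1⟩ := huv.eq_run
  obtain ⟨s', y', h2⟩ := hv'.eq_run
  rw [show (8 : ℕ) = 4 + 4 from rfl, run_add] at h1 h2
  obtain ⟨rfl, h3⟩ := List.append_inj h1 (by simpa using hu)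
  obtain ⟨h4, -⟩ := List.append_inj h2 (by simp [ht])
  have h5 : v ++ [y] = invWord (run s ((turn s)^[4] x) 4) := by rw [← h3, invWord_invWord]
  have h6 : invWord (run s ((turn s)^[4] x) 4) =
      invWord (run s ((turn s)^[5] x) 3) ++ [((turn s)^[4] x).inv] := by
    rw [show (4 : ℕ) = 1 + 3 from rfl, run_add]
    simp [run, invWord, List.range_succ]
  rw [h6] at h5
  obtain ⟨rfl, h7⟩ := List.append_inj' h5 rfl
  obtain rfl : y = ((turn s)^[4] x).inv := by simpa using h7
  have h8 : y' = ((turn s)^[4] x).inv := by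
    rw [run_four] at h4
    exact (List.cons.inj h4).1.symm
  subst h8
  refine ⟨s, s', x, w, ?_, ?_⟩
  · rw [← h4]; rfl
  · rw [← h4]

lemma lets_numeral {n : ℕ} {l w : List Letter} {x0 x1 x2 x3 x4 x5 x6 : Letter}
    (hn : l.length = n) (hl : l = x0 :: x1 :: x2 :: x3 :: x4 :: x5 :: x6 :: w) :
    lets n l 0 = x0 ∧ lets n l 1 = x1 ∧ lets n l 2 = x2 ∧ lets n l 3 = x3 ∧ lets n l 4 = x4 ∧
      lets n l 5 = x5 ∧ lets n l 6 = x6 := by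
  have h7 : 7 ≤ n := by rw [← hn, hl]; simp
  have key := fun k (hk : k < n) => lets_natCast hn hk
  exact ⟨by simpa [hl] using key 0 (by omega), by simpa [hl] using key 1 (by omega),
    by simpa [hl] using key 2 (by omega), by simpa [hl] using key 3 (by omega),
    by simpa [hl] using key 4 (by omega), by simpa [hl] using key 5 (by omega),
    by simpa [hl] using key 6 (by omega)⟩

lemma intCast_ne {n : ℕ} (hn : 7 ≤ n) {a b : ℤ} (h1 : a < b) (h2 : b < a + 7) :
    (a : ZMod n) ≠ (b : ZMod n) := by
  intro h
  rw [ZMod.intCast_eq_intCast_iff_dvd_sub] at h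
  have := Int.le_of_dvd (by omega) h
  omega

/-- The new half cycle runs around the octagon on the other side, so its three inner turns change
sign, while the turns at both of its ends decrease by `s.sgn`. The shift by 3 accounts for the
rotation of the new word, which begins with the fourth letter of the new half cycle. -/
lemma ReplaceHalf.halfMove {n : ℕ} [NeZero n] {l l' : List Letter} (h : ReplaceHalf l l')
    (hn : l.length = n) (hr : IsReduced (l : Cycle Letter)) :
    7 ≤ n ∧ l'.length = n ∧ ∃ s τ', (∀ i, turns (lets n l') i = τ' (i + 3)) ∧
      HalfMove (turns (lets n l)) τ' s := by
  obtain ⟨s, s', x, w, h1, h2⟩ := h.exists_run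
  set y := ((turn s)^[4] x).inv with hy
  have hl := lets_numeral hn (w := w) (h1.trans (by rw [run_four, run_four]; rfl))
  obtain ⟨l0, l1, l2, l3, l4, l5, l6⟩ := hl
  have h7 : 7 ≤ n := by rw [← hn, h1]; simp; omega
  have t4 := turns_eq_iff (x := lets n l) (k := s'.sgn + s.sgn) three_add_one_eq_four.symm
  have hx4 : turn s' y = rot (s'.sgn + s.sgn) (turn s (turn s (turn s x))).inv := by
    rw [hy, turn, Letter.inv_inv, Function.iterate_succ_apply' _ 3, turn, rot_rot, add_comm]; rfl
  rw [l3, l4, hx4, eq_self_iff_true, iff_true] at t4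
  -- If the new half cycle ran around an octagon on the other side, the turn number 4 would be a
  -- backtracking.
  have hs : s' = s := by
    rcases Side.eq_or_eq_opp s s' with h | h
    · exact h
    · rw [h, Side.sgn_opp, neg_add_cancel] at t4
      exact absurd t4 ((hr.reducedTurns hn).ne_zero 4)
  subst hs
  set m := invWord (run s' ((turn s')^[5] x) 3) ++ (run s' y 4 ++ w) with hm
  have hmn : m.length = n := by rw [← hn, h1, hm, invWord]; simp; omega
  have hml : m.rotate 3 = l' := by
    rw [hm, h2]
    exact List.rotate_append_length_eq _ _
  have hm' := lets_numeral hmn (w := w) (x0 := ((turn s')^[7] x).inv)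
    (x1 := ((turn s')^[6] x).inv) (x2 := ((turn s')^[5] x).inv) (hm.trans (by rw [run_four]; rfl))
  obtain ⟨m0, m1, m2, m3, m4, m5, m6⟩ := hm'
  have cast_val : ∀ i : ZMod n, ((i.val : ℕ) : ZMod n) = i := ZMod.natCast_zmod_val
  have hsame : ∀ i : ZMod n, i ≠ 0 → i ≠ 1 → i ≠ 2 → i ≠ 3 → lets n m i = lets n l i := by
    intro i i0 i1 i2 i3
    have hi : 4 ≤ i.val := by
      by_contra hlt
      have := cast_val i
      obtain h | h | h | h : i.val = 0 ∨ i.val = 1 ∨ i.val = 2 ∨ i.val = 3 := by omega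
      all_goals rw [h] at this; push_cast at this
      exacts [i0 this.symm, i1 this.symm, i2 this.symm, i3 this.symm]
    rw [lets, lets, hm, h1, run_four, run_four, List.tail_cons]
    obtain ⟨k, hk⟩ := Nat.exists_eq_add_of_le hi
    rw [hk, add_comm 4 k]
    simp [run, invWord, List.range_succ]
  have hrot : ∀ i, turns (lets n l') i = turns (lets n m) (i + 3) := by
    intro i
    have h3 := turns_rotate hmn 3 i
    rwa [show (3 : ZMod n) = ((3 : ℕ) : ZMod n) by norm_cast, ZMod.val_natCast_of_lt (by omega),
      hml] at h3
  have ne : ∀ {a b : ℤ}, a < b → b < a + 7 → (a : ZMod n) ≠ (b : ZMod n) := intCast_ne h7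
  have t1 : ∀ {z : ZMod n → Letter} {i j : ZMod n} {k : ZMod 8}, j = i + 1 → z j = rot k (z i).inv →
      turns z j = k := fun h => (turns_eq_iff h).mpr
  refine ⟨h7, by rw [← hml, List.length_rotate, hmn], s', _, hrot, ?_⟩
  have d7 : ∀ s x, ((turn s)^[7] x).inv.angle = x.angle - s.sgn := by
    intro s; cases s <;> decide
  have d6 : ∀ s x, ((turn s)^[6] x).inv = rot (-s.sgn) ((turn s)^[7] x) := by
    intro s; cases s <;> decide
  have d5 : ∀ s x, ((turn s)^[5] x).inv = rot (-s.sgn) ((turn s)^[6] x) := by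
    intro s; cases s <;> decide
  have d4 : ∀ s x, ((turn s)^[4] x).inv = rot (-s.sgn) ((turn s)^[5] x) := by
    intro s; cases s <;> decide
  constructor
  · exact t1 (zero_add 1).symm (by rw [l1, l0]; rfl)
  · exact t1 (i := 1) (by norm_num) (by rw [l2, l1]; rfl)
  · exact t1 (i := 2) (by norm_num) (by rw [l3, l2]; rfl)
  · rw [two_mul]; exact t4
  · exact t1 (i := 4) (by norm_num) (by rw [l5, l4]; rfl)
  · exact t1 (i := 5) (by norm_num) (by rw [l6, l5]; rfl)
  · rw [turns, turns, m0, l0, hsame, d7]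
    · ring
    · have := ne (a := -1) (b := 0) (by norm_num) (by norm_num); push_cast at this; rwa [zero_sub]
    · have := ne (a := -1) (b := 1) (by norm_num) (by norm_num); push_cast at this; rwa [zero_sub]
    · have := ne (a := -1) (b := 2) (by norm_num) (by norm_num); push_cast at this; rwa [zero_sub]
    · have := ne (a := -1) (b := 3) (by norm_num) (by norm_num); push_cast at this; rwa [zero_sub]
  · exact t1 (zero_add 1).symm (by rw [m1, m0, Letter.inv_inv, d6])
  · exact t1 (i := 1) (by norm_num) (by rw [m2, m1, Letter.inv_inv, d5])
  · exact t1 (i := 2) (by norm_num) (by rw [m3, m2, Letter.inv_inv, hy, d4])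
  · exact t1 (i := 3) (by norm_num) (by rw [m4, m3]; rfl)
  · intro i i0 i1 i2 i3 i4
    rw [turns, turns, hsame i i0 i1 i2 i3, hsame (i - 1)]
    · intro h; apply i1; rw [sub_eq_zero.mp h]
    · intro h; apply i2; rw [sub_eq_iff_eq_add.mp h]; norm_num
    · intro h; apply i3; rw [sub_eq_iff_eq_add.mp h]; norm_num
    · intro h; apply i4; rw [sub_eq_iff_eq_add.mp h]; norm_num

/-- The places at which a window of turns with the property `P` begins. -/
def seen {n : ℕ} (τ : ZMod n → ZMod 8) (P : (ZMod n → ZMod 8) → Prop) : Set (ZMod n) :=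
  {j | P fun i => τ (j + i)}

/-- Three turns of a half cycle. -/
def HalfWindow {n : ℕ} (σ : ZMod n → ZMod 8) : Prop :=
  ∃ t, σ 0 = Side.sgn t ∧ σ 1 = t.sgn ∧ σ 2 = t.sgn

/-- The turns of a half cycle that has to be replaced. -/
def ReplaceableWindow {n : ℕ} (σ : ZMod n → ZMod 8) : Prop :=
  ∃ t, σ 0 = Side.sgn t ∧ σ 1 = t.sgn ∧ σ 2 = t.sgn ∧ σ 3 = 2 * t.sgn ∧ σ 4 = t.sgn ∧ σ 5 = t.sgn

lemma ncard_seen_shift {n : ℕ} [NeZero n] (τ : ZMod n → ZMod 8) (m : ZMod n)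
    (P : (ZMod n → ZMod 8) → Prop) :
    (seen (fun i => τ (i + m)) P).ncard = (seen τ P).ncard := by
  rw [← Set.ncard_image_of_injective _ (add_left_injective m)]
  congr 1
  ext j
  rw [Set.mem_image]
  constructor
  · rintro ⟨i, hi, rfl⟩
    change P fun k => τ (i + m + k)
    simp only [add_right_comm i m]
    exact hi
  · intro hj
    refine ⟨j - m, ?_, sub_add_cancel j m⟩
    change P fun k => τ (j - m + k + m)
    simp only [sub_add_eq_add_sub, add_sub_cancel_right]
    exact hj

lemma mem_half {n : ℕ} {τ : ZMod n → ZMod 8} {j : ZMod n} : j ∈ seen τ HalfWindow ↔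
    ∃ t, τ j = Side.sgn t ∧ τ (j + 1) = t.sgn ∧ τ (j + 2) = t.sgn := by
  rw [← add_zero j]
  simp only [seen, HalfWindow, Set.mem_ofPred_eq, add_zero]

lemma mem_replaceable {n : ℕ} {τ : ZMod n → ZMod 8} {j : ZMod n} : j ∈ seen τ ReplaceableWindow ↔
    ∃ t, τ j = Side.sgn t ∧ τ (j + 1) = t.sgn ∧ τ (j + 2) = t.sgn ∧ τ (j + 3) = 2 * t.sgn ∧
      τ (j + 4) = t.sgn ∧ τ (j + 5) = t.sgn := by
  rw [← add_zero j]
  simp only [seen, ReplaceableWindow, Set.mem_ofPred_eq, add_zero]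

namespace HalfMove

variable {n : ℕ} {τ τ' : ZMod n → ZMod 8} {s : Side}

lemma ne_sgn (h : HalfMove τ τ' s) (hr : ReducedTurns τ) : τ 0 ≠ s.sgn := by
  intro h0
  refine hr.four (-1) s ?_ ?_ ?_ ?_
  · rw [neg_add_cancel]; exact h0
  · rw [← h.t1]; congr 1; ring
  · rw [← h.t2]; congr 1; ring
  · rw [← h.t3]; congr 1; ring

/-- The window at 1 turns into one of the other side. Other windows that meet the changed turns did
not exist before, because of `ne_sgn` and the wide turn 4, except for the one that ends at 0. -/
lemma half_mem (h : HalfMove τ τ' s) (hr : ReducedTurns τ) {j : ZMod n}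
    (hj : j ∈ seen τ HalfWindow) (h2 : j ≠ -2) : j ∈ seen τ' HalfWindow := by
  rw [mem_half] at hj ⊢
  obtain ⟨t, a0, a1, a2⟩ := hj
  by_cases i0 : j = 0
  · subst i0
    simp only [zero_add] at a1
    rw [h.t1] at a1
    rw [← a1] at a0
    exact absurd a0 (h.ne_sgn hr)
  by_cases i1 : j = 1
  · subst i1
    refine ⟨s.opp, ?_, ?_, ?_⟩
    · simp [h.t1']
    · simp [one_add_one_eq_two, h.t2']
    · simp [show (1 + 2 : ZMod n) = 3 by norm_num, h.t3']
  by_cases i2 : j = 2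
  · subst i2
    rw [show (2 + 2 : ZMod n) = 4 by norm_num, h.t4] at a2
    exact absurd a2.symm (Side.sgn_ne_two _ _)
  by_cases i3 : j = 3
  · subst i3
    rw [show (3 + 1 : ZMod n) = 4 by norm_num, h.t4] at a1
    exact absurd a1.symm (Side.sgn_ne_two _ _)
  by_cases i4 : j = 4
  · subst i4
    rw [h.t4] at a0
    exact absurd a0.symm (Side.sgn_ne_two _ _)
  by_cases i5 : j = -1
  · subst i5
    rw [neg_add_cancel] at a1
    rw [show (-1 + 2 : ZMod n) = 1 by norm_num, h.t1] at a2
    rw [← a2] at a1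
    exact absurd a1 (h.ne_sgn hr)
  refine ⟨t, ?_, ?_, ?_⟩
  all_goals
    rw [h.same]
    · assumption
    all_goals
      intro e
      first
      | exact i0 (by linear_combination e) | exact i1 (by linear_combination e)
      | exact i2 (by linear_combination e) | exact i3 (by linear_combination e)
      | exact i4 (by linear_combination e) | exact i5 (by linear_combination e)
      | exact h2 (by linear_combination e)

lemma ne_small (hn : 7 ≤ n) {a : ℤ} (h : a = -2 ∨ a = -1 ∨ a = 5 ∨ a = 6) :
    (a : ZMod n) ≠ 0 ∧ (a : ZMod n) ≠ 1 ∧ (a : ZMod n) ≠ 2 ∧ (a : ZMod n) ≠ 3 ∧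
      (a : ZMod n) ≠ 4 := by
  have key : ∀ b : ℤ, 0 ≤ b → b ≤ 4 → (a : ZMod n) ≠ b := by
    intro b h1 h2
    rcases lt_or_ge a b with h3 | h3
    · exact intCast_ne hn h3 (by omega)
    · exact (intCast_ne hn (a := b) (b := a) (by omega) (by omega)).symm
  have h0 := key 0 (by norm_num) (by norm_num)
  have h1 := key 1 (by norm_num) (by norm_num)
  have h2 := key 2 (by norm_num) (by norm_num)
  have h3 := key 3 (by norm_num) (by norm_num)
  have h4 := key 4 (by norm_num) (by norm_num)
  push_cast at h0 h1 h2 h3 h4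
  exact ⟨h0, h1, h2, h3, h4⟩

lemma same_small (h : HalfMove τ τ' s) (hn : 7 ≤ n) {a : ℤ}
    (ha : a = -2 ∨ a = -1 ∨ a = 5 ∨ a = 6 := by norm_num) : τ' a = τ a := by
  obtain ⟨h0, h1, h2, h3, h4⟩ := ne_small hn ha
  exact h.same _ h0 h1 h2 h3 h4

lemma t5' (h : HalfMove τ τ' s) (hn : 7 ≤ n) : τ' 5 = s.sgn := by
  have := h.same_small hn (a := 5)
  push_cast at this
  rw [this, h.t5]

lemma t6' (h : HalfMove τ τ' s) (hn : 7 ≤ n) : τ' 6 = s.sgn := by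
  have := h.same_small hn (a := 6)
  push_cast at this
  rw [this, h.t6]

lemma four_mem (h : HalfMove τ τ' s) (hn : 7 ≤ n) : 4 ∈ seen τ' HalfWindow := by
  refine mem_half.mpr ⟨s, h.t4', ?_, ?_⟩
  · rw [← h.t5' hn]; congr 1; norm_num
  · rw [← h.t6' hn]; congr 1; norm_num

lemma four_not_mem (h : HalfMove τ τ' s) : 4 ∉ seen τ HalfWindow := by
  intro h4
  obtain ⟨t, a0, -⟩ := mem_half.mp h4
  rw [h.t4] at a0
  exact Side.sgn_ne_two _ _ a0.symm

/-- A half cycle appears at 4, and at most the one at −2 is lost. -/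
lemma half_le [NeZero n] (h : HalfMove τ τ' s) (hn : 7 ≤ n) (hr : ReducedTurns τ) :
    (seen τ HalfWindow).ncard < (seen τ' HalfWindow).ncard ∨
      (seen τ HalfWindow).ncard = (seen τ' HalfWindow).ncard ∧ -2 ∈ seen τ HalfWindow := by
  by_cases h2 : -2 ∈ seen τ HalfWindow
  · have hsub : insert 4 (seen τ HalfWindow \ {-2}) ⊆ seen τ' HalfWindow := by
      rintro j (rfl | ⟨hj, hj'⟩)
      · exact h.four_mem hn
      · exact h.half_mem hr hj hj'
    have h3 := Set.ncard_le_ncard hsub (Set.toFinite _)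
    rw [Set.ncard_insert_of_notMem (fun h4 => h.four_not_mem h4.1) (Set.toFinite _),
      Set.ncard_sdiff_singleton_add_one h2 (Set.toFinite _)] at h3
    rcases eq_or_lt_of_le h3 with h4 | h4
    · exact Or.inr ⟨h4, h2⟩
    · exact Or.inl h4
  · refine Or.inl (Set.ncard_lt_ncard ⟨fun j hj => h.half_mem hr hj ?_, fun h3 => ?_⟩
      (Set.toFinite _))
    · rintro rfl; exact h2 hj
    · exact h.four_not_mem (h3 (h.four_mem hn))

lemma before (h : HalfMove τ τ' s) (hr : ReducedTurns τ) (h2 : -2 ∈ seen τ HalfWindow) :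
    τ (-2) = -s.sgn ∧ τ (-1) = -s.sgn ∧ τ 0 = -s.sgn := by
  obtain ⟨t, a0, a1, a2⟩ := mem_half.mp h2
  rw [show (-2 + 1 : ZMod n) = -1 by norm_num] at a1
  rw [neg_add_cancel] at a2
  obtain rfl : t = s.opp := (Side.eq_or_eq_opp s t).resolve_left (by
    rintro rfl; exact h.ne_sgn hr a2)
  rw [Side.sgn_opp] at a0 a1 a2
  exact ⟨a0, a1, a2⟩

/-- If there was a half cycle at −2, the turn 0 has become `-2 * s.sgn`. This value and the sharp
turns 4, 5, 6 exclude new replaceable windows across the changed turns, except at 4, where the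
procedure continues. -/
lemma replaceable_mem (h : HalfMove τ τ' s) (hn : 7 ≤ n) (hr : ReducedTurns τ)
    (h2 : -2 ∈ seen τ HalfWindow) {j : ZMod n} (hj : j ∈ seen τ' ReplaceableWindow) :
    j = 4 ∨ j ∈ seen τ ReplaceableWindow ∧ j ≠ 1 := by
  obtain ⟨b2, b1, b0⟩ := h.before hr h2
  have c1 := h.same_small hn (a := -1)
  have c2 := h.same_small hn (a := -2)
  push_cast at c1 c2
  rw [b1] at c1
  rw [b2] at c2
  have c0 := h.t0'
  rw [b0] at c0
  have d0 : ∀ t : Side, -s.sgn - s.sgn ≠ t.sgn := by cases s <;> intro t <;> cases t <;> decide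
  rw [mem_replaceable] at hj ⊢
  obtain ⟨t, a0, a1, a2, a3, a4, a5⟩ := hj
  by_cases i4 : j = 4
  · exact Or.inl i4
  by_cases i0 : j = 0
  · subst i0
    rw [c0] at a0
    exact absurd a0 (d0 t)
  by_cases i1 : j = 1
  · subst i1
    rw [h.t1'] at a0
    rw [show (1 + 3 : ZMod n) = 4 by norm_num, h.t4'] at a3
    exact absurd a3 (Side.sgn_ne_two _ _)
  by_cases i2 : j = 2
  · subst i2
    rw [show (2 + 3 : ZMod n) = 5 by norm_num, h.t5' hn] at a3
    exact absurd a3 (Side.sgn_ne_two _ _)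
  by_cases i3 : j = 3
  · subst i3
    rw [show (3 + 3 : ZMod n) = 6 by norm_num, h.t6' hn] at a3
    exact absurd a3 (Side.sgn_ne_two _ _)
  by_cases i5 : j = -1
  · subst i5
    rw [neg_add_cancel, c0] at a1
    exact absurd a1 (d0 t)
  by_cases i6 : j = -2
  · subst i6
    rw [neg_add_cancel, c0] at a2
    exact absurd a2 (d0 t)
  by_cases i7 : j = -3
  · subst i7
    rw [show (-3 + 1 : ZMod n) = -2 by norm_num, c2] at a1
    rw [h.same _ i0 i1 i2 i3 i4, ← a1, ← Side.sgn_opp] at a0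
    rw [← Side.sgn_opp] at b0 b1 b2
    refine absurd ?_ (hr.four (-4) s.opp ?_ ?_ ?_)
    · rw [← b0]; congr 1; norm_num
    · rw [← a0]; congr 1; norm_num
    · rw [← b2]; congr 1; norm_num
    · rw [← b1]; congr 1; norm_num
  by_cases i8 : j = -4
  · subst i8
    rw [show (-4 + 3 : ZMod n) = -1 by norm_num, c1, ← Side.sgn_opp] at a3
    exact absurd a3 (Side.sgn_ne_two _ _)
  by_cases i9 : j = -5
  · subst i9
    rw [neg_add_cancel, c0] at a5
    exact absurd a5 (d0 t)
  refine Or.inr ⟨⟨t, ?_, ?_, ?_, ?_, ?_, ?_⟩, i1⟩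
  all_goals
    rw [← h.same]
    · assumption
    all_goals
      intro e
      first
      | exact i0 (by linear_combination e) | exact i1 (by linear_combination e)
      | exact i2 (by linear_combination e) | exact i3 (by linear_combination e)
      | exact i4 (by linear_combination e) | exact i5 (by linear_combination e)
      | exact i6 (by linear_combination e) | exact i7 (by linear_combination e)
      | exact i8 (by linear_combination e) | exact i9 (by linear_combination e)

lemma one_mem (h : HalfMove τ τ' s) : 1 ∈ seen τ ReplaceableWindow := by
  refine mem_replaceable.mpr ⟨s, h.t1, ?_, ?_, ?_, ?_, ?_⟩
  · rw [← h.t2]; congr 1; norm_num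
  · rw [← h.t3]; congr 1; norm_num
  · rw [← h.t4]; congr 1; norm_num
  · rw [← h.t5]; congr 1; norm_num
  · rw [← h.t6]; congr 1; norm_num

lemma ncard_turns_lt [NeZero n] (h : HalfMove τ τ' s) (hn : 7 ≤ n) (hr : ReducedTurns τ)
    (h2 : -2 ∈ seen τ HalfWindow) : {j | τ' j = s.sgn}.ncard < {j | τ j = s.sgn}.ncard := by
  obtain ⟨b2, b1, b0⟩ := h.before hr h2
  have c0 := h.t0'
  rw [b0] at c0
  have d0 : -s.sgn - s.sgn ≠ s.sgn := by cases s <;> decide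
  have d1 : -s.sgn ≠ s.sgn := by cases s <;> decide
  have h12 : (2 : ZMod n) ≠ 1 := by
    have := intCast_ne hn (a := 1) (b := 2) (by norm_num) (by norm_num)
    push_cast at this
    exact this.symm
  -- The turns 1, 2, 3 are lost and only the turn 4 is gained; two of the losses suffice for the
  -- inequality.
  have hsub : {j | τ' j = s.sgn} ⊆ insert 4 (({j | τ j = s.sgn} \ {1}) \ {2}) := by
    intro j hj
    change τ' j = _ at hj
    by_cases i4 : j = 4
    · exact Or.inl i4
    by_cases i0 : j = 0
    · subst i0; exact absurd (c0.symm.trans hj) d0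
    by_cases i1 : j = 1
    · subst i1; exact absurd (h.t1'.symm.trans hj) d1
    by_cases i2 : j = 2
    · subst i2; exact absurd (h.t2'.symm.trans hj) d1
    by_cases i3 : j = 3
    · subst i3; exact absurd (h.t3'.symm.trans hj) d1
    exact Or.inr ⟨⟨(h.same j i0 i1 i2 i3 i4).symm.trans hj, i1⟩, i2⟩
  have h3 := Set.ncard_le_ncard hsub (Set.toFinite _)
  have h4 := Set.ncard_insert_le 4 (({j | τ j = s.sgn} \ {1}) \ {2})
  have h5 := Set.ncard_sdiff_singleton_add_one (s := {j | τ j = s.sgn}) (a := 1) h.t1 (Set.toFinite _)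
  have h6 := Set.ncard_sdiff_singleton_add_one (s := {j | τ j = s.sgn} \ {1}) (a := 2)
    ⟨h.t2, h12⟩ (Set.toFinite _)
  omega

/-- The effect of the replacement of a half cycle on the numbers of half cycles, of replaceable half
cycles and of turns. -/
theorem descent [NeZero n] (h : HalfMove τ τ' s) (hn : 7 ≤ n) (hr : ReducedTurns τ) :
    (seen τ HalfWindow).ncard < (seen τ' HalfWindow).ncard ∨
      (seen τ HalfWindow).ncard = (seen τ' HalfWindow).ncard ∧
        ((seen τ' ReplaceableWindow).ncard < (seen τ ReplaceableWindow).ncard ∨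
          (seen τ' ReplaceableWindow).ncard = (seen τ ReplaceableWindow).ncard ∧
            4 ∈ seen τ' ReplaceableWindow ∧
            {j | τ' j = s.sgn}.ncard < {j | τ j = s.sgn}.ncard) := by
  refine (h.half_le hn hr).imp_right fun ⟨h1, h2⟩ => ⟨h1, ?_⟩
  have h3 := Set.ncard_sdiff_singleton_add_one h.one_mem (Set.toFinite _)
  by_cases h4 : 4 ∈ seen τ' ReplaceableWindow
  · have hsub : seen τ' ReplaceableWindow ⊆ insert 4 (seen τ ReplaceableWindow \ {1}) :=
      fun j hj => h.replaceable_mem hn hr h2 hj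
    have h5 := Set.ncard_le_ncard hsub (Set.toFinite _)
    have h6 := Set.ncard_insert_le 4 (seen τ ReplaceableWindow \ {1})
    rcases Nat.lt_or_ge (seen τ' ReplaceableWindow).ncard (seen τ ReplaceableWindow).ncard with h7 | h7
    · exact Or.inl h7
    · exact Or.inr ⟨by omega, h4, h.ncard_turns_lt hn hr h2⟩
  · have hsub : seen τ' ReplaceableWindow ⊆ seen τ ReplaceableWindow \ {1} := fun j hj =>
      (h.replaceable_mem hn hr h2 hj).resolve_left (by rintro rfl; exact h4 hj)
    have h5 := Set.ncard_le_ncard hsub (Set.toFinite _)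
    exact Or.inl (by omega)

end HalfMove

end SurfaceSnakes

end


noncomputable section
namespace SurfaceSnakes

/-! ### The algorithm -/

lemma ncard_seen_isRotated {l l' : List Letter} (h : l ~r l')
    (P : ∀ n, (ZMod n → ZMod 8) → Prop) :
    (seen (turns (lets l.length l)) (P _)).ncard = (seen (turns (lets l'.length l')) (P _)).ncard := by
  obtain ⟨m, rfl⟩ := h
  rcases eq_or_ne l [] with rfl | hl
  · rw [List.rotate_nil]
  have : NeZero l.length := ⟨by simpa using hl⟩
  have h1 : turns (lets l.length (l.rotate m)) =
      fun i => turns (lets l.length l) (i + (m : ZMod l.length)) := by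
    funext i
    rw [← turns_rotate rfl, ZMod.val_natCast, List.rotate_mod]
  rw [List.length_rotate, h1, ncard_seen_shift]

/-- The number of windows of turns with the property `P` in a cyclic word. -/
def windowCount (P : ∀ n, (ZMod n → ZMod 8) → Prop) (w : Cycle Letter) : ℕ :=
  Quotient.lift (s := List.IsRotated.setoid Letter) (fun l : List Letter => (seen (turns (lets l.length l)) (P _)).ncard)
    (fun _ _ h => ncard_seen_isRotated h P) w

lemma windowCount_coe (P : ∀ n, (ZMod n → ZMod 8) → Prop) {n : ℕ} {l : List Letter}
    (hn : l.length = n) :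
    windowCount P (l : Cycle Letter) = (seen (turns (lets n l)) (P _)).ncard := by
  subst hn; rfl

/-- The number of half cycles in a cyclic word. -/
def halfCount : Cycle Letter → ℕ := windowCount fun _ => HalfWindow

/-- The number of half cycles in a cyclic word that have to be replaced. -/
def replaceableCount : Cycle Letter → ℕ := windowCount fun _ => ReplaceableWindow

lemma halfCount_le (w : Cycle Letter) (hw : 0 < w.length) : halfCount w ≤ w.length := by
  induction w using Quotient.inductionOn with
  | h l =>
    change 0 < l.length at hw
    have : NeZero l.length := ⟨hw.ne'⟩
    have h1 := Set.ncard_le_card (seen (turns (lets l.length l)) HalfWindow)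
    rwa [Nat.card_zmod] at h1

/-- The half cycle at the beginning of a word has to be replaced. -/
def HeadReplaceable (l : List Letter) : Prop :=
  1 ∈ seen (turns (lets l.length l)) ReplaceableWindow

/-- The number of turns of a word that are equal to the first one. -/
def headCount (l : List Letter) : ℕ :=
  {j | turns (lets l.length l) j = turns (lets l.length l) 1}.ncard

lemma headReplaceable_iff {n : ℕ} {l : List Letter} (hn : l.length = n) :
    HeadReplaceable l ↔ 1 ∈ seen (turns (lets n l)) ReplaceableWindow := by
  subst hn; rfl

lemma headCount_eq {n : ℕ} {l : List Letter} (hn : l.length = n) :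
    headCount l = {j | turns (lets n l) j = turns (lets n l) 1}.ncard := by
  subst hn; rfl

open Classical in
/-- The rank decreases with every move of the first three steps of the algorithm. -/
def rank : Config → ℕ ×ₗ ℕ ×ₗ ℕ ×ₗ ℕ
  -- The added constants order the steps for words of equal length: 3 for the first step, 2 for the
  -- second, at most 1 for the third. Words that are not reduced get 0, since their next shortening
  -- lowers the length. In the last entry, a head count is at most the length, the third step has
  -- the length plus 1, and a follow-up whose half cycle is not replaceable has the length plus 2,
  -- as it leads back to the third step.
  | .step1 w => toLex (w.length, toLex (w.length + 3, toLex (0, 0)))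
  | .step2 w => if IsReduced w then toLex (w.length, toLex (w.length + 2, toLex (0, 0)))
      else toLex (w.length, toLex (0, toLex (0, 0)))
  | .step3 w => toLex (w.length, toLex (w.length - halfCount w + 1,
      toLex (replaceableCount w, w.length + 1)))
  | .follow l => if IsReduced (l : Cycle Letter) then
      toLex (l.length, toLex (l.length - halfCount l + 1, toLex (replaceableCount l,
        if HeadReplaceable l then headCount l else l.length + 2)))
      else toLex (l.length, toLex (0, toLex (0, 1)))
  | _ => toLex (0, toLex (0, toLex (0, 0)))

lemma Cancel.length_lt {w w' : Cycle Letter} (h : Cancel w w') : w'.length < w.length := by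
  cases h; simp

lemma Complementary.length_add {u v : List Letter} (h : Complementary u v) :
    u.length + v.length = 8 := by
  obtain ⟨s, x, h⟩ := h.eq_run
  simpa [invWord] using congrArg List.length h

lemma ReplaceLong.length_lt {w w' : Cycle Letter} (h : ReplaceLong w w') :
    w'.length < w.length := by
  obtain @⟨u, v, w, hu, huv⟩ := h
  have := huv.length_add
  simp
  omega

/-- A cyclic word represents the conjugacy class of `g`. -/
def Represents (w : Cycle Letter) (g : G) : Prop :=
  ∀ l : List Letter, (l : Cycle Letter) = w → IsConj g (evalWord l)

lemma represents_coe {l : List Letter} {g : G} :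
    Represents (l : Cycle Letter) g ↔ IsConj g (evalWord l) :=
  ⟨fun h => h l rfl, fun h _ h' =>
    h.trans (isConj_evalWord_of_isRotated (Cycle.coe_eq_coe.mp h').symm)⟩

lemma Represents.cancel {w w' : Cycle Letter} {g : G} (h : Represents w g) (hc : Cancel w w') :
    Represents w' g := by
  cases hc with
  | mk x w =>
    rw [represents_coe] at h ⊢
    rwa [evalWord_cons, evalWord_cons, toG_inv, mul_inv_cancel_left] at h

lemma Represents.replaceLong {w w' : Cycle Letter} {g : G} (h : Represents w g)
    (hc : ReplaceLong w w') : Represents w' g := by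
  obtain @⟨u, v, w, hu, huv⟩ := hc
  rw [represents_coe] at h ⊢
  rwa [evalWord_append, huv.evalWord_eq, ← evalWord_append] at h

lemma Represents.replaceHalf {l l' : List Letter} {g : G} (h : Represents (l : Cycle Letter) g)
    (hc : ReplaceHalf l l') : Represents (l' : Cycle Letter) g := by
  obtain ⟨u, v, t, w, y, hu, huv, ht, hyt⟩ := hc
  rw [represents_coe] at h ⊢
  refine h.trans ?_
  rw [List.append_assoc, evalWord_append, huv.evalWord_eq, ← evalWord_append, List.append_assoc]
  refine isConj_evalWord_of_isRotated ⟨v.length, ?_⟩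
  rw [List.rotate_append_length_eq]
  simp

/-- What remains true while the algorithm, started with a word that represents the conjugacy class
of `g`, is running. -/
def Good (g : G) : Config → Prop
  | .step1 w | .step2 w => Represents w g
  | .step3 w => Represents w g ∧ IsReduced w
  | .follow l => Represents (l : Cycle Letter) g ∧ 7 ≤ l.length
  | .step4 w => Represents w g ∧ IsReduced w ∧
      ¬ ∃ v v' : List Letter, (v : Cycle Letter) = w ∧ ReplaceHalf v v'
  | .step5 t S => ∃ e τ n, IsPeriodic e τ n t ∧ Partial e τ t S ∧ IsConj g t
  | .output S => ∃ e τ n t, IsPeriodic e τ n t ∧ S = trackEdges (IsPath.track e τ) ∧ IsConj g t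

lemma Represents.ne_nil {l : List Letter} {g : G} (hg : g ≠ 1)
    (h : Represents (l : Cycle Letter) g) : l ≠ [] := by
  rintro rfl
  rw [represents_coe, evalWord_nil, isConj_one_left] at h
  exact hg h

lemma ReplaceHalf.seven_le {l l' : List Letter} (h : ReplaceHalf l l') :
    7 ≤ l.length ∧ l'.length = l.length := by
  obtain ⟨s, s', x, w, h1, h2⟩ := h.exists_run
  rw [h1, h2]
  simp [invWord]
  omega

lemma Good.move {g : G} (hg : g ≠ 1) {c c' : Config} (h : Good g c) (hm : Move c c') :
    Good g c' := by
  cases hm with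
  | cancel hc => exact Represents.cancel h hc
  | cancel_done _ => exact h
  | shorten hc => exact hc.elim (Represents.cancel h) (Represents.replaceLong h)
  | shorten_done hr => exact ⟨h, hr⟩
  | half hc => exact ⟨Represents.replaceHalf h.1 hc, hc.seven_le.2 ▸ hc.seven_le.1⟩
  | follow_shorten _ => exact h.1
  | follow_half _ hc => exact ⟨Represents.replaceHalf h.1 hc, hc.seven_le.2 ▸ hc.seven_le.1⟩
  | follow_done hr _ => exact ⟨h.1, hr⟩
  | half_done hn => exact ⟨h.1, h.2, hn⟩
  | @lift l E hE =>
    obtain ⟨h1, h2, h3⟩ := h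
    have hl := Represents.ne_nil hg h1
    have : NeZero l.length := ⟨by simpa using hl⟩
    have hp := hE.isPeriodic hl (tight_of_reduced rfl h2 h3)
    refine ⟨_, _, _, hp, ?_, ?_⟩
    · rw [hE.pathEdges_eq hl]
      exact hp.partial_path
    · rw [represents_coe] at h1
      refine h1.trans (isConj_iff.mpr ⟨E 0, ?_⟩)
      rw [period, hE.eval]
  | complete hc =>
    obtain ⟨e, τ, n, h1, h2, h3⟩ := h
    exact ⟨e, τ, n, h1, (h1.complete h2 hc).1, h3⟩
  | complete_done hn =>
    obtain ⟨e, τ, n, h1, h2, h3⟩ := h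
    exact ⟨e, τ, n, _, h1, h1.eq_trackEdges h2 hn, h3⟩

lemma Good.progress {g : G} (hg : g ≠ 1) {c : Config} (h : Good g c) :
    (∃ c', Move c c') ∨ ∃ S, c = .output S := by
  cases c with
  | step1 w =>
    by_cases h1 : ∃ w', Cancel w w'
    · exact Or.inl ⟨_, .cancel h1.choose_spec⟩
    · exact Or.inl ⟨_, .cancel_done h1⟩
  | step2 w =>
    by_cases h1 : IsReduced w
    · exact Or.inl ⟨_, .shorten_done h1⟩
    · obtain ⟨w', h1⟩ := not_not.mp h1
      exact Or.inl ⟨_, .shorten h1⟩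
  | step3 w =>
    by_cases h1 : ∃ v v' : List Letter, (v : Cycle Letter) = w ∧ ReplaceHalf v v'
    · obtain ⟨v, v', rfl, h1⟩ := h1
      exact Or.inl ⟨_, .half h1⟩
    · exact Or.inl ⟨_, .half_done h1⟩
  | follow l =>
    by_cases h1 : IsReduced (l : Cycle Letter)
    · by_cases h2 : ∃ l', ReplaceHalf l l'
      · exact Or.inl ⟨_, .follow_half h1 h2.choose_spec⟩
      · exact Or.inl ⟨_, .follow_done h1 h2⟩
    · exact Or.inl ⟨_, .follow_shorten h1⟩
  | step4 w =>
    induction w using Quotient.inductionOn with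
    | h l =>
      obtain ⟨E, hE, -⟩ := exists_readsOff (Represents.ne_nil hg h.1) 1
      exact Or.inl ⟨_, .lift hE⟩
  | step5 t S =>
    by_cases h1 : ∃ S', Complete t S S'
    · exact Or.inl ⟨_, .complete h1.choose_spec⟩
    · exact Or.inl ⟨_, .complete_done h1⟩
  | output S => exact Or.inr ⟨S, rfl⟩

/-- The algorithm cannot go on forever from `c`. -/
abbrev Halts (c : Config) : Prop := Acc (fun c' c => Move c c') c

lemma halts_step5 {e : ℤ → DEdge} {τ : ℤ → ZMod 8} {n : ℕ} {t : G} (h : IsPeriodic e τ n t)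
    {S : Set (Sym2 G)} (hS : Partial e τ t S) : Halts (.step5 t S) := by
  induction hm : (missing e n S).ncard using Nat.strong_induction_on generalizing S with
  | h m ih =>
    subst hm
    refine ⟨_, fun c hc => ?_⟩
    cases hc with
    | complete hc =>
      obtain ⟨h1, h2⟩ := h.complete hS hc
      exact ih _ h2 h1 rfl
    | complete_done _ => exact ⟨_, fun c hc => nomatch hc⟩

lemma halts_step4 {g : G} (hg : g ≠ 1) {w : Cycle Letter} (h : Good g (.step4 w)) :
    Halts (.step4 w) := by
  refine ⟨_, fun c hc => ?_⟩
  have h1 := h.move hg hc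
  cases hc with
  | lift hE =>
    obtain ⟨e, τ, n, h2, h3, -⟩ := h1
    exact halts_step5 h2 h3

lemma lex_lt_iff {p p' q q' r r' t t' : ℕ} :
    toLex (p, toLex (q, toLex (r, t))) < toLex (p', toLex (q', toLex (r', t'))) ↔
      p < p' ∨ p = p' ∧ (q < q' ∨ q = q' ∧ (r < r' ∨ r = r' ∧ t < t')) := by
  simp only [Prod.Lex.toLex_lt_toLex]

lemma HeadReplaceable.exists_replaceHalf {l : List Letter} (hl : 7 ≤ l.length)
    (h : HeadReplaceable l) : ∃ l', ReplaceHalf l l' := by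
  have : NeZero l.length := ⟨by omega⟩
  obtain ⟨t, h1, h2, h3, h4, h5, h6⟩ := mem_replaceable.mp h
  refine SurfaceSnakes.exists_replaceHalf rfl hl (s := t) (fun j hj => ?_) ?_ ?_ ?_
  · obtain rfl | rfl | rfl : j = 0 ∨ j = 1 ∨ j = 2 := by omega
    · rw [Nat.cast_zero, zero_add]; exact h1
    · rw [Nat.cast_one]; exact h2
    · rw [← h3]; congr 1; rw [Nat.cast_two, add_comm]
  · rw [← h4]; congr 1; norm_num
  · rw [← h5]; congr 1; norm_num
  · rw [← h6]; congr 1; norm_num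

/-- The replacement of a half cycle decreases the rank. -/
lemma ReplaceHalf.rank_lt {l l' : List Letter} (h : ReplaceHalf l l')
    (hr : IsReduced (l : Cycle Letter)) :
    HeadReplaceable l ∧ ∀ p, headCount l ≤ p → rank (.follow l') < toLex (l.length,
      toLex (l.length - halfCount l + 1, toLex (replaceableCount l, p))) := by
  have h7 := h.seven_le.1
  obtain ⟨n, hn⟩ : ∃ n, l.length = n := ⟨_, rfl⟩
  have : NeZero n := ⟨by omega⟩
  obtain ⟨hn7, hn', s, τ', hτ', hm⟩ := h.halfMove hn hr
  refine ⟨(headReplaceable_iff hn).mpr hm.one_mem, fun p hp => ?_⟩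
  by_cases hr' : IsReduced (l' : Cycle Letter)
  · rw [rank, if_pos hr']
    have hsh : turns (lets n l') = fun i => τ' (i + 3) := funext hτ'
    have e1 : halfCount l' = (seen τ' HalfWindow).ncard := by
      rw [halfCount, windowCount_coe _ hn', hsh, ncard_seen_shift]
    have e2 : replaceableCount l' = (seen τ' ReplaceableWindow).ncard := by
      rw [replaceableCount, windowCount_coe _ hn', hsh, ncard_seen_shift]
    have e3 : HeadReplaceable l' ↔ 4 ∈ seen τ' ReplaceableWindow := by
      have h4 : (1 + 3 : ZMod n) = 4 := by norm_num
      rw [headReplaceable_iff hn', hsh, ← h4]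
      simp only [mem_replaceable, add_right_comm _ _ (3 : ZMod n)]
    have e4 : headCount l' = {j | τ' j = s.sgn}.ncard := by
      rw [headCount_eq hn', hsh, ← hm.t4']
      beta_reduce
      rw [show (1 + 3 : ZMod n) = 4 by norm_num,
        ← Set.ncard_image_of_injective {j | τ' (j + 3) = τ' 4} (add_left_injective (3 : ZMod n))]
      congr 1
      ext j
      constructor
      · rintro ⟨i, hi, rfl⟩; exact hi
      · intro hj
        exact ⟨j - 3, by simpa using hj, sub_add_cancel j 3⟩
    have e5 : headCount l = {j | turns (lets n l) j = s.sgn}.ncard := by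
      rw [headCount_eq hn, hm.t1]
    have hle := halfCount_le (l' : Cycle Letter) (by rw [Cycle.length_coe]; omega)
    rw [Cycle.length_coe, hn', e1] at hle
    rw [lex_lt_iff, e1, e2, hn, hn', halfCount, replaceableCount, windowCount_coe _ hn,
      windowCount_coe _ hn]
    refine Or.inr ⟨rfl, ?_⟩
    rcases hm.descent hn7 (hr.reducedTurns hn) with h1 | ⟨h1, h2⟩
    · exact Or.inl (by omega)
    · refine Or.inr ⟨by rw [h1], h2.imp_right fun ⟨h3, h4, h5⟩ => ⟨h3, ?_⟩⟩
      rw [if_pos (e3.mpr h4)]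
      omega
  · rw [rank, if_neg hr', lex_lt_iff]
    exact Or.inr ⟨by omega, Or.inl (by omega)⟩

theorem Good.halts {g : G} (hg : g ≠ 1) {c : Config} (h : Good g c) : Halts c := by
  induction hr : rank c using WellFoundedLT.induction generalizing c with
  | ind r ih =>
    subst hr
    refine ⟨_, fun c' hm => ?_⟩
    have h' := h.move hg hm
    cases hm with
    | cancel hc =>
      refine ih _ ?_ h' rfl
      rw [rank, rank, lex_lt_iff]
      exact Or.inl hc.length_lt
    | cancel_done _ =>
      refine ih _ ?_ h' rfl
      rw [rank, rank]
      split_ifs <;> rw [lex_lt_iff] <;> exact Or.inr ⟨rfl, Or.inl (by omega)⟩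
    | @shorten w w' hc =>
      refine ih _ ?_ h' rfl
      have hlt : w'.length < w.length := hc.elim Cancel.length_lt ReplaceLong.length_lt
      rw [rank, rank]
      split_ifs <;> rw [lex_lt_iff] <;> exact Or.inl hlt
    | shorten_done hr =>
      refine ih _ ?_ h' rfl
      rw [rank, rank, if_pos hr, lex_lt_iff]
      exact Or.inr ⟨rfl, Or.inl (by omega)⟩
    | @half l l' hc =>
      refine ih _ ?_ h' rfl
      refine (hc.rank_lt h.2).2 (l.length + 1) ?_
      have : NeZero l.length := ⟨by have := hc.seven_le.1; omega⟩
      have h1 := Set.ncard_le_card {j | turns (lets l.length l) j = turns (lets l.length l) 1}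
      rw [Nat.card_zmod] at h1
      exact h1.trans (by omega)
    | follow_shorten hr =>
      refine ih _ ?_ h' rfl
      rw [rank, rank, if_neg hr, if_neg hr, lex_lt_iff]
      exact Or.inr ⟨rfl, Or.inr ⟨rfl, Or.inr ⟨rfl, by norm_num⟩⟩⟩
    | follow_half hr hc =>
      refine ih _ ?_ h' rfl
      obtain ⟨h1, h2⟩ := hc.rank_lt hr
      conv_rhs => rw [rank, if_pos hr, if_pos h1]
      exact h2 _ le_rfl
    | follow_done hr hn =>
      refine ih _ ?_ h' rfl
      rw [rank, rank, if_pos hr, if_neg fun h1 => hn (h1.exists_replaceHalf h.2), lex_lt_iff]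
      exact Or.inr ⟨rfl, Or.inr ⟨rfl, Or.inr ⟨rfl, by simp⟩⟩⟩
    | half_done hn => exact halts_step4 hg h'
    | lift hE =>
      obtain ⟨e, τ, n, h2, h3, -⟩ := h'
      exact halts_step5 h2 h3
    | complete hc =>
      obtain ⟨e, τ, n, h2, h3, -⟩ := h'
      exact halts_step5 h2 h3
    | complete_done _ => exact ⟨_, fun c hc => nomatch hc⟩

lemma Good.of_reaches {w : List Letter} (hw : evalWord w ≠ 1) {c : Config}
    (h : Reaches (w : Cycle Letter) c) : Good (evalWord w) c := by
  induction h with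
  | refl => exact represents_coe.mpr (IsConj.refl _)
  | tail _ hm ih => exact ih.move hw hm

theorem terminates {w : List Letter} (hw : evalWord w ≠ 1) : Terminates (w : Cycle Letter) := by
  refine ⟨?_, fun c hc => (Good.of_reaches hw hc).progress hw⟩
  rintro ⟨c, h0, hc⟩
  have key : ∀ d, Halts d → ∀ n, c n ≠ d := by
    intro d hd
    induction hd with
    | intro d _ ih =>
      rintro n rfl
      exact ih _ (hc n) (n + 1) rfl
  exact key _ ((Good.of_reaches hw (.refl)).halts hw) 0 h0

end SurfaceSnakes

end


noncomputable section
namespace SurfaceSnakes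

/-! ### Limit points -/

/-- This is the invariance of |z − w|² / ((1 − |z|²)(1 − |w|²)), a function of the hyperbolic
distance. -/
lemma normSq_mob_sub {M : Matrix.SpecialLinearGroup (Fin 2) ℂ} (hM : M ∈ su11) {z w : ℂ}
    (hz : Complex.normSq z < 1) (hw : Complex.normSq w < 1) :
    Complex.normSq (mob M z - mob M w) * ((1 - Complex.normSq z) * (1 - Complex.normSq w)) =
      Complex.normSq (z - w) *
        ((1 - Complex.normSq (mob M z)) * (1 - Complex.normSq (mob M w))) := by
  have h1 := den_ne_zero hM hz
  have h2 := den_ne_zero hM hw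
  have hdet : M 0 0 * M 1 1 - M 0 1 * M 1 0 = 1 := by
    have := M.det_coe
    rwa [Matrix.det_fin_two] at this
  have key : mob M z - mob M w = (z - w) / (den M z * den M w) := by
    change (M 0 0 * z + M 0 1) / den M z - (M 0 0 * w + M 0 1) / den M w = _
    rw [div_sub_div _ _ h1 h2]
    congr 1
    rw [den, den]
    linear_combination (z - w) * hdet
  rw [key, one_sub_normSq_mob hM hz, one_sub_normSq_mob hM hw, Complex.normSq_div,
    Complex.normSq_mul]
  ring

/-- Points from a fixed compact part of the disc get close to each other in the Euclidean metric
when an isometry moves them towards the boundary circle. -/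
lemma normSq_mob_sub_le {M : Matrix.SpecialLinearGroup (Fin 2) ℂ} (hM : M ∈ su11) {z w : ℂ}
    (hz : Complex.normSq z < 1) (hw : Complex.normSq w < 1) {δ : ℝ} (hδ : 0 < δ)
    (hzδ : δ ≤ 1 - Complex.normSq z) (hwδ : δ ≤ 1 - Complex.normSq w) :
    Complex.normSq (mob M z - mob M w) ≤ 4 / δ ^ 2 * (1 - Complex.normSq (mob M z)) := by
  have h1 := normSq_mob_sub hM hz hw
  have h2 := normSq_mob_lt hM hz
  have h3 : Complex.normSq (z - w) ≤ 4 := by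
    have h4 : ‖z - w‖ ≤ 2 := (norm_sub_le _ _).trans (by
      have := normSq_lt_one_iff.mp hz
      have := normSq_lt_one_iff.mp hw
      linarith)
    rw [Complex.normSq_eq_norm_sq]
    nlinarith [norm_nonneg (z - w)]
  have h5 := Complex.normSq_nonneg (mob M w)
  have h6 := Complex.normSq_nonneg (mob M z - mob M w)
  have h7 := normSq_mob_lt hM hw
  rw [div_mul_eq_mul_div, le_div_iff₀ (by positivity)]
  calc Complex.normSq (mob M z - mob M w) * δ ^ 2
      ≤ Complex.normSq (mob M z - mob M w) * ((1 - Complex.normSq z) * (1 - Complex.normSq w)) := by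
        rw [sq]
        gcongr
    _ = Complex.normSq (z - w) *
        ((1 - Complex.normSq (mob M z)) * (1 - Complex.normSq (mob M w))) := h1
    _ ≤ 4 * ((1 - Complex.normSq (mob M z)) * 1) := by
        have h9 : 0 ≤ 1 - Complex.normSq (mob M z) := by linarith
        exact mul_le_mul h3 (mul_le_mul_of_nonneg_left (by linarith) h9)
          (mul_nonneg h9 (by linarith)) (by norm_num)
    _ = _ := by ring

lemma segment_subset_disc (g : G) : segment ℝ 0 (position g) ⊆ {z | Complex.normSq z < 1} := by
  intro z hz
  have h := (convex_ball (0 : ℂ) 1).segment_subset (x := 0) (y := position g) (by simp)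
    (by simpa using normSq_lt_one_iff.mp (normSq_position g)) hz
  exact normSq_lt_one_iff.mpr (by simpa using h)

lemma segmentOf_subset_disc (e : DEdge) : segmentOf e ⊆ {z | Complex.normSq z < 1} := by
  rintro _ ⟨z, hz, rfl⟩
  exact normSq_act_lt _ (segment_subset_disc _ hz)

lemma isCompact_segmentOf (e : DEdge) : IsCompact (segmentOf e) := by
  refine IsCompact.image_of_continuousOn ?_ ((continuousOn_act e.1).mono (segment_subset_disc _))
  rw [segment_eq_image_lineMap]
  exact isCompact_Icc.image (by fun_prop)

lemma act_mem_segmentOf {g : G} {e : DEdge} {z : ℂ} (hz : z ∈ segmentOf e) :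
    act g z ∈ segmentOf (shift g e) := by
  obtain ⟨v, hv, rfl⟩ := hz
  exact ⟨v, hv, act_mul _ _ (segment_subset_disc _ hv)⟩

lemma shift_inv_shift (g : G) (e : DEdge) : shift g (shift g⁻¹ e) = e :=
  Prod.ext (mul_inv_cancel_left _ _) rfl

lemma exists_act_eq {g : G} {e : DEdge} {z : ℂ} (hz : z ∈ segmentOf (shift g e)) :
    ∃ w ∈ segmentOf e, z = act g w := by
  obtain ⟨v, hv, rfl⟩ := hz
  exact ⟨act e.1 v, ⟨v, hv, rfl⟩, act_mul _ _ (segment_subset_disc _ hv)⟩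

lemma exists_lower_bound {F : Set (Sym2 G)} (hF : F.Finite) :
    ∃ δ > 0, ∀ e : DEdge, e.edge ∈ F → ∀ z ∈ segmentOf e, δ ≤ 1 - Complex.normSq z := by
  have hD : (DEdge.edge ⁻¹' F).Finite := by
    refine hF.preimage' fun x _ => ?_
    by_cases hx : ∃ e : DEdge, e.edge = x
    · obtain ⟨e, rfl⟩ := hx
      exact (Set.toFinite {e, rev e}).subset fun e' he' => edge_inj he'
    · convert Set.finite_empty
      ext e
      simpa using fun h => hx ⟨e, h⟩
  have hK : IsCompact (⋃ e ∈ DEdge.edge ⁻¹' F, segmentOf e) :=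
    hD.isCompact_biUnion fun e _ => isCompact_segmentOf e
  have hc : Continuous fun z : ℂ => 1 - Complex.normSq z :=
    continuous_const.sub Complex.continuous_normSq
  rcases (⋃ e ∈ DEdge.edge ⁻¹' F, segmentOf e).eq_empty_or_nonempty with h | h
  · refine ⟨1, one_pos, fun e he z hz => ?_⟩
    have : z ∈ ⋃ e ∈ DEdge.edge ⁻¹' F, segmentOf e := Set.mem_biUnion he hz
    rw [h] at this
    exact absurd this (Set.notMem_empty _)
  · obtain ⟨z₀, hz₀, hmin⟩ := hK.exists_isMinOn h hc.continuousOn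
    refine ⟨1 - Complex.normSq z₀, ?_, fun e he z hz => hmin (Set.mem_biUnion he hz)⟩
    obtain ⟨e, -, hz⟩ := Set.mem_iUnion₂.mp hz₀
    have := segmentOf_subset_disc e hz
    exact sub_pos.mpr this

/-- The limit points of a set of edges that lies in finitely many orbits under a cyclic group of deck
transformations are among those of each set that contains an orbit. -/
theorem limitPoints_subset {S S' F : Set (Sym2 G)} {t : G} (hF : F.Finite)
    (hS : ∀ x ∈ S, ∃ k : ℤ, ∃ y ∈ F, x = trans (t ^ k) y) {e₀ : DEdge}
    (h₀ : ∀ k : ℤ, (shift (t ^ k) e₀).edge ∈ S') : limitPoints S ⊆ limitPoints S' := by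
  obtain ⟨δ, hδ, hmin⟩ := exists_lower_bound (hF.insert e₀.edge)
  have hw : position e₀.1 ∈ segmentOf e₀ := ⟨0, left_mem_segment _ _ _, rfl⟩
  -- A power of `t` brings each point of `S` into one of finitely many segments; the same power
  -- moves the initial vertex of `e₀` to a nearby point of `S'`.
  have key : ∀ z ∈ realization S, ∃ z' ∈ realization S',
      Complex.normSq (z - z') ≤ 4 / δ ^ 2 * (1 - Complex.normSq z) := by
    rintro z ⟨e, he, hz⟩
    obtain ⟨k, y, hy, hk⟩ := hS _ he
    rw [← shift_inv_shift (t ^ k) e] at hz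
    obtain ⟨w, hw', rfl⟩ := exists_act_eq hz
    have hy' : (shift (t ^ k)⁻¹ e).edge = y := by
      rw [← trans_edge, hk, trans_trans, inv_mul_cancel, trans_one]
    refine ⟨act (t ^ k) (position e₀.1), ⟨_, h₀ k, act_mem_segmentOf hw⟩, ?_⟩
    exact normSq_mob_sub_le (deck_mem _) (segmentOf_subset_disc _ hw') (normSq_position _) hδ
      (hmin _ (hy' ▸ Or.inr hy) _ hw') (hmin e₀ (Or.inl rfl) _ hw)
  rintro ζ ⟨h1, h2⟩
  refine ⟨h1, ?_⟩
  obtain ⟨z, hz, hlim⟩ := mem_closure_iff_seq_limit.mp h2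
  choose z' hz' hle using fun n => key (z n) (hz n)
  refine mem_closure_iff_seq_limit.mpr ⟨z', hz', ?_⟩
  have h3 : Filter.Tendsto (fun n => 4 / δ ^ 2 * (1 - Complex.normSq (z n))) Filter.atTop
      (nhds 0) := by
    have h4 : Complex.normSq ζ = 1 := by
      rw [Complex.normSq_eq_norm_sq, mem_sphere_zero_iff_norm.mp h1, one_pow]
    have h5 := ((Complex.continuous_normSq.tendsto ζ).comp hlim).const_sub 1 |>.const_mul (4 / δ ^ 2)
    rwa [h4, sub_self, mul_zero] at h5
  have h6 : Filter.Tendsto (fun n => Complex.normSq (z n - z' n)) Filter.atTop (nhds 0) :=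
    squeeze_zero (fun _ => Complex.normSq_nonneg _) hle h3
  have h7 : Filter.Tendsto (fun n => z n - z' n) Filter.atTop (nhds 0) := by
    rw [tendsto_zero_iff_norm_tendsto_zero]
    have h8 := (Real.continuous_sqrt.tendsto 0).comp h6
    rw [Real.sqrt_zero] at h8
    refine h8.congr fun n => ?_
    rw [Function.comp_apply, Complex.normSq_eq_norm_sq, Real.sqrt_sq (norm_nonneg _)]
  have h9 := hlim.sub h7
  simpa using h9

lemma limitPoints_eq {w : List Letter} (hw : w ≠ []) {e : ℤ → DEdge} {τ : ℤ → ZMod 8} {n : ℕ} {t : G}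
    (h : IsPeriodic e τ n t) (ht : IsConj (evalWord w) t) :
    ∃ E, ReadsOff E w ∧ limitPoints (trackEdges (IsPath.track e τ)) = limitPoints (pathEdges E) := by
  obtain ⟨c, hc⟩ := isConj_iff.mp ht
  -- Starting the lift at the conjugating element `c` makes its period equal to `t`, and not only
  -- conjugate to it.
  obtain ⟨E, hE, h0⟩ := exists_readsOff hw c
  have hp : period E w.length = t := by rw [period, hE.eval, h0, hc]
  have hadd := hE.darts_add hw
  rw [hp] at hadd
  have hn : (0 : ℤ) < w.length := by exact_mod_cast List.length_pos_iff.mpr hw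
  refine ⟨E, hE, Set.Subset.antisymm ?_ ?_⟩
  · obtain ⟨F, hF, hS⟩ := h.exists_finite
    refine limitPoints_subset (t := t) hF hS (e₀ := darts E w 0) fun k => ?_
    rw [hE.pathEdges_eq hw, ← hadd]
    exact ⟨_, rfl⟩
  · refine limitPoints_subset (t := t) (F := (fun i : ℕ => (darts E w i).edge) '' Finset.range w.length)
      ((Finset.finite_toSet _).image _) ?_ (e₀ := e 0) fun k => ?_
    · rw [hE.pathEdges_eq hw]
      rintro _ ⟨i, rfl⟩
      have h1 := Int.emod_lt_of_pos i hn
      have h2 := Int.emod_nonneg i hn.ne'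
      refine ⟨i / w.length, _, ⟨(i % w.length).toNat, ?_, rfl⟩, ?_⟩
      · simp only [Finset.coe_range, Set.mem_Iio]
        omega
      · beta_reduce
        rw [trans_edge, ← hadd, Int.toNat_of_nonneg h2, mul_comm, Int.emod_add_mul_ediv]
    · rw [← h.add]
      exact h.edge_mem_track _

end SurfaceSnakes

end


theorem mainTheorem7 (w : List SurfaceSnakes.Letter) (hw : SurfaceSnakes.evalWord w ≠ 1) :
    SurfaceSnakes.Terminates (w : Cycle SurfaceSnakes.Letter) ∧
    ∀ S : Set (Sym2 SurfaceSnakes.G),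
      SurfaceSnakes.Reaches (w : Cycle SurfaceSnakes.Letter) (.output S) →
        SurfaceSnakes.IsGeometricalSnake S ∧
        (∃ J : ℤ → SurfaceSnakes.State,
          SurfaceSnakes.IsMarkovElement J ∧ SurfaceSnakes.IsImageOf S J) ∧
        ∃ E : ℤ → SurfaceSnakes.G, SurfaceSnakes.ReadsOff E w ∧
          SurfaceSnakes.limitPoints S =
            SurfaceSnakes.limitPoints (SurfaceSnakes.pathEdges E) := by
  refine ⟨SurfaceSnakes.terminates hw, fun S hS => ?_⟩
  obtain ⟨e, τ, n, t, h, rfl, ht⟩ := SurfaceSnakes.Good.of_reaches hw hS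
  refine ⟨?_, h.isTrack.exists_markov,
    SurfaceSnakes.limitPoints_eq (by rintro rfl; exact hw rfl) h ht⟩
  obtain ⟨c, hc, -, heq⟩ := h.isTrack.exists_snake
  exact heq ▸ hc.isGeometricalSnake
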